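/- **Theorem 1.1 (Quantitative Mode Stability on the Real Axis).** For $|a|<M$ put $r_\pm=M\pm\sqrt{M^2-a^2}$, $\Delta=r^2-2Mr+a^2$, and let $r^*:(r_+,\infty)\to\mathbb{R}$ be defined up to an additive constant by $\frac{dr^*}{dr}=\frac{r^2+a^2}{\Delta}$; a prime denotes $\frac{d}{dr^*}$. For $\omega\in\mathbb{R}\setminus\{0\}$ and integers $l\ge|m|$, let $\lambda_{ml}$ be the eigenvalue with label $l$ of $$\frac{1}{\sin\theta}\frac{d}{d\theta}\Big(\sin\theta\frac{dS}{d\theta}\Big)-\Big(\frac{m^2}{\sin^2\theta}-a^2\omega^2\cos^2\theta\Big)S+\lambda S=0\quad(0<\theta<\pi),\qquad e^{im\phi}S(\theta)\text{ extends smoothly to }\mathbb{S}^2,$$ where $\lambda_{ml}=l(l+1)$ for $a=0$ and the labelling for $a\ne0$ is determined by continuity in $a$. Let $$V=\frac{4Mram\omega-a^2m^2+\Delta(\lambda_{ml}+a^2\omega^2)}{(r^2+a^2)^2}+\frac{\Delta\,\big(a^2\Delta+2Mr(r^2-a^2)\big)}{(r^2+a^2)^4},\qquad \xi=\frac{i(am-2Mr_+\omega)}{r_+-r_-}.$$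 Let $u_{\rm hor}$ and $u_{\rm out}$ be the solutions of $u''+(\omega^2-V)u=0$, each unique up to a constant phase, such that * $(r-r_+)^{-\xi}u_{\rm hor}$ is holomorphic in $r$ near $r_+$ and has modulus $1$ at $r=r_+$; * $e^{-i\omega r^*}u_{\rm out}$ has modulus tending to $1$ as $r^*\to\infty$, and there are constants $C_i\in\mathbb{C}$ such that for every $N$, $u_{\rm out}=e^{i\omega r^*}\sum_{i=0}^N C_ir^{-i}+O(r^{-N-1})$ for large $r$. Let $W(\omega,m,l)=u_{\rm out}'u_{\rm hor}-u_{\rm hor}'u_{\rm out}$, which is independent of $r^*$ and determined up to a phase. There is a function $G(C,a,M)$ with the following properties. 1. $G$ is effective: there is a computable $g:\mathbb{N}\to\mathbb{N}$ such that $G(C,a,M)\le g(N)$ whenever $|a|<M$ and $N\in\mathbb{N}$ satisfies $N\ge\max\{C,\,M,\,1/(M-|a|)\}$. 2. For all $|a|<M$ and every set $\mathscr{A}\subset\{(\omega,m,l)\in\mathbb{R}\times\mathbb{Z}\times\mathbb{Z}: l\ge|m|\}$ with $$C_{\mathscr{A}}:=\sup_{(\omega,m,l)\in\mathscr{A}}\big(|\omega|+|\omega|^{-1}+|m|+|l|\big)<\infty$$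 (where $|0|^{-1}=\infty$), the quantities $\lambda_{ml}$, $u_{\rm hor}$, $u_{\rm out}$, $W$ exist for every $(\omega,m,l)\in\mathscr{A}$, and $$\sup_{(\omega,m,l)\in\mathscr{A}}\big|W(\omega,m,l)^{-1}\big|\le G(C_{\mathscr{A}},a,M),$$ with $|W^{-1}|=\infty$ if $W=0$. -/

import Mathlib

open scoped Manifold Topology ENNReal

noncomputable section

namespace Kerr

/-- The outer root `r₊ = M + √(M² - a²)` of `Δ`. -/
def rPlus (a M : ℝ) : ℝ := M + Real.sqrt (M ^ 2 - a ^ 2)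

/-- The inner root `r₋ = M - √(M² - a²)` of `Δ`. -/
def rMinus (a M : ℝ) : ℝ := M - Real.sqrt (M ^ 2 - a ^ 2)

/-- The horizon function `Δ = r² - 2Mr + a² = (r - r₊)(r - r₋)`. -/
def Delta (a M r : ℝ) : ℝ := r ^ 2 - 2 * M * r + a ^ 2

/-- `rad` is the Boyer-Lindquist radius `r ∈ (r₊, ∞)` written as a function of a tortoise coordinate
`r* ∈ (-∞, ∞)`, where `dr*/dr = (r² + a²) / Δ`.  The coordinate `r*` is only determined up to an
additive constant, so `rad` is determined up to a translation; every such `rad` is an increasing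
bijection from `ℝ` onto `(r₊, ∞)`. -/
def IsRadius (a M : ℝ) (rad : ℝ → ℝ) : Prop :=
  ∀ x : ℝ, rPlus a M < rad x ∧
    HasDerivAt rad (Delta a M (rad x) / (rad x ^ 2 + a ^ 2)) x

/-! ### The angular equation -/

/-- The function `e^{imφ} S(θ)` extends smoothly to the unit sphere. -/
def ExtendsSmoothly (m : ℤ) (S : ℝ → ℂ) : Prop :=
  ∃ Y : Metric.sphere (0 : EuclideanSpace ℝ (Fin 3)) 1 → ℂ,
    ContMDiff (𝓡 2) 𝓘(ℝ, ℂ) ((⊤ : ℕ∞) : WithTop ℕ∞) Y ∧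
    ∀ p : Metric.sphere (0 : EuclideanSpace ℝ (Fin 3)) 1, ∀ θ ∈ Set.Ioo 0 Real.pi, ∀ φ : ℝ,
      (p : EuclideanSpace ℝ (Fin 3)) =
          !₂[Real.sin θ * Real.cos φ, Real.sin θ * Real.sin φ, Real.cos θ] →
        Y p = Complex.exp (Complex.I * m * φ) * S θ

/-- `lam` is an eigenvalue of the angular ODE
`(1 / sin θ) (sin θ S')' - (m² / sin² θ - a² ω² cos² θ) S + lam S = 0`
on `(0, π)`, with the boundary condition that `e^{imφ} S(θ)` extends smoothly to the sphere.
The boundary condition makes `S` smooth on `(0, π)`, so that the derivatives are genuine. -/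
def IsAngularEigenvalue (a ω : ℝ) (m : ℤ) (lam : ℝ) : Prop :=
  ∃ S : ℝ → ℂ, ExtendsSmoothly m S ∧ (∃ θ ∈ Set.Ioo 0 Real.pi, S θ ≠ 0) ∧
    ∀ θ ∈ Set.Ioo 0 Real.pi,
      1 / (Real.sin θ : ℂ) * deriv (fun t : ℝ => (Real.sin t : ℂ) * deriv S t) θ
        - (((m : ℝ) ^ 2 / Real.sin θ ^ 2 - a ^ 2 * ω ^ 2 * Real.cos θ ^ 2 : ℝ) : ℂ) * S θ
        + (lam : ℂ) * S θ = 0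

/-- `lam = λ_{ml}`: for vanishing rotation parameter the label `l` belongs to the eigenvalue
`l (l + 1)`, and for `a ≠ 0` the labelling is fixed by continuity in the rotation parameter. -/
def IsAngularEigenvalueLabelled (a ω : ℝ) (m l : ℤ) (lam : ℝ) : Prop :=
  ∃ L : ℝ → ℝ, ContinuousOn L (Set.uIcc 0 a) ∧
    (∀ s ∈ Set.uIcc 0 a, IsAngularEigenvalue s ω m (L s)) ∧
    L 0 = (l : ℝ) * ((l : ℝ) + 1) ∧ L a = lam

/-! ### The radial equation -/

/-- The radial potential `V`, as a function of `r`. -/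
def potential (a M ω : ℝ) (m : ℤ) (lam r : ℝ) : ℝ :=
  (4 * M * r * a * m * ω - a ^ 2 * (m : ℝ) ^ 2 + Delta a M r * (lam + a ^ 2 * ω ^ 2))
      / (r ^ 2 + a ^ 2) ^ 2
    + Delta a M r / (r ^ 2 + a ^ 2) ^ 4
      * (a ^ 2 * Delta a M r + 2 * M * r * (r ^ 2 - a ^ 2))

/-- `u'' + (ω² - V) u = 0` for a function `u` of `r*`. -/
def SolvesRadial (a M : ℝ) (rad : ℝ → ℝ) (ω : ℝ) (m : ℤ) (lam : ℝ) (u : ℝ → ℂ) : Prop :=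
  Differentiable ℝ u ∧ Differentiable ℝ (deriv u) ∧
    ∀ x : ℝ, deriv (deriv u) x + ((ω ^ 2 - potential a M ω m lam (rad x) : ℝ) : ℂ) * u x = 0

/-- The exponent `i (am - 2 M r₊ ω) / (r₊ - r₋)`. -/
def horExponent (a M ω : ℝ) (m : ℤ) : ℂ :=
  Complex.I * ((a * m - 2 * M * rPlus a M * ω : ℝ) : ℂ) / ((rPlus a M - rMinus a M : ℝ) : ℂ)

/-- `u` is a normalised horizon solution `u_hor`: with `ξ` the exponent above,
`(r - r₊)^{-ξ} u` is holomorphic in `r` near `r = r₊`, and it has modulus one there. -/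
structure IsHor (a M : ℝ) (rad : ℝ → ℝ) (ω : ℝ) (m : ℤ) (lam : ℝ) (u : ℝ → ℂ) : Prop where
  ode : SolvesRadial a M rad ω m lam u
  asymptotics : ∃ f : ℂ → ℂ, AnalyticAt ℂ f (rPlus a M : ℂ) ∧
    ∀ᶠ x in Filter.atBot,
      ((rad x - rPlus a M : ℝ) : ℂ) ^ (-horExponent a M ω m) * u x = f (rad x : ℂ)
  normalised : Filter.Tendsto
    (fun x => ‖((rad x - rPlus a M : ℝ) : ℂ) ^ (-horExponent a M ω m) * u x‖ ^ 2)
    Filter.atBot (𝓝 1)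

/-- `u` is a normalised outgoing solution `u_out`: `e^{-iωr*} u` has an asymptotic expansion in
powers of `1 / r` as `r* → ∞`, and its limit has modulus one. -/
structure IsOut (a M : ℝ) (rad : ℝ → ℝ) (ω : ℝ) (m : ℤ) (lam : ℝ) (u : ℝ → ℂ) : Prop where
  ode : SolvesRadial a M rad ω m lam u
  asymptotics : ∃ c : ℕ → ℂ, ∀ N : ℕ,
    (fun x : ℝ => u x - Complex.exp (Complex.I * ω * x)
        * ∑ i ∈ Finset.range (N + 1), c i / (rad x : ℂ) ^ i)
      =O[Filter.atTop] (fun x : ℝ => (1 / rad x ^ (N + 1) : ℝ))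
  normalised : Filter.Tendsto
    (fun x : ℝ => ‖Complex.exp (-(Complex.I * ω * x)) * u x‖ ^ 2) Filter.atTop (𝓝 1)

/-- The values of the Wronskian `W(ω, m, l) = u_out' u_hor - u_hor' u_out` (a constant function of
`r*`).  The normalisations fix `u_hor` and `u_out` up to a constant phase, so `W` is fixed up to a
phase; the set contains the value for each choice. -/
def wronskianValues (a M : ℝ) (rad : ℝ → ℝ) (ω : ℝ) (m l : ℤ) : Set ℂ :=
  {W | ∃ (lam : ℝ) (uHor uOut : ℝ → ℂ),
    IsAngularEigenvalueLabelled a ω m l lam ∧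
    IsHor a M rad ω m lam uHor ∧ IsOut a M rad ω m lam uOut ∧
    ∀ x : ℝ, deriv uOut x * uHor x - deriv uHor x * uOut x = W}

/-! ### Frequency sets and the bounding function -/

/-- `C_𝒜 = sup (|ω| + |ω|⁻¹ + |m| + |l|)` in `[0, ∞]`, where `|0|⁻¹ = ∞`. -/
def freqBound (A : Set (ℝ × ℤ × ℤ)) : ℝ≥0∞ :=
  ⨆ p ∈ A, (‖p.1‖ₑ + ‖p.1‖ₑ⁻¹ + (p.2.1.natAbs : ℝ≥0∞) + (p.2.2.natAbs : ℝ≥0∞))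

/-- The function `G` of `(C, a, M)` is effective: from an integer bound `N` on `C`, `M` and
`1 / (M - |a|)` one can compute an upper bound for `G`. -/
def IsEffective (G : ℝ → ℝ → ℝ → ℝ) : Prop :=
  ∃ g : ℕ → ℕ, Computable g ∧
    ∀ (N : ℕ) (C a M : ℝ), |a| < M → C ≤ N → M ≤ N → 1 / (M - |a|) ≤ N → G C a M ≤ g N

end Kerr

end

/-! Put `s = r - r₊` and `d = r₊ - r₋`. Once explicit powers and an exponential are split off
(`radialFactor`), the radial equation becomes a confluent Heun equation with regular singular points
`s = 0` and `s = -d` (`radial_identity`, `SolvesRadialHeun.hasDerivAt`). The horizon solution comes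
from the Frobenius series with value one at `s = 0`. The outgoing solution comes from a Laplace
transform `∫ exp (-s t) φ t dt`, where `φ` solves a second confluent Heun equation, with singular
points `0` and `σ = 2iω`, and behaves like `t ^ ρ`, `ρ = -4iMω`, at the origin (`laplace_heun`).
Watson's lemma turns the Frobenius series of `φ` into the expansion of the transform at infinity
(`exists_norm_laplace_sub_le`).

The Wronskian measures the singular part of the transform at `s = 0`, hence the behaviour of `φ` at
infinity. Positivity appears when the ray of integration is turned by `q = -iω` onto the half of the
imaginary axis that avoids `σ`. There the transformed equation has a real potential in normal form,
so `im (conj Φ * Φ')` is conserved. At the origin this current is `-κ` with `κ = 4Mω`; at infinity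
it is `ν (‖δ‖² - ‖b‖²)` with `ν = ωd/2`, where `b` and `δ` are the amplitudes of the two asymptotic
modes. Hence `‖b‖² = 8M/d + ‖δ‖²`, and `b` is bounded below for every frequency, superradiant or not
(`IsRaySolution.exists_amplitudes`).

The two rays give proportional transforms: their Wronskian carries the factor `exp (σ s)`, which
decays in a direction where both transforms stay bounded, and the leading terms at infinity control
the factor of proportionality. Near `s = 0` the amplitude `b` produces the term `b Γ(1 - iτ)`, and
`‖Γ(1 - iτ)‖ ≥ exp (-π|τ|)`. This yields the connection coefficient in `exists_horizon_wronskian`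
and the explicit `wronskianBound`, in which the angular eigenvalue does not occur, so that no
estimate of `λ` is needed. `IsHor.eq_const_mul` and `IsOut.eq_const_mul` carry the bound from the
constructed pair to any normalised pair.

The labelled eigenvalues are found separately. With `k = |m|` and `S = sin^k θ f (1 - cos θ)`, the
function `f` regular at one pole gives an eigenfunction as soon as `f 1 * f' 1 = 0`. The argument of
`f 1 + i f' 1` lifts to a continuous phase on the parameter plane, and the Lagrange identity makes
it strictly monotone in suitable directions. Its level sets are therefore Lipschitz graphs, which
continue the polynomial solutions of the spherical case (`exists_spheroidal_branch`). -/

namespace Kerr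

open Set Filter MeasureTheory Topology

/-! ### Linear ordinary differential equations on the line: Picard series and uniqueness. -/

section LinearODE

variable {E : Type*} [NormedAddCommGroup E] [NormedSpace ℝ E]

/-- The terms of the Picard series of the linear equation `f' = A f`. -/
noncomputable def picardTerm (A : ℝ → E →L[ℝ] E) (t₀ : ℝ) (x₀ : E) : ℕ → ℝ → E
  | 0 => fun _ => x₀
  | n + 1 => fun t => ∫ τ in t₀..t, A τ (picardTerm A t₀ x₀ n τ)

theorem continuous_picardTerm [CompleteSpace E] {A : ℝ → E →L[ℝ] E} (hA : Continuous A) (t₀ : ℝ)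
    (x₀ : E) : ∀ n, Continuous (picardTerm A t₀ x₀ n)
  | 0 => continuous_const
  | n + 1 => by
    have h := hA.clm_apply (continuous_picardTerm hA t₀ x₀ n)
    exact intervalIntegral.continuous_primitive (fun a b => h.intervalIntegrable a b) t₀

/-- Each integration of the previous bound raises the power of `|t - t₀|` and extends the factorial.
The factorial makes the Picard series converge on intervals of every length. -/
theorem norm_picardTerm_le [CompleteSpace E] {A : ℝ → E →L[ℝ] E} (hA : Continuous A) (t₀ : ℝ)
    (x₀ : E) {K T : ℝ} (hK : ∀ t ∈ Icc (t₀ - T) (t₀ + T), ‖A t‖ ≤ K) (n : ℕ) :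
    ∀ t ∈ Icc (t₀ - T) (t₀ + T),
      ‖picardTerm A t₀ x₀ n t‖ ≤ ‖x₀‖ * ((K * |t - t₀|) ^ n / n.factorial) := by
  induction n with
  | zero => intro t _; simp [picardTerm]
  | succ n ih =>
    intro t ht
    have hT : 0 ≤ T := by linarith [ht.1, ht.2]
    have hK0 : 0 ≤ K := (norm_nonneg _).trans (hK t ht)
    have hsub : ∀ τ ∈ uIoc t₀ t, τ ∈ Icc (t₀ - T) (t₀ + T) := by
      intro τ hτ
      have : τ ∈ uIcc t₀ t := uIoc_subset_uIcc hτ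
      exact ordConnected_Icc.uIcc_subset ⟨by linarith, by linarith⟩ ht this
    have hint : ∫ τ in uIoc t₀ t, |τ - t₀| ^ n = |t - t₀| ^ (n + 1) / (n + 1) :=
      integral_pow_abs_sub_uIoc n
    calc ‖picardTerm A t₀ x₀ (n + 1) t‖
        ≤ ∫ τ in uIoc t₀ t, ‖A τ (picardTerm A t₀ x₀ n τ)‖ := by
          simpa [picardTerm] using
            intervalIntegral.norm_integral_le_integral_norm_uIoc (a := t₀) (b := t)
              (f := fun τ => A τ (picardTerm A t₀ x₀ n τ)) (μ := volume)
      _ ≤ ∫ τ in uIoc t₀ t, K * (‖x₀‖ * (K ^ n / n.factorial)) * |τ - t₀| ^ n := by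
          refine setIntegral_mono_on ?_ ?_ measurableSet_uIoc ?_
          · exact ((hA.clm_apply (continuous_picardTerm hA t₀ x₀ n)).norm.intervalIntegrable
              t₀ t).def'
          · exact ((by fun_prop : Continuous fun τ : ℝ =>
              K * (‖x₀‖ * (K ^ n / n.factorial)) * |τ - t₀| ^ n).intervalIntegrable t₀ t).def'
          · intro τ hτ
            calc ‖A τ (picardTerm A t₀ x₀ n τ)‖ ≤ ‖A τ‖ * ‖picardTerm A t₀ x₀ n τ‖ :=
                  (A τ).le_opNorm _
              _ ≤ K * (‖x₀‖ * ((K * |τ - t₀|) ^ n / n.factorial)) := by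
                  gcongr
                  · exact hK τ (hsub τ hτ)
                  · exact ih τ (hsub τ hτ)
              _ = _ := by rw [mul_pow]; ring
      _ = ‖x₀‖ * ((K * |t - t₀|) ^ (n + 1) / (n + 1).factorial) := by
          rw [integral_const_mul, hint, Nat.factorial_succ, mul_pow]
          push_cast
          have : (n.factorial : ℝ) ≠ 0 := by positivity
          field_simp
          ring

/-- By linearity the Picard series converges locally uniformly on the whole line, so no patching of
local solutions is needed. -/
theorem exists_linear_ode [CompleteSpace E] {A : ℝ → E →L[ℝ] E} (hA : Continuous A) (t₀ : ℝ)
    (x₀ : E) : ∃ f : ℝ → E, f t₀ = x₀ ∧ ∀ t, HasDerivAt f (A t (f t)) t := by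
  let g : ℕ → ℝ → E := picardTerm A t₀ x₀
  let g' : ℕ → ℝ → E := fun n => match n with
    | 0 => fun _ => 0
    | n + 1 => fun t => A t (picardTerm A t₀ x₀ n t)
  have hg : ∀ n t, HasDerivAt (g n) (g' n t) t := by
    intro n t
    cases n with
    | zero => exact hasDerivAt_const t x₀
    | succ n =>
      have h := hA.clm_apply (continuous_picardTerm hA t₀ x₀ n)
      exact intervalIntegral.integral_hasDerivAt_right (h.intervalIntegrable _ _)
        (h.stronglyMeasurableAtFilter _ _) h.continuousAt
  have hg0 : ∀ n, g n t₀ = if n = 0 then x₀ else 0 := by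
    intro n
    cases n with
    | zero => rfl
    | succ n => simp [g, picardTerm]
  refine ⟨fun t => ∑' n, g n t, ?_, ?_⟩
  · simp only [hg0, tsum_ite_eq]
  · intro t
    set T := |t - t₀| + 1 with hT
    obtain ⟨K, hK⟩ := (isCompact_Icc (a := t₀ - T) (b := t₀ + T)).exists_bound_of_continuousOn
      hA.continuousOn
    have hK0 : 0 ≤ K := (norm_nonneg _).trans (hK t₀ ⟨by linarith [abs_nonneg (t - t₀)],
      by linarith [abs_nonneg (t - t₀)]⟩)
    have hbd : ∀ n, ∀ y ∈ Ioo (t₀ - T) (t₀ + T),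
        ‖g n y‖ ≤ ‖x₀‖ * ((K * T) ^ n / n.factorial) := by
      intro n y hy
      refine (norm_picardTerm_le hA t₀ x₀ hK n y (Ioo_subset_Icc_self hy)).trans ?_
      have : |y - t₀| ≤ T := abs_le.2 ⟨by linarith [hy.1], by linarith [hy.2]⟩
      gcongr
    -- The zeroth term is constant, so the majorant of the derivatives starts with `0` and is that
    -- of the terms shifted by one.
    let u : ℕ → ℝ := fun n => match n with
      | 0 => 0
      | n + 1 => K * (‖x₀‖ * ((K * T) ^ n / n.factorial))
    have hsum : Summable fun n : ℕ => ‖x₀‖ * ((K * T) ^ n / n.factorial) :=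
      (Real.summable_pow_div_factorial _).mul_left _
    have hu : Summable u := (summable_nat_add_iff 1).1 (hsum.mul_left K)
    have hu' : ∀ n, ∀ y ∈ Ioo (t₀ - T) (t₀ + T), ‖g' n y‖ ≤ u n := by
      intro n y hy
      cases n with
      | zero => simp [g', u]
      | succ n =>
        refine ((A y).le_opNorm _).trans ?_
        exact mul_le_mul (hK y (Ioo_subset_Icc_self hy)) (hbd n y hy) (norm_nonneg _) hK0
    have htm : t ∈ Ioo (t₀ - T) (t₀ + T) := by
      constructor <;> rcases abs_cases (t - t₀) with h | h <;> linarith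
    have ht0m : t₀ ∈ Ioo (t₀ - T) (t₀ + T) := by
      constructor <;> linarith [abs_nonneg (t - t₀)]
    have key := hasDerivAt_tsum_of_isPreconnected hu isOpen_Ioo isPreconnected_Ioo
      (fun n y _ => hg n y) hu' ht0m
      (Summable.of_norm_bounded hsum fun n => hbd n t₀ ht0m) htm
    convert key using 1
    have hs : Summable fun n => g n t := Summable.of_norm_bounded hsum fun n => hbd n t htm
    -- After the zeroth term is dropped, the series of derivatives is `A t` applied to the series
    -- itself.
    have hs' : Summable fun n => g' n t := Summable.of_norm_bounded hu fun n => hu' n t htm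
    rw [hs'.tsum_eq_zero_add, (A t).map_tsum hs]
    simp [g', g]

theorem linear_ode_unique {A : ℝ → E →L[ℝ] E} {S : Set ℝ} (hS : S.OrdConnected)
    (hA : ContinuousOn A S) {f g : ℝ → E}
    (hf : ∀ t ∈ S, HasDerivAt f (A t (f t)) t) (hg : ∀ t ∈ S, HasDerivAt g (A t (g t)) t)
    {t₀ : ℝ} (ht₀ : t₀ ∈ S) (heq : f t₀ = g t₀) : EqOn f g S := by
  intro t ht
  have hsub : uIcc t₀ t ⊆ S := hS.uIcc_subset ht₀ ht
  obtain ⟨K, hK⟩ := (isCompact_uIcc (a := t₀) (b := t)).exists_bound_of_continuousOn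
    (hA.mono hsub)
  have hlip : ∀ τ ∈ uIcc t₀ t, LipschitzOnWith K.toNNReal (fun x => A τ x) univ := by
    intro τ hτ
    refine ((A τ).lipschitz.weaken ?_).lipschitzOnWith
    rw [← NNReal.coe_le_coe]
    exact (hK τ hτ).trans (Real.le_coe_toNNReal K)
  have cf : ContinuousOn f (uIcc t₀ t) := fun τ hτ => (hf τ (hsub hτ)).continuousAt.continuousWithinAt
  have cg : ContinuousOn g (uIcc t₀ t) := fun τ hτ => (hg τ (hsub hτ)).continuousAt.continuousWithinAt
  rcases le_total t₀ t with h | h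
  · rw [uIcc_of_le h] at *
    exact ODE_solution_unique_of_mem_Icc_right (v := fun τ x => A τ x) (s := fun _ => univ)
      (fun τ hτ => hlip τ (Ico_subset_Icc_self hτ)) cf
      (fun τ hτ => (hf τ (hsub (Ico_subset_Icc_self hτ))).hasDerivWithinAt) (fun _ _ => trivial) cg
      (fun τ hτ => (hg τ (hsub (Ico_subset_Icc_self hτ))).hasDerivWithinAt) (fun _ _ => trivial)
      heq ⟨h, le_rfl⟩
  · rw [uIcc_of_ge h] at *
    exact ODE_solution_unique_of_mem_Icc_left (v := fun τ x => A τ x) (s := fun _ => univ)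
      (fun τ hτ => hlip τ (Ioc_subset_Icc_self hτ)) cf
      (fun τ hτ => (hf τ (hsub (Ioc_subset_Icc_self hτ))).hasDerivWithinAt) (fun _ _ => trivial) cg
      (fun τ hτ => (hg τ (hsub (Ioc_subset_Icc_self hτ))).hasDerivWithinAt) (fun _ _ => trivial)
      heq ⟨le_rfl, h⟩

end LinearODE

/-! ### Second-order equations as first-order systems. -/

section SecondOrder

/-- The companion matrix of `y'' = a y' + b y`. -/
noncomputable def companion (a b : ℂ) : ℂ × ℂ →L[ℝ] ℂ × ℂ :=
  (ContinuousLinearMap.inl ℝ ℂ ℂ).comp (ContinuousLinearMap.snd ℝ ℂ ℂ) +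
    (ContinuousLinearMap.inr ℝ ℂ ℂ).comp
      (b • ContinuousLinearMap.fst ℝ ℂ ℂ + a • ContinuousLinearMap.snd ℝ ℂ ℂ)

theorem companion_apply (a b : ℂ) (v : ℂ × ℂ) : companion a b v = (v.2, a * v.2 + b * v.1) := by
  ext <;> simp [companion, add_comm]

theorem continuousOn_companion {a b : ℝ → ℂ} {S : Set ℝ} (ha : ContinuousOn a S)
    (hb : ContinuousOn b S) : ContinuousOn (fun t => companion (a t) (b t)) S := by
  unfold companion
  fun_prop

/-- A solution of the homogeneous linear equation `y'' = a y' + b y` on a set, with the derivative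
as a separate function. -/
def SolvesOn (a b : ℝ → ℂ) (S : Set ℝ) (y y' : ℝ → ℂ) : Prop :=
  ∀ t ∈ S, HasDerivAt y (y' t) t ∧ HasDerivAt y' (a t * y' t + b t * y t) t

theorem SolvesOn.hasDerivAt_pair {a b : ℝ → ℂ} {S : Set ℝ} {y y' : ℝ → ℂ}
    (h : SolvesOn a b S y y') {t : ℝ} (ht : t ∈ S) :
    HasDerivAt (fun t => (y t, y' t)) (companion (a t) (b t) (y t, y' t)) t := by
  rw [companion_apply]
  exact (h t ht).1.prodMk (h t ht).2

theorem exists_solvesOn_univ {a b : ℝ → ℂ} (ha : Continuous a) (hb : Continuous b) (t₀ : ℝ)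
    (c c' : ℂ) : ∃ y y' : ℝ → ℂ, SolvesOn a b univ y y' ∧ y t₀ = c ∧ y' t₀ = c' := by
  have hc : Continuous fun t => companion (a t) (b t) :=
    continuousOn_univ.1 (continuousOn_companion ha.continuousOn hb.continuousOn)
  obtain ⟨f, hf0, hf⟩ := exists_linear_ode hc t₀ (c, c')
  refine ⟨fun t => (f t).1, fun t => (f t).2, fun t _ => ?_, by simp [hf0], by simp [hf0]⟩
  have := hf t
  rw [companion_apply] at this
  exact ⟨(ContinuousLinearMap.fst ℝ ℂ ℂ).hasFDerivAt.comp_hasDerivAt t this,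
    (ContinuousLinearMap.snd ℝ ℂ ℂ).hasFDerivAt.comp_hasDerivAt t this⟩

theorem SolvesOn.eqOn {a b : ℝ → ℂ} {S : Set ℝ} (hS : S.OrdConnected) (ha : ContinuousOn a S)
    (hb : ContinuousOn b S) {y y' w w' : ℝ → ℂ} (hy : SolvesOn a b S y y')
    (hw : SolvesOn a b S w w') {t₀ : ℝ} (ht₀ : t₀ ∈ S) (h : y t₀ = w t₀) (h' : y' t₀ = w' t₀) :
    ∀ t ∈ S, y t = w t ∧ y' t = w' t := by
  have := linear_ode_unique hS (continuousOn_companion ha hb) (fun t ht => hy.hasDerivAt_pair ht)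
    (fun t ht => hw.hasDerivAt_pair ht) ht₀ (by simp [h, h'])
  intro t ht
  simpa using this ht

/-- A solution near the left end of a half-line extends to the half-line. -/
theorem SolvesOn.exists_extension {a b : ℝ → ℂ} {l r : ℝ} (hlr : l < r)
    (ha : ContinuousOn a (Ioi l)) (hb : ContinuousOn b (Ioi l)) {w w' : ℝ → ℂ}
    (hw : SolvesOn a b (Ioo l r) w w') :
    ∃ y y' : ℝ → ℂ, SolvesOn a b (Ioi l) y y' ∧ ∀ t ∈ Ioo l r, y t = w t ∧ y' t = w' t := by
  set m := (l + r) / 2 with hm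
  have hlm : l < m := by rw [hm]; linarith
  have hmr : m < r := by rw [hm]; linarith
  set m' := (l + m) / 2 with hm'
  have hlm' : l < m' := by rw [hm']; linarith
  have hmm' : m' < m := by rw [hm']; linarith
  -- Freezing the coefficients to the left of `m'` makes them continuous on `ℝ`. The resulting
  -- global solution is correct on `(m', ∞)` and is glued to `w` at `m`, inside the overlap `(m',
  -- r)`.
  have hmax : Continuous fun t : ℝ => max t m' := by fun_prop
  have hmem : ∀ t : ℝ, max t m' ∈ Ioi l := fun t => lt_max_of_lt_right hlm'
  obtain ⟨y, y', hy, hym, hym'⟩ := exists_solvesOn_univ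
    (ha.comp_continuous hmax hmem) (hb.comp_continuous hmax hmem) m (w m) (w' m)
  have hy1 : SolvesOn a b (Ioi m') y y' := by
    intro t ht
    have := hy t trivial
    simpa [max_eq_left (le_of_lt (mem_Ioi.1 ht))] using this
  have hsub : Ioo m' r ⊆ Ioi l := fun t ht => lt_trans hlm' ht.1
  have heq : ∀ t ∈ Ioo m' r, y t = w t ∧ y' t = w' t :=
    SolvesOn.eqOn ordConnected_Ioo (ha.mono hsub) (hb.mono hsub)
      (fun t ht => hy1 t ht.1) (fun t ht => hw t ⟨lt_trans hlm' ht.1, ht.2⟩) ⟨hmm', hmr⟩ hym hym'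
  refine ⟨fun t => if t < m then w t else y t, fun t => if t < m then w' t else y' t, ?_, ?_⟩
  · intro t ht
    rcases lt_or_ge t m with htm | htm
    · have e : ∀ᶠ τ in 𝓝 t, τ < m := Iio_mem_nhds htm
      have h := hw t ⟨ht, htm.trans hmr⟩
      constructor
      · simpa [htm] using h.1.congr_of_eventuallyEq (e.mono fun τ hτ => by simp [hτ])
      · simpa [htm] using h.2.congr_of_eventuallyEq (e.mono fun τ hτ => by simp [hτ])
    · have h := hy1 t (lt_of_lt_of_le hmm' htm)
      have e : ∀ᶠ τ in 𝓝 t, m' < τ := Ioi_mem_nhds (lt_of_lt_of_le hmm' htm)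
      have hnot : ¬ t < m := not_lt.2 htm
      constructor
      · simp only [hnot, if_false]
        refine h.1.congr_of_eventuallyEq (e.mono fun τ hτ => ?_)
        by_cases hτm : τ < m
        · simp [hτm, (heq τ ⟨hτ, hτm.trans hmr⟩).1]
        · simp [hτm]
      · simp only [hnot, if_false]
        refine h.2.congr_of_eventuallyEq (e.mono fun τ hτ => ?_)
        by_cases hτm : τ < m
        · simp [hτm, (heq τ ⟨hτ, hτm.trans hmr⟩).2]
        · simp [hτm]
  · intro t ht
    by_cases htm : t < m
    · simp [htm]
    · simp [htm, heq t ⟨lt_of_lt_of_le hmm' (not_lt.1 htm), ht.2⟩]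

end SecondOrder

/-! ### Power series described by their coefficients. -/

section PowerSeries

/-- The power series with coefficients `c` converges absolutely on the open disc of radius `ρ`. -/
def ConvergesOn (ρ : ℝ) (c : ℕ → ℂ) : Prop :=
  ∀ r : ℝ, 0 ≤ r → r < ρ → Summable fun n => ‖c n‖ * r ^ n

/-- The sum of a power series. -/
noncomputable def pseries (c : ℕ → ℂ) (z : ℂ) : ℂ := ∑' n, c n * z ^ n

/-- The coefficients of the derivative of a power series. -/
def dcoeff (c : ℕ → ℂ) (n : ℕ) : ℂ := (n + 1) * c (n + 1)

/-- The coefficients of `z` times a power series. -/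
def shiftCoeff (c : ℕ → ℂ) : ℕ → ℂ
  | 0 => 0
  | n + 1 => c n

variable {ρ : ℝ} {c : ℕ → ℂ}

theorem ConvergesOn.summable (h : ConvergesOn ρ c) {z : ℂ} (hz : ‖z‖ < ρ) :
    Summable fun n => c n * z ^ n :=
  Summable.of_norm (by simpa using h ‖z‖ (norm_nonneg _) hz)

theorem ConvergesOn.shift (h : ConvergesOn ρ c) : ConvergesOn ρ (shiftCoeff c) := by
  intro r hr hrρ
  rw [← summable_nat_add_iff 1]
  have := (h r hr hrρ).mul_right r
  simpa [shiftCoeff, pow_succ, mul_assoc] using this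

/-- The factor `n + 1` is absorbed by passing to a slightly larger radius `r'`, since `(n + 1) (r /
r') ^ n` tends to zero. -/
theorem ConvergesOn.dcoeff (h : ConvergesOn ρ c) : ConvergesOn ρ (dcoeff c) := by
  intro r hr hrρ
  obtain ⟨r', hr', hr'ρ⟩ := exists_between hrρ
  have hr'0 : 0 < r' := lt_of_le_of_lt hr hr'
  have hs := (summable_nat_add_iff 1).2 (h r' hr'0.le hr'ρ)
  have hq : |r / r'| < 1 := by
    rw [abs_of_nonneg (by positivity), div_lt_one hr'0]; exact hr'
  have ht : Tendsto (fun n : ℕ => ((n : ℝ) + 1) * (r / r') ^ n) atTop (𝓝 0) := by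
    have h1 := tendsto_pow_const_mul_const_pow_of_abs_lt_one 1 hq
    have h2 := tendsto_pow_atTop_nhds_zero_of_abs_lt_one hq
    simpa [add_mul] using h1.add h2
  have hev : ∀ᶠ n : ℕ in atTop, ((n : ℝ) + 1) * (r / r') ^ n < r' :=
    ht.eventually (gt_mem_nhds hr'0)
  refine Summable.of_norm_bounded_eventually_nat hs ?_
  filter_upwards [hev] with n hn
  have e1 : ‖Kerr.dcoeff c n‖ = ((n : ℝ) + 1) * ‖c (n + 1)‖ := by
    simp only [Kerr.dcoeff, norm_mul]
    congr 1
    exact_mod_cast Complex.norm_natCast (n + 1)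
  have e2 : r ^ n = (r / r') ^ n * r' ^ n := by
    rw [← mul_pow, div_mul_cancel₀ _ hr'0.ne']
  rw [Real.norm_of_nonneg (by positivity), e1, e2, pow_succ]
  calc ((n : ℝ) + 1) * ‖c (n + 1)‖ * ((r / r') ^ n * r' ^ n)
      = (((n : ℝ) + 1) * (r / r') ^ n) * (‖c (n + 1)‖ * r' ^ n) := by ring
    _ ≤ r' * (‖c (n + 1)‖ * r' ^ n) := by gcongr
    _ = _ := by ring

theorem pseries_shift (h : ConvergesOn ρ c) {z : ℂ} (hz : ‖z‖ < ρ) :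
    pseries (shiftCoeff c) z = z * pseries c z := by
  rw [pseries, (h.shift.summable hz).tsum_eq_zero_add]
  simp only [shiftCoeff, zero_mul, zero_add, pseries, ← tsum_mul_left]
  congr 1
  ext n
  ring

theorem pseries_zero (c : ℕ → ℂ) : pseries c 0 = c 0 := by
  rw [pseries, tsum_eq_single 0 (by intro n hn; simp [hn])]
  simp

theorem hasDerivAt_pseries (h : ConvergesOn ρ c) {z : ℂ} (hz : ‖z‖ < ρ) :
    HasDerivAt (pseries c) (pseries (dcoeff c) z) z := by
  obtain ⟨r, hr, hrρ⟩ := exists_between hz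
  have hr0 : 0 < r := lt_of_le_of_lt (norm_nonneg _) hr
  -- The majorant is `n ‖c n‖ r ^ (n - 1)`, written so that it is zero at `n = 0` without
  -- subtraction in the exponent.
  have hu : Summable fun n : ℕ => ‖shiftCoeff (dcoeff c) n‖ * r ^ n / r :=
    (h.dcoeff.shift r hr0.le hrρ).div_const r
  have key := hasDerivAt_tsum_of_isPreconnected (g := fun n z => c n * z ^ n)
    (g' := fun n z => c n * (n * z ^ (n - 1))) (t := Metric.ball 0 r) (y₀ := 0) (y := z)
    hu Metric.isOpen_ball
    (convex_ball (0 : ℂ) r).isPreconnected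
    (fun n y _ => (hasDerivAt_pow n y).const_mul (c n))
    (fun n y hy => ?_) (Metric.mem_ball_self hr0) ?_ (by simpa using hr)
  · refine HasDerivAt.congr_deriv (f := pseries c) key ?_
    have hs : Summable fun n : ℕ => c n * ((n : ℂ) * z ^ (n - 1)) := by
      rw [← summable_nat_add_iff 1]
      refine (h.dcoeff.summable hz).congr fun n => ?_
      simp only [dcoeff, Nat.add_sub_cancel, Nat.cast_add, Nat.cast_one]
      ring
    rw [hs.tsum_eq_zero_add]
    simp only [Nat.cast_zero, zero_mul, mul_zero, zero_add, pseries, dcoeff, Nat.add_sub_cancel,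
      Nat.cast_add, Nat.cast_one]
    congr 1
    ext n
    ring
  · have hy' : ‖y‖ ≤ r := by simpa using (Metric.mem_ball.1 hy).le
    cases n with
    | zero => simp [shiftCoeff]
    | succ n =>
      simp only [shiftCoeff, dcoeff, Nat.add_sub_cancel, norm_mul, norm_pow]
      rw [pow_succ, ← mul_assoc (‖(n : ℂ) + 1‖ * ‖c (n + 1)‖), mul_div_cancel_right₀ _ hr0.ne']
      have : ‖((n + 1 : ℕ) : ℂ)‖ = ‖(n : ℂ) + 1‖ := by push_cast; rfl
      rw [this]
      calc ‖c (n + 1)‖ * (‖(n : ℂ) + 1‖ * ‖y‖ ^ n) ≤ ‖c (n + 1)‖ * (‖(n : ℂ) + 1‖ * r ^ n) := by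
            gcongr
        _ = _ := by ring
  · exact h.summable (by simpa using lt_of_le_of_lt (norm_nonneg z) hz)

end PowerSeries

/-! ### Frobenius solutions of confluent Heun equations. -/

section Frobenius

/-- The coefficients of `z (z - z₀) f'' + (q₀ + q₁ z + q₂ z²) f' + (k₀ + k₁ z + k₂ z²) f = 0`. -/
structure HeunCoeffs where
  z₀ : ℂ
  q₀ : ℂ
  q₁ : ℂ
  q₂ : ℂ
  k₀ : ℂ
  k₁ : ℂ
  k₂ : ℂ

/-- The triples `(c n, c (n - 1), c (n - 2))` of coefficients of the Frobenius solution with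
exponent zero at the origin. -/
noncomputable def HeunCoeffs.state (H : HeunCoeffs) : ℕ → ℂ × ℂ × ℂ
  | 0 => (1, 0, 0)
  | n + 1 =>
    let v := H.state n
    (-(((n : ℂ) * (n - 1) + H.q₁ * n + H.k₀) * v.1 + (H.q₂ * (n - 1) + H.k₁) * v.2.1
      + H.k₂ * v.2.2) / ((n + 1) * (H.q₀ - H.z₀ * n)), v.1, v.2.1)

/-- The coefficients of the Frobenius solution with exponent zero at the origin. -/
noncomputable def HeunCoeffs.coeff (H : HeunCoeffs) (n : ℕ) : ℂ := (H.state n).1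

variable (H : HeunCoeffs)

theorem HeunCoeffs.coeff_zero : H.coeff 0 = 1 := rfl

theorem HeunCoeffs.state_snd_fst (n : ℕ) : (H.state n).2.1 = shiftCoeff H.coeff n := by
  cases n <;> rfl

theorem HeunCoeffs.state_snd_snd (n : ℕ) :
    (H.state n).2.2 = shiftCoeff (shiftCoeff H.coeff) n := by
  rcases n with _ | _ | n <;> rfl

theorem HeunCoeffs.coeff_succ (n : ℕ) :
    H.coeff (n + 1) = -(((n : ℂ) * (n - 1) + H.q₁ * n + H.k₀) * H.coeff n
      + (H.q₂ * (n - 1) + H.k₁) * shiftCoeff H.coeff n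
      + H.k₂ * shiftCoeff (shiftCoeff H.coeff) n) / ((n + 1) * (H.q₀ - H.z₀ * n)) := by
  rw [← H.state_snd_fst, ← H.state_snd_snd]
  rfl

theorem HeunCoeffs.recurrence (h : ∀ n : ℕ, H.q₀ - H.z₀ * n ≠ 0) (n : ℕ) :
    (n + 1) * (H.q₀ - H.z₀ * n) * H.coeff (n + 1) + ((n : ℂ) * (n - 1) + H.q₁ * n + H.k₀) * H.coeff n
      + (H.q₂ * (n - 1) + H.k₁) * shiftCoeff H.coeff n
      + H.k₂ * shiftCoeff (shiftCoeff H.coeff) n = 0 := by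
  have h1 : (n : ℂ) + 1 ≠ 0 := Nat.cast_add_one_ne_zero n
  rw [H.coeff_succ, mul_div_cancel₀ _ (mul_ne_zero h1 (h n))]
  ring

/-- Both sides are quadratic in `n`, with leading coefficients `θ ^ 2` and `θ ^ 3 * x`; the second
is larger because `1 < θ * x`. With `x = ‖z₀‖` and `y = ‖q₀‖` this is the inductive step for a
geometric bound of ratio `θ`. -/
theorem norm_recurrence_bound {R θ x y : ℝ} (hR : 0 ≤ R) (hθ : 0 < θ) (hx : 1 < θ * x)
    (hy : 0 ≤ y) :
    ∃ n₀ : ℕ, ∀ n : ℕ, n₀ ≤ n → 0 < x * n - y ∧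
      ((n : ℝ) * n + R * n + R) * θ ^ 2 + (R * (n + 1) + R) * θ + R ≤
        θ ^ 3 * ((n + 1) * (x * n - y)) := by
  have hx0 : 0 < x := by
    by_contra h
    have := mul_nonpos_of_nonneg_of_nonpos hθ.le (not_lt.1 h)
    linarith
  set δ := θ ^ 2 * (θ * x - 1) with hδ
  have hδ0 : 0 < δ := mul_pos (by positivity) (by linarith)
  set B := R * θ ^ 2 + R * θ + θ ^ 3 * y with hB
  set B' := R * θ ^ 2 + 2 * R * θ + R + θ ^ 3 * y with hB'
  have hB0 : 0 ≤ B := by positivity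
  have hB'0 : 0 ≤ B' := by positivity
  -- The first summand pays for the lower-order terms, the second makes `x * n - y` positive, and
  -- the third gives `1 < n`.
  obtain ⟨n₀, hn₀⟩ := exists_nat_gt ((B + B') / δ + y / x + 1)
  refine ⟨n₀, fun n hn => ?_⟩
  have hn' : (B + B') / δ + y / x + 1 < n := hn₀.trans_le (by exact_mod_cast hn)
  have hyx : 0 ≤ y / x := by positivity
  have hBδ : 0 ≤ (B + B') / δ := by positivity
  have hn1 : 1 < (n : ℝ) := by linarith
  have h1 : y < x * n := by
    have : y / x < n := by linarith
    rwa [div_lt_iff₀ hx0, mul_comm] at this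
  have h2 : B + B' < δ * n := by
    have : (B + B') / δ < n := by linarith
    rwa [div_lt_iff₀ hδ0, mul_comm] at this
  refine ⟨by linarith, ?_⟩
  have h3 : B * n + B' ≤ δ * n * n := by nlinarith
  have h4 : 0 ≤ θ ^ 3 * (x * n) := by positivity
  have e : θ ^ 3 * ((n + 1) * (x * n - y)) - (((n : ℝ) * n + R * n + R) * θ ^ 2
      + (R * (n + 1) + R) * θ + R) = δ * n * n - (B * n + B') + θ ^ 3 * (x * n) := by
    rw [hδ, hB, hB']; ring
  linarith

/-- The index `n₀` depends only on `z₀`, `q₀`, `R` and `θ`, so one geometric bound serves all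
equations with coefficients at most `R`. This uniformity later yields continuity of the spheroidal
functions in their parameters. -/
theorem HeunCoeffs.exists_norm_coeff_le (z₀ q₀ : ℂ) {R θ : ℝ} (hR : 0 ≤ R) (hθ : 0 < θ)
    (hz : 1 < θ * ‖z₀‖) :
    ∃ n₀ : ℕ, ∀ H : HeunCoeffs, H.z₀ = z₀ → H.q₀ = q₀ → ‖H.q₁‖ ≤ R → ‖H.q₂‖ ≤ R → ‖H.k₀‖ ≤ R →
      ‖H.k₁‖ ≤ R → ‖H.k₂‖ ≤ R → ∀ C : ℝ, (∀ n ≤ n₀, ‖H.coeff n‖ ≤ C * θ ^ n) →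
      ∀ n, ‖H.coeff n‖ ≤ C * θ ^ n := by
  obtain ⟨n₁, hn₁⟩ := norm_recurrence_bound hR hθ hz (norm_nonneg q₀)
  refine ⟨n₁ + 2, ?_⟩
  intro H hz₀ hq₀ h1 h2 h3 h4 h5 C hC n
  induction n using Nat.strong_induction_on with
  | _ n ih =>
  by_cases hn : n ≤ n₁ + 2
  · exact hC n hn
  -- The coefficient of index `n` is computed from the three before it. Since `n ≥ 3`, these are
  -- genuine coefficients and not the zeros that pad `shiftCoeff`.
  obtain ⟨k, rfl⟩ : ∃ k, n = k + 1 + 1 + 1 := ⟨n - 3, by omega⟩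
  set m := k + 1 + 1 with hm
  obtain ⟨hpos, hle⟩ := hn₁ m (by omega)
  have a1 : ‖H.coeff m‖ ≤ C * θ ^ k * θ ^ 2 := by
    simpa [hm, pow_succ, mul_assoc] using ih m (by omega)
  have a2 : ‖shiftCoeff H.coeff m‖ ≤ C * θ ^ k * θ := by
    simpa [hm, pow_succ, mul_assoc, shiftCoeff] using ih (k + 1) (by omega)
  have a3 : ‖shiftCoeff (shiftCoeff H.coeff) m‖ ≤ C * θ ^ k := by
    simpa [hm, shiftCoeff] using ih k (by omega)
  have hm1 : (1 : ℝ) ≤ m := by rw [hm]; push_cast; linarith [(Nat.cast_nonneg k : (0 : ℝ) ≤ k)]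
  have b0 : ‖(m : ℂ) - 1‖ ≤ m := by
    have : (m : ℂ) - 1 = ((m - 1 : ℝ) : ℂ) := by push_cast; rfl
    rw [this, Complex.norm_real, Real.norm_of_nonneg (by linarith)]
    linarith
  have b1 : ‖(m : ℂ) * (m - 1) + H.q₁ * m + H.k₀‖ ≤ m * m + R * m + R := by
    refine (norm_add₃_le).trans ?_
    rw [norm_mul, norm_mul, Complex.norm_natCast]
    gcongr
  have b2 : ‖H.q₂ * (m - 1) + H.k₁‖ ≤ R * (m + 1) + R := by
    refine (norm_add_le _ _).trans ?_
    rw [norm_mul]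
    gcongr
    linarith
  have hden : (m + 1 : ℝ) * (‖z₀‖ * m - ‖q₀‖) ≤ ‖((m : ℂ) + 1) * (H.q₀ - H.z₀ * m)‖ := by
    rw [norm_mul]
    have e1 : ‖(m : ℂ) + 1‖ = m + 1 := by exact_mod_cast Complex.norm_natCast (m + 1)
    rw [e1]
    gcongr
    rw [hq₀, hz₀, norm_sub_rev]
    calc ‖z₀‖ * m - ‖q₀‖ = ‖z₀ * m‖ - ‖q₀‖ := by rw [norm_mul, Complex.norm_natCast]
      _ ≤ _ := norm_sub_norm_le _ _
  have hden0 : 0 < (m + 1 : ℝ) * (‖z₀‖ * m - ‖q₀‖) := by positivity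
  have hCk : 0 ≤ C * θ ^ k := (norm_nonneg _).trans a3
  rw [H.coeff_succ, norm_div, norm_neg, div_le_iff₀ (hden0.trans_le hden)]
  calc _ ≤ (m * m + R * m + R) * (C * θ ^ k * θ ^ 2) + (R * (m + 1) + R) * (C * θ ^ k * θ)
        + R * (C * θ ^ k) := by
        refine (norm_add₃_le).trans ?_
        rw [norm_mul, norm_mul, norm_mul]
        gcongr
    _ = C * θ ^ k * ((m * m + R * m + R) * θ ^ 2 + (R * (m + 1) + R) * θ + R) := by ring
    _ ≤ C * θ ^ k * (θ ^ 3 * ((m + 1) * (‖z₀‖ * m - ‖q₀‖))) := by gcongr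
    _ = C * θ ^ (m + 1) * ((m + 1) * (‖z₀‖ * m - ‖q₀‖)) := by rw [hm]; ring
    _ ≤ _ := by
        have : 0 ≤ C * θ ^ (m + 1) := by
          have : C * θ ^ (m + 1) = C * θ ^ k * θ ^ 3 := by rw [hm]; ring
          rw [this]; positivity
        gcongr

theorem HeunCoeffs.exists_norm_coeff_le_geometric {θ : ℝ} (hθ : 0 < θ) (hz : 1 < θ * ‖H.z₀‖) :
    ∃ C : ℝ, ∀ n, ‖H.coeff n‖ ≤ C * θ ^ n := by
  set R := ‖H.q₁‖ + ‖H.q₂‖ + ‖H.k₀‖ + ‖H.k₁‖ + ‖H.k₂‖ with hR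
  have := norm_nonneg H.q₁
  have := norm_nonneg H.q₂
  have := norm_nonneg H.k₀
  have := norm_nonneg H.k₁
  have := norm_nonneg H.k₂
  obtain ⟨n₀, h⟩ := HeunCoeffs.exists_norm_coeff_le H.z₀ H.q₀ (R := R) (by positivity) hθ hz
  refine ⟨∑ k ∈ Finset.range (n₀ + 1), ‖H.coeff k‖ / θ ^ k, h H rfl rfl (by linarith)
    (by linarith) (by linarith) (by linarith) (by linarith) _ fun n hn => ?_⟩
  rw [← div_le_iff₀ (by positivity)]
  exact Finset.single_le_sum (f := fun k => ‖H.coeff k‖ / θ ^ k)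
    (fun k _ => by positivity) (Finset.mem_range.2 (by omega))

/-- The series converges up to the other singular point: for `r < x < ‖z₀‖` the coefficients are
bounded by a multiple of `(1 / x) ^ n`. -/
theorem HeunCoeffs.convergesOn_coeff : ConvergesOn ‖H.z₀‖ H.coeff := by
  intro r hr hrz
  obtain ⟨x, hrx, hxz⟩ := exists_between hrz
  have hx : 0 < x := lt_of_le_of_lt hr hrx
  obtain ⟨C, hC⟩ := H.exists_norm_coeff_le_geometric (θ := 1 / x) (by positivity)
    (by rw [one_div, ← div_eq_inv_mul]; exact (one_lt_div hx).2 hxz)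
  have hlt : r / x < 1 := (div_lt_one hx).2 hrx
  refine Summable.of_nonneg_of_le (fun n => by positivity) (fun n => ?_)
    ((summable_geometric_of_lt_one (by positivity) hlt).mul_left C)
  calc ‖H.coeff n‖ * r ^ n ≤ C * (1 / x) ^ n * r ^ n := by gcongr; exact hC n
    _ = C * (r / x) ^ n := by rw [mul_assoc, ← mul_pow]; congr 2; ring

/-- The Frobenius solution with exponent zero at the origin. -/
noncomputable def HeunCoeffs.sol : ℂ → ℂ := pseries H.coeff

/-- The derivative of the Frobenius solution. -/
noncomputable def HeunCoeffs.sol' : ℂ → ℂ := pseries (dcoeff H.coeff)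

/-- The second derivative of the Frobenius solution. -/
noncomputable def HeunCoeffs.sol'' : ℂ → ℂ := pseries (dcoeff (dcoeff H.coeff))

variable {H} {z : ℂ}

theorem HeunCoeffs.sol_zero : H.sol 0 = 1 := (pseries_zero _).trans H.coeff_zero

theorem HeunCoeffs.hasDerivAt_sol (hz : ‖z‖ < ‖H.z₀‖) : HasDerivAt H.sol (H.sol' z) z :=
  hasDerivAt_pseries H.convergesOn_coeff hz

theorem HeunCoeffs.hasDerivAt_sol' (hz : ‖z‖ < ‖H.z₀‖) : HasDerivAt H.sol' (H.sol'' z) z :=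
  hasDerivAt_pseries H.convergesOn_coeff.dcoeff hz

/-- Multiplication by `z` shifts coefficients, so the coefficients of the left side are exactly the
recurrence. The hypothesis says that no denominator in `coeff` vanishes, that is, there is no
resonance with the other exponent. -/
theorem HeunCoeffs.sol_eq (h : ∀ n : ℕ, H.q₀ - H.z₀ * n ≠ 0) (hz : ‖z‖ < ‖H.z₀‖) :
    z * (z - H.z₀) * H.sol'' z + (H.q₀ + H.q₁ * z + H.q₂ * z ^ 2) * H.sol' z
      + (H.k₀ + H.k₁ * z + H.k₂ * z ^ 2) * H.sol z = 0 := by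
  set c := H.coeff with hc
  have C0 : ConvergesOn ‖H.z₀‖ c := H.convergesOn_coeff
  have C1 := C0.dcoeff
  have C2 := C1.dcoeff
  have t1 : z * (z * H.sol'' z) = pseries (shiftCoeff (shiftCoeff (dcoeff (dcoeff c)))) z := by
    rw [pseries_shift C2.shift hz, pseries_shift C2 hz]; rfl
  have t2 : z * H.sol'' z = pseries (shiftCoeff (dcoeff (dcoeff c))) z := by
    rw [pseries_shift C2 hz]; rfl
  have t3 : z * H.sol' z = pseries (shiftCoeff (dcoeff c)) z := by rw [pseries_shift C1 hz]; rfl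
  have t4 : z * (z * H.sol' z) = pseries (shiftCoeff (shiftCoeff (dcoeff c))) z := by
    rw [pseries_shift C1.shift hz, pseries_shift C1 hz]; rfl
  have t5 : z * H.sol z = pseries (shiftCoeff c) z := by rw [pseries_shift C0 hz]; rfl
  have t6 : z * (z * H.sol z) = pseries (shiftCoeff (shiftCoeff c)) z := by
    rw [pseries_shift C0.shift hz, pseries_shift C0 hz]; rfl
  have e : z * (z - H.z₀) * H.sol'' z + (H.q₀ + H.q₁ * z + H.q₂ * z ^ 2) * H.sol' z
      + (H.k₀ + H.k₁ * z + H.k₂ * z ^ 2) * H.sol z =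
      z * (z * H.sol'' z) + (-H.z₀) * (z * H.sol'' z) + H.q₀ * H.sol' z + H.q₁ * (z * H.sol' z)
        + H.q₂ * (z * (z * H.sol' z)) + H.k₀ * H.sol z + H.k₁ * (z * H.sol z)
        + H.k₂ * (z * (z * H.sol z)) := by ring
  have s1 := (C2.shift.shift.summable hz).hasSum
  have s2 := ((C2.shift.summable hz).hasSum).mul_left (-H.z₀)
  have s3 := ((C1.summable hz).hasSum).mul_left H.q₀
  have s4 := ((C1.shift.summable hz).hasSum).mul_left H.q₁
  have s5 := ((C1.shift.shift.summable hz).hasSum).mul_left H.q₂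
  have s6 := ((C0.summable hz).hasSum).mul_left H.k₀
  have s7 := ((C0.shift.summable hz).hasSum).mul_left H.k₁
  have s8 := ((C0.shift.shift.summable hz).hasSum).mul_left H.k₂
  have total := ((((((s1.add s2).add s3).add s4).add s5).add s6).add s7).add s8
  rw [e, t1, t2, t4, t6, t3, t5]
  refine total.unique ?_
  convert! (hasSum_zero : HasSum (fun _ : ℕ => (0 : ℂ)) 0) using 1
  ext n
  have hr := H.recurrence h n
  rw [← hc] at hr
  have this : (0 : ℂ) = ((n + 1) * (H.q₀ - H.z₀ * n) * c (n + 1)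
      + ((n : ℂ) * (n - 1) + H.q₁ * n + H.k₀) * c n
      + (H.q₂ * (n - 1) + H.k₁) * shiftCoeff c n
      + H.k₂ * shiftCoeff (shiftCoeff c) n) * z ^ n := by rw [hr, zero_mul]
  rw [this]
  -- The two lowest indices are separate because a double shift is defined by cases there.
  rcases n with _ | _ | n
  · simp [shiftCoeff, dcoeff]
  · simp [shiftCoeff, dcoeff]; ring
  · simp [shiftCoeff, dcoeff]; ring

end Frobenius

/-! ### Laplace transforms on a half-plane. -/

section Laplace

/-- The Laplace transform of a function on the half-line. -/
noncomputable def laplace (φ : ℝ → ℂ) (z : ℂ) : ℂ := ∫ t in Ioi (0 : ℝ), Complex.exp (-(z * t)) * φ t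

/-- A function on `(0, ∞)` which is `O(t ^ (-1 / 2))` at the origin and grows at infinity at most
like `exp (c' t)` for every `c' > c`. -/
def ExpBounded (c : ℝ) (φ : ℝ → ℂ) : Prop :=
  ∀ c' > c, ∃ C : ℝ, ∀ t > 0, ‖φ t‖ ≤ C * t ^ (-(1 / 2) : ℝ) * Real.exp (c' * t)

variable {c : ℝ} {φ ψ : ℝ → ℂ}

theorem ExpBounded.add (h : ExpBounded c φ) (h' : ExpBounded c ψ) :
    ExpBounded c fun t => φ t + ψ t := by
  intro c' hc'
  obtain ⟨C, hC⟩ := h c' hc'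
  obtain ⟨C', hC'⟩ := h' c' hc'
  refine ⟨C + C', fun t ht => (norm_add_le _ _).trans ?_⟩
  linarith [hC t ht, hC' t ht]

theorem ExpBounded.const_mul (h : ExpBounded c φ) (k : ℂ) : ExpBounded c fun t => k * φ t := by
  intro c' hc'
  obtain ⟨C, hC⟩ := h c' hc'
  refine ⟨‖k‖ * C, fun t ht => ?_⟩
  rw [norm_mul]
  calc ‖k‖ * ‖φ t‖ ≤ ‖k‖ * (C * t ^ (-(1 / 2) : ℝ) * Real.exp (c' * t)) := by
        gcongr; exact hC t ht
    _ = _ := by ring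

/-- The factor `t` is absorbed by an arbitrarily small increase of the exponential rate. -/
theorem ExpBounded.mul_id (h : ExpBounded c φ) : ExpBounded c fun t => t * φ t := by
  intro c' hc'
  obtain ⟨c'', h1, h2⟩ := exists_between hc'
  obtain ⟨C, hC⟩ := h c'' h1
  have hδ : 0 < c' - c'' := by linarith
  refine ⟨C / (c' - c''), fun t ht => ?_⟩
  have hC0 : 0 ≤ C * t ^ (-(1 / 2) : ℝ) * Real.exp (c'' * t) := (norm_nonneg _).trans (hC t ht)
  have e1 : (c' - c'') * t ≤ Real.exp ((c' - c'') * t) :=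
    (by linarith [Real.add_one_le_exp ((c' - c'') * t)])
  have e2 : Real.exp (c' * t) = Real.exp (c'' * t) * Real.exp ((c' - c'') * t) := by
    rw [← Real.exp_add]; congr 1; ring
  rw [norm_mul, Complex.norm_real, Real.norm_of_nonneg ht.le, e2]
  calc t * ‖φ t‖ ≤ t * (C * t ^ (-(1 / 2) : ℝ) * Real.exp (c'' * t)) := by
        gcongr; exact hC t ht
    _ = (C * t ^ (-(1 / 2) : ℝ) * Real.exp (c'' * t)) * ((c' - c'') * t) / (c' - c'') := by
        field_simp
    _ ≤ (C * t ^ (-(1 / 2) : ℝ) * Real.exp (c'' * t)) * Real.exp ((c' - c'') * t) / (c' - c'') := by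
        gcongr
    _ = _ := by ring

theorem continuousOn_exp_neg_mul (hφ : ContinuousOn φ (Ioi 0)) (z : ℂ) :
    ContinuousOn (fun t : ℝ => Complex.exp (-(z * t)) * φ t) (Ioi 0) := by
  fun_prop

theorem norm_exp_neg_mul (z : ℂ) (t : ℝ) : ‖Complex.exp (-(z * t))‖ = Real.exp (-(z.re * t)) := by
  rw [Complex.norm_exp]; simp

theorem integrableOn_rpow_mul_exp {σ x : ℝ} (hσ : 0 < σ) (hx : 0 < x) :
    IntegrableOn (fun t : ℝ => t ^ (σ - 1) * Real.exp (-(x * t))) (Ioi 0) := by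
  have := integrableOn_rpow_mul_exp_neg_mul_rpow (p := 1) (s := σ - 1) (b := x) (by linarith)
    one_pos hx
  simpa [neg_mul] using this

theorem ExpBounded.integrableOn (h : ExpBounded c φ) (hφ : ContinuousOn φ (Ioi 0)) {z : ℂ}
    (hz : c < z.re) : IntegrableOn (fun t : ℝ => Complex.exp (-(z * t)) * φ t) (Ioi 0) := by
  obtain ⟨c', h1, h2⟩ := exists_between hz
  obtain ⟨C, hC⟩ := h c' h1
  have hi : IntegrableOn (fun t : ℝ => C * (t ^ ((1 / 2 : ℝ) - 1) * Real.exp (-((z.re - c') * t))))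
      (Ioi 0) := (integrableOn_rpow_mul_exp (by norm_num) (by linarith)).const_mul C
  refine hi.mono' ((continuousOn_exp_neg_mul hφ z).aestronglyMeasurable measurableSet_Ioi) ?_
  filter_upwards [self_mem_ae_restrict measurableSet_Ioi] with t ht
  rw [norm_mul, norm_exp_neg_mul]
  calc Real.exp (-(z.re * t)) * ‖φ t‖
      ≤ Real.exp (-(z.re * t)) * (C * t ^ (-(1 / 2) : ℝ) * Real.exp (c' * t)) := by
        gcongr; exact hC t ht
    _ = C * (t ^ (-(1 / 2) : ℝ) * (Real.exp (-(z.re * t)) * Real.exp (c' * t))) := by ring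
    _ = _ := by rw [← Real.exp_add]; norm_num; left; left; ring

theorem ExpBounded.tendsto (h : ExpBounded c φ) {z : ℂ} (hz : c < z.re) :
    Tendsto (fun t : ℝ => Complex.exp (-(z * t)) * φ t) atTop (𝓝 0) := by
  obtain ⟨c', h1, h2⟩ := exists_between hz
  obtain ⟨C, hC⟩ := h c' h1
  have hlim : Tendsto (fun t : ℝ => |C| * Real.exp (-((z.re - c') * t))) atTop (𝓝 0) := by
    have : Tendsto (fun t : ℝ => Real.exp (-((z.re - c') * t))) atTop (𝓝 0) :=
      Real.tendsto_exp_neg_atTop_nhds_zero.comp (tendsto_id.const_mul_atTop (by linarith))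
    simpa using this.const_mul |C|
  refine squeeze_zero_norm' ?_ hlim
  filter_upwards [eventually_ge_atTop 1] with t ht
  have ht0 : 0 < t := by linarith
  rw [norm_mul, norm_exp_neg_mul]
  have hp : t ^ (-(1 / 2) : ℝ) ≤ 1 := Real.rpow_le_one_of_one_le_of_nonpos ht (by norm_num)
  calc Real.exp (-(z.re * t)) * ‖φ t‖
      ≤ Real.exp (-(z.re * t)) * (|C| * 1 * Real.exp (c' * t)) := by
        gcongr
        refine (hC t ht0).trans ?_
        gcongr
        exact le_abs_self C
    _ = |C| * (Real.exp (-(z.re * t)) * Real.exp (c' * t)) := by ring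
    _ = _ := by rw [← Real.exp_add]; congr 2; ring

/-- The majorant integrates to a Gamma function. Used with `σ = N + 1` for remainders at infinity
and with `σ = 1 / 2` for the growth at the origin. -/
theorem norm_laplace_le {σ C : ℝ} (hσ : 0 < σ)
    (h : ∀ t > 0, ‖φ t‖ ≤ C * t ^ (σ - 1) * Real.exp (c * t)) {z : ℂ} (hz : c < z.re) :
    ‖laplace φ z‖ ≤ C * Real.Gamma σ * (z.re - c) ^ (-σ) := by
  have hx : 0 < z.re - c := by linarith
  have hi := (integrableOn_rpow_mul_exp hσ hx).const_mul C
  have hint : ∫ t in Ioi (0 : ℝ), C * (t ^ (σ - 1) * Real.exp (-((z.re - c) * t))) =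
      C * Real.Gamma σ * (z.re - c) ^ (-σ) := by
    rw [integral_const_mul, Real.integral_rpow_mul_exp_neg_mul_Ioi hσ hx, one_div,
      Real.inv_rpow hx.le, Real.rpow_neg hx.le]
    ring
  rw [← hint]
  refine norm_integral_le_of_norm_le hi ?_
  filter_upwards [self_mem_ae_restrict measurableSet_Ioi] with t ht
  rw [norm_mul, norm_exp_neg_mul]
  calc Real.exp (-(z.re * t)) * ‖φ t‖
      ≤ Real.exp (-(z.re * t)) * (C * t ^ (σ - 1) * Real.exp (c * t)) := by
        gcongr; exact h t ht
    _ = C * (t ^ (σ - 1) * (Real.exp (-(z.re * t)) * Real.exp (c * t))) := by ring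
    _ = _ := by rw [← Real.exp_add]; congr 3; ring

/-- Differentiation under the integral sign: for a real `c₁` between `c` and `re z`, the integrand
of the derivative at `c₁` dominates on the ball of radius `re z - c₁`. -/
theorem hasDerivAt_laplace (h : ExpBounded c φ) (hφ : ContinuousOn φ (Ioi 0)) {z : ℂ}
    (hz : c < z.re) : HasDerivAt (laplace φ) (-laplace (fun t => t * φ t) z) z := by
  obtain ⟨c₁, h1, h2⟩ := exists_between hz
  have hcont : ContinuousOn (fun t : ℝ => (t : ℂ) * φ t) (Ioi 0) := by fun_prop
  have hre : ∀ w ∈ Metric.ball z (z.re - c₁), c₁ < w.re := by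
    intro w hw
    have h3 := (Complex.abs_re_le_norm (w - z)).trans_lt (by simpa [dist_eq_norm] using hw)
    have := (abs_lt.1 h3).1
    simp at this
    linarith
  have hbi := (h.mul_id.integrableOn hcont (z := (c₁ : ℂ)) (by simpa using h1)).norm
  have key := (hasDerivAt_integral_of_dominated_loc_of_deriv_le
    (μ := volume.restrict (Ioi (0 : ℝ))) (𝕜 := ℂ)
    (F := fun z t => Complex.exp (-(z * t)) * φ t)
    (F' := fun z t => Complex.exp (-(z * t)) * -(t * φ t))
    (bound := fun t : ℝ => ‖Complex.exp (-((c₁ : ℂ) * t)) * (t * φ t)‖)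
    (s := Metric.ball z (z.re - c₁)) (x₀ := z)
    (Metric.ball_mem_nhds z (by linarith)) ?_ (h.integrableOn hφ hz) ?_ ?_ hbi ?_).2
  · convert! key using 1
    rw [laplace, ← integral_neg]
    congr 1; ext t; ring
  · exact Eventually.of_forall fun w =>
      (continuousOn_exp_neg_mul hφ w).aestronglyMeasurable measurableSet_Ioi
  · exact (continuousOn_exp_neg_mul hcont.neg z).aestronglyMeasurable measurableSet_Ioi
  · filter_upwards [self_mem_ae_restrict measurableSet_Ioi] with t ht w hw
    rw [norm_mul, norm_mul, norm_neg, norm_exp_neg_mul, norm_exp_neg_mul]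
    have ht' : 0 ≤ t := le_of_lt ht
    have := (hre w hw).le
    simp only [Complex.ofReal_re]
    gcongr
  · filter_upwards with t w _
    have := ((hasDerivAt_id w).mul_const (t : ℂ)).neg.cexp.mul_const (φ t)
    convert! this using 1
    simp only [id, Pi.neg_apply]
    ring

theorem differentiableOn_laplace (h : ExpBounded c φ) (hφ : ContinuousOn φ (Ioi 0)) :
    DifferentiableOn ℂ (laplace φ) {z | c < z.re} := fun _ hz =>
  (hasDerivAt_laplace h hφ hz).differentiableAt.differentiableWithinAt

/-- A power `t ^ σ` with `σ ≥ -1/2` is at most `t ^ (-1/2)` times `1 + t ^ n`, and `t ^ n` costs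
only an arbitrarily small exponential. -/
theorem expBounded_of_norm_le {σ C : ℝ} (hσ : -(1 / 2) ≤ σ)
    (h : ∀ t > 0, ‖φ t‖ ≤ C * t ^ σ * Real.exp (c * t)) : ExpBounded c φ := by
  intro c' hc'
  obtain ⟨n, hn⟩ := exists_nat_ge (σ + 1 / 2)
  have hδ : 0 < c' - c := by linarith
  -- for small times compare powers, for large times absorb the power in the exponential
  refine ⟨|C| * (1 + n.factorial / (c' - c) ^ n), fun t ht => (h t ht).trans ?_⟩
  have hpow : t ^ (σ + 1 / 2) ≤ 1 + t ^ n := by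
    rcases le_total t 1 with h1 | h1
    · have := Real.rpow_le_one ht.le h1 (by linarith : 0 ≤ σ + 1 / 2)
      have : 0 ≤ t ^ n := by positivity
      linarith
    · have := Real.rpow_le_rpow_of_exponent_le h1 hn
      rw [Real.rpow_natCast] at this
      linarith
  have hexp : t ^ n ≤ n.factorial / (c' - c) ^ n * Real.exp ((c' - c) * t) := by
    have := Real.pow_div_factorial_le_exp ((c' - c) * t) (by positivity) n
    rw [mul_pow, div_le_iff₀ (by positivity)] at this
    rw [div_mul_eq_mul_div, le_div_iff₀ (by positivity)]
    linarith
  have h1 : 1 ≤ Real.exp ((c' - c) * t) := Real.one_le_exp (by positivity)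
  have e : t ^ σ = t ^ (-(1 / 2) : ℝ) * t ^ (σ + 1 / 2) := by
    rw [← Real.rpow_add ht]; congr 1; ring
  calc C * t ^ σ * Real.exp (c * t) ≤ |C| * t ^ σ * Real.exp (c * t) := by
        gcongr; exact le_abs_self C
    _ = |C| * t ^ (-(1 / 2) : ℝ) * t ^ (σ + 1 / 2) * Real.exp (c * t) := by rw [e]; ring
    _ ≤ |C| * t ^ (-(1 / 2) : ℝ) * ((1 + n.factorial / (c' - c) ^ n) * Real.exp ((c' - c) * t))
        * Real.exp (c * t) := by
        gcongr
        nlinarith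
    _ = |C| * (1 + n.factorial / (c' - c) ^ n) * t ^ (-(1 / 2) : ℝ)
        * (Real.exp ((c' - c) * t) * Real.exp (c * t)) := by ring
    _ = _ := by rw [← Real.exp_add]; congr 2; ring

theorem continuousOn_ofReal_cpow (a : ℂ) : ContinuousOn (fun t : ℝ => (t : ℂ) ^ a) (Ioi 0) :=
  fun t ht => (Complex.continuousAt_ofReal_cpow_const t a (Or.inr (ne_of_gt ht))).continuousWithinAt

/-- The Laplace transform of a power. -/
theorem laplace_cpow {a z : ℂ} (ha : 1 ≤ a.re) (hz : 0 < z.re) :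
    laplace (fun t => (t : ℂ) ^ (a - 1)) z = z ^ (-a) * Complex.Gamma a := by
  have hb : ExpBounded 0 fun t : ℝ => (t : ℂ) ^ (a - 1) := by
    refine expBounded_of_norm_le (σ := a.re - 1) (C := 1) (by linarith) fun t ht => ?_
    rw [Complex.norm_cpow_eq_rpow_re_of_pos ht]
    simp
  have hopen : IsOpen {z : ℂ | 0 < z.re} := isOpen_lt continuous_const Complex.continuous_re
  have hconv : Convex ℝ {z : ℂ | 0 < z.re} := convex_halfSpace_re_gt 0
  have A1 : AnalyticOnNhd ℂ (laplace fun t => (t : ℂ) ^ (a - 1)) {z | 0 < z.re} :=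
    (differentiableOn_laplace hb (continuousOn_ofReal_cpow _)).analyticOnNhd hopen
  have A2 : AnalyticOnNhd ℂ (fun z : ℂ => z ^ (-a) * Complex.Gamma a) {z | 0 < z.re} := by
    refine DifferentiableOn.analyticOnNhd (fun w hw => ?_) hopen
    have : w ∈ Complex.slitPlane := Or.inl hw
    exact ((differentiableAt_id.cpow_const this).mul_const _).differentiableWithinAt
  -- Identity theorem: both sides are holomorphic on the half-plane and agree on the positive reals,
  -- where the formula is the Gamma integral. The points `1 + 1 / (n + 1)` accumulate at `1`.
  refine A1.eqOn_of_preconnected_of_frequently_eq A2 hconv.isPreconnected (z₀ := 1) (by simp) ?_ hz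
  have hreal : ∀ r : ℝ, 0 < r → laplace (fun t => (t : ℂ) ^ (a - 1)) r
      = (r : ℂ) ^ (-a) * Complex.Gamma a := by
    intro r hr
    have := Complex.integral_cpow_mul_exp_neg_mul_Ioi (a := a) (by linarith) hr
    rw [laplace, Complex.cpow_neg, ← Complex.inv_cpow, ← one_div, ← this]
    · congr 1; ext t; ring
    · rw [Complex.arg_ofReal_of_nonneg hr.le]; exact Real.pi_pos.ne
  have htend : Tendsto (fun n : ℕ => (((1 : ℝ) + 1 / (n + 1) : ℝ) : ℂ)) atTop (𝓝[≠] 1) := by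
    refine tendsto_nhdsWithin_iff.2 ⟨?_, Eventually.of_forall fun n => ?_⟩
    · have : Tendsto (fun n : ℕ => (1 : ℝ) + 1 / ((n : ℝ) + 1)) atTop (𝓝 (1 + 0)) :=
        tendsto_const_nhds.add tendsto_one_div_add_atTop_nhds_zero_nat
      rw [add_zero] at this
      exact (Complex.continuous_ofReal.tendsto 1).comp this
    · simp only [mem_compl_iff, mem_singleton_iff]
      rw [Complex.ofReal_eq_one]
      have : (0 : ℝ) < 1 / (n + 1) := by positivity
      linarith
  exact htend.frequently (Eventually.of_forall fun n => hreal _ (by positivity)).frequently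

end Laplace

/-! ### Laplace transforms of solutions of confluent Heun equations. -/

section LaplaceODE

variable {c : ℝ} {φ φ' φ'' : ℝ → ℂ}

/-- The Laplace transform turns one confluent Heun equation into another one. -/
theorem laplace_heun {D p p' σ α β : ℂ} (hφ : ∀ t > 0, HasDerivAt φ (φ' t) t)
    (hφ' : ∀ t > 0, HasDerivAt φ' (φ'' t) t)
    (hode : ∀ t : ℝ, 0 < t → t * (t - σ) * φ'' t
      + (2 * (2 * t - σ) + D * t ^ 2 - (p + p' + σ * D) * t + α) * φ' t
      + (2 + 2 * D * t - p * D * t - (p + p') - σ * D + β) * φ t = 0)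
    (hb : ExpBounded c φ) (hb' : ExpBounded c fun t => t * φ' t)
    (h0 : Tendsto (fun t : ℝ => t * φ t) (𝓝[>] 0) (𝓝 0))
    (h0' : Tendsto (fun t : ℝ => (α - σ) * φ t - σ * (t * φ' t)) (𝓝[>] 0) (𝓝 0))
    (h1' : Tendsto (fun t : ℝ => t * (t * φ' t)) (𝓝[>] 0) (𝓝 0))
    {z : ℂ} (hz : c < z.re) :
    z * (z + D) * laplace (fun t => t * (t * φ t)) z
      + (p * (z + D) + p' * z + σ * (z * (z + D))) * (-laplace (fun t => t * φ t) z)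
      + (α * z + β) * laplace φ z = 0 := by
  have cφ : ContinuousOn φ (Ioi 0) := fun t ht => (hφ t ht).continuousAt.continuousWithinAt
  have c1 : ContinuousOn (fun t : ℝ => (t : ℂ) * φ t) (Ioi 0) := by fun_prop
  have c2 : ContinuousOn (fun t : ℝ => (t : ℂ) * (t * φ t)) (Ioi 0) := by fun_prop
  have i0 := hb.integrableOn cφ hz
  have i1 := hb.mul_id.integrableOn c1 hz
  have i2 := hb.mul_id.mul_id.integrableOn c2 hz
  -- `exp (-z t) * G t` is the boundary term produced by integrating by parts. By `hode` its
  -- derivative is minus the integrand of the claim, so only its limits at `0` and infinity matter.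
  set G : ℝ → ℂ := fun t => (2 * t - σ) * φ t + t * (t - σ) * φ' t + z * (t * (t - σ)) * φ t
    + (D * t ^ 2 - (p + p' + σ * D) * t + α) * φ t with hG
  set F : ℝ → ℂ := fun t => Complex.exp (-(z * t)) * G t with hF
  have hof : ∀ t : ℝ, HasDerivAt (fun t : ℝ => (t : ℂ)) 1 t := fun t =>
    Complex.ofRealCLM.hasDerivAt
  have hderiv : ∀ t ∈ Ioi (0 : ℝ), HasDerivAt F
      (-(z * (z + D)) * (Complex.exp (-(z * t)) * (t * (t * φ t)))
        + (p * (z + D) + p' * z + σ * (z * (z + D))) * (Complex.exp (-(z * t)) * (t * φ t))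
        - (α * z + β) * (Complex.exp (-(z * t)) * φ t)) t := by
    intro t ht
    have d0 := hof t
    have dφ := hφ t ht
    have dφ' := hφ' t ht
    have dG : HasDerivAt G _ t := ((((d0.const_mul 2).sub_const σ).mul dφ).add
      ((d0.mul (d0.sub_const σ)).mul dφ')).add
      (((d0.mul (d0.sub_const σ)).const_mul z).mul dφ) |>.add
      (((((d0.pow 2).const_mul D).sub (d0.const_mul (p + p' + σ * D))).add_const α).mul dφ)
    have dE := (d0.const_mul z).neg.cexp
    refine (dE.mul dG).congr_deriv ?_
    have := hode t ht
    simp only [hG, Nat.cast_ofNat, Pi.neg_apply, Pi.mul_apply, Pi.sub_apply, Pi.pow_apply]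
    linear_combination (exp := 1) Complex.exp (-(z * t)) * this
  have hint := ((i2.const_mul (-(z * (z + D)))).add
    (i1.const_mul (p * (z + D) + p' * z + σ * (z * (z + D))))).sub (i0.const_mul (α * z + β))
  have hGb : ExpBounded c G := by
    have e : G = fun t : ℝ => (α - σ) * φ t + (2 - z * σ - (p + p' + σ * D)) * (t * φ t)
        + (z + D) * (t * (t * φ t)) + (t * (t * φ' t) + (-σ) * (t * φ' t)) := by
      ext t; simp only [hG]; ring
    rw [e]
    exact (((hb.const_mul _).add (hb.mul_id.const_mul _)).add (hb.mul_id.mul_id.const_mul _)).add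
      (hb'.mul_id.add (hb'.const_mul _))
  have hF0 : Tendsto F (𝓝[>] 0) (𝓝 0) := by
    have ht0 : Tendsto (fun t : ℝ => (t : ℂ)) (𝓝[>] 0) (𝓝 0) :=
      (Complex.continuous_ofReal.tendsto' 0 0 (by simp)).mono_left nhdsWithin_le_nhds
    have hE : Tendsto (fun t : ℝ => Complex.exp (-(z * t))) (𝓝[>] 0) (𝓝 1) := by
      have : Continuous fun t : ℝ => Complex.exp (-(z * t)) := by fun_prop
      exact (this.tendsto' 0 1 (by simp)).mono_left nhdsWithin_le_nhds
    -- Every term but the first carries a factor of `t` that makes it vanish at the origin; the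
    -- first vanishes by `h0'`, which is a condition on the exponent of `φ` at `0`.
    have e : G = fun t : ℝ => ((α - σ) * φ t - σ * (t * φ' t))
        + (2 - z * σ - (p + p' + σ * D)) * (t * φ t)
        + (z + D) * (t * (t * φ t)) + t * (t * φ' t) := by
      ext t; simp only [hG]; ring
    have : Tendsto G (𝓝[>] 0) (𝓝 0) := by
      rw [e]
      simpa using ((h0'.add (h0.const_mul _)).add ((ht0.mul h0).const_mul (z + D))).add h1'
    simpa using hE.mul this
  -- `F` is redefined at `0` by its right limit, since the fundamental theorem needs continuity at
  -- the endpoint.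
  have key := integral_Ioi_of_hasDerivAt_of_tendsto (a := 0) (f := Function.update F 0 0)
    (m := 0) ?_ (fun t ht => (hderiv t ht).congr_of_eventuallyEq ?_) hint ?_
  · rw [Function.update_self, sub_zero] at key
    have j2 := i2.const_mul (-(z * (z + D)))
    have j1 := i1.const_mul (p * (z + D) + p' * z + σ * (z * (z + D)))
    have j0 := i0.const_mul (α * z + β)
    have e1 := integral_sub (j2.add j1) j0
    have e2 := integral_add j2 j1
    simp only [Pi.add_apply] at e1
    rw [e1, e2, integral_const_mul, integral_const_mul, integral_const_mul] at key
    simp only [laplace]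
    linear_combination -key
  · rw [← continuousWithinAt_Ioi_iff_Ici]
    have : Tendsto (Function.update F 0 0) (𝓝[>] 0) (𝓝 0) :=
      hF0.congr' (eventually_nhdsWithin_of_forall fun t ht =>
        (Function.update_of_ne (ne_of_gt ht) _ _).symm)
    simpa [ContinuousWithinAt] using this
  · filter_upwards [Ioi_mem_nhds ht] with τ hτ
    exact Function.update_of_ne (ne_of_gt hτ) _ _
  · refine (hGb.tendsto hz).congr' ?_
    filter_upwards [eventually_gt_atTop 0] with τ hτ
    change F τ = _
    exact (Function.update_of_ne (ne_of_gt hτ) _ _).symm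

end LaplaceODE

/-! ### Subexponential growth of solutions. -/

section Growth

variable {φ φ' : ℝ → ℂ}

theorem expBounded_zero_of_bounds (hφ : ContinuousOn φ (Ioi 0))
    (h0 : ∃ δ > 0, ∃ C : ℝ, ∀ t ∈ Ioo 0 δ, ‖φ t‖ ≤ C)
    (h1 : ∀ ε > 0, ∃ C T : ℝ, ∀ t ≥ T, ‖φ t‖ ≤ C * Real.exp (ε * t)) : ExpBounded 0 φ := by
  intro c' hc'
  obtain ⟨ε, hε, hεc⟩ := exists_between hc'
  obtain ⟨δ, hδ, C₀, hC₀⟩ := h0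
  obtain ⟨C₁, T, hC₁⟩ := h1 ε hε
  have hsub : Icc δ (max T δ) ⊆ Ioi 0 := fun t ht => hδ.trans_le ht.1
  obtain ⟨C₂, hC₂⟩ := isCompact_Icc.exists_bound_of_continuousOn (hφ.mono hsub)
  have key : ∀ t > 0, ‖φ t‖ ≤ (|C₀| + |C₁| + |C₂|) * t ^ (0 : ℝ) * Real.exp (ε * t) := by
    intro t ht
    have he : 1 ≤ Real.exp (ε * t) := Real.one_le_exp (by positivity)
    have p0 := abs_nonneg C₀
    have p1 := abs_nonneg C₁
    have p2 := abs_nonneg C₂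
    rw [Real.rpow_zero, mul_one]
    rcases lt_or_ge t δ with h | h
    · nlinarith [hC₀ t ⟨ht, h⟩, le_abs_self C₀]
    rcases le_or_gt t (max T δ) with h' | h'
    · nlinarith [hC₂ t ⟨h, h'⟩, le_abs_self C₂]
    · have := hC₁ t ((le_max_left _ _).trans h'.le)
      nlinarith [le_abs_self C₁]
  exact expBounded_of_norm_le (by norm_num) key c' hεc

/-- Solutions of a linear equation whose coefficients tend to those of `y'' = - D y'`, with
`0 ≤ re D`, grow slower than every exponential. -/
theorem SolvesOn.subexponential {a b : ℝ → ℂ} {D : ℂ} (hD : 0 ≤ D.re)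
    (h : SolvesOn a b (Ioi 0) φ φ') (ha : Tendsto a atTop (𝓝 (-D))) (hb : Tendsto b atTop (𝓝 0))
    {ε : ℝ} (hε : 0 < ε) :
    ∃ C T : ℝ, ∀ t ≥ T, ‖φ t‖ ≤ C * Real.exp (ε * t) ∧ ‖φ' t‖ ≤ C * Real.exp (ε * t) := by
  set δ : ℝ := ε / 2 with hδ
  have hδ0 : 0 < δ := by positivity
  -- The permitted deviation of the coefficients from their limits, chosen so that `ε' ≤ δ` and `ε'
  -- * (‖D‖ + 1) ≤ δ ^ 2`.
  set ε' : ℝ := δ ^ 2 / (δ + 2 * (‖D‖ + 1)) with hε'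
  have hε'0 : 0 < ε' := by positivity
  have ha' : ∀ᶠ t in atTop, ‖D + a t‖ < ε' := by
    have : Tendsto (fun t => ‖D + a t‖) atTop (𝓝 0) := by
      simpa using (ha.const_add D).norm
    exact this.eventually (gt_mem_nhds hε'0)
  have hb' : ∀ᶠ t in atTop, ‖b t‖ < ε' := by
    have : Tendsto (fun t => ‖b t‖) atTop (𝓝 0) := by simpa using hb.norm
    exact this.eventually (gt_mem_nhds hε'0)
  obtain ⟨T, hT⟩ := eventually_atTop.1 ((ha'.and hb').and (eventually_gt_atTop 0))
  -- `w` is constant for the limiting equation `y'' = -D y'`, so its derivative is small here. In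
  -- the energy `N` the weight `δ ^ 2` turns the cross term into at most `δ * N`, and `0 ≤ re D`
  -- gives the remaining term a favourable sign.
  set w : ℝ → ℂ := fun t => φ' t + D * φ t with hw
  set N : ℝ → ℝ := fun t => ‖w t‖ ^ 2 + δ ^ 2 * ‖φ t‖ ^ 2 with hN
  have hderiv : ∀ t ≥ T, ∃ N', HasDerivAt N N' t ∧ N' ≤ 2 * ε * N t := by
    intro t ht
    obtain ⟨⟨h1, h2⟩, h3⟩ := hT t ht
    obtain ⟨d1, d2⟩ := h t h3
    have dw : HasDerivAt w ((D + a t) * φ' t + b t * φ t) t :=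
      (d2.add (d1.const_mul D)).congr_deriv (by ring)
    refine ⟨_, dw.norm_sq.add ((d1.norm_sq).const_mul (δ ^ 2)), ?_⟩
    set x := ‖φ t‖ with hx
    set v := ‖w t‖ with hv
    have hx0 : 0 ≤ x := norm_nonneg _
    have hv0 : 0 ≤ v := norm_nonneg _
    have e1 : φ' t = w t - D * φ t := by simp [hw]
    have n1 : ‖φ' t‖ ≤ v + ‖D‖ * x := by
      rw [e1]; exact (norm_sub_le _ _).trans (by rw [norm_mul])
    have n2 : ‖(D + a t) * φ' t + b t * φ t‖ ≤ ε' * (v + (‖D‖ + 1) * x) := by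
      refine (norm_add_le _ _).trans ?_
      rw [norm_mul, norm_mul]
      have m1 : ‖D + a t‖ * ‖φ' t‖ ≤ ε' * (v + ‖D‖ * x) := by gcongr
      have m2 : ‖b t‖ * ‖φ t‖ ≤ ε' * x := by gcongr
      linarith
    have i1 : inner ℝ (w t) ((D + a t) * φ' t + b t * φ t) ≤ v * (ε' * (v + (‖D‖ + 1) * x)) :=
      (real_inner_le_norm _ _).trans (by gcongr)
    have i2 : inner ℝ (φ t) (φ' t) ≤ x * v := by
      have e2 : inner ℝ (φ t) (D * φ t) = D.re * x ^ 2 := by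
        rw [Complex.inner, hx, ← Complex.normSq_eq_norm_sq, Complex.normSq_apply]
        simp [Complex.mul_re, Complex.mul_im]
        ring
      rw [e1, inner_sub_right, e2]
      have := real_inner_le_norm (φ t) (w t)
      have : 0 ≤ D.re * x ^ 2 := by positivity
      linarith
    have hε2 : ε' * (δ + 2 * (‖D‖ + 1)) = δ ^ 2 := by rw [hε']; field_simp
    have hDn := norm_nonneg D
    have am : 2 * (δ * x) * v ≤ v ^ 2 + δ ^ 2 * x ^ 2 := by nlinarith [sq_nonneg (δ * x - v)]
    have hδε : ε = 2 * δ := by rw [hδ]; ring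
    -- collect the cross terms
    have c1 : ε' ≤ δ := by
      rw [hε', div_le_iff₀ (by positivity)]; nlinarith
    have c2 : ε' * (‖D‖ + 1) ≤ δ ^ 2 := by nlinarith
    have t1 : v * (ε' * (v + (‖D‖ + 1) * x)) ≤ δ * v ^ 2 + δ ^ 2 * x * v := by
      have : ε' * v ^ 2 ≤ δ * v ^ 2 := by gcongr
      have : ε' * (‖D‖ + 1) * (x * v) ≤ δ ^ 2 * (x * v) := by gcongr
      nlinarith
    calc 2 * inner ℝ (w t) ((D + a t) * φ' t + b t * φ t) + δ ^ 2 * (2 * inner ℝ (φ t) (φ' t))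
        ≤ 2 * (δ * v ^ 2 + δ ^ 2 * x * v) + δ ^ 2 * (2 * (x * v)) := by
          have : δ ^ 2 * (2 * inner ℝ (φ t) (φ' t)) ≤ δ ^ 2 * (2 * (x * v)) := by gcongr
          linarith
      _ ≤ 2 * ε * (v ^ 2 + δ ^ 2 * x ^ 2) := by
          rw [hδε]
          have : 0 ≤ δ * v ^ 2 := by positivity
          have : 0 ≤ δ * (δ ^ 2 * x ^ 2) := by positivity
          have : δ * (2 * (δ * x) * v) ≤ δ * (v ^ 2 + δ ^ 2 * x ^ 2) := by gcongr
          nlinarith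
  choose! N' hN' hNle using hderiv
  -- Grönwall's inequality in the form of monotonicity.
  have hanti : AntitoneOn (fun t => N t * Real.exp (-(2 * ε * t))) (Ici T) := by
    have hd : ∀ t ≥ T, HasDerivAt (fun t => N t * Real.exp (-(2 * ε * t)))
        ((N' t - 2 * ε * N t) * Real.exp (-(2 * ε * t))) t := by
      intro t ht
      refine ((hN' t ht).mul (((hasDerivAt_id t).const_mul (2 * ε)).neg.exp)).congr_deriv ?_
      simp
      ring
    refine antitoneOn_of_deriv_nonpos (convex_Ici T)
      (fun t ht => (hd t ht).continuousAt.continuousWithinAt)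
      (fun t ht => (hd t (interior_subset ht)).differentiableAt.differentiableWithinAt) ?_
    intro t ht
    have ht' : T ≤ t := interior_subset ht
    rw [(hd t ht').deriv]
    exact mul_nonpos_of_nonpos_of_nonneg (by linarith [hNle t ht']) (Real.exp_pos _).le
  set K : ℝ := N T * Real.exp (-(2 * ε * T)) with hK
  have hNT : 0 ≤ N T := by positivity
  have hK0 : 0 ≤ K := by positivity
  have hNbound : ∀ t ≥ T, N t ≤ K * Real.exp (ε * t) ^ 2 := by
    intro t ht
    have h1 : N t * Real.exp (-(2 * ε * t)) ≤ K := hanti (self_mem_Ici) ht ht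
    have e : Real.exp (-(2 * ε * t)) * Real.exp (ε * t) ^ 2 = 1 := by
      rw [← Real.exp_nat_mul, ← Real.exp_add]; simp; ring
    calc N t = N t * Real.exp (-(2 * ε * t)) * Real.exp (ε * t) ^ 2 := by
          rw [mul_assoc, e, mul_one]
      _ ≤ _ := by gcongr
  have hφb : ∀ t ≥ T, ‖φ t‖ ≤ Real.sqrt K / δ * Real.exp (ε * t) := by
    intro t ht
    have h1 := hNbound t ht
    have h2 : (δ * ‖φ t‖) ^ 2 ≤ (Real.sqrt K * Real.exp (ε * t)) ^ 2 := by
      rw [mul_pow, mul_pow, Real.sq_sqrt hK0]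
      have : 0 ≤ ‖w t‖ ^ 2 := by positivity
      simp only [hN] at h1
      linarith
    have h3 := abs_le_of_sq_le_sq h2 (by positivity)
    rw [div_mul_eq_mul_div, le_div_iff₀ hδ0, mul_comm]
    exact (le_abs_self _).trans h3
  have hwb : ∀ t ≥ T, ‖w t‖ ≤ Real.sqrt K * Real.exp (ε * t) := by
    intro t ht
    have h1 := hNbound t ht
    have h2 : ‖w t‖ ^ 2 ≤ (Real.sqrt K * Real.exp (ε * t)) ^ 2 := by
      rw [mul_pow, Real.sq_sqrt hK0]
      have : 0 ≤ δ ^ 2 * ‖φ t‖ ^ 2 := by positivity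
      simp only [hN] at h1
      linarith
    exact (le_abs_self _).trans (abs_le_of_sq_le_sq h2 (by positivity))
  refine ⟨Real.sqrt K + (‖D‖ + 1) * (Real.sqrt K / δ), T, fun t ht => ⟨?_, ?_⟩⟩
  · refine (hφb t ht).trans ?_
    gcongr
    have : 0 ≤ ‖D‖ * (Real.sqrt K / δ) := by positivity
    have := Real.sqrt_nonneg K
    linarith
  · have e1 : φ' t = w t - D * φ t := by simp [hw]
    rw [e1]
    refine (norm_sub_le _ _).trans ?_
    rw [norm_mul]
    have h1 := hwb t ht
    have h2 : ‖D‖ * ‖φ t‖ ≤ ‖D‖ * (Real.sqrt K / δ * Real.exp (ε * t)) := by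
      gcongr; exact hφb t ht
    have h3 : 0 ≤ Real.sqrt K / δ * Real.exp (ε * t) := by positivity
    linarith

end Growth

/-! ### The solution along a ray whose Laplace transform solves the radial equation. -/

section RaySolution

/-- The coefficient of the first derivative in the Laplace transformed radial equation. -/
noncomputable def rayA (D σ ρ : ℂ) (t : ℝ) : ℂ := -(D + (1 - ρ) / t + 1 / (t - σ))

/-- The coefficient of the unknown in the Laplace transformed radial equation. -/
noncomputable def rayB (D σ ρ p β : ℂ) (t : ℝ) : ℂ :=
  -(((2 - p) * D * t - ρ - σ * D + β) / (t * (t - σ)))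

/-- The equation for the regular factor of the solution with exponent `ρ` at the origin. -/
noncomputable def rayHeun (D σ ρ p β : ℂ) : HeunCoeffs where
  z₀ := σ
  q₀ := -σ * (1 + ρ)
  q₁ := 2 + ρ - σ * D
  q₂ := D
  k₀ := ρ * (ρ - 1) + ρ * (2 - ρ - σ * D) - ρ - σ * D + β
  k₁ := (ρ + 2 - p) * D
  k₂ := 0

/-- The solution of the Laplace transformed radial equation with exponent `ρ` at the origin, and its
derivative. -/
structure IsRaySolution (D σ ρ p β : ℂ) (φ φ' : ℝ → ℂ) : Prop where
  solves : SolvesOn (rayA D σ ρ) (rayB D σ ρ p β) (Ioi 0) φ φ'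
  eq : ∀ t ∈ Ioo 0 ‖σ‖, φ t = (t : ℂ) ^ ρ * (rayHeun D σ ρ p β).sol t
  eq' : ∀ t ∈ Ioo 0 ‖σ‖, φ' t = (t : ℂ) ^ ρ * ((rayHeun D σ ρ p β).sol' t
    + ρ / t * (rayHeun D σ ρ p β).sol t)

variable {D σ ρ p β : ℂ}

theorem sub_ne_zero_of_not_real (hσ : ∀ t : ℝ, 0 < t → (t : ℂ) ≠ σ) {t : ℝ} (ht : 0 < t) :
    (t : ℂ) - σ ≠ 0 := sub_ne_zero.2 (hσ t ht)

theorem continuousOn_rayA (hσ : ∀ t : ℝ, 0 < t → (t : ℂ) ≠ σ) :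
    ContinuousOn (rayA D σ ρ) (Ioi 0) := by
  unfold rayA
  have h1 : ∀ t ∈ Ioi (0 : ℝ), (t : ℂ) ≠ 0 := fun t ht => by exact_mod_cast ne_of_gt ht
  have h2 : ∀ t ∈ Ioi (0 : ℝ), (t : ℂ) - σ ≠ 0 := fun t ht => sub_ne_zero_of_not_real hσ ht
  fun_prop (disch := assumption)

theorem continuousOn_rayB (hσ : ∀ t : ℝ, 0 < t → (t : ℂ) ≠ σ) :
    ContinuousOn (rayB D σ ρ p β) (Ioi 0) := by
  unfold rayB
  have h1 : ∀ t ∈ Ioi (0 : ℝ), (t : ℂ) * (t - σ) ≠ 0 := fun t ht =>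
    mul_ne_zero (by exact_mod_cast ne_of_gt ht) (sub_ne_zero_of_not_real hσ ht)
  fun_prop (disch := assumption)

/-- `t ^ ρ` times a Frobenius series solves the equation on `(0, ‖σ‖)`, without resonance because
`re ρ = 0` keeps `1 + ρ + n` away from zero. The solution extends to `(0, ∞)` since the ray misses
the singular point `σ`. -/
theorem exists_isRaySolution (hσ0 : σ ≠ 0) (hσ : ∀ t : ℝ, 0 < t → (t : ℂ) ≠ σ) (hρ : ρ.re = 0) :
    ∃ φ φ' : ℝ → ℂ, IsRaySolution D σ ρ p β φ φ' := by
  set H := rayHeun D σ ρ p β with hH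
  have hrec : ∀ n : ℕ, H.q₀ - H.z₀ * n ≠ 0 := by
    intro n h
    have : σ * (1 + ρ + n) = 0 := by
      simp only [hH, rayHeun] at h
      linear_combination -h
    rcases mul_eq_zero.1 this with h | h
    · exact hσ0 h
    · have := congrArg Complex.re h
      simp [hρ] at this
      have hn : (0 : ℝ) ≤ n := Nat.cast_nonneg n
      linarith
  set w : ℝ → ℂ := fun t => (t : ℂ) ^ ρ * H.sol t with hw
  set w' : ℝ → ℂ := fun t => (t : ℂ) ^ ρ * (H.sol' t + ρ / t * H.sol t) with hw'
  have hsol : SolvesOn (rayA D σ ρ) (rayB D σ ρ p β) (Ioo 0 ‖σ‖) w w' := by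
    intro t ht
    have ht0 : (t : ℂ) ≠ 0 := by exact_mod_cast ne_of_gt ht.1
    have htσ := sub_ne_zero_of_not_real hσ ht.1
    have hnorm : ‖(t : ℂ)‖ < ‖H.z₀‖ := by
      rw [Complex.norm_real, Real.norm_of_nonneg ht.1.le]; exact ht.2
    have d0 : HasDerivAt (fun t : ℝ => (t : ℂ)) 1 t := Complex.ofRealCLM.hasDerivAt
    have dp : HasDerivAt (fun t : ℝ => (t : ℂ) ^ ρ) ((t : ℂ) ^ ρ * (ρ / t)) t := by
      have h1 := (hasDerivAt_id (t : ℂ)).cpow_const (c := ρ) (Or.inl (by simpa using ht.1))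
      have h2 := h1.comp_ofReal
      refine h2.congr_deriv ?_
      simp only [id]
      rw [Complex.cpow_sub _ _ ht0, Complex.cpow_one]
      field_simp
    have ds := (HeunCoeffs.hasDerivAt_sol hnorm).comp_ofReal
    have ds' := (HeunCoeffs.hasDerivAt_sol' hnorm).comp_ofReal
    have ode := HeunCoeffs.sol_eq hrec hnorm
    rw [show H.z₀ = σ from rfl, show H.q₀ = -σ * (1 + ρ) from rfl,
      show H.q₁ = 2 + ρ - σ * D from rfl, show H.q₂ = D from rfl,
      show H.k₀ = ρ * (ρ - 1) + ρ * (2 - ρ - σ * D) - ρ - σ * D + β from rfl,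
      show H.k₁ = (ρ + 2 - p) * D from rfl, show H.k₂ = 0 from rfl] at ode
    constructor
    · refine (dp.mul ds).congr_deriv ?_
      simp only [hw']
      ring
    · have dinv : HasDerivAt (fun t : ℝ => ρ / (t : ℂ)) (-ρ / (t : ℂ) ^ 2) t := by
        refine ((hasDerivAt_const t ρ).div d0 ht0).congr_deriv ?_
        ring
      refine (dp.mul (ds'.add (dinv.mul ds))).congr_deriv ?_
      simp only [hw, hw', rayA, rayB]
      simp only [Pi.add_apply, Pi.mul_apply]
      set P := (t : ℂ) ^ ρ
      set f := H.sol t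
      set f' := H.sol' t
      set f'' := H.sol'' t
      have e : f'' = -((-σ * (1 + ρ) + (2 + ρ - σ * D) * t + D * t ^ 2) * f' +
          (ρ * (ρ - 1) + ρ * (2 - ρ - σ * D) - ρ - σ * D + β + (ρ + 2 - p) * D * t
            + 0 * t ^ 2) * f) / (t * (t - σ)) := by
        rw [eq_div_iff (mul_ne_zero ht0 htσ)]
        linear_combination ode
      rw [e]
      field_simp
      ring
  obtain ⟨φ, φ', h1, h2⟩ := SolvesOn.exists_extension (norm_pos_iff.2 hσ0)
    (continuousOn_rayA hσ) (continuousOn_rayB hσ) hsol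
  exact ⟨φ, φ', h1, fun t ht => (h2 t ht).1, fun t ht => (h2 t ht).2⟩

variable {φ φ' : ℝ → ℂ}

theorem tendsto_inv_ofReal_sub (σ : ℂ) : Tendsto (fun t : ℝ => 1 / ((t : ℂ) - σ)) atTop (𝓝 0) := by
  have h : Tendsto (fun t : ℝ => ‖(t : ℂ) - σ‖) atTop atTop := by
    refine tendsto_atTop_mono (fun t => ?_) (tendsto_atTop_add_const_right atTop (-‖σ‖) tendsto_id)
    have h1 := norm_sub_norm_le (t : ℂ) σ
    have h2 := le_abs_self t
    rw [Complex.norm_real, Real.norm_eq_abs] at h1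
    simp only [id]
    linarith
  have := tendsto_inv₀_cobounded.comp (tendsto_norm_atTop_iff_cobounded.1 h)
  simpa [Function.comp_def] using this

theorem tendsto_rayA : Tendsto (rayA D σ ρ) atTop (𝓝 (-D)) := by
  unfold rayA
  have h0 : Tendsto (fun t : ℝ => 1 / (t : ℂ)) atTop (𝓝 0) := by
    simpa using tendsto_inv_ofReal_sub 0
  have h1 : Tendsto (fun t : ℝ => (1 - ρ) / (t : ℂ)) atTop (𝓝 0) := by
    simpa [div_eq_mul_inv] using h0.const_mul (1 - ρ)
  simpa using ((h1.const_add D).add (tendsto_inv_ofReal_sub σ)).neg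

theorem tendsto_rayB : Tendsto (rayB D σ ρ p β) atTop (𝓝 0) := by
  have h0 : Tendsto (fun t : ℝ => 1 / (t : ℂ)) atTop (𝓝 0) := by
    simpa using tendsto_inv_ofReal_sub 0
  have h1 := tendsto_inv_ofReal_sub σ
  have h2 : Tendsto (fun t : ℝ => -((2 - p) * D * (1 / ((t : ℂ) - σ))
      + (-ρ - σ * D + β) * (1 / (t : ℂ) * (1 / ((t : ℂ) - σ))))) atTop (𝓝 0) := by
    simpa using ((h1.const_mul ((2 - p) * D)).add ((h0.mul h1).const_mul (-ρ - σ * D + β))).neg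
  refine h2.congr' ?_
  filter_upwards [eventually_gt_atTop 0, eventually_gt_atTop ‖σ‖] with t ht htσ
  have ht0 : (t : ℂ) ≠ 0 := by exact_mod_cast ne_of_gt ht
  have hts : (t : ℂ) - σ ≠ 0 := by
    intro h
    rw [sub_eq_zero] at h
    rw [← h, Complex.norm_real, Real.norm_of_nonneg ht.le] at htσ
    exact lt_irrefl _ htσ
  unfold rayB
  field_simp
  ring

namespace IsRaySolution

theorem continuousOn (h : IsRaySolution D σ ρ p β φ φ') : ContinuousOn φ (Ioi 0) :=
  fun t ht => (h.solves t ht).1.continuousAt.continuousWithinAt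

theorem continuousOn' (h : IsRaySolution D σ ρ p β φ φ') : ContinuousOn φ' (Ioi 0) :=
  fun t ht => (h.solves t ht).2.continuousAt.continuousWithinAt

theorem norm_cpow_of_re_eq_zero (hρ : ρ.re = 0) {t : ℝ} (ht : 0 < t) : ‖(t : ℂ) ^ ρ‖ = 1 := by
  rw [Complex.norm_cpow_eq_rpow_re_of_pos ht, hρ, Real.rpow_zero]

theorem tendsto_sol (hσ0 : σ ≠ 0) :
    Tendsto (fun t : ℝ => (rayHeun D σ ρ p β).sol t) (𝓝[>] 0) (𝓝 1) := by
  have hc : ContinuousAt (rayHeun D σ ρ p β).sol 0 :=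
    (HeunCoeffs.hasDerivAt_sol (by simpa [rayHeun] using hσ0)).continuousAt
  have h1 : Tendsto (fun t : ℝ => (t : ℂ)) (𝓝[>] 0) (𝓝 0) :=
    (Complex.continuous_ofReal.tendsto' 0 0 (by simp)).mono_left nhdsWithin_le_nhds
  rw [ContinuousAt, HeunCoeffs.sol_zero] at hc
  exact hc.comp h1

theorem tendsto_mul_sol' (hσ0 : σ ≠ 0) :
    Tendsto (fun t : ℝ => t * (rayHeun D σ ρ p β).sol' t) (𝓝[>] 0) (𝓝 0) := by
  have hc : ContinuousAt (rayHeun D σ ρ p β).sol' 0 :=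
    (HeunCoeffs.hasDerivAt_sol' (by simpa [rayHeun] using hσ0)).continuousAt
  have h1 : Tendsto (fun t : ℝ => (t : ℂ)) (𝓝[>] 0) (𝓝 0) :=
    (Complex.continuous_ofReal.tendsto' 0 0 (by simp)).mono_left nhdsWithin_le_nhds
  simpa using h1.mul (hc.tendsto.comp h1)

theorem mul_eq' (h : IsRaySolution D σ ρ p β φ φ') {t : ℝ} (ht : t ∈ Ioo 0 ‖σ‖) :
    t * φ' t = (t : ℂ) ^ ρ * (t * (rayHeun D σ ρ p β).sol' t + ρ * (rayHeun D σ ρ p β).sol t) := by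
  have ht0 : (t : ℂ) ≠ 0 := by exact_mod_cast ne_of_gt ht.1
  rw [h.eq' t ht]
  field_simp

theorem Ioo_mem (hσ0 : σ ≠ 0) : Ioo 0 ‖σ‖ ∈ 𝓝[>] (0 : ℝ) :=
  Ioo_mem_nhdsGT (norm_pos_iff.2 hσ0)

theorem exists_bound_of_eventually {f g : ℝ → ℂ} {c : ℂ} (hρ : ρ.re = 0)
    (hg : Tendsto g (𝓝[>] 0) (𝓝 c)) (hfg : ∀ᶠ t : ℝ in 𝓝[>] 0, f t = (t : ℂ) ^ ρ * g t) :
    ∃ δ > 0, ∃ C : ℝ, ∀ t ∈ Ioo 0 δ, ‖f t‖ ≤ C := by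
  have h1 : ∀ᶠ t : ℝ in 𝓝[>] 0, ‖f t‖ ≤ ‖c‖ + 1 := by
    filter_upwards [hfg, hg.norm.eventually (gt_mem_nhds (lt_add_one ‖c‖)), self_mem_nhdsWithin]
      with t h1 h2 h3
    rw [h1, norm_mul, norm_cpow_of_re_eq_zero hρ h3, one_mul]
    exact h2.le
  obtain ⟨δ, hδ, h⟩ := mem_nhdsGT_iff_exists_Ioo_subset.1 h1
  exact ⟨δ, hδ, _, fun t ht => h ht⟩

theorem exists_bound (h : IsRaySolution D σ ρ p β φ φ') (hσ0 : σ ≠ 0) (hρ : ρ.re = 0) :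
    ∃ δ > 0, ∃ C : ℝ, ∀ t ∈ Ioo 0 δ, ‖φ t‖ ≤ C :=
  exists_bound_of_eventually hρ (tendsto_sol hσ0)
    (by filter_upwards [Ioo_mem hσ0] with t ht using h.eq t ht)

theorem exists_bound' (h : IsRaySolution D σ ρ p β φ φ') (hσ0 : σ ≠ 0) (hρ : ρ.re = 0) :
    ∃ δ > 0, ∃ C : ℝ, ∀ t ∈ Ioo 0 δ, ‖t * φ' t‖ ≤ C :=
  exists_bound_of_eventually hρ ((tendsto_mul_sol' hσ0).add ((tendsto_sol hσ0).const_mul ρ))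
    (by filter_upwards [Ioo_mem hσ0] with t ht using h.mul_eq' ht)

/-- `re ρ = 0` keeps `φ` bounded at the origin and `0 ≤ re D` excludes exponential growth, so the
transform exists on the whole right half-plane. -/
theorem expBounded (h : IsRaySolution D σ ρ p β φ φ') (hD : 0 ≤ D.re) (hσ0 : σ ≠ 0)
    (hρ : ρ.re = 0) : ExpBounded 0 φ :=
  expBounded_zero_of_bounds h.continuousOn (h.exists_bound hσ0 hρ) fun _ hε =>
    let ⟨C, T, hCT⟩ := h.solves.subexponential hD tendsto_rayA tendsto_rayB hε
    ⟨C, T, fun t ht => (hCT t ht).1⟩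

theorem expBounded' (h : IsRaySolution D σ ρ p β φ φ') (hD : 0 ≤ D.re) (hσ0 : σ ≠ 0)
    (hρ : ρ.re = 0) : ExpBounded 0 fun t => t * φ' t := by
  have hc := h.continuousOn'
  refine expBounded_zero_of_bounds (by fun_prop) (h.exists_bound' hσ0 hρ) fun ε hε => ?_
  obtain ⟨C, T, hCT⟩ := h.solves.subexponential hD tendsto_rayA tendsto_rayB (half_pos hε)
  refine ⟨2 / ε * C, max T 0, fun t ht => ?_⟩
  have ht0 : 0 ≤ t := (le_max_right _ _).trans ht
  have h1 := (hCT t ((le_max_left _ _).trans ht)).2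
  have h2 : ε / 2 * t ≤ Real.exp (ε / 2 * t) := by linarith [Real.add_one_le_exp (ε / 2 * t)]
  have h3 : Real.exp (ε * t) = Real.exp (ε / 2 * t) * Real.exp (ε / 2 * t) := by
    rw [← Real.exp_add]; congr 1; ring
  have hC : 0 ≤ C * Real.exp (ε / 2 * t) := (norm_nonneg _).trans h1
  rw [norm_mul, Complex.norm_real, Real.norm_of_nonneg ht0, h3]
  calc t * ‖φ' t‖ ≤ t * (C * Real.exp (ε / 2 * t)) := by gcongr
    _ = 2 / ε * ((C * Real.exp (ε / 2 * t)) * (ε / 2 * t)) := by field_simp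
    _ ≤ 2 / ε * ((C * Real.exp (ε / 2 * t)) * Real.exp (ε / 2 * t)) := by gcongr
    _ = _ := by ring

/-- The Laplace transform of a ray solution solves the radial equation. -/
theorem laplace_eq (h : IsRaySolution D σ ρ p β φ φ') (hD : 0 ≤ D.re) (hσ0 : σ ≠ 0)
    (hσ : ∀ t : ℝ, 0 < t → (t : ℂ) ≠ σ) (hρ : ρ.re = 0) {z : ℂ} (hz : 0 < z.re) :
    z * (z + D) * laplace (fun t => t * (t * φ t)) z
      + (p * (z + D) + (2 + ρ - p) * z + σ * (z * (z + D))) * (-laplace (fun t => t * φ t) z)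
      + (σ * (1 + ρ) * z + β) * laplace φ z = 0 := by
  have ht0 : Tendsto (fun t : ℝ => (t : ℂ)) (𝓝[>] 0) (𝓝 0) :=
    (Complex.continuous_ofReal.tendsto' 0 0 (by simp)).mono_left nhdsWithin_le_nhds
  -- The oscillating factor `t ^ ρ` has modulus one, so boundary limits that are zero can be
  -- computed on the regular factor.
  have small : ∀ {f g : ℝ → ℂ} {c : ℂ}, Tendsto g (𝓝[>] 0) (𝓝 c) →
      (∀ᶠ t : ℝ in 𝓝[>] 0, f t = (t : ℂ) ^ ρ * g t) → c = 0 → Tendsto f (𝓝[>] 0) (𝓝 0) := by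
    intro f g c hg hfg hc
    rw [hc] at hg
    refine squeeze_zero_norm' ?_ (tendsto_zero_iff_norm_tendsto_zero.1 hg)
    filter_upwards [hfg, self_mem_nhdsWithin] with t h1 h2
    rw [h1, norm_mul, norm_cpow_of_re_eq_zero hρ h2, one_mul]
  have hs := tendsto_sol (D := D) (ρ := ρ) (p := p) (β := β) hσ0
  have hs' := tendsto_mul_sol' (D := D) (ρ := ρ) (p := p) (β := β) hσ0
  refine laplace_heun (φ'' := fun t => rayA D σ ρ t * φ' t + rayB D σ ρ p β t * φ t)
    (fun t ht => (h.solves t ht).1) (fun t ht => (h.solves t ht).2) (fun t ht => ?_)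
    (h.expBounded hD hσ0 hρ) (h.expBounded' hD hσ0 hρ)
    (small (ht0.mul hs) ?_ (by simp))
    -- The limit is `σρ - σρ = 0`; this is where the value `σ (1 + ρ)` of the parameter `α` is
    -- forced.
    (small ((hs.const_mul (σ * (1 + ρ) - σ)).sub ((hs'.add (hs.const_mul ρ)).const_mul σ)) ?_
      (by ring))
    (small (ht0.mul (hs'.add (hs.const_mul ρ))) ?_ (by simp)) hz
  · have h0 : (t : ℂ) ≠ 0 := by exact_mod_cast ne_of_gt ht
    have h1 := sub_ne_zero_of_not_real hσ ht
    simp only [rayA, rayB]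
    field_simp
    ring
  · filter_upwards [Ioo_mem hσ0] with t ht
    rw [h.eq t ht]; ring
  · filter_upwards [Ioo_mem hσ0] with t ht
    rw [h.mul_eq' ht, h.eq t ht]; ring
  · filter_upwards [Ioo_mem hσ0] with t ht
    rw [h.mul_eq' ht]; ring

end IsRaySolution

end RaySolution

/-! ### Asymptotics at infinity for a real potential with a Coulomb tail. -/

section Levinson

/-- Integrating the bound gives increments of at most `K / y₁ - K / y₂`, hence the Cauchy property
together with the rate `K / y`. -/
theorem exists_limit_of_norm_deriv_le {a a' : ℝ → ℂ} {K Y : ℝ} (hY : 0 < Y)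
    (ha : ∀ y ≥ Y, HasDerivAt a (a' y) y) (hK : ∀ y ≥ Y, ‖a' y‖ ≤ K / y ^ 2) :
    ∃ L : ℂ, ∀ y ≥ Y, ‖a y - L‖ ≤ K / y := by
  have hK0 : 0 ≤ K := by
    have h := (norm_nonneg _).trans (hK Y le_rfl)
    by_contra hneg
    have : K / Y ^ 2 < 0 := div_neg_of_neg_of_pos (not_le.1 hneg) (by positivity)
    linarith
  have hstep : ∀ y₁ ≥ Y, ∀ y₂ ≥ y₁, ‖a y₂ - a y₁‖ ≤ K / y₁ - K / y₂ := by
    intro y₁ h1 y₂ h2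
    have hy : ∀ x ∈ Icc y₁ y₂, Y ≤ x := fun x hx => h1.le.trans hx.1
    have := image_norm_le_of_norm_deriv_right_le_deriv_boundary' (f := fun y => a y - a y₁)
      (f' := a') (a := y₁) (b := y₂) (B := fun y => K / y₁ - K / y) (B' := fun y => K / y ^ 2)
      (fun x hx => ((ha x (hy x hx)).continuousAt.sub continuousAt_const).continuousWithinAt)
      (fun x hx => ((ha x (hy x (Ico_subset_Icc_self hx))).sub_const _).hasDerivWithinAt)
      (by simp)
      (fun x hx => ContinuousAt.continuousWithinAt (by
        have : x ≠ 0 := (hY.trans_le (hy x hx)).ne'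
        fun_prop (disch := assumption)))
      (fun x hx => by
        have hx0 : x ≠ 0 := (hY.trans_le (hy x (Ico_subset_Icc_self hx))).ne'
        refine (((hasDerivAt_const x K).div (hasDerivAt_id x) hx0).const_sub
          (K / y₁)).hasDerivWithinAt.congr_deriv ?_
        simp [neg_div])
      (fun x hx => hK x (hy x (Ico_subset_Icc_self hx)))
    exact this ⟨h2, le_rfl⟩
  have hpos : ∀ y, 0 < max y Y := fun y => lt_max_of_lt_right hY
  have hcauchy : CauchySeq fun y => a (max y Y) := by
    refine cauchySeq_of_le_tendsto_0' (fun y => K / max y Y) (fun y₁ y₂ h => ?_) ?_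
    · rw [dist_comm, dist_eq_norm]
      refine (hstep _ (le_max_right _ _) _ (max_le_max_right _ h)).trans ?_
      have : 0 ≤ K / max y₂ Y := by have := hpos y₂; positivity
      linarith
    · exact (tendsto_atTop_mono (fun y => le_max_left y Y) tendsto_id).const_div_atTop K
  obtain ⟨L, hL⟩ := cauchySeq_tendsto_of_complete hcauchy
  refine ⟨L, fun y hy => ?_⟩
  have hy0 : 0 < y := hY.trans_le hy
  have h1 : Tendsto (fun x => ‖a y - a (max x Y)‖) atTop (𝓝 ‖a y - L‖) := (hL.const_sub _).norm
  refine le_of_tendsto h1 ?_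
  filter_upwards [eventually_ge_atTop y] with x hx
  have hm : max x Y = x := max_eq_left (hy.le.trans hx)
  rw [hm, norm_sub_rev]
  refine (hstep y hy x hx).trans ?_
  have : 0 ≤ K / x := by have := hy0.trans_le hx; positivity
  linarith

/-- Asymptotics at infinity of the solutions of `Φ'' + V Φ = 0` for a real potential with a
Coulomb tail, and the value of the conserved current. -/
theorem exists_oscillating_asymptotics {V : ℝ → ℝ} {ν γ C₀ : ℝ} (hν : ν ≠ 0)
    (hV : ∀ y ≥ 1, |V y - (ν ^ 2 + γ / y)| ≤ C₀ / y ^ 2) {Φ Φ' : ℝ → ℂ}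
    (hΦ : ∀ y > 0, HasDerivAt Φ (Φ' y) y) (hΦ' : ∀ y > 0, HasDerivAt Φ' (-(V y : ℂ) * Φ y) y) :
    ∃ A B : ℂ, ∃ C Y : ℝ, 1 ≤ Y ∧
      (∀ y ≥ Y, ‖Φ y - (A * Complex.exp (Complex.I * (ν * y + γ / (2 * ν) * Real.log y))
        + B * Complex.exp (-(Complex.I * (ν * y + γ / (2 * ν) * Real.log y))))‖ ≤ C / y) ∧
      (∀ y ≥ Y, ‖Φ y‖ ≤ C) ∧
      Tendsto (fun y => (starRingEnd ℂ (Φ y) * Φ' y).im) atTop (𝓝 (ν * (‖A‖ ^ 2 - ‖B‖ ^ 2))) := by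
  -- `θ` is the WKB phase with its Coulomb logarithm and `k` is its derivative; `k ^ 2` agrees with
  -- `V` up to `O(y⁻²)`.
  set k : ℝ → ℝ := fun y => ν + γ / (2 * ν * y) with hk
  set θ : ℝ → ℝ := fun y => ν * y + γ / (2 * ν) * Real.log y with hθ
  have hνabs : 0 < |ν| := abs_pos.2 hν
  -- Beyond this point `|k| ≥ |ν| / 2`, so that dividing by `k` is harmless.
  set Y : ℝ := max 1 (|γ| / ν ^ 2) with hYdef
  have hY1 : 1 ≤ Y := le_max_left _ _
  have hY0 : 0 < Y := by linarith
  have hkν : ∀ y ≥ Y, |k y - ν| ≤ |γ| / (2 * |ν|) / y := by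
    intro y hy
    have hy0 : 0 < y := hY0.trans_le hy
    have : k y - ν = γ / (2 * ν * y) := by simp [hk]
    rw [this, abs_div, abs_mul, abs_mul, abs_of_pos hy0, abs_of_pos (by norm_num : (0 : ℝ) < 2),
      div_div]
  have hkpos : ∀ y ≥ Y, |ν| / 2 ≤ |k y| := by
    intro y hy
    have hy0 : 0 < y := hY0.trans_le hy
    have h1 : |γ| / ν ^ 2 ≤ y := (le_max_right _ _).trans hy
    rw [div_le_iff₀ (by positivity)] at h1
    have h2 : |γ| / (2 * |ν|) / y ≤ |ν| / 2 := by
      rw [div_div, div_le_div_iff₀ (by positivity) (by norm_num)]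
      have : |ν| * (2 * |ν| * y) = 2 * (y * ν ^ 2) := by rw [← sq_abs ν]; ring
      rw [this]; linarith
    have h3 := hkν y hy
    have h4 := abs_sub_abs_le_abs_sub ν (k y)
    rw [abs_sub_comm] at h4
    linarith
  have dθ : ∀ y > 0, HasDerivAt (fun y => (θ y : ℂ)) (k y : ℂ) y := by
    intro y hy
    have h1 : HasDerivAt θ (k y) y := by
      refine (((hasDerivAt_id y).const_mul ν).add
        ((Real.hasDerivAt_log hy.ne').const_mul (γ / (2 * ν)))).congr_deriv ?_
      simp only [hk]; field_simp
    exact h1.ofReal_comp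
  have dk : ∀ y > 0, HasDerivAt (fun y => (k y : ℂ)) ((-(γ / (2 * ν) / y ^ 2) : ℝ) : ℂ) y := by
    intro y hy
    have h1 : HasDerivAt k (-(γ / (2 * ν) / y ^ 2)) y := by
      have h2 : HasDerivAt (fun y : ℝ => γ / (2 * ν) * y⁻¹) (γ / (2 * ν) * -(y ^ 2)⁻¹) y :=
        (hasDerivAt_inv hy.ne').const_mul _
      have h3 : k = fun y => ν + γ / (2 * ν) * y⁻¹ := by
        ext y; simp only [hk, div_eq_mul_inv, mul_inv]; ring
      rw [h3]
      refine (h2.const_add ν).congr_deriv ?_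
      rw [div_eq_mul_inv (γ / (2 * ν))]; ring
    exact h1.ofReal_comp
  -- Variation of constants: `ap` and `am` are, up to the factor `2ik` and a sign, the amplitudes of
  -- `exp (iθ)` and `exp (-iθ)`. Their derivatives contain only `R = k ^ 2 - V` and `S = i k'`, both
  -- `O(y⁻²)`, multiplied by `Φ`.
  set ap : ℝ → ℂ := fun y => Complex.exp (-(Complex.I * θ y)) * (Φ' y + Complex.I * k y * Φ y)
    with hap
  set am : ℝ → ℂ := fun y => Complex.exp (Complex.I * θ y) * (Φ' y - Complex.I * k y * Φ y)
    with ham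
  set R : ℝ → ℂ := fun y => (k y : ℂ) ^ 2 - V y with hR
  set S : ℝ → ℂ := fun y => Complex.I * ((-(γ / (2 * ν) / y ^ 2) : ℝ) : ℂ) with hS
  have dap : ∀ y > 0, HasDerivAt ap (Complex.exp (-(Complex.I * θ y)) * ((R y + S y) * Φ y)) y := by
    intro y hy
    have h1 := ((dθ y hy).const_mul Complex.I).neg.cexp
    have h2 := (hΦ' y hy).add (((dk y hy).const_mul Complex.I).mul (hΦ y hy))
    refine (h1.mul h2).congr_deriv ?_
    simp only [hR, hS, Pi.add_apply, Pi.mul_apply, Pi.neg_apply]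
    linear_combination (exp := 1)
      -(Complex.exp (-(Complex.I * θ y)) * (k y : ℂ) ^ 2 * Φ y) * Complex.I_sq
  have dam : ∀ y > 0, HasDerivAt am (Complex.exp (Complex.I * θ y) * ((R y - S y) * Φ y)) y := by
    intro y hy
    have h1 := ((dθ y hy).const_mul Complex.I).cexp
    have h2 := (hΦ' y hy).sub (((dk y hy).const_mul Complex.I).mul (hΦ y hy))
    refine (h1.mul h2).congr_deriv ?_
    simp only [hR, hS, Pi.sub_apply, Pi.mul_apply]
    linear_combination (exp := 1)
      -(Complex.exp (Complex.I * θ y) * (k y : ℂ) ^ 2 * Φ y) * Complex.I_sq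
  have nexp : ∀ x : ℝ, ‖Complex.exp (Complex.I * x)‖ = 1 := fun x => by
    rw [mul_comm]; exact Complex.norm_exp_ofReal_mul_I x
  have nexp' : ∀ x : ℝ, ‖Complex.exp (-(Complex.I * x))‖ = 1 := fun x => by
    have := nexp (-x)
    rwa [Complex.ofReal_neg, mul_neg] at this
  have ee : ∀ x : ℂ, Complex.exp x * Complex.exp (-x) = 1 := fun x => by
    rw [← Complex.exp_add, add_neg_cancel, Complex.exp_zero]
  -- the solution in terms of the amplitudes
  have hΦeq : ∀ y, 2 * Complex.I * k y * Φ y =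
      Complex.exp (Complex.I * θ y) * ap y - Complex.exp (-(Complex.I * θ y)) * am y := by
    intro y
    simp only [hap, ham]
    linear_combination (-2 * Complex.I * k y * Φ y) * ee (Complex.I * θ y)
  have hΦle : ∀ y ≥ Y, |ν| * ‖Φ y‖ ≤ ‖ap y‖ + ‖am y‖ := by
    intro y hy
    have h1 : ‖2 * Complex.I * k y * Φ y‖ ≤ ‖ap y‖ + ‖am y‖ := by
      rw [hΦeq]
      have q1 : ‖Complex.exp (Complex.I * θ y) * ap y‖ = ‖ap y‖ :=
        (norm_mul _ _).trans (by rw [nexp, one_mul])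
      have q2 : ‖Complex.exp (-(Complex.I * θ y)) * am y‖ = ‖am y‖ :=
        (norm_mul _ _).trans (by rw [nexp', one_mul])
      rw [← q1, ← q2]
      exact norm_sub_le _ _
    have h2 : ‖2 * Complex.I * k y * Φ y‖ = 2 * |k y| * ‖Φ y‖ := by
      simp
    rw [h2] at h1
    have := hkpos y hy
    nlinarith [norm_nonneg (Φ y)]
  set E : ℝ := |C₀| + γ ^ 2 / (4 * ν ^ 2) + |γ| / (2 * |ν|) with hE
  have hE0 : 0 ≤ E := by positivity
  have hRn : ∀ y ≥ Y, ‖R y‖ ≤ (|C₀| + γ ^ 2 / (4 * ν ^ 2)) / y ^ 2 := by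
    intro y hy
    have hy0 : 0 < y := hY0.trans_le hy
    have e : R y = ((k y ^ 2 - V y : ℝ) : ℂ) := by simp [hR]
    rw [e, Complex.norm_real, Real.norm_eq_abs]
    have e2 : k y ^ 2 - V y = -(V y - (ν ^ 2 + γ / y)) + γ ^ 2 / (4 * ν ^ 2) / y ^ 2 := by
      simp only [hk]; field_simp; ring
    rw [e2]
    refine (abs_add_le _ _).trans ?_
    rw [abs_neg, add_div, abs_of_nonneg (by positivity : 0 ≤ γ ^ 2 / (4 * ν ^ 2) / y ^ 2)]
    gcongr
    refine (hV y (hY1.trans hy)).trans ?_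
    gcongr
    exact le_abs_self _
  have hSn : ∀ y ≥ Y, ‖S y‖ = |γ| / (2 * |ν|) / y ^ 2 := by
    intro y hy
    simp only [hS, norm_mul, Complex.norm_I, one_mul, Complex.norm_real, Real.norm_eq_abs, abs_neg,
      abs_div, abs_mul, abs_pow, sq_abs]
    norm_num
  have hRS : ∀ y ≥ Y, ‖R y + S y‖ ≤ E / y ^ 2 ∧ ‖R y - S y‖ ≤ E / y ^ 2 := by
    intro y hy
    have h1 := hRn y hy
    have h2 := hSn y hy
    have e : E / y ^ 2 = (|C₀| + γ ^ 2 / (4 * ν ^ 2)) / y ^ 2 + |γ| / (2 * |ν|) / y ^ 2 := by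
      rw [hE]; ring
    rw [e]
    exact ⟨(norm_add_le _ _).trans (by linarith), (norm_sub_le _ _).trans (by linarith)⟩
  set F : ℝ := E / |ν| with hF
  have hF0 : 0 ≤ F := by positivity
  have hbp : ∀ y ≥ Y, ‖Complex.exp (-(Complex.I * θ y)) * ((R y + S y) * Φ y)‖ ≤
      F / y ^ 2 * (‖ap y‖ + ‖am y‖) := by
    intro y hy
    rw [norm_mul, nexp', one_mul, norm_mul]
    have h1 := (hRS y hy).1
    have h2 : ‖Φ y‖ ≤ (‖ap y‖ + ‖am y‖) / |ν| := by
      rw [le_div_iff₀ hνabs, mul_comm]; exact hΦle y hy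
    calc ‖R y + S y‖ * ‖Φ y‖ ≤ E / y ^ 2 * ((‖ap y‖ + ‖am y‖) / |ν|) := by gcongr
      _ = _ := by rw [hF]; ring
  have hbm : ∀ y ≥ Y, ‖Complex.exp (Complex.I * θ y) * ((R y - S y) * Φ y)‖ ≤
      F / y ^ 2 * (‖ap y‖ + ‖am y‖) := by
    intro y hy
    rw [norm_mul, nexp, one_mul, norm_mul]
    have h1 := (hRS y hy).2
    have h2 : ‖Φ y‖ ≤ (‖ap y‖ + ‖am y‖) / |ν| := by
      rw [le_div_iff₀ hνabs, mul_comm]; exact hΦle y hy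
    calc ‖R y - S y‖ * ‖Φ y‖ ≤ E / y ^ 2 * ((‖ap y‖ + ‖am y‖) / |ν|) := by gcongr
      _ = _ := by rw [hF]; ring
  -- boundedness of the amplitudes
  set N : ℝ → ℝ := fun y => ‖ap y‖ ^ 2 + ‖am y‖ ^ 2 with hN
  -- `N' ≤ (4F / y²) N`, and `exp (4F / y)` is the integrating factor, which stays bounded on `y ≥
  -- Y`.
  have hanti : AntitoneOn (fun y => N y * Real.exp (4 * F / y)) (Ici Y) := by
    have hd : ∀ y ≥ Y, ∃ n, HasDerivAt (fun y => N y * Real.exp (4 * F / y)) n y ∧ n ≤ 0 := by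
      intro y hy
      have hy0 : 0 < y := hY0.trans_le hy
      have d1 := (dap y hy0).norm_sq.add (dam y hy0).norm_sq
      have d2 : HasDerivAt (fun y => Real.exp (4 * F / y))
          (Real.exp (4 * F / y) * -(4 * F / y ^ 2)) y := by
        have : HasDerivAt (fun y : ℝ => 4 * F / y) (-(4 * F / y ^ 2)) y := by
          refine ((hasDerivAt_const y (4 * F)).div (hasDerivAt_id y) hy0.ne').congr_deriv ?_
          simp [neg_div]
        exact this.exp
      refine ⟨_, d1.mul d2, ?_⟩
      have j1 := (real_inner_le_norm (ap y) _).trans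
        (mul_le_mul_of_nonneg_left (hbp y hy) (norm_nonneg _))
      have j2 := (real_inner_le_norm (am y) _).trans
        (mul_le_mul_of_nonneg_left (hbm y hy) (norm_nonneg _))
      have hFy : 0 ≤ F / y ^ 2 := by positivity
      have e0 : 4 * F / y ^ 2 = 4 * (F / y ^ 2) := by ring
      have hx := norm_nonneg (ap y)
      have hx' := norm_nonneg (am y)
      have key : 2 * inner ℝ (ap y) (Complex.exp (-(Complex.I * θ y)) * ((R y + S y) * Φ y))
          + 2 * inner ℝ (am y) (Complex.exp (Complex.I * θ y) * ((R y - S y) * Φ y))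
          ≤ 4 * F / y ^ 2 * N y := by
        simp only [hN]
        rw [e0]
        have : F / y ^ 2 * (2 * (‖ap y‖ + ‖am y‖) ^ 2) ≤
            F / y ^ 2 * (4 * (‖ap y‖ ^ 2 + ‖am y‖ ^ 2)) :=
          mul_le_mul_of_nonneg_left (by nlinarith [sq_nonneg (‖ap y‖ - ‖am y‖)]) hFy
        nlinarith
      have hexp := Real.exp_pos (4 * F / y)
      simp only [Pi.add_apply]
      have : (2 * inner ℝ (ap y) (Complex.exp (-(Complex.I * θ y)) * ((R y + S y) * Φ y))
          + 2 * inner ℝ (am y) (Complex.exp (Complex.I * θ y) * ((R y - S y) * Φ y))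
          - 4 * F / y ^ 2 * N y) * Real.exp (4 * F / y) ≤ 0 :=
        mul_nonpos_of_nonpos_of_nonneg (by linarith) hexp.le
      simp only [hN] at this ⊢
      linarith
    choose! n hn hn0 using hd
    refine antitoneOn_of_deriv_nonpos (convex_Ici Y)
      (fun t ht => (hn t ht).continuousAt.continuousWithinAt)
      (fun t ht => (hn t (interior_subset ht)).differentiableAt.differentiableWithinAt) ?_
    intro t ht
    rw [(hn t (interior_subset ht)).deriv]
    exact hn0 t (interior_subset ht)
  set K : ℝ := Real.sqrt (N Y * Real.exp (4 * F / Y)) with hKdef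
  have hNb : ∀ y ≥ Y, ‖ap y‖ ≤ K ∧ ‖am y‖ ≤ K := by
    intro y hy
    have hy0 : 0 < y := hY0.trans_le hy
    have h1 : N y * Real.exp (4 * F / y) ≤ N Y * Real.exp (4 * F / Y) := hanti self_mem_Ici hy hy
    have h2 : 1 ≤ Real.exp (4 * F / y) := Real.one_le_exp (by positivity)
    have h3 : 0 ≤ N y := by positivity
    have h4 : N y ≤ N Y * Real.exp (4 * F / Y) := by nlinarith
    constructor
    · refine Real.le_sqrt_of_sq_le ?_
      have : 0 ≤ ‖am y‖ ^ 2 := by positivity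
      simp only [hN] at h4 ⊢
      linarith
    · refine Real.le_sqrt_of_sq_le ?_
      have : 0 ≤ ‖ap y‖ ^ 2 := by positivity
      simp only [hN] at h4 ⊢
      linarith
  have hsum : ∀ y ≥ Y, F / y ^ 2 * (‖ap y‖ + ‖am y‖) ≤ (2 * F * K) / y ^ 2 := by
    intro y hy
    have hy0 : 0 < y := hY0.trans_le hy
    obtain ⟨h1, h2⟩ := hNb y hy
    calc F / y ^ 2 * (‖ap y‖ + ‖am y‖) ≤ F / y ^ 2 * (K + K) := by gcongr
      _ = _ := by ring
  obtain ⟨Lp, hLp⟩ := exists_limit_of_norm_deriv_le hY0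
    (fun y hy => dap y (hY0.trans_le hy)) (fun y hy => (hbp y hy).trans (hsum y hy))
  obtain ⟨Lm, hLm⟩ := exists_limit_of_norm_deriv_le hY0
    (fun y hy => dam y (hY0.trans_le hy)) (fun y hy => (hbm y hy).trans (hsum y hy))
  have hΦK : ∀ y ≥ Y, ‖Φ y‖ ≤ 2 * K / |ν| := by
    intro y hy
    rw [le_div_iff₀ hνabs, mul_comm]
    have := hΦle y hy
    obtain ⟨h1, h2⟩ := hNb y hy
    linarith
  have hK0 : 0 ≤ K := Real.sqrt_nonneg _
  have hνc : (ν : ℂ) ≠ 0 := by exact_mod_cast hν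
  set C : ℝ := (2 * (2 * F * K) + |γ| / |ν| * (2 * K / |ν|)) / (2 * |ν|) + 2 * K / |ν| with hC
  have hKν : 0 ≤ 2 * K / |ν| := by positivity
  have hCC : 0 ≤ (2 * (2 * F * K) + |γ| / |ν| * (2 * K / |ν|)) / (2 * |ν|) := by positivity
  refine ⟨Lp / (2 * Complex.I * ν), -Lm / (2 * Complex.I * ν), C, Y, hY1, fun y hy => ?_,
    fun y hy => (hΦK y hy).trans (by linarith), ?_⟩
  · have hy0 : 0 < y := hY0.trans_le hy
    have hθc : (ν : ℂ) * y + γ / (2 * ν) * Real.log y = (θ y : ℂ) := by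
      simp only [hθ]; push_cast; ring
    rw [hθc]
    have e1 : 2 * Complex.I * ν * (Φ y - (Lp / (2 * Complex.I * ν) * Complex.exp (Complex.I * θ y)
        + -Lm / (2 * Complex.I * ν) * Complex.exp (-(Complex.I * θ y)))) =
        Complex.exp (Complex.I * θ y) * (ap y - Lp) - Complex.exp (-(Complex.I * θ y)) * (am y - Lm)
        + 2 * Complex.I * ((ν - k y : ℝ) : ℂ) * Φ y := by
      have := hΦeq y
      have hI := Complex.I_ne_zero
      push_cast
      field_simp
      linear_combination this
    have e2 : ‖2 * Complex.I * (ν : ℂ)‖ = 2 * |ν| := by simp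
    have h3 : 2 * |ν| * ‖Φ y - (Lp / (2 * Complex.I * ν) * Complex.exp (Complex.I * θ y)
        + -Lm / (2 * Complex.I * ν) * Complex.exp (-(Complex.I * θ y)))‖ ≤
        (2 * (2 * F * K) + |γ| / |ν| * (2 * K / |ν|)) / y := by
      rw [← e2, ← norm_mul, e1]
      refine (norm_add_le _ _).trans ?_
      have a1 := norm_sub_le (Complex.exp (Complex.I * θ y) * (ap y - Lp))
        (Complex.exp (-(Complex.I * θ y)) * (am y - Lm))
      rw [norm_mul, norm_mul, nexp, nexp', one_mul, one_mul] at a1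
      have a2 : ‖2 * Complex.I * ((ν - k y : ℝ) : ℂ) * Φ y‖ ≤
          2 * (|γ| / (2 * |ν|) / y) * (2 * K / |ν|) := by
        rw [norm_mul, norm_mul, norm_mul, Complex.norm_I, Complex.norm_real, Real.norm_eq_abs,
          abs_sub_comm]
        have := hkν y hy
        have := hΦK y hy
        norm_num
        gcongr
      have a3 := hLp y hy
      have a4 := hLm y hy
      have e3 : (2 * (2 * F * K) + |γ| / |ν| * (2 * K / |ν|)) / y = 2 * F * K / y + 2 * F * K / y
          + 2 * (|γ| / (2 * |ν|) / y) * (2 * K / |ν|) := by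
        field_simp; ring
      rw [e3]
      linarith
    have h4 : ‖Φ y - (Lp / (2 * Complex.I * ν) * Complex.exp (Complex.I * θ y)
        + -Lm / (2 * Complex.I * ν) * Complex.exp (-(Complex.I * θ y)))‖ ≤
        (2 * (2 * F * K) + |γ| / |ν| * (2 * K / |ν|)) / (2 * |ν|) / y := by
      rw [div_right_comm, le_div_iff₀ (by positivity), mul_comm]
      exact h3
    refine h4.trans ?_
    gcongr
    rw [hC]
    linarith
  · have hlim : ∀ {a : ℝ → ℂ} {L : ℂ}, (∀ y ≥ Y, ‖a y - L‖ ≤ 2 * F * K / y) →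
        Tendsto a atTop (𝓝 L) := by
      intro a L h
      rw [tendsto_iff_norm_sub_tendsto_zero]
      refine squeeze_zero' (Eventually.of_forall fun _ => norm_nonneg _)
        ((eventually_ge_atTop Y).mono h) (tendsto_id.const_div_atTop _)
    have t1 := (hlim hLp).norm.pow 2
    have t2 := (hlim hLm).norm.pow 2
    have tk : Tendsto k atTop (𝓝 ν) := by
      have : Tendsto (fun y : ℝ => γ / (2 * ν) / y) atTop (𝓝 0) := tendsto_id.const_div_atTop _
      simpa [hk, div_div] using this.const_add ν
    -- `‖ap‖² - ‖am‖²` is exactly `4k` times the current, so the limit of the current comes from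
    -- those of the amplitudes.
    have t3 := (t1.sub t2).div (tk.const_mul 4) (mul_ne_zero (by norm_num) hν)
    have e : (‖Lp‖ ^ 2 - ‖Lm‖ ^ 2) / (4 * ν) =
        ν * (‖Lp / (2 * Complex.I * ν)‖ ^ 2 - ‖-Lm / (2 * Complex.I * ν)‖ ^ 2) := by
      simp only [norm_div, norm_neg, norm_mul, Complex.norm_I, Complex.norm_real, Real.norm_eq_abs,
        div_pow, mul_pow, sq_abs]
      norm_num
      field_simp
    rw [← e]
    refine t3.congr' ?_
    filter_upwards [eventually_ge_atTop Y] with y hy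
    have hky : k y ≠ 0 := by
      have := hkpos y hy
      intro h
      rw [h, abs_zero] at this
      linarith
    simp only [Pi.div_apply]
    rw [div_eq_iff (mul_ne_zero (by norm_num) hky)]
    simp only [hap, ham, norm_mul, nexp, nexp', one_mul]
    rw [← Complex.normSq_eq_norm_sq, ← Complex.normSq_eq_norm_sq, Complex.normSq_apply,
      Complex.normSq_apply]
    simp
    ring

end Levinson

/-! ### The ray solution on the imaginary axis and its conserved current. -/

section ImaginaryRay

/-- The potential of the Laplace transformed radial equation on the imaginary axis, in normal
form. -/
noncomputable def rayPotential (ν κ τ μ y : ℝ) : ℝ :=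
  ν ^ 2 + (1 + κ ^ 2) / (4 * y ^ 2) + 1 / (4 * (y + 2) ^ 2) - ν * κ / y
    - 1 / (2 * (y * (y + 2))) + 2 * ν * τ / y - μ / (y * (y + 2))

/-- The Coulomb coefficient is `2ντ - νκ`. Every other term is `y⁻²` times a polynomial in `y / (y +
2) ∈ [0, 1]`; in particular `μ`, which will contain the angular eigenvalue, enters only at order
`y⁻²`. -/
theorem abs_rayPotential_sub_le (ν κ τ μ : ℝ) {y : ℝ} (hy : 1 ≤ y) :
    |rayPotential ν κ τ μ y - (ν ^ 2 + (2 * ν * τ - ν * κ) / y)| ≤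
      ((1 + κ ^ 2) / 4 + 1 / 4 + 1 / 2 + |μ|) / y ^ 2 := by
  have hy0 : 0 < y := by linarith
  have e : rayPotential ν κ τ μ y - (ν ^ 2 + (2 * ν * τ - ν * κ) / y) =
      ((1 + κ ^ 2) / 4 + 1 / 4 * (y / (y + 2)) ^ 2 - 1 / 2 * (y / (y + 2)) - μ * (y / (y + 2)))
        / y ^ 2 := by
    unfold rayPotential
    field_simp
    ring
  have hq0 : 0 ≤ y / (y + 2) := by positivity
  have hq1 : y / (y + 2) ≤ 1 := by rw [div_le_one (by positivity)]; linarith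
  rw [e, abs_div, abs_of_pos (by positivity : (0 : ℝ) < y ^ 2)]
  gcongr
  set q := y / (y + 2)
  have hq2 : q ^ 2 ≤ 1 := pow_le_one₀ hq0 hq1
  have hμ : |μ * q| ≤ |μ| := by
    rw [abs_mul, abs_of_nonneg hq0]
    exact mul_le_of_le_one_right (abs_nonneg μ) hq1
  have := abs_le.1 hμ
  have := sq_nonneg κ
  have := sq_nonneg q
  rw [abs_le]
  constructor <;> linarith

variable {ν κ τ μ : ℝ} {φ φ' : ℝ → ℂ}

/-- The integrating factor which brings the transformed radial equation to normal form. -/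
noncomputable def rayFactor (ν κ y : ℝ) : ℂ :=
  (y : ℂ) ^ ((1 + Complex.I * κ) / 2) * ((Real.sqrt (y + 2) : ℝ) : ℂ)
    * Complex.exp (-(Complex.I * (ν * y)))

/-- The logarithmic derivative is minus half the coefficient of the first derivative, which is what
removes that term from the equation. -/
theorem hasDerivAt_rayFactor {y : ℝ} (hy : 0 < y) :
    HasDerivAt (rayFactor ν κ) (rayFactor ν κ y *
      (-(rayA (-(2 * Complex.I * ν)) (-2) (-(Complex.I * κ)) y) / 2)) y := by
  have hy0 : (y : ℂ) ≠ 0 := by exact_mod_cast hy.ne'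
  have hy2 : (0 : ℝ) < y + 2 := by linarith
  have hy2c : (y : ℂ) + 2 ≠ 0 := by exact_mod_cast hy2.ne'
  have d0 : HasDerivAt (fun t : ℝ => (t : ℂ)) 1 y := Complex.ofRealCLM.hasDerivAt
  have dp : HasDerivAt (fun t : ℝ => (t : ℂ) ^ ((1 + Complex.I * κ) / 2))
      ((y : ℂ) ^ ((1 + Complex.I * κ) / 2) * ((1 + Complex.I * κ) / 2 / y)) y := by
    have h1 := (hasDerivAt_id (y : ℂ)).cpow_const (c := (1 + Complex.I * κ) / 2)
      (Or.inl (by simpa using hy))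
    refine h1.comp_ofReal.congr_deriv ?_
    simp only [id]
    rw [Complex.cpow_sub _ _ hy0, Complex.cpow_one]
    field_simp
  have hs0 : ((Real.sqrt (y + 2) : ℝ) : ℂ) ≠ 0 := by
    exact_mod_cast (Real.sqrt_pos.2 hy2).ne'
  have hs2 : ((Real.sqrt (y + 2) : ℝ) : ℂ) ^ 2 = y + 2 := by
    have := Real.sq_sqrt hy2.le
    exact_mod_cast congrArg (fun x : ℝ => (x : ℂ)) this
  have ds : HasDerivAt (fun t : ℝ => ((Real.sqrt (t + 2) : ℝ) : ℂ))
      (((Real.sqrt (y + 2) : ℝ) : ℂ) * (1 / (2 * (y + 2)))) y := by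
    have h1 := (((hasDerivAt_id y).add_const 2).sqrt hy2.ne').ofReal_comp
    refine h1.congr_deriv ?_
    simp only [id]
    push_cast
    field_simp
    rw [hs2]
  have de := ((d0.const_mul (ν : ℂ)).const_mul Complex.I).neg.cexp
  refine ((dp.mul ds).mul de).congr_deriv ?_
  simp only [rayFactor, rayA, Pi.mul_apply, Pi.neg_apply]
  have e : (y : ℂ) - -2 = y + 2 := by ring
  rw [e]
  field_simp
  ring

theorem norm_rayFactor_sq {y : ℝ} (hy : 0 < y) : ‖rayFactor ν κ y‖ ^ 2 = y * (y + 2) := by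
  have h1 : ‖Complex.exp (-(Complex.I * (ν * y)))‖ = 1 := by
    have := Complex.norm_exp_ofReal_mul_I (-(ν * y))
    rw [← this]; congr 2; push_cast; ring
  rw [rayFactor, norm_mul, norm_mul, h1, mul_one, Complex.norm_cpow_eq_rpow_re_of_pos hy,
    Complex.norm_real, Real.norm_of_nonneg (Real.sqrt_nonneg _), mul_pow,
    Real.sq_sqrt (by linarith)]
  have : ((1 + Complex.I * (κ : ℂ)) / 2).re = 1 / 2 := by simp
  rw [this, ← Real.sqrt_eq_rpow, Real.sq_sqrt hy.le]

/-- The behaviour at infinity of the ray solution on the imaginary axis: the two amplitudes are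
related by the conserved current, which forces one of them to be bounded away from zero. -/
theorem IsRaySolution.exists_amplitudes (hν : ν ≠ 0)
    (h : IsRaySolution (-(2 * Complex.I * ν)) (-2) (-(Complex.I * κ)) (1 - Complex.I * τ)
      (4 * ν * τ - μ + Complex.I * (2 * ν - κ / 2)) φ φ') :
    ∃ b δ : ℂ, ∃ C : ℝ, ‖b‖ ^ 2 = κ / ν + ‖δ‖ ^ 2 ∧
      ∀ y : ℝ, 0 < y → ‖y * φ y - (b * (y : ℂ) ^ (-(Complex.I * τ))
        + δ * Complex.exp (2 * Complex.I * ν * y) * (y : ℂ) ^ (Complex.I * (τ - κ)))‖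
        ≤ C * y ^ (-(1 / 2) : ℝ) := by
  set D : ℂ := -(2 * Complex.I * ν) with hD
  set ρ : ℂ := -(Complex.I * κ) with hρ
  set p : ℂ := 1 - Complex.I * τ with hp
  set β : ℂ := 4 * ν * τ - μ + Complex.I * (2 * ν - κ / 2) with hβ
  have hρre : ρ.re = 0 := by simp [hρ]
  have hσ0 : (-2 : ℂ) ≠ 0 := by norm_num
  set G := rayFactor ν κ with hG
  set a := rayA D (-2) ρ with ha
  set Φ : ℝ → ℂ := fun y => G y * φ y with hΦ
  set Φ' : ℝ → ℂ := fun y => G y * (φ' y - a y / 2 * φ y) with hΦ'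
  have dG : ∀ y > 0, HasDerivAt G (G y * (-(a y) / 2)) y := fun y hy => hasDerivAt_rayFactor hy
  have dΦ : ∀ y > 0, HasDerivAt Φ (Φ' y) y := by
    intro y hy
    refine ((dG y hy).mul (h.solves y hy).1).congr_deriv ?_
    simp only [hΦ']; ring
  have da : ∀ y : ℝ, 0 < y → HasDerivAt a ((1 - ρ) / y ^ 2 + 1 / (y + 2) ^ 2) y := by
    intro y hy
    have hy0 : (y : ℂ) ≠ 0 := by exact_mod_cast hy.ne'
    have hy2 : (y : ℂ) - -2 ≠ 0 := by
      have : (0 : ℝ) < y + 2 := by linarith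
      have e : (y : ℂ) - -2 = ((y + 2 : ℝ) : ℂ) := by push_cast; ring
      rw [e]; exact_mod_cast this.ne'
    have d0 : HasDerivAt (fun t : ℝ => (t : ℂ)) 1 y := Complex.ofRealCLM.hasDerivAt
    refine (((((hasDerivAt_const y (1 - ρ)).div d0 hy0).const_add D).add
      ((hasDerivAt_const y (1 : ℂ)).div (d0.sub_const (-2)) hy2)).neg).congr_deriv ?_
    have e : (y : ℂ) + 2 = y - -2 := by ring
    rw [e]
    ring
  have dΦ' : ∀ y > 0, HasDerivAt Φ' (-(rayPotential ν κ τ μ y : ℂ) * Φ y) y := by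
    intro y hy
    have hy0 : (y : ℂ) ≠ 0 := by exact_mod_cast hy.ne'
    have hy2 : (y : ℂ) + 2 ≠ 0 := by
      have : (0 : ℝ) < y + 2 := by linarith
      exact_mod_cast this.ne'
    refine ((dG y hy).mul ((h.solves y hy).2.sub
      (((da y hy).div_const 2).mul (h.solves y hy).1))).congr_deriv ?_
    simp only [hΦ, Pi.sub_apply, Pi.mul_apply]
    rw [← ha]
    -- The heart of the argument: for these parameters all imaginary parts cancel and the potential
    -- in normal form is real.
    have key : rayB D (-2) ρ p β y + a y ^ 2 / 4 - ((1 - ρ) / y ^ 2 + 1 / (y + 2) ^ 2) / 2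
        = -(rayPotential ν κ τ μ y : ℂ) := by
      have e : (y : ℂ) - -2 = y + 2 := by ring
      simp only [ha, rayA, rayB, rayPotential, e]
      push_cast
      rw [hD, hρ, hp, hβ]
      have hI := Complex.I_sq
      field_simp
      ring_nf
      simp only [Complex.I_sq]
      ring
    linear_combination (G y * φ y) * key
  obtain ⟨A, B, C, Y, hY1, hasym, hbd, hflux⟩ := exists_oscillating_asymptotics hν
    (fun y hy => abs_rayPotential_sub_le ν κ τ μ hy) dΦ dΦ'
  have hY0 : 0 < Y := by linarith
  -- the conserved current
  set J : ℝ → ℂ := fun y => starRingEnd ℂ (Φ y) * Φ' y with hJ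
  have dJ : ∀ y > 0, HasDerivAt (fun y => (J y).im) 0 y := by
    intro y hy
    have h1 := ((dΦ y hy).star.mul (dΦ' y hy))
    have h2 := Complex.imCLM.hasFDerivAt.comp_hasDerivAt y h1
    refine h2.congr_deriv ?_
    simp
    ring
  have hJconst : ∀ y > 0, (J y).im = (J 1).im := by
    intro y hy
    exact (convex_Ioi (0 : ℝ)).is_const_of_fderivWithin_eq_zero (𝕜 := ℝ)
      (f := fun y => (J y).im)
      (fun x hx => (dJ x hx).differentiableAt.differentiableWithinAt)
      (fun x hx => by
        rw [fderivWithin_of_isOpen isOpen_Ioi hx]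
        ext
        simp [(dJ x hx).deriv]) hy (mem_Ioi.2 one_pos)
  -- At the origin `‖G‖² = y (y + 2)` cancels the pole of the logarithmic derivative, and the
  -- current tends to `im (1 + ρ) = -κ` whatever `μ`, `τ` and `ν` are.
  have hJ0 : Tendsto (fun y => (J y).im) (𝓝[>] 0) (𝓝 (-κ)) := by
    have ht0 : Tendsto (fun t : ℝ => (t : ℂ)) (𝓝[>] 0) (𝓝 0) :=
      (Complex.continuous_ofReal.tendsto' 0 0 (by simp)).mono_left nhdsWithin_le_nhds
    have hs := IsRaySolution.tendsto_sol (D := D) (ρ := ρ) (p := p) (β := β) hσ0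
    have hs' := IsRaySolution.tendsto_mul_sol' (D := D) (ρ := ρ) (p := p) (β := β) hσ0
    set H := rayHeun D (-2) ρ p β with hH
    have hya : Tendsto (fun y : ℝ => y * a y) (𝓝[>] 0) (𝓝 (-(1 - ρ))) := by
      have h1 : ContinuousAt (fun y : ℝ => -((y : ℂ) * D + (1 - ρ) + y * (1 / (y - -2)))) 0 := by
        have : ((0 : ℝ) : ℂ) - -2 ≠ 0 := by norm_num
        fun_prop (disch := assumption)
      have h2 : Tendsto (fun y : ℝ => -((y : ℂ) * D + (1 - ρ) + y * (1 / (y - -2)))) (𝓝[>] 0)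
          (𝓝 (-(1 - ρ))) := by
        have := h1.tendsto.mono_left (nhdsWithin_le_nhds (s := Ioi 0))
        simpa using this
      refine h2.congr' ?_
      filter_upwards [self_mem_nhdsWithin] with y hy
      have hy0 : (y : ℂ) ≠ 0 := by exact_mod_cast ne_of_gt hy
      simp only [ha, rayA]
      field_simp
    have hss : Tendsto (fun t : ℝ => starRingEnd ℂ (H.sol t)) (𝓝[>] 0) (𝓝 1) := by
      have := (Complex.continuous_conj.tendsto (1 : ℂ)).comp hs
      simpa [Function.comp_def] using this
    have key : Tendsto (fun y : ℝ => ((y : ℂ) + 2) * (starRingEnd ℂ (H.sol y) *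
        ((y * H.sol' y + ρ * H.sol y) - (y * a y) / 2 * H.sol y))) (𝓝[>] 0)
        (𝓝 ((0 + 2) * (1 * ((0 + ρ * 1) - (-(1 - ρ)) / 2 * 1)))) :=
      (ht0.add_const 2).mul (hss.mul ((hs'.add (hs.const_mul ρ)).sub ((hya.div_const 2).mul hs)))
    have e : (0 + 2) * (1 * ((0 + ρ * 1) - (-(1 - ρ)) / 2 * 1)) = 1 + ρ := by ring
    rw [e] at key
    have hre : (1 + ρ).im = -κ := by simp [hρ]
    rw [← hre]
    refine ((Complex.continuous_im.tendsto _).comp key).congr' ?_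
    filter_upwards [IsRaySolution.Ioo_mem hσ0] with y hy
    have hy0 : (y : ℂ) ≠ 0 := by exact_mod_cast ne_of_gt hy.1
    have hGG : starRingEnd ℂ (G y) * G y = y * (y + 2) := by
      rw [mul_comm, Complex.mul_conj, Complex.normSq_eq_norm_sq, hG, norm_rayFactor_sq hy.1]
      push_cast; ring
    have hPP : starRingEnd ℂ ((y : ℂ) ^ ρ) * (y : ℂ) ^ ρ = 1 := by
      rw [mul_comm, Complex.mul_conj, Complex.normSq_eq_norm_sq,
        IsRaySolution.norm_cpow_of_re_eq_zero hρre hy.1]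
      norm_num
    have hyφ := h.mul_eq' hy
    have hφ := h.eq y hy
    simp only [Function.comp]
    congr 1
    simp only [hJ, hΦ, hΦ', map_mul]
    have e1 : starRingEnd ℂ (G y) * starRingEnd ℂ (φ y) * (G y * (φ' y - a y / 2 * φ y)) =
        (y + 2) * (starRingEnd ℂ (φ y) * (y * φ' y - y * a y / 2 * φ y)) := by
      linear_combination (starRingEnd ℂ (φ y) * (φ' y - a y / 2 * φ y)) * hGG
    rw [e1, hyφ, hφ, map_mul]
    linear_combination -((y : ℂ) + 2) * (starRingEnd ℂ (H.sol y) *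
        ((y * H.sol' y + ρ * H.sol y) - (y * a y) / 2 * H.sol y)) * hPP
  have hJval : (J 1).im = -κ := by
    refine tendsto_nhds_unique (tendsto_const_nhds.congr' ?_) hJ0
    filter_upwards [self_mem_nhdsWithin] with y hy
    exact (hJconst y hy).symm
  -- Equating the current at infinity with its value at the origin.
  have hflux' : ν * (‖A‖ ^ 2 - ‖B‖ ^ 2) = -κ := by
    refine tendsto_nhds_unique hflux (tendsto_const_nhds.congr' ?_)
    filter_upwards [eventually_gt_atTop 0] with y hy
    rw [← hJval]; exact (hJconst y hy).symm
  -- the pointwise estimate at infinity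
  have hγ : (2 * ν * τ - ν * κ) / (2 * ν) = τ - κ / 2 := by field_simp
  have hC0 : 0 ≤ C := (norm_nonneg _).trans (hbd Y le_rfl)
  set err : ℝ → ℂ := fun y => y * φ y - (B * (y : ℂ) ^ (-(Complex.I * τ))
        + A * Complex.exp (2 * Complex.I * ν * y) * (y : ℂ) ^ (Complex.I * (τ - κ))) with herr
  have hlarge : ∀ y ≥ Y, ‖err y‖ ≤ 3 * C / y := by
    intro y hy
    have hy0 : 0 < y := hY0.trans_le hy
    have hyc : (y : ℂ) ≠ 0 := by exact_mod_cast hy0.ne'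
    have hy2 : (0 : ℝ) < y + 2 := by linarith
    set r : ℝ := Real.sqrt (y + 2) with hr
    have hr0 : 0 < r := Real.sqrt_pos.2 hy2
    have hrc : (r : ℂ) ≠ 0 := by exact_mod_cast hr0.ne'
    set s : ℝ := Real.sqrt y with hs
    have hs0 : 0 < s := Real.sqrt_pos.2 hy0
    set L : ℂ := (Real.log y : ℂ) with hL
    have hLc : Complex.log y = L := by rw [hL, Complex.ofReal_log hy0.le]
    -- `U` undoes the phase of `rayFactor`. It turns the two WKB exponentials into `y ^ (-iτ)` and
    -- `exp (2iνy) * y ^ (i(τ - κ))`.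
    set U : ℂ := Complex.exp (Complex.I * (ν * y) - Complex.I * κ / 2 * L) with hU
    have hUn : ‖U‖ = 1 := by
      have := Complex.norm_exp_ofReal_mul_I (ν * y - κ / 2 * Real.log y)
      rw [← this, hU, hL]; congr 2; push_cast; ring
    have hsexp : (s : ℂ) = Complex.exp (L / 2) := by
      rw [hs, Real.sqrt_eq_rpow, Real.rpow_def_of_pos hy0, hL]
      push_cast; congr 1; ring
    have hyexp : (y : ℂ) = Complex.exp L := by rw [hL, ← Complex.ofReal_exp, Real.exp_log hy0]
    have hΦφ : (s : ℂ) * U * Φ y = r * (y * φ y) := by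
      simp only [hΦ, hG, rayFactor]
      rw [Complex.cpow_def_of_ne_zero hyc, hLc, hsexp, hU]
      have : Complex.exp (L / 2) * Complex.exp (Complex.I * (ν * y) - Complex.I * κ / 2 * L) *
          (Complex.exp (L * ((1 + Complex.I * κ) / 2)) * Complex.exp (-(Complex.I * (ν * y))))
          = y := by
        rw [← Complex.exp_add, ← Complex.exp_add, ← Complex.exp_add]
        refine (congrArg Complex.exp ?_).trans hyexp.symm
        ring
      linear_combination (r * φ y) * this
    set M : ℂ := A * Complex.exp (Complex.I * (ν * y + (2 * ν * τ - ν * κ : ℝ) / (2 * ν)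
        * Real.log y)) + B * Complex.exp (-(Complex.I * (ν * y + (2 * ν * τ - ν * κ : ℝ) / (2 * ν)
        * Real.log y))) with hM
    have hγc : ((2 * ν * τ - ν * κ : ℝ) : ℂ) / (2 * ν) = τ - κ / 2 := by
      exact_mod_cast congrArg (fun x : ℝ => (x : ℂ)) hγ
    have hUM : U * M = B * (y : ℂ) ^ (-(Complex.I * τ))
        + A * Complex.exp (2 * Complex.I * ν * y) * (y : ℂ) ^ (Complex.I * (τ - κ)) := by
      rw [hM, hγc, Complex.cpow_def_of_ne_zero hyc, Complex.cpow_def_of_ne_zero hyc, hLc, hU, ← hL,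
        mul_add, mul_left_comm, mul_left_comm _ B, ← Complex.exp_add, ← Complex.exp_add,
        mul_assoc A, ← Complex.exp_add, add_comm]
      congr 3 <;> ring
    have h1 : err y = ((s / r - 1 : ℝ) : ℂ) * (U * Φ y) + U * (Φ y - M) := by
      simp only [herr]
      rw [← hUM]
      have : (y : ℂ) * φ y = s / r * (U * Φ y) := by
        rw [div_mul_eq_mul_div, eq_div_iff hrc]
        linear_combination -hΦφ
      rw [this]
      push_cast
      ring
    -- The factor `s / r = √(y / (y + 2))` is the price of replacing the modulus `√(y (y + 2))` of
    -- `rayFactor` by `y`.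
    have hsr : |s / r - 1| ≤ 2 / y := by
      have hle : s ≤ r := Real.sqrt_le_sqrt (by linarith)
      have hq : s / r ≤ 1 := (div_le_one hr0).2 hle
      have hq2 : y / (y + 2) ≤ s / r := by
        have : (s / r) ^ 2 = y / (y + 2) := by
          rw [div_pow, hs, hr, Real.sq_sqrt hy0.le, Real.sq_sqrt hy2.le]
        rw [← this]
        have : 0 ≤ s / r := by positivity
        nlinarith
      have hq3 : 1 - y / (y + 2) ≤ 2 / y := by
        have : 1 - y / (y + 2) = 2 / (y + 2) := by field_simp; ring
        rw [this]
        gcongr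
        linarith
      rw [abs_le]
      have : 0 < 2 / y := by positivity
      constructor <;> linarith
    rw [h1]
    refine (norm_add_le _ _).trans ?_
    have n1 : ‖((s / r - 1 : ℝ) : ℂ) * (U * Φ y)‖ = |s / r - 1| * ‖Φ y‖ := by
      rw [norm_mul, norm_mul (U : ℂ) (Φ y), hUn, one_mul, Complex.norm_real, Real.norm_eq_abs]
    have n2 : ‖U * (Φ y - M)‖ = ‖Φ y - M‖ := by rw [norm_mul, hUn, one_mul]
    rw [n1, n2]
    have h2 := hasym y hy
    rw [← hM] at h2
    have h3 := hbd y hy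
    have h4 : |s / r - 1| * ‖Φ y‖ ≤ 2 / y * C := by gcongr
    have h5 : 3 * C / y = 2 / y * C + C / y := by ring
    linarith
  -- the remaining times
  have hcont : ContinuousOn err (Ioi 0) := by
    have c1 := continuousOn_ofReal_cpow (-(Complex.I * τ))
    have c2 := continuousOn_ofReal_cpow (Complex.I * (τ - κ))
    have c3 := h.continuousOn
    simp only [herr]
    fun_prop
  obtain ⟨η, hη, C₁, hC₁⟩ := h.exists_bound hσ0 hρre
  have hsub : Icc η (max Y η) ⊆ Ioi 0 := fun t ht => hη.trans_le ht.1
  obtain ⟨C₂, hC₂⟩ := isCompact_Icc.exists_bound_of_continuousOn (hcont.mono hsub)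
  have hsmall : ∀ y ∈ Ioo 0 η, ‖err y‖ ≤ η * |C₁| + ‖B‖ + ‖A‖ := by
    intro y hy
    have e1 : ‖(y : ℂ) ^ (-(Complex.I * τ))‖ = 1 := IsRaySolution.norm_cpow_of_re_eq_zero (by simp) hy.1
    have e2 : ‖(y : ℂ) ^ (Complex.I * (τ - κ))‖ = 1 := IsRaySolution.norm_cpow_of_re_eq_zero (by simp) hy.1
    have e3 : ‖Complex.exp (2 * Complex.I * ν * y)‖ = 1 := by
      have := Complex.norm_exp_ofReal_mul_I (2 * ν * y)
      rw [← this]; congr 2; push_cast; ring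
    simp only [herr]
    refine (norm_sub_le _ _).trans ?_
    have h1 := norm_add_le (B * (y : ℂ) ^ (-(Complex.I * τ)))
      (A * Complex.exp (2 * Complex.I * ν * y) * (y : ℂ) ^ (Complex.I * (τ - κ)))
    rw [norm_mul, norm_mul, norm_mul, e1, e2, e3, mul_one, mul_one, mul_one] at h1
    have h2 : ‖(y : ℂ) * φ y‖ ≤ η * |C₁| := by
      rw [norm_mul, Complex.norm_real, Real.norm_of_nonneg hy.1.le]
      have := (hC₁ y hy).trans (le_abs_self C₁)
      exact mul_le_mul hy.2.le this (norm_nonneg _) hη.le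
    linarith
  set m : ℝ := η * |C₁| + ‖B‖ + ‖A‖ + |C₂| with hm
  have hm0 : 0 ≤ m := by positivity
  set Z : ℝ := max Y η with hZ
  have hZ0 : 0 < Z := hY0.trans_le (le_max_left _ _)
  -- One power serves all of `(0, ∞)`: up to `Z` the error is at most `m ≤ m * Z ^ (1/2) * y ^
  -- (-1/2)`, and beyond `Z` the bound `3C / y` is at most `3C * y ^ (-1/2)`. The exponent `-1/2` is
  -- integrable at the origin and still decays at infinity.
  refine ⟨B, A, m * Z ^ (1 / 2 : ℝ) + 3 * C, ?_, fun y hy => ?_⟩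
  · field_simp
    linarith
  · have hpow : 0 < y ^ (-(1 / 2) : ℝ) := Real.rpow_pos_of_pos hy _
    rcases le_or_gt y Z with hyZ | hyZ
    · have h1 : ‖err y‖ ≤ m := by
        rcases lt_or_ge y η with h2 | h2
        · have := hsmall y ⟨hy, h2⟩
          have := abs_nonneg C₂
          linarith
        · have h3 := hC₂ y ⟨h2, hyZ⟩
          have h4 := le_abs_self C₂
          have : 0 ≤ η * |C₁| + ‖B‖ + ‖A‖ := by positivity
          linarith
      have h2 : 1 ≤ Z ^ (1 / 2 : ℝ) * y ^ (-(1 / 2) : ℝ) := by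
        rw [Real.rpow_neg hy.le, ← div_eq_mul_inv, one_le_div (Real.rpow_pos_of_pos hy _)]
        exact Real.rpow_le_rpow hy.le hyZ (by norm_num)
      calc ‖err y‖ ≤ m * 1 := by linarith
        _ ≤ m * (Z ^ (1 / 2 : ℝ) * y ^ (-(1 / 2) : ℝ)) := by gcongr
        _ ≤ _ := by
          have : 0 ≤ 3 * C * y ^ (-(1 / 2) : ℝ) := by positivity
          linarith
    · have hyY : Y ≤ y := (le_max_left _ _).trans hyZ.le
      have h1 := hlarge y hyY
      have h2 : 1 / y ≤ y ^ (-(1 / 2) : ℝ) := by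
        rw [one_div, ← Real.rpow_neg_one]
        exact Real.rpow_le_rpow_of_exponent_le (by linarith) (by norm_num)
      calc ‖err y‖ ≤ 3 * C * (1 / y) := by rw [mul_one_div]; exact h1
        _ ≤ 3 * C * y ^ (-(1 / 2) : ℝ) := by gcongr
        _ ≤ _ := by
          have : 0 ≤ m * Z ^ (1 / 2 : ℝ) * y ^ (-(1 / 2) : ℝ) := by positivity
          linarith

end ImaginaryRay

/-! ### Laplace transforms of ray solutions at infinity and at the origin. -/

section Asymptotics

/-- Uses only that the argument is at most `π` in modulus. This bound and the next one are crude,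
but the factors `exp (π |im a|)` keep all later constants explicit. -/
theorem norm_cpow_le_mul_exp {z : ℂ} (hz : z ≠ 0) (a : ℂ) :
    ‖z ^ a‖ ≤ ‖z‖ ^ a.re * Real.exp (Real.pi * |a.im|) := by
  rw [Complex.norm_cpow_of_ne_zero hz, div_eq_mul_inv, ← Real.exp_neg]
  gcongr
  calc -(z.arg * a.im) ≤ |z.arg * a.im| := neg_le_abs _
    _ = |z.arg| * |a.im| := abs_mul _ _
    _ ≤ _ := by gcongr; exact Complex.abs_arg_le_pi z

theorem mul_exp_le_norm_cpow {z : ℂ} (hz : z ≠ 0) (a : ℂ) :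
    ‖z‖ ^ a.re * Real.exp (-(Real.pi * |a.im|)) ≤ ‖z ^ a‖ := by
  rw [Complex.norm_cpow_of_ne_zero hz, div_eq_mul_inv, ← Real.exp_neg]
  refine mul_le_mul_of_nonneg_left (Real.exp_le_exp.2 (neg_le_neg ?_)) (by positivity)
  calc z.arg * a.im ≤ |z.arg * a.im| := le_abs_self _
    _ = |z.arg| * |a.im| := abs_mul _ _
    _ ≤ _ := by gcongr; exact Complex.abs_arg_le_pi z

theorem exists_pseries_remainder_le {ρ r : ℝ} {c : ℕ → ℂ} (h : ConvergesOn ρ c) (hr : 0 < r)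
    (hrρ : r < ρ) (N : ℕ) :
    ∃ C, ∀ z : ℂ, ‖z‖ ≤ r →
      ‖pseries c z - ∑ k ∈ Finset.range N, c k * z ^ k‖ ≤ C * ‖z‖ ^ N := by
  have hs := h r hr.le hrρ
  have hs' := (summable_nat_add_iff N).2 hs
  refine ⟨(∑' n, ‖c (n + N)‖ * r ^ (n + N)) / r ^ N, fun z hz => ?_⟩
  have hsz := h.summable (lt_of_le_of_lt hz hrρ)
  rw [pseries, ← hsz.sum_add_tsum_nat_add N, add_sub_cancel_left, div_mul_eq_mul_div, mul_comm,
    mul_div_right_comm, ← tsum_mul_left]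
  refine tsum_of_norm_bounded (hs'.mul_left _).hasSum fun n => ?_
  rw [norm_mul, norm_pow, pow_add, pow_add]
  have : ‖z‖ ^ n ≤ r ^ n := by gcongr
  calc ‖c (n + N)‖ * (‖z‖ ^ n * ‖z‖ ^ N) ≤ ‖c (n + N)‖ * (r ^ n * ‖z‖ ^ N) := by gcongr
    _ = _ := by field_simp

variable {c : ℝ} {φ ψ : ℝ → ℂ}

theorem laplace_add (h : ExpBounded c φ) (hφ : ContinuousOn φ (Ioi 0)) (h' : ExpBounded c ψ)
    (hψ : ContinuousOn ψ (Ioi 0)) {z : ℂ} (hz : c < z.re) :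
    laplace (fun t => φ t + ψ t) z = laplace φ z + laplace ψ z := by
  simp only [laplace, mul_add]
  exact integral_add (h.integrableOn hφ hz) (h'.integrableOn hψ hz)

theorem laplace_const_mul (k z : ℂ) : laplace (fun t => k * φ t) z = k * laplace φ z := by
  simp only [laplace, mul_left_comm _ k]
  exact integral_const_mul k _

theorem expBounded_cpow {a : ℂ} (ha : 1 ≤ a.re) : ExpBounded 0 fun t : ℝ => (t : ℂ) ^ (a - 1) := by
  refine expBounded_of_norm_le (σ := a.re - 1) (C := 1) (by linarith) fun t ht => ?_
  rw [Complex.norm_cpow_eq_rpow_re_of_pos ht]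
  simp

namespace IsRaySolution
variable {D σ ρ p β : ℂ} {φ φ' : ℝ → ℂ}

/-- For `t ≤ ‖σ‖ / 2` this is Taylor's estimate for the regular factor. For larger `t`, both `φ` and
the partial sum are separately bounded by a multiple of `t ^ N * exp t`. -/
theorem exists_remainder_bound (h : IsRaySolution D σ ρ p β φ φ') (hD : 0 ≤ D.re) (hσ0 : σ ≠ 0)
    (hρ : ρ.re = 0) (N : ℕ) :
    ∃ C, ∀ t > 0, ‖φ t - ∑ k ∈ Finset.range N,
      (rayHeun D σ ρ p β).coeff k * (t : ℂ) ^ ((k + 1 + ρ : ℂ) - 1)‖ ≤ C * t ^ N * Real.exp t := by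
  set H := rayHeun D σ ρ p β with hH
  have hσ : 0 < ‖σ‖ := norm_pos_iff.2 hσ0
  set r := ‖σ‖ / 2 with hr
  have hr0 : 0 < r := by positivity
  obtain ⟨C₁, h1⟩ := exists_pseries_remainder_le H.convergesOn_coeff hr0
    (show r < ‖H.z₀‖ by simp only [hH, rayHeun]; linarith) N
  obtain ⟨C₂, h2⟩ := h.expBounded hD hσ0 hρ 1 one_pos
  have hpow : ∀ t : ℝ, 0 < t → ∀ k : ℕ, (t : ℂ) ^ ((k + 1 + ρ : ℂ) - 1) = (t : ℂ) ^ ρ * (t : ℂ) ^ k := by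
    intro t ht k
    have ht0 : (t : ℂ) ≠ 0 := by exact_mod_cast ht.ne'
    rw [show (k + 1 + ρ : ℂ) - 1 = ρ + k by ring, Complex.cpow_add _ _ ht0, Complex.cpow_natCast]
  set C₃ := ∑ k ∈ Finset.range N, ‖H.coeff k‖ / r ^ (N - k) with hC₃
  have hC₃0 : 0 ≤ C₃ := Finset.sum_nonneg fun k _ => by positivity
  set C₄ := |C₂| * r ^ (-(1 / 2) : ℝ) / r ^ N with hC₄
  have hC₄0 : 0 ≤ C₄ := by positivity
  refine ⟨|C₁| + C₄ + C₃, fun t ht => ?_⟩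
  have e : ∑ k ∈ Finset.range N, H.coeff k * (t : ℂ) ^ ((k + 1 + ρ : ℂ) - 1) =
      (t : ℂ) ^ ρ * ∑ k ∈ Finset.range N, H.coeff k * (t : ℂ) ^ k := by
    rw [Finset.mul_sum]
    refine Finset.sum_congr rfl fun k _ => ?_
    rw [hpow t ht]; ring
  have hnρ := norm_cpow_of_re_eq_zero hρ ht
  have hnt : ‖(t : ℂ)‖ = t := by rw [Complex.norm_real, Real.norm_of_nonneg ht.le]
  have hexp : 1 ≤ Real.exp t := Real.one_le_exp ht.le
  rw [e]
  rcases le_or_gt t r with htr | htr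
  · rw [h.eq t ⟨ht, by linarith⟩, ← mul_sub, norm_mul, hnρ, one_mul]
    have := h1 t (by rwa [hnt])
    rw [hnt] at this
    calc _ ≤ C₁ * t ^ N := this
      _ ≤ (|C₁| + C₄ + C₃) * t ^ N * 1 := by
        rw [mul_one]; gcongr; have := le_abs_self C₁; linarith
      _ ≤ _ := by gcongr
  · have b1 : ‖φ t‖ ≤ C₄ * t ^ N * Real.exp t := by
      calc ‖φ t‖ ≤ C₂ * t ^ (-(1 / 2) : ℝ) * Real.exp (1 * t) := h2 t ht
        _ ≤ |C₂| * r ^ (-(1 / 2) : ℝ) * Real.exp t := by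
          rw [one_mul]
          gcongr ?_ * ?_ * _
          · exact le_abs_self _
          · exact Real.rpow_le_rpow_of_nonpos hr0 htr.le (by norm_num)
        _ ≤ C₄ * t ^ N * Real.exp t := by
          refine mul_le_mul_of_nonneg_right ?_ (Real.exp_nonneg _)
          rw [hC₄, div_mul_eq_mul_div, le_div_iff₀ (by positivity)]
          gcongr
    have b2 : ‖∑ k ∈ Finset.range N, H.coeff k * (t : ℂ) ^ k‖ ≤ C₃ * t ^ N := by
      rw [hC₃, Finset.sum_mul]
      refine norm_sum_le_of_le _ fun k hk => ?_
      rw [norm_mul, norm_pow, hnt, div_mul_eq_mul_div, mul_div_assoc]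
      gcongr
      rw [le_div_iff₀ (by positivity)]
      have hk' : k + (N - k) = N := by have := Finset.mem_range.1 hk; omega
      calc t ^ k * r ^ (N - k) ≤ t ^ k * t ^ (N - k) := by gcongr
        _ = t ^ N := by rw [← pow_add, hk']
    refine (norm_sub_le _ _).trans ?_
    rw [norm_mul, hnρ, one_mul]
    calc _ ≤ C₄ * t ^ N * Real.exp t + C₃ * t ^ N * 1 := by rw [mul_one]; exact add_le_add b1 b2
      _ ≤ C₄ * t ^ N * Real.exp t + C₃ * t ^ N * Real.exp t := by gcongr
      _ ≤ (|C₁| + C₄ + C₃) * t ^ N * Real.exp t := by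
        have : 0 ≤ |C₁| * t ^ N * Real.exp t := by positivity
        linarith

/-- The asymptotic expansion of the Laplace transform of a ray solution at infinity. -/
theorem exists_norm_laplace_sub_le (h : IsRaySolution D σ ρ p β φ φ') (hD : 0 ≤ D.re) (hσ0 : σ ≠ 0)
    (hρ : ρ.re = 0) (N : ℕ) :
    ∃ C, ∀ z : ℂ, 1 < z.re → ‖laplace φ z - ∑ k ∈ Finset.range N,
      (rayHeun D σ ρ p β).coeff k * (z ^ (-(k + 1 + ρ : ℂ)) * Complex.Gamma (k + 1 + ρ))‖
        ≤ C * (z.re - 1) ^ (-(N + 1 : ℝ)) := by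
  set H := rayHeun D σ ρ p β with hH
  obtain ⟨C, hC⟩ := h.exists_remainder_bound hD hσ0 hρ N
  refine ⟨C * Real.Gamma (N + 1), fun z hz => ?_⟩
  have hre : ∀ k : ℕ, 1 ≤ (k + 1 + ρ : ℂ).re := fun k => by simp [hρ]
  -- The powers are subtracted one at a time, since additivity of the transform needs integrability
  -- and continuity at each stage.
  have key : ∀ n : ℕ, (ExpBounded 0 fun t => φ t - ∑ k ∈ Finset.range n,
        H.coeff k * (t : ℂ) ^ ((k + 1 + ρ : ℂ) - 1)) ∧
      (ContinuousOn (fun t : ℝ => φ t - ∑ k ∈ Finset.range n,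
        H.coeff k * (t : ℂ) ^ ((k + 1 + ρ : ℂ) - 1)) (Ioi 0)) ∧
      laplace (fun t => φ t - ∑ k ∈ Finset.range n,
        H.coeff k * (t : ℂ) ^ ((k + 1 + ρ : ℂ) - 1)) z = laplace φ z - ∑ k ∈ Finset.range n,
      H.coeff k * (z ^ (-(k + 1 + ρ : ℂ)) * Complex.Gamma (k + 1 + ρ)) := by
    intro n
    induction n with
    | zero => simpa using ⟨h.expBounded hD hσ0 hρ, h.continuousOn⟩
    | succ n ih =>
      obtain ⟨i1, i2, i3⟩ := ih
      have j1 := (expBounded_cpow (hre n)).const_mul (-H.coeff n)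
      have j2 : ContinuousOn (fun t : ℝ => -H.coeff n * (t : ℂ) ^ ((n + 1 + ρ : ℂ) - 1)) (Ioi 0) :=
        (continuousOn_ofReal_cpow _).const_mul _
      have e : (fun t : ℝ => φ t - ∑ k ∈ Finset.range (n + 1),
          H.coeff k * (t : ℂ) ^ ((k + 1 + ρ : ℂ) - 1)) = fun t : ℝ => (φ t - ∑ k ∈ Finset.range n,
          H.coeff k * (t : ℂ) ^ ((k + 1 + ρ : ℂ) - 1))
            + -H.coeff n * (t : ℂ) ^ ((n + 1 + ρ : ℂ) - 1) := by
        ext t; rw [Finset.sum_range_succ]; ring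
      rw [e]
      refine ⟨i1.add j1, i2.add j2, ?_⟩
      rw [laplace_add i1 i2 j1 j2 (by linarith), i3, laplace_const_mul,
        laplace_cpow (hre n) (by linarith), Finset.sum_range_succ]
      ring
  rw [← (key N).2.2]
  -- Watson's lemma: a remainder `O(t ^ N * exp t)` has a transform `O((re z - 1) ^ (-(N + 1)))`.
  refine norm_laplace_le (σ := N + 1) (c := 1) (by positivity) (fun t ht => ?_) hz
  rw [add_sub_cancel_right, Real.rpow_natCast, one_mul]
  exact hC t ht

/-- The first term of the expansion, along any ray in the open right half-plane. The remainder is of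
second order while the power in front grows only linearly. -/
theorem tendsto_cpow_mul_laplace (h : IsRaySolution D σ ρ p β φ φ') (hD : 0 ≤ D.re) (hσ0 : σ ≠ 0)
    (hρ : ρ.re = 0) {w : ℂ} (hw : 0 < w.re) :
    Tendsto (fun x : ℝ => (x * w) ^ (1 + ρ) * laplace φ (x * w)) atTop
      (𝓝 (Complex.Gamma (1 + ρ))) := by
  obtain ⟨C, hC⟩ := h.exists_norm_laplace_sub_le hD hσ0 hρ 1
  have hw0 : 0 < ‖w‖ := norm_pos_iff.2 fun h => by simp [h] at hw
  rw [tendsto_iff_norm_sub_tendsto_zero]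
  have hlim : Tendsto (fun x : ℝ => (‖w‖ / w.re * Real.exp (Real.pi * |(1 + ρ).im|) * C) *
      (((x * w.re - 1) ^ (-1 : ℝ)) + ((x * w.re - 1) ^ (-2 : ℝ)))) atTop (𝓝 0) := by
    have h1 : Tendsto (fun x : ℝ => x * w.re - 1) atTop atTop :=
      tendsto_atTop_add_const_right _ _ (tendsto_id.atTop_mul_const hw)
    have h2 := (tendsto_rpow_neg_atTop one_pos).comp h1
    have h3 := (tendsto_rpow_neg_atTop two_pos).comp h1
    simpa [Function.comp_def] using (h2.add h3).const_mul
      (‖w‖ / w.re * Real.exp (Real.pi * |(1 + ρ).im|) * C)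
  refine squeeze_zero' (Eventually.of_forall fun _ => norm_nonneg _) ?_ hlim
  filter_upwards [eventually_gt_atTop (1 / w.re), eventually_gt_atTop 0] with x hx hx0
  have hxw : 1 < x * w.re := by rwa [div_lt_iff₀ hw] at hx
  have hz0 : (x : ℂ) * w ≠ 0 := mul_ne_zero (by exact_mod_cast hx0.ne') (norm_pos_iff.1 hw0)
  have hre : ((x : ℂ) * w).re = x * w.re := by simp
  have h1 := hC (x * w) (by rw [hre]; exact hxw)
  rw [hre] at h1
  simp only [Finset.sum_range_one, HeunCoeffs.coeff_zero, one_mul, Nat.cast_zero, zero_add,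
    Nat.cast_one] at h1
  have e : (x * w) ^ (1 + ρ) * laplace φ (x * w) - Complex.Gamma (1 + ρ) =
      (x * w) ^ (1 + ρ) * (laplace φ (x * w) - (x * w) ^ (-(1 + ρ)) * Complex.Gamma (1 + ρ)) := by
    rw [Complex.cpow_neg]
    field_simp [Complex.cpow_ne_zero_iff]
    have := (Complex.cpow_ne_zero_iff (x := (x : ℂ) * w) (y := 1 + ρ)).2 (Or.inl hz0)
    field_simp
  rw [e, norm_mul]
  have h2 := norm_cpow_le_mul_exp hz0 (1 + ρ)
  have hr1 : (1 + ρ).re = 1 := by simp [hρ]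
  rw [hr1, Real.rpow_one, norm_mul, Complex.norm_real, Real.norm_of_nonneg hx0.le] at h2
  have hy : 0 < x * w.re - 1 := by linarith
  have h3 : (x * w.re - 1) ^ (-1 : ℝ) + (x * w.re - 1) ^ (-2 : ℝ) =
      x * w.re * (x * w.re - 1) ^ (-(1 + 1 : ℝ)) := by
    have : (x * w.re - 1) ^ (-1 : ℝ) = (x * w.re - 1) * (x * w.re - 1) ^ (-2 : ℝ) := by
      rw [mul_comm (x * w.re - 1), ← Real.rpow_add_one hy.ne']; norm_num
    rw [this, show (-(1 + 1 : ℝ)) = -2 by norm_num]; ring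
  rw [h3]
  calc _ ≤ (x * ‖w‖ * Real.exp (Real.pi * |(1 + ρ).im|)) *
        (C * (x * w.re - 1) ^ (-(1 + 1 : ℝ))) := by gcongr
    _ = _ := by field_simp

end IsRaySolution

/-- The contribution to the Laplace transform near the origin of a function whose behaviour at
infinity is the sum of a power and an oscillating power. -/
theorem tendsto_cpow_mul_laplace_of_amplitudes {φ : ℝ → ℂ} (hφ : ContinuousOn φ (Ioi 0))
    {b δ : ℂ} {C ν τ τ' : ℝ} (hν : ν ≠ 0)
    (h : ∀ y : ℝ, 0 < y → ‖y * φ y - (b * (y : ℂ) ^ (-(Complex.I * τ))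
        + δ * Complex.exp (2 * Complex.I * ν * y) * (y : ℂ) ^ (Complex.I * τ'))‖
        ≤ C * y ^ (-(1 / 2) : ℝ)) {w : ℂ} (hw : 0 < w.re) :
    Tendsto (fun x : ℝ => (x * w) ^ (1 - Complex.I * τ) * laplace (fun y => y * φ y) (x * w))
      (𝓝[>] 0) (𝓝 (b * Complex.Gamma (1 - Complex.I * τ))) := by
  have hw0 : w ≠ 0 := fun h => by simp [h] at hw
  -- The function splits into three parts. The power `f₁` gives the main term; the oscillating `f₂`
  -- has a transform singular at `2iν`, hence bounded near `0`; the remainder `f₃` contributes only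
  -- `O(x ^ (-1/2))`, which is weaker than `1 / x`.
  set f₁ : ℝ → ℂ := fun y => (y : ℂ) ^ ((1 - Complex.I * τ : ℂ) - 1) with hf₁
  set f₂ : ℝ → ℂ := fun y => Complex.exp (2 * Complex.I * ν * y)
    * (y : ℂ) ^ ((1 + Complex.I * τ' : ℂ) - 1) with hf₂
  set f₃ : ℝ → ℂ := fun y => y * φ y - (b * f₁ y + δ * f₂ y) with hf₃
  have r1 : (1 - Complex.I * τ : ℂ).re = 1 := by simp
  have r2 : (1 + Complex.I * τ' : ℂ).re = 1 := by simp
  have b1 : ExpBounded 0 f₁ := expBounded_cpow r1.ge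
  have c1 : ContinuousOn f₁ (Ioi 0) := continuousOn_ofReal_cpow _
  have c2 : ContinuousOn f₂ (Ioi 0) := by
    have := continuousOn_ofReal_cpow ((1 + Complex.I * τ' : ℂ) - 1)
    fun_prop
  have b2 : ExpBounded 0 f₂ := by
    refine expBounded_of_norm_le (σ := 0) (C := 1) (by norm_num) fun t ht => ?_
    have e3 : ‖Complex.exp (2 * Complex.I * ν * t)‖ = 1 := by
      have := Complex.norm_exp_ofReal_mul_I (2 * ν * t)
      rw [← this]; congr 2; push_cast; ring
    rw [hf₂, norm_mul, e3, Complex.norm_cpow_eq_rpow_re_of_pos ht]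
    simp
  have c3 : ContinuousOn f₃ (Ioi 0) := by fun_prop
  have bd3 : ∀ y > 0, ‖f₃ y‖ ≤ C * y ^ ((1 / 2 : ℝ) - 1) * Real.exp (0 * y) := by
    intro y hy
    have := h y hy
    simp only [hf₃, hf₁, hf₂]
    rw [zero_mul, Real.exp_zero, mul_one, show (1 / 2 : ℝ) - 1 = -(1 / 2) by norm_num,
      show (1 - Complex.I * τ : ℂ) - 1 = -(Complex.I * τ) by ring,
      show (1 + Complex.I * τ' : ℂ) - 1 = Complex.I * τ' by ring, ← mul_assoc δ]
    exact this
  have b3 : ExpBounded 0 f₃ := by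
    refine expBounded_of_norm_le (σ := -(1 / 2)) (C := C) le_rfl fun t ht => ?_
    have := bd3 t ht
    rwa [show (1 / 2 : ℝ) - 1 = -(1 / 2) by norm_num] at this
  have split : ∀ z : ℂ, 0 < z.re → laplace (fun y => y * φ y) z =
      b * (z ^ (-(1 - Complex.I * τ : ℂ)) * Complex.Gamma (1 - Complex.I * τ)) +
      δ * ((z - 2 * Complex.I * ν) ^ (-(1 + Complex.I * τ' : ℂ))
        * Complex.Gamma (1 + Complex.I * τ')) + laplace f₃ z := by
    intro z hz
    have e : (fun y : ℝ => (y : ℂ) * φ y) = fun y => (b * f₁ y + δ * f₂ y) + f₃ y := by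
      ext y; simp only [hf₃]; ring
    have l2 : laplace f₂ z = (z - 2 * Complex.I * ν) ^ (-(1 + Complex.I * τ' : ℂ))
        * Complex.Gamma (1 + Complex.I * τ') := by
      rw [← laplace_cpow r2.ge (by simpa using hz)]
      simp only [laplace, hf₂]
      refine integral_congr_ae (Eventually.of_forall fun t => ?_)
      simp only
      rw [← mul_assoc, ← Complex.exp_add]
      congr 2; ring
    rw [e, laplace_add ((b1.const_mul b).add (b2.const_mul δ))
      ((c1.const_mul b).add (c2.const_mul δ)) b3 c3 hz,
      laplace_add (b1.const_mul b) (c1.const_mul b) (b2.const_mul δ) (c2.const_mul δ) hz,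
      laplace_const_mul, laplace_const_mul, l2, hf₁, laplace_cpow r1.ge hz]
  have hx : Tendsto (fun x : ℝ => x) (𝓝[>] 0) (𝓝 0) := nhdsWithin_le_nhds
  have hz : Tendsto (fun x : ℝ => (x : ℂ) * w) (𝓝[>] 0) (𝓝 0) := by
    have : Continuous fun x : ℝ => (x : ℂ) * w := by fun_prop
    exact (this.tendsto' 0 0 (by simp)).mono_left nhdsWithin_le_nhds
  have hcp : ∀ x : ℝ, 0 < x → ‖((x : ℂ) * w) ^ (1 - Complex.I * τ)‖ ≤
      x * (‖w‖ * Real.exp (Real.pi * |(1 - Complex.I * τ : ℂ).im|)) := by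
    intro x hx
    have hz0 : (x : ℂ) * w ≠ 0 := mul_ne_zero (by exact_mod_cast hx.ne') hw0
    have := norm_cpow_le_mul_exp hz0 (1 - Complex.I * τ)
    rwa [r1, Real.rpow_one, norm_mul, Complex.norm_real, Real.norm_of_nonneg hx.le,
      mul_assoc] at this
  have t0 : Tendsto (fun x : ℝ => ((x : ℂ) * w) ^ (1 - Complex.I * τ)) (𝓝[>] 0) (𝓝 0) := by
    have hlim := hx.mul_const (‖w‖ * Real.exp (Real.pi * |(1 - Complex.I * τ : ℂ).im|))
    rw [zero_mul] at hlim
    refine squeeze_zero_norm' ?_ hlim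
    filter_upwards [self_mem_nhdsWithin] with x hx using hcp x hx
  have t2 : Tendsto (fun x : ℝ => (x * w - 2 * Complex.I * ν) ^ (-(1 + Complex.I * τ' : ℂ)))
      (𝓝[>] 0) (𝓝 ((0 - 2 * Complex.I * ν) ^ (-(1 + Complex.I * τ' : ℂ)))) := by
    refine (hz.sub_const _).cpow tendsto_const_nhds (Or.inr ?_)
    simpa using hν
  have t3 : Tendsto (fun x : ℝ => ((x : ℂ) * w) ^ (1 - Complex.I * τ) * laplace f₃ (x * w))
      (𝓝[>] 0) (𝓝 0) := by
    have hlim : Tendsto (fun x : ℝ => (‖w‖ * Real.exp (Real.pi * |(1 - Complex.I * τ : ℂ).im|)) *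
        (C * Real.Gamma (1 / 2) * w.re ^ (-(1 / 2) : ℝ)) * x ^ (1 / 2 : ℝ)) (𝓝[>] 0) (𝓝 0) := by
      have : Tendsto (fun x : ℝ => x ^ (1 / 2 : ℝ)) (𝓝[>] 0) (𝓝 0) := by
        have := (Real.continuousAt_rpow_const 0 (1 / 2) (Or.inr (by norm_num))).tendsto
        rw [Real.zero_rpow (by norm_num)] at this
        exact this.mono_left nhdsWithin_le_nhds
      simpa using this.const_mul ((‖w‖ * Real.exp (Real.pi * |(1 - Complex.I * τ : ℂ).im|)) *
        (C * Real.Gamma (1 / 2) * w.re ^ (-(1 / 2) : ℝ)))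
    refine squeeze_zero_norm' ?_ hlim
    filter_upwards [self_mem_nhdsWithin] with x hx
    have hx0 : 0 < x := hx
    have hre : ((x : ℂ) * w).re = x * w.re := by simp
    have h1 := norm_laplace_le (c := 0) (by norm_num : (0 : ℝ) < 1 / 2) bd3
      (show 0 < ((x : ℂ) * w).re by rw [hre]; positivity)
    rw [hre, sub_zero, Real.mul_rpow hx0.le hw.le] at h1
    have e : x * x ^ (-(1 / 2) : ℝ) = x ^ (1 / 2 : ℝ) := by
      rw [mul_comm, ← Real.rpow_add_one hx0.ne']; norm_num
    rw [norm_mul, ← e]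
    calc _ ≤ _ := mul_le_mul (hcp x hx0) h1 (norm_nonneg _) (by positivity)
      _ = _ := by ring
  have total := ((tendsto_const_nhds (x := b * Complex.Gamma (1 - Complex.I * τ))).add
    (t0.mul ((t2.mul_const (Complex.Gamma (1 + Complex.I * τ'))).const_mul δ))).add t3
  simp only [zero_mul, add_zero] at total
  refine total.congr' ?_
  filter_upwards [self_mem_nhdsWithin] with x hx
  have hx0 : 0 < x := hx
  have hz0 : (x : ℂ) * w ≠ 0 := mul_ne_zero (by exact_mod_cast hx0.ne') hw0
  have hinv : ((x : ℂ) * w) ^ (1 - Complex.I * τ) * ((x : ℂ) * w) ^ (-(1 - Complex.I * τ)) = 1 := by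
    rw [← Complex.cpow_add _ _ hz0, add_neg_cancel, Complex.cpow_zero]
  rw [split _ (by simpa using mul_pos hx0 hw)]
  linear_combination (-b * Complex.Gamma (1 - Complex.I * τ)) * hinv

/-- Needed to see that the transform of `φ` itself, in contrast to that of `y * φ y`, is only `O(x ^
(-1/2))` at the origin and so drops out of the limit of the Wronskian. -/
theorem IsRaySolution.exists_norm_le_rpow {D σ ρ p β : ℂ} {φ φ' : ℝ → ℂ}
    (hr : IsRaySolution D σ ρ p β φ φ') (hσ0 : σ ≠ 0) (hρ : ρ.re = 0)
    {b δ : ℂ} {C ν τ τ' : ℝ}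
    (h : ∀ y : ℝ, 0 < y → ‖y * φ y - (b * (y : ℂ) ^ (-(Complex.I * τ))
        + δ * Complex.exp (2 * Complex.I * ν * y) * (y : ℂ) ^ (Complex.I * τ'))‖
        ≤ C * y ^ (-(1 / 2) : ℝ)) :
    ∃ C', ∀ y > 0, ‖φ y‖ ≤ C' * y ^ (-(1 / 2) : ℝ) := by
  obtain ⟨η, hη, C₁, hC₁⟩ := hr.exists_bound hσ0 hρ
  refine ⟨|C₁| * η ^ (1 / 2 : ℝ) + ((‖b‖ + ‖δ‖) * η ^ (-(1 / 2) : ℝ) + |C| * η ^ (-1 : ℝ)),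
    fun y hy => ?_⟩
  have hpow : 0 < y ^ (-(1 / 2) : ℝ) := Real.rpow_pos_of_pos hy _
  rcases lt_or_ge y η with hyη | hyη
  · have h1 := (hC₁ y ⟨hy, hyη⟩).trans (le_abs_self C₁)
    have h2 : 1 ≤ η ^ (1 / 2 : ℝ) * y ^ (-(1 / 2) : ℝ) := by
      rw [Real.rpow_neg hy.le, ← div_eq_mul_inv, one_le_div (Real.rpow_pos_of_pos hy _)]
      exact Real.rpow_le_rpow hy.le hyη.le (by norm_num)
    calc ‖φ y‖ ≤ |C₁| * 1 := by linarith
      _ ≤ |C₁| * (η ^ (1 / 2 : ℝ) * y ^ (-(1 / 2) : ℝ)) := by gcongr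
      _ ≤ _ := by
        have : 0 ≤ ((‖b‖ + ‖δ‖) * η ^ (-(1 / 2) : ℝ) + |C| * η ^ (-1 : ℝ)) *
          y ^ (-(1 / 2) : ℝ) := by positivity
        linarith
  · have e1 : ‖(y : ℂ) ^ (-(Complex.I * τ))‖ = 1 := norm_cpow_of_re_eq_zero (by simp) hy
    have e2 : ‖(y : ℂ) ^ (Complex.I * τ')‖ = 1 := norm_cpow_of_re_eq_zero (by simp) hy
    have e3 : ‖Complex.exp (2 * Complex.I * ν * y)‖ = 1 := by
      have := Complex.norm_exp_ofReal_mul_I (2 * ν * y)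
      rw [← this]; congr 2; push_cast; ring
    have h1 := norm_add_le (b * (y : ℂ) ^ (-(Complex.I * τ)))
      (δ * Complex.exp (2 * Complex.I * ν * y) * (y : ℂ) ^ (Complex.I * τ'))
    rw [norm_mul, norm_mul, norm_mul, e1, e2, e3, mul_one, mul_one, mul_one] at h1
    have h2 := h y hy
    have h3 := norm_le_norm_add_norm_sub' ((y : ℂ) * φ y) (b * (y : ℂ) ^ (-(Complex.I * τ))
        + δ * Complex.exp (2 * Complex.I * ν * y) * (y : ℂ) ^ (Complex.I * τ'))
    have h4 : y * ‖φ y‖ ≤ (‖b‖ + ‖δ‖) + |C| * y ^ (-(1 / 2) : ℝ) := by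
      rw [norm_mul, Complex.norm_real, Real.norm_of_nonneg hy.le] at h3
      have : C * y ^ (-(1 / 2) : ℝ) ≤ |C| * y ^ (-(1 / 2) : ℝ) := by
        gcongr; exact le_abs_self C
      linarith
    have h5 : ‖φ y‖ ≤ ((‖b‖ + ‖δ‖) * y ^ (-(1 / 2) : ℝ) + |C| * y ^ (-1 : ℝ))
        * y ^ (-(1 / 2) : ℝ) := by
      have e4 : y ^ (-(1 / 2) : ℝ) * y ^ (-(1 / 2) : ℝ) = y ^ (-1 : ℝ) := by
        rw [← Real.rpow_add hy]; norm_num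
      have e5 : y ^ (-1 : ℝ) = y⁻¹ := Real.rpow_neg_one y
      have : ‖φ y‖ ≤ y⁻¹ * ((‖b‖ + ‖δ‖) + |C| * y ^ (-(1 / 2) : ℝ)) := by
        rw [← div_eq_inv_mul, le_div_iff₀ hy]; linarith
      calc ‖φ y‖ ≤ _ := this
        _ = (‖b‖ + ‖δ‖) * y⁻¹ + |C| * y⁻¹ * y ^ (-(1 / 2) : ℝ) := by ring
        _ = _ := by rw [← e5]; nth_rewrite 1 [← e4]; ring
    have h6 : y ^ (-(1 / 2) : ℝ) ≤ η ^ (-(1 / 2) : ℝ) :=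
      Real.rpow_le_rpow_of_nonpos hη hyη (by norm_num)
    have h7 : y ^ (-1 : ℝ) ≤ η ^ (-1 : ℝ) := Real.rpow_le_rpow_of_nonpos hη hyη (by norm_num)
    refine h5.trans (mul_le_mul_of_nonneg_right ?_ hpow.le)
    have : 0 ≤ |C₁| * η ^ (1 / 2 : ℝ) := by positivity
    have : (‖b‖ + ‖δ‖) * y ^ (-(1 / 2) : ℝ) ≤ (‖b‖ + ‖δ‖) * η ^ (-(1 / 2) : ℝ) := by gcongr
    have : |C| * y ^ (-1 : ℝ) ≤ |C| * η ^ (-1 : ℝ) := by gcongr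
    linarith

end Asymptotics

/-! ### The connection coefficient between infinity and the horizon. -/

section Connection

/-- `h` solves the radial equation, with regular singular points at `0` and `-d`, on `U`. -/
def SolvesHeun (d p p' σ α β : ℂ) (U : Set ℂ) (h h' : ℂ → ℂ) : Prop :=
  ∀ s ∈ U, ∃ h'' : ℂ, HasDerivAt h (h' s) s ∧ HasDerivAt h' h'' s ∧
    s * (s + d) * h'' + (p * (s + d) + p' * s + σ * (s * (s + d))) * h' s + (α * s + β) * h s = 0

/-- The Wronskian of two functions, multiplied by the factor which makes it constant for solutions
of the radial equation. -/
noncomputable def abelWronskian (d p p' σ : ℂ) (h h' k k' : ℂ → ℂ) (s : ℂ) : ℂ :=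
  s ^ p * (s + d) ^ p' * Complex.exp (σ * s) * (h' s * k s - h s * k' s)

variable {d p p' σ α β : ℂ} {U : Set ℂ} {h h' k k' : ℂ → ℂ}

theorem SolvesHeun.mono {V : Set ℂ} (hh : SolvesHeun d p p' σ α β U h h') (hV : V ⊆ U) :
    SolvesHeun d p p' σ α β V h h' := fun s hs => hh s (hV hs)

/-- Abel's identity: the prefactor has logarithmic derivative `p / s + p' / (s + d) + σ`, the
coefficient of the first derivative in the equation divided by its leading coefficient. -/
theorem hasDerivAt_abelWronskian (hh : SolvesHeun d p p' σ α β U h h')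
    (hk : SolvesHeun d p p' σ α β U k k') {s : ℂ} (hs : s ∈ U) (h0 : s ∈ Complex.slitPlane)
    (hd : s + d ∈ Complex.slitPlane) :
    HasDerivAt (abelWronskian d p p' σ h h' k k') 0 s := by
  obtain ⟨h'', a1, a2, a3⟩ := hh s hs
  obtain ⟨k'', b1, b2, b3⟩ := hk s hs
  have s0 := Complex.slitPlane_ne_zero h0
  have s1 := Complex.slitPlane_ne_zero hd
  have d1 : HasDerivAt (fun s : ℂ => s ^ p) (s ^ p * (p / s)) s := by
    refine ((hasDerivAt_id s).cpow_const (c := p) h0).congr_deriv ?_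
    simp only [id]
    rw [Complex.cpow_sub _ _ s0, Complex.cpow_one]; field_simp
  have d2 : HasDerivAt (fun s : ℂ => (s + d) ^ p') ((s + d) ^ p' * (p' / (s + d))) s := by
    refine (((hasDerivAt_id s).add_const d).cpow_const (c := p') hd).congr_deriv ?_
    simp only [id]
    rw [Complex.cpow_sub _ _ s1, Complex.cpow_one]; field_simp
  have d3 : HasDerivAt (fun s : ℂ => Complex.exp (σ * s)) (Complex.exp (σ * s) * σ) s := by
    simpa using ((hasDerivAt_id s).const_mul σ).cexp
  refine (((d1.mul d2).mul d3).mul ((a2.mul b1).sub (a1.mul b2))).congr_deriv ?_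
  simp only [Pi.mul_apply, Pi.sub_apply]
  field_simp
  linear_combination ((s + d) ^ p' * s ^ p * Complex.exp (s * σ)) * (k s * a3 - h s * b3)

theorem abelWronskian_eq (hU : IsOpen U) (hU' : Convex ℝ U) (h0 : U ⊆ Complex.slitPlane)
    (hd : ∀ s ∈ U, s + d ∈ Complex.slitPlane) (hh : SolvesHeun d p p' σ α β U h h')
    (hk : SolvesHeun d p p' σ α β U k k') {s t : ℂ} (hs : s ∈ U) (ht : t ∈ U) :
    abelWronskian d p p' σ h h' k k' s = abelWronskian d p p' σ h h' k k' t :=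
  hU.is_const_of_deriv_eq_zero hU'.isPreconnected
    (fun x hx => (hasDerivAt_abelWronskian hh hk hx (h0 hx) (hd x hx)).differentiableAt
      |>.differentiableWithinAt)
    (fun x hx => (hasDerivAt_abelWronskian hh hk hx (h0 hx) (hd x hx)).deriv) hs ht

/-- Two holomorphic functions with vanishing Wronskian are proportional. -/
theorem exists_eqOn_const_mul (hU : IsOpen U) (hU' : IsPreconnected U)
    (hh : ∀ s ∈ U, HasDerivAt h (h' s) s) (hk : ∀ s ∈ U, HasDerivAt k (k' s) s)
    (hw : ∀ s ∈ U, h' s * k s - h s * k' s = 0) {s₀ : ℂ} (hs₀ : s₀ ∈ U) (hk₀ : k s₀ ≠ 0) :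
    ∃ c : ℂ, ∀ s ∈ U, h s = c * k s := by
  refine ⟨h s₀ / k s₀, ?_⟩
  have hcont : ContinuousAt k s₀ := (hk s₀ hs₀).continuousAt
  have hev : ∀ᶠ s in 𝓝 s₀, k s ≠ 0 ∧ s ∈ U :=
    (hcont.eventually_ne hk₀).and (hU.mem_nhds hs₀)
  obtain ⟨r, hr, hball⟩ := Metric.eventually_nhds_iff_ball.1 hev
  have hder : ∀ s ∈ Metric.ball s₀ r, HasDerivAt (fun s => h s / k s) 0 s := by
    intro s hs
    obtain ⟨h1, h2⟩ := hball s hs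
    refine ((hh s h2).div (hk s h2) h1).congr_deriv ?_
    rw [hw s h2, zero_div]
  have hconst : ∀ s ∈ Metric.ball s₀ r, h s / k s = h s₀ / k s₀ := fun s hs =>
    Metric.isOpen_ball.is_const_of_deriv_eq_zero (convex_ball s₀ r).isPreconnected
      (fun x hx => (hder x hx).differentiableAt.differentiableWithinAt)
      (fun x hx => (hder x hx).deriv) hs (Metric.mem_ball_self hr)
  have A1 : AnalyticOnNhd ℂ h U := DifferentiableOn.analyticOnNhd
    (fun s hs => (hh s hs).differentiableAt.differentiableWithinAt) hU
  have A2 : AnalyticOnNhd ℂ (fun s => h s₀ / k s₀ * k s) U := DifferentiableOn.analyticOnNhd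
    (fun s hs => ((hk s hs).const_mul _).differentiableAt.differentiableWithinAt) hU
  refine fun s hs => A1.eqOn_of_preconnected_of_eventuallyEq A2 hU' hs₀ ?_ hs
  filter_upwards [Metric.ball_mem_nhds s₀ hr] with s hs
  rw [← hconst s hs, div_mul_cancel₀ _ (hball s hs).1]

theorem ExpBounded.exists_norm_laplace_le {φ : ℝ → ℂ} (hφ : ExpBounded 0 φ) {r : ℝ} (hr : 0 < r) :
    ∃ C, 0 ≤ C ∧ ∀ z : ℂ, r ≤ z.re → ‖laplace φ z‖ ≤ C := by
  obtain ⟨C, hC⟩ := hφ (r / 2) (by positivity)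
  refine ⟨|C| * Real.Gamma (1 / 2) * (r / 2) ^ (-(1 / 2) : ℝ), by positivity, fun z hz => ?_⟩
  have h1 := norm_laplace_le (c := r / 2) (C := |C|) (by norm_num : (0 : ℝ) < 1 / 2)
    (fun t ht => (hC t ht).trans (by
      rw [show (1 / 2 : ℝ) - 1 = -(1 / 2) by norm_num]
      gcongr
      exact le_abs_self C)) (show r / 2 < z.re by linarith)
  refine h1.trans ?_
  gcongr ?_ * ?_
  exact Real.rpow_le_rpow_of_nonpos (by positivity) (by linarith) (by norm_num)

/-- The coefficients of the radial equation at the singular point `0`. -/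
noncomputable def horizonHeun (d p p' σ α β : ℂ) : HeunCoeffs where
  z₀ := -d
  q₀ := p * d
  q₁ := p + p' + σ * d
  q₂ := σ
  k₀ := β
  k₁ := α
  k₂ := 0

/-- The positive real part of `p` excludes resonance, because the relevant denominators are `d * (p
+ n)`. -/
theorem solvesHeun_horizonHeun (hd : d ≠ 0) (hp : 0 < p.re) :
    SolvesHeun d p p' σ α β (Metric.ball 0 ‖d‖) (horizonHeun d p p' σ α β).sol
      (horizonHeun d p p' σ α β).sol' := by
  intro s hs
  set H := horizonHeun d p p' σ α β with hH
  have hz : ‖s‖ < ‖H.z₀‖ := by simpa [hH, horizonHeun] using hs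
  refine ⟨H.sol'' s, HeunCoeffs.hasDerivAt_sol hz, HeunCoeffs.hasDerivAt_sol' hz, ?_⟩
  have hres : ∀ n : ℕ, H.q₀ - H.z₀ * n ≠ 0 := by
    intro n h0
    have h1 : d * (p + n) = 0 := by rw [← h0]; simp only [hH, horizonHeun]; ring
    have h2 := congrArg Complex.re ((mul_eq_zero.1 h1).resolve_left hd)
    simp at h2
    have : (0 : ℝ) ≤ n := n.cast_nonneg
    linarith
  have := HeunCoeffs.sol_eq hres hz
  simp only [hH, horizonHeun] at this ⊢
  linear_combination this

namespace IsRaySolution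
variable {ρ : ℂ} {φ φ' : ℝ → ℂ}

/-- The exponent `ρ` at the origin of the ray fixes `p + p' = 2 + ρ` and `α = σ (1 + ρ)`; the radial
equation satisfies both relations with `ρ = -4iMω`. -/
theorem solvesHeun_laplace (hr : IsRaySolution d σ ρ p β φ φ') (hd : 0 ≤ d.re) (hσ0 : σ ≠ 0)
    (hσ : ∀ t : ℝ, 0 < t → (t : ℂ) ≠ σ) (hρ : ρ.re = 0) :
    SolvesHeun d p (2 + ρ - p) σ (σ * (1 + ρ)) β {s | 0 < s.re} (laplace φ)
      (fun s => -laplace (fun t => t * φ t) s) := by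
  intro s hs
  have b0 := hr.expBounded hd hσ0 hρ
  have c0 := hr.continuousOn
  have c1 : ContinuousOn (fun t : ℝ => (t : ℂ) * φ t) (Ioi 0) := by fun_prop
  exact ⟨laplace (fun t => t * (t * φ t)) s, hasDerivAt_laplace b0 c0 hs,
    (hasDerivAt_laplace b0.mul_id c1 hs).neg.congr_deriv (neg_neg _), hr.laplace_eq hd hσ0 hσ hρ hs⟩

/-- The Laplace transform of a solution along a rotated ray. -/
theorem solvesHeun_laplace_comp {q : ℂ} (hr : IsRaySolution (q * d) (σ / q) ρ p β φ φ') (hq : q ≠ 0)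
    (hd : 0 ≤ (q * d).re) (hσ0 : σ ≠ 0) (hσ : ∀ t : ℝ, 0 < t → (t : ℂ) ≠ σ / q) (hρ : ρ.re = 0) :
    SolvesHeun d p (2 + ρ - p) σ (σ * (1 + ρ)) β {s | 0 < (q * s).re}
      (fun s => laplace φ (q * s)) (fun s => q * -laplace (fun t => t * φ t) (q * s)) := by
  intro s hs
  obtain ⟨h'', a1, a2, a3⟩ := hr.solvesHeun_laplace hd (div_ne_zero hσ0 hq) hσ hρ (q * s) hs
  have dq : HasDerivAt (fun s => q * s) q s := by simpa using (hasDerivAt_id s).const_mul q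
  refine ⟨q * (q * h''), ?_, ?_, ?_⟩
  · exact (a1.comp s dq).congr_deriv (mul_comm _ _)
  · exact ((a2.comp s dq).congr_deriv (mul_comm _ _)).const_mul q
  · have e : σ / q * q = σ := div_mul_cancel₀ _ hq
    linear_combination a3 + (s * (q * d + q * s) * laplace (fun t => t * φ t) (q * s)
      - (1 + ρ) * s * laplace φ (q * s)) * e
end IsRaySolution

set_option maxHeartbeats 1000000 in
open Complex in
/-- The connection coefficient between the outgoing solution and the horizon solution of the radial
equation, together with a lower bound. -/
theorem exists_horizon_wronskian {ω d κ τ μ : ℝ} (hω : ω ≠ 0) (hd : 0 < d) {φ φ' : ℝ → ℂ}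
    (hr : IsRaySolution d (2 * I * ω) (-(I * κ)) (1 - I * τ)
      (2 * ω * d * τ - μ + I * (ω * d - κ / 2)) φ φ') :
    ∃ W : ℂ, Real.sqrt (2 * κ / (ω * d)) * d * ‖Gamma (1 - I * τ)‖ * |ω|
        * Real.exp (-(2 * Real.pi * (|τ| + |κ|))) ≤ ‖W‖ ∧
      ∀ s : ℂ, 0 < s.re → ‖s‖ < d →
        abelWronskian d (1 - I * τ) (2 + -(I * κ) - (1 - I * τ)) (2 * I * ω) (laplace φ)
          (fun s => -laplace (fun t => t * φ t) s)
          (horizonHeun d (1 - I * τ) (2 + -(I * κ) - (1 - I * τ)) (2 * I * ω)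
            (2 * I * ω * (1 + -(I * κ))) (2 * ω * d * τ - μ + I * (ω * d - κ / 2))).sol
          (horizonHeun d (1 - I * τ) (2 + -(I * κ) - (1 - I * τ)) (2 * I * ω)
            (2 * I * ω * (1 + -(I * κ))) (2 * ω * d * τ - μ + I * (ω * d - κ / 2))).sol' s = W := by
  set σ : ℂ := 2 * I * ω with hσdef
  set ρ : ℂ := -(I * κ) with hρdef
  set p : ℂ := 1 - I * τ with hpdef
  set p' : ℂ := 2 + ρ - p with hp'def
  set β : ℂ := 2 * ω * d * τ - μ + I * (ω * d - κ / 2) with hβdef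
  set H := horizonHeun d p p' σ (σ * (1 + ρ)) β with hH
  -- Turning the ray by `q` sends it to the half of the imaginary axis opposite to `σ`: then `σ / q
  -- = -2` is negative, and `q * d` has real part zero.
  set q : ℂ := -(I * ω) with hq
  have hωc : (ω : ℂ) ≠ 0 := by exact_mod_cast hω
  have hdc : (d : ℂ) ≠ 0 := by exact_mod_cast hd.ne'
  have hq0 : q ≠ 0 := neg_ne_zero.2 (mul_ne_zero I_ne_zero hωc)
  have hnq : ‖q‖ = |ω| := by simp [hq]
  have hσ0 : σ ≠ 0 := mul_ne_zero (mul_ne_zero two_ne_zero I_ne_zero) hωc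
  have hρ : ρ.re = 0 := by simp [hρdef]
  have hρim : |(1 + ρ).im| = |κ| := by simp [hρdef]
  have hpre : p.re = 1 := by simp [hpdef]
  have hpim : |p.im| = |τ| := by simp [hpdef]
  have hp're : p'.re = 1 := by simp [hp'def, hρdef, hpdef]; norm_num
  have hσq : σ / q = -2 := by rw [hσdef, hq]; field_simp
  have hd0 : (0 : ℝ) ≤ (d : ℂ).re := by simpa using hd.le
  have hqd : 0 ≤ (q * d : ℂ).re := by simp [hq]
  have hσr : ∀ t : ℝ, 0 < t → (t : ℂ) ≠ σ := by
    intro t _ h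
    have := congrArg Complex.im h
    simp [hσdef] at this
    exact hω this
  have hσr' : ∀ t : ℝ, 0 < t → (t : ℂ) ≠ σ / q := by
    intro t ht h
    rw [hσq] at h
    have := congrArg Complex.re h
    simp at this
    linarith
  have hσ0' : σ / q ≠ 0 := div_ne_zero hσ0 hq0
  -- the solution obtained from the rotated ray
  obtain ⟨ψ, ψ', hψ⟩ := exists_isRaySolution (D := q * d) (p := p) (β := β) hσ0' hσr' hρ
  -- With `ν = ωd / 2` one has `q * d = -2iν`, and the parameters become those of
  -- `exists_amplitudes`.
  have hν : ω * d / 2 ≠ 0 := by positivity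
  obtain ⟨b, δ, C, hb, hamp⟩ := IsRaySolution.exists_amplitudes (ν := ω * d / 2) (κ := κ) (τ := τ)
    (μ := μ) (φ := ψ) (φ' := ψ') hν (by
      convert hψ using 1
      · rw [hq]; push_cast; ring
      · rw [hσq]
      · rw [hβdef]; push_cast; ring)
  rw [← ofReal_sub] at hamp
  obtain ⟨C', hC'⟩ := hψ.exists_norm_le_rpow hσ0' hρ hamp
  set h₁ : ℂ → ℂ := fun s => laplace ψ (q * s) with hh₁
  set h₁' : ℂ → ℂ := fun s => q * -laplace (fun t => t * ψ t) (q * s) with hh₁'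
  set h₂ : ℂ → ℂ := laplace φ with hh₂
  set h₂' : ℂ → ℂ := fun s => -laplace (fun t => t * φ t) s with hh₂'
  have S₁ : SolvesHeun d p p' σ (σ * (1 + ρ)) β {s | 0 < (q * s).re} h₁ h₁' :=
    hψ.solvesHeun_laplace_comp hq0 hqd hσ0 hσr' hρ
  have S₂ : SolvesHeun d p p' σ (σ * (1 + ρ)) β {s | 0 < s.re} h₂ h₂' :=
    hr.solvesHeun_laplace hd0 hσ0 hσr hρ
  have S₃ : SolvesHeun d p p' σ (σ * (1 + ρ)) β (Metric.ball 0 d) H.sol H.sol' := by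
    have := solvesHeun_horizonHeun (p := p) (p' := p') (σ := σ) (α := σ * (1 + ρ)) (β := β) hdc
      (by rw [hpre]; exact one_pos)
    rwa [norm_real, Real.norm_of_nonneg hd.le] at this
  have slit : ∀ s : ℂ, 0 < s.re → s ∈ slitPlane := fun s hs => Or.inl hs
  have slit' : ∀ s : ℂ, 0 < s.re → s + d ∈ slitPlane := fun s hs => Or.inl (by simp; linarith)
  have hre1 : Convex ℝ {s : ℂ | 0 < s.re} := convex_halfSpace_re_gt 0
  have ho1 : IsOpen {s : ℂ | 0 < s.re} := isOpen_lt continuous_const continuous_re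
  -- the quarter plane where both solutions are defined
  set Q : Set ℂ := {s | 0 < s.re} ∩ {s | 0 < (q * s).re} with hQ
  have hQo : IsOpen Q := ho1.inter (isOpen_lt continuous_const (by fun_prop))
  have hQc : Convex ℝ Q := by
    refine hre1.inter ?_
    have : IsLinearMap ℝ fun s : ℂ => (q * s).re :=
      ⟨fun x y => by simp [mul_add], fun c x => by simp; ring⟩
    exact convex_halfSpace_gt this 0
  -- A direction inside both half-planes of convergence: `re w = 1` and `re (q w) = ω²`. Moreover
  -- `re (σ w) = -2ω²`.
  set w : ℂ := 1 + I * ω with hw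
  have hwre : w.re = 1 := by simp [hw]
  have hqw : (q * w).re = ω ^ 2 := by simp [hq, hw]; ring
  have hw2 : 0 < ω ^ 2 := by positivity
  have hwQ : ∀ x : ℝ, 0 < x → (x : ℂ) * w ∈ Q := by
    intro x hx
    refine ⟨by simp [hwre, hx], ?_⟩
    have e : q * (x * w) = x * (q * w) := by ring
    change 0 < (q * (x * w)).re
    rw [e, re_ofReal_mul, hqw]
    positivity
  have hw0 : 0 < ‖w‖ := norm_pos_iff.2 fun h => by simp [h] at hwre
  -- the Wronskian of the two Laplace transforms vanishes
  have hW0 : ∀ s ∈ Q, abelWronskian d p p' σ h₁ h₁' h₂ h₂' s = 0 := by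
    -- Along `x * w` both transforms and their derivatives are bounded and the powers grow like
    -- `x²`, while `exp (σ s)` has modulus `exp (-2ω²x)`. So the constant Wronskian is zero.
    have hlim : Tendsto (fun x : ℝ => abelWronskian d p p' σ h₁ h₁' h₂ h₂' (x * w)) atTop
        (𝓝 0) := by
      have bψ := hψ.expBounded hqd hσ0' hρ
      have bφ := hr.expBounded hd0 hσ0 hρ
      obtain ⟨A₁, A₁0, hA₁⟩ := bψ.exists_norm_laplace_le hw2
      obtain ⟨A₂, A₂0, hA₂⟩ := bψ.mul_id.exists_norm_laplace_le hw2
      obtain ⟨A₃, A₃0, hA₃⟩ := bφ.exists_norm_laplace_le one_pos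
      obtain ⟨A₄, A₄0, hA₄⟩ := bφ.mul_id.exists_norm_laplace_le one_pos
      have hb1 : Tendsto (fun x : ℝ => (‖w‖ * Real.exp (Real.pi * |p.im|)) *
          ((‖w‖ + d) * Real.exp (Real.pi * |p'.im|)) * (|ω| * A₂ * A₃ + A₁ * A₄) *
          (x ^ 2 * Real.exp (-(2 * ω ^ 2) * x))) atTop (𝓝 0) := by
        have h1 := tendsto_rpow_mul_exp_neg_mul_atTop_nhds_zero 2 (2 * ω ^ 2) (by positivity)
        simp only [Real.rpow_two] at h1
        simpa using h1.const_mul ((‖w‖ * Real.exp (Real.pi * |p.im|)) *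
          ((‖w‖ + d) * Real.exp (Real.pi * |p'.im|)) * (|ω| * A₂ * A₃ + A₁ * A₄))
      refine squeeze_zero_norm' ?_ hb1
      filter_upwards [eventually_ge_atTop 1] with x hx
      have hx0 : 0 < x := by linarith
      have hxw : (x : ℂ) * w ≠ 0 := mul_ne_zero (by exact_mod_cast hx0.ne') (norm_pos_iff.1 hw0)
      have hnx : ‖(x : ℂ) * w‖ = x * ‖w‖ := by rw [norm_mul, norm_real, Real.norm_of_nonneg hx0.le]
      have hqx : (q * (x * w)).re = x * ω ^ 2 := by
        rw [mul_left_comm, re_ofReal_mul, hqw]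
      have hx1 : 1 ≤ ((x : ℂ) * w).re := by rw [re_ofReal_mul, hwre]; linarith
      have hx2 : ω ^ 2 ≤ (q * (x * w)).re := by rw [hqx]; nlinarith
      have n1 : ‖((x : ℂ) * w) ^ p‖ ≤ x * (‖w‖ * Real.exp (Real.pi * |p.im|)) := by
        have := norm_cpow_le_mul_exp hxw p
        rwa [hpre, Real.rpow_one, hnx, mul_assoc] at this
      have n2 : ‖((x : ℂ) * w + d) ^ p'‖ ≤ x * ((‖w‖ + d) * Real.exp (Real.pi * |p'.im|)) := by
        have h1 := norm_cpow_le_mul_exp (slitPlane_ne_zero (slit' _ (by linarith))) p'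
          (z := (x : ℂ) * w + d)
        rw [hp're, Real.rpow_one] at h1
        have h2 : ‖(x : ℂ) * w + d‖ ≤ x * (‖w‖ + d) := by
          refine (norm_add_le _ _).trans ?_
          rw [hnx, norm_real, Real.norm_of_nonneg hd.le]
          nlinarith
        rw [← mul_assoc]
        exact h1.trans (mul_le_mul_of_nonneg_right h2 (Real.exp_nonneg _))
      have n3 : ‖exp (σ * (x * w))‖ = Real.exp (-(2 * ω ^ 2) * x) := by
        rw [norm_exp]
        congr 1
        simp [hσdef, hw]; ring
      have n4 : ‖h₁' (x * w) * h₂ (x * w) - h₁ (x * w) * h₂' (x * w)‖ ≤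
          |ω| * A₂ * A₃ + A₁ * A₄ := by
        refine (norm_sub_le _ _).trans ?_
        simp only [hh₁, hh₁', hh₂, hh₂', norm_mul, norm_neg, hnq]
        gcongr
        · exact hA₂ _ hx2
        · exact hA₃ _ hx1
        · exact hA₁ _ hx2
        · exact hA₄ _ hx1
      rw [abelWronskian, norm_mul, norm_mul, norm_mul, n3]
      calc _ ≤ (x * (‖w‖ * Real.exp (Real.pi * |p.im|))) *
            (x * ((‖w‖ + d) * Real.exp (Real.pi * |p'.im|))) * Real.exp (-(2 * ω ^ 2) * x) *
            (|ω| * A₂ * A₃ + A₁ * A₄) := by gcongr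
        _ = _ := by ring
    intro s hs
    refine tendsto_nhds_unique (tendsto_const_nhds.congr' ?_) hlim
    filter_upwards [eventually_gt_atTop 0] with x hx
    exact abelWronskian_eq hQo hQc (fun s hs => slit s hs.1) (fun s hs => slit' s hs.1)
      (S₁.mono inter_subset_right) (S₂.mono inter_subset_left) hs (hwQ x hx)
  have hW0' : ∀ s ∈ Q, h₁' s * h₂ s - h₁ s * h₂' s = 0 := by
    intro s hs
    have := hW0 s hs
    rw [abelWronskian] at this
    refine (mul_eq_zero.1 this).resolve_left (mul_ne_zero (mul_ne_zero ?_ ?_) (exp_ne_zero _))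
    · exact cpow_ne_zero_iff.2 (Or.inl (slitPlane_ne_zero (slit s hs.1)))
    · exact cpow_ne_zero_iff.2 (Or.inl (slitPlane_ne_zero (slit' s hs.1)))
  -- the two transforms are proportional
  have hΓ : Gamma (1 + ρ) ≠ 0 := Gamma_ne_zero_of_re_pos (by simp [hρ])
  have lim₂ : Tendsto (fun x : ℝ => (x * w) ^ (1 + ρ) * h₂ (x * w)) atTop (𝓝 (Gamma (1 + ρ))) :=
    hr.tendsto_cpow_mul_laplace hd0 hσ0 hρ (by rw [hwre]; exact one_pos)
  have lim₁ : Tendsto (fun x : ℝ => (x * (q * w)) ^ (1 + ρ) * laplace ψ (x * (q * w))) atTop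
      (𝓝 (Gamma (1 + ρ))) :=
    hψ.tendsto_cpow_mul_laplace hqd hσ0' hρ (by rw [hqw]; exact hw2)
  obtain ⟨x₀, hx₀, hx₀'⟩ : ∃ x : ℝ, 0 < x ∧ h₂ (x * w) ≠ 0 := by
    obtain ⟨x, h1, h2⟩ := ((lim₂.eventually_ne hΓ).and (eventually_gt_atTop 0)).exists
    exact ⟨x, h2, right_ne_zero_of_mul h1⟩
  obtain ⟨c, hc⟩ := exists_eqOn_const_mul hQo hQc.isPreconnected
    (fun s hs => (S₁ s hs.2).choose_spec.1) (fun s hs => (S₂ s hs.1).choose_spec.1) hW0'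
    (hwQ x₀ hx₀) hx₀'
  have hc' : ∀ s ∈ Q, h₁' s = c * h₂' s := by
    intro s hs
    have a1 := (S₁ s hs.2).choose_spec.1
    have a2 := ((S₂ s hs.1).choose_spec.1).const_mul c
    refine a1.unique (a2.congr_of_eventuallyEq ?_)
    filter_upwards [hQo.mem_nhds hs] with t ht using hc t ht
  -- Both transforms, multiplied by the power `1 + ρ` of their own argument, tend to `Γ(1 + ρ)`. The
  -- arguments differ by `q`, which accounts for `|ω|`, and comparing branches of the powers costs
  -- `exp (π|κ|)` twice.
  have hcn : ‖c‖ * |ω| ≤ Real.exp (2 * Real.pi * |κ|) := by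
    have key : ∀ᶠ x : ℝ in atTop, ‖c‖ * |ω| * ‖(x * w) ^ (1 + ρ) * h₂ (x * w)‖ ≤
        Real.exp (2 * Real.pi * |κ|) *
          ‖(x * (q * w)) ^ (1 + ρ) * laplace ψ (x * (q * w))‖ := by
      filter_upwards [eventually_gt_atTop 0] with x hx
      have hxc : (x : ℂ) ≠ 0 := by exact_mod_cast hx.ne'
      have hxw : (x : ℂ) * w ≠ 0 := mul_ne_zero hxc (norm_pos_iff.1 hw0)
      have hxqw : (x : ℂ) * (q * w) ≠ 0 := mul_ne_zero hxc (mul_ne_zero hq0 (norm_pos_iff.1 hw0))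
      have e1 := hc _ (hwQ x hx)
      simp only [hh₁] at e1
      rw [mul_left_comm] at e1
      rw [norm_mul, norm_mul, e1, norm_mul]
      have g1 := norm_cpow_le_mul_exp hxw (1 + ρ)
      have g2 := mul_exp_le_norm_cpow hxqw (1 + ρ)
      have hr1 : (1 + ρ).re = 1 := by simp [hρ]
      have hn : ‖(x : ℂ) * (q * w)‖ = |ω| * ‖(x : ℂ) * w‖ := by
        rw [mul_left_comm, norm_mul, hnq]
      rw [hr1, hρim, Real.rpow_one] at g1 g2
      rw [hn] at g2
      have g3 : |ω| * ‖((x : ℂ) * w) ^ (1 + ρ)‖ ≤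
          Real.exp (2 * Real.pi * |κ|) * ‖((x : ℂ) * (q * w)) ^ (1 + ρ)‖ := by
        calc _ ≤ |ω| * (‖(x : ℂ) * w‖ * Real.exp (Real.pi * |κ|)) := by gcongr
          _ = Real.exp (2 * Real.pi * |κ|) *
              (|ω| * ‖(x : ℂ) * w‖ * Real.exp (-(Real.pi * |κ|))) := by
            have : Real.exp (Real.pi * |κ|) =
                Real.exp (2 * Real.pi * |κ|) * Real.exp (-(Real.pi * |κ|)) := by
              rw [← Real.exp_add]; congr 1; ring
            rw [this]; ring
          _ ≤ _ := by gcongr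
      calc _ = ‖c‖ * ‖h₂ (x * w)‖ * (|ω| * ‖((x : ℂ) * w) ^ (1 + ρ)‖) := by ring
        _ ≤ ‖c‖ * ‖h₂ (x * w)‖ * (Real.exp (2 * Real.pi * |κ|) *
            ‖((x : ℂ) * (q * w)) ^ (1 + ρ)‖) := by gcongr
        _ = _ := by ring
    have := le_of_tendsto_of_tendsto (lim₂.norm.const_mul _) (lim₁.norm.const_mul _) key
    exact le_of_mul_le_mul_right this (norm_pos_iff.2 hΓ)
  -- the Wronskian with the horizon solution
  set U : Set ℂ := {s | 0 < s.re} ∩ Metric.ball 0 d with hU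
  have hUo : IsOpen U := ho1.inter Metric.isOpen_ball
  have hUc : Convex ℝ U := hre1.inter (convex_ball 0 d)
  have hs₁ : ((d / 2 : ℝ) : ℂ) ∈ U := by
    refine ⟨by simpa using hd, ?_⟩
    rw [mem_ball_zero_iff, norm_real, Real.norm_of_nonneg (by positivity)]
    linarith
  set W := abelWronskian d p p' σ h₂ h₂' H.sol H.sol' ((d / 2 : ℝ) : ℂ) with hWdef
  have hW : ∀ s : ℂ, 0 < s.re → ‖s‖ < d → abelWronskian d p p' σ h₂ h₂' H.sol H.sol' s = W := by
    intro s h1 h2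
    exact abelWronskian_eq hUo hUc (fun s hs => slit s hs.1) (fun s hs => slit' s hs.1)
      (S₂.mono inter_subset_left) (S₃.mono inter_subset_right)
      ⟨h1, by simpa using h2⟩ hs₁
  refine ⟨W, ?_, hW⟩
  have hz : Tendsto (fun x : ℝ => (x : ℂ) * w) (𝓝[>] 0) (𝓝 0) := by
    have : Continuous fun x : ℝ => (x : ℂ) * w := by fun_prop
    exact (this.tendsto' 0 0 (by simp)).mono_left nhdsWithin_le_nhds
  have hsol : Tendsto (fun x : ℝ => H.sol (x * w)) (𝓝[>] 0) (𝓝 1) := by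
    have h0 : (0 : ℂ) ∈ Metric.ball (0 : ℂ) d := Metric.mem_ball_self hd
    have := (S₃ 0 h0).choose_spec.1.continuousAt.tendsto.comp hz
    rwa [HeunCoeffs.sol_zero] at this
  have hsol' : Tendsto (fun x : ℝ => H.sol' (x * w)) (𝓝[>] 0) (𝓝 (H.sol' 0)) := by
    have h0 : (0 : ℂ) ∈ Metric.ball (0 : ℂ) d := Metric.mem_ball_self hd
    exact (S₃ 0 h0).choose_spec.2.1.continuousAt.tendsto.comp hz
  have limψ : Tendsto (fun x : ℝ => (x * (q * w)) ^ p
      * laplace (fun y => y * ψ y) (x * (q * w))) (𝓝[>] 0) (𝓝 (b * Gamma p)) := by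
    exact tendsto_cpow_mul_laplace_of_amplitudes (ν := ω * d / 2) (τ' := τ - κ) (δ := δ) (C := C)
      hψ.continuousOn hν hamp (by rw [hqw]; exact hw2)
  -- `re p = 1` and the transform is `O(x ^ (-1/2))`, so the product is `O(x ^ (1/2))`.
  have lim0 : Tendsto (fun x : ℝ => ‖((x : ℂ) * w) ^ p * h₁ (x * w)‖) (𝓝[>] 0) (𝓝 0) := by
    have hpow : Tendsto (fun x : ℝ => x ^ (1 / 2 : ℝ)) (𝓝[>] 0) (𝓝 0) := by
      have := (Real.continuousAt_rpow_const 0 (1 / 2) (Or.inr (by norm_num))).tendsto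
      rw [Real.zero_rpow (by norm_num)] at this
      exact this.mono_left nhdsWithin_le_nhds
    have hlim := hpow.const_mul ((‖w‖ * Real.exp (Real.pi * |p.im|)) *
        (C' * Real.Gamma (1 / 2) * (ω ^ 2) ^ (-(1 / 2) : ℝ)))
    rw [mul_zero] at hlim
    refine squeeze_zero' (Eventually.of_forall fun _ => norm_nonneg _) ?_ hlim
    filter_upwards [self_mem_nhdsWithin] with x hx
    have hx0 : 0 < x := hx
    have hxw : (x : ℂ) * w ≠ 0 := mul_ne_zero (by exact_mod_cast hx0.ne') (norm_pos_iff.1 hw0)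
    have hqx : (q * (x * w)).re = x * ω ^ 2 := by
      rw [mul_left_comm, re_ofReal_mul, hqw]
    have h1 := norm_laplace_le (c := 0) (φ := ψ) (C := C') (by norm_num : (0 : ℝ) < 1 / 2)
      (fun t ht => by
        rw [zero_mul, Real.exp_zero, mul_one, show (1 / 2 : ℝ) - 1 = -(1 / 2) by norm_num]
        exact hC' t ht) (show 0 < (q * (x * w)).re by rw [hqx]; positivity)
    rw [hqx, sub_zero, Real.mul_rpow hx0.le hw2.le] at h1
    have h2 := norm_cpow_le_mul_exp hxw p
    rw [hpre, Real.rpow_one, norm_mul, norm_real, Real.norm_of_nonneg hx0.le] at h2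
    have e : x * x ^ (-(1 / 2) : ℝ) = x ^ (1 / 2 : ℝ) := by
      rw [mul_comm, ← Real.rpow_add_one hx0.ne']; norm_num
    rw [norm_mul, ← e]
    calc _ ≤ _ := mul_le_mul h2 h1 (norm_nonneg _) (by positivity)
      _ = _ := by ring
  have limpre : Tendsto (fun x : ℝ => ‖((x : ℂ) * w + d) ^ p' * exp (σ * (x * w))‖) (𝓝[>] 0)
      (𝓝 d) := by
    have h1 := ((hz.add_const (d : ℂ)).cpow (tendsto_const_nhds (x := p')) (Or.inl (by
      simpa using hd))).mul (hz.const_mul σ).cexp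
    have h2 := h1.norm
    rw [zero_add, mul_zero, exp_zero, mul_one, norm_cpow_eq_rpow_re_of_pos hd, hp're,
      Real.rpow_one] at h2
    exact h2
  -- In `c * W` the functions `c * h₂` and `c * h₂'` are replaced by `h₁` and `h₁'`, whose behaviour
  -- at the origin is known. Passing from `(q s) ^ p` to `s ^ p` produces `|ω|`, cancelled by the
  -- `q` in `h₁'`, and the loss `exp (-2π|τ|)`.
  have key : ∀ᶠ x : ℝ in 𝓝[>] 0, ‖((x : ℂ) * w + d) ^ p' * exp (σ * (x * w))‖ *
      (Real.exp (-(2 * Real.pi * |τ|)) *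
        ‖(x * (q * w)) ^ p * laplace (fun y => y * ψ y) (x * (q * w))‖ * ‖H.sol (x * w)‖
        - ‖((x : ℂ) * w) ^ p * h₁ (x * w)‖ * ‖H.sol' (x * w)‖) ≤ ‖c‖ * ‖W‖ := by
    have hsmall : ∀ᶠ x : ℝ in 𝓝[>] 0, ‖(x : ℂ) * w‖ < d := by
      have := hz.norm
      rw [norm_zero] at this
      exact this.eventually (gt_mem_nhds hd)
    filter_upwards [hsmall, self_mem_nhdsWithin] with x hxd hx
    have hx0 : 0 < x := hx
    have hxc : (x : ℂ) ≠ 0 := by exact_mod_cast hx0.ne'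
    have hxw : (x : ℂ) * w ≠ 0 := mul_ne_zero hxc (norm_pos_iff.1 hw0)
    have hxqw : (x : ℂ) * (q * w) ≠ 0 := mul_ne_zero hxc (mul_ne_zero hq0 (norm_pos_iff.1 hw0))
    have hmem := hwQ x hx0
    rw [← hW _ hmem.1 hxd, ← norm_mul c]
    have e1 : c * abelWronskian d p p' σ h₂ h₂' H.sol H.sol' (x * w) =
        (((x : ℂ) * w + d) ^ p' * exp (σ * (x * w))) *
        (((x : ℂ) * w) ^ p * h₁' (x * w) * H.sol (x * w)
          - ((x : ℂ) * w) ^ p * h₁ (x * w) * H.sol' (x * w)) := by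
      rw [abelWronskian, hc _ hmem, hc' _ hmem]; ring
    rw [e1, norm_mul (((x : ℂ) * w + d) ^ p' * exp (σ * (x * w)))]
    gcongr
    refine le_trans ?_ (norm_sub_norm_le _ _)
    rw [norm_mul _ (H.sol (x * w)), norm_mul _ (H.sol' (x * w))]
    gcongr
    have g1 := norm_cpow_le_mul_exp hxqw p
    have g2 := mul_exp_le_norm_cpow hxw p
    have hn : ‖(x : ℂ) * (q * w)‖ = |ω| * ‖(x : ℂ) * w‖ := by
      rw [mul_left_comm, norm_mul, hnq]
    rw [hpre, hpim, Real.rpow_one] at g1 g2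
    rw [hn] at g1
    have g3 : Real.exp (-(2 * Real.pi * |τ|)) * ‖((x : ℂ) * (q * w)) ^ p‖ ≤
        |ω| * ‖((x : ℂ) * w) ^ p‖ := by
      calc _ ≤ Real.exp (-(2 * Real.pi * |τ|)) *
            (|ω| * ‖(x : ℂ) * w‖ * Real.exp (Real.pi * |τ|)) := by gcongr
        _ = |ω| * (‖(x : ℂ) * w‖ * Real.exp (-(Real.pi * |τ|))) := by
          have : Real.exp (-(Real.pi * |τ|)) =
              Real.exp (-(2 * Real.pi * |τ|)) * Real.exp (Real.pi * |τ|) := by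
            rw [← Real.exp_add]; congr 1; ring
          rw [this]; ring
        _ ≤ _ := by gcongr
    have e2 : ‖((x : ℂ) * w) ^ p * h₁' (x * w)‖ = |ω| * ‖((x : ℂ) * w) ^ p‖ *
        ‖laplace (fun y => y * ψ y) (x * (q * w))‖ := by
      simp only [hh₁']
      rw [norm_mul, norm_mul q, hnq, norm_neg, mul_left_comm q]; ring
    rw [e2, norm_mul, ← mul_assoc]
    gcongr
  have hlim := limpre.mul (((limψ.norm.const_mul (Real.exp (-(2 * Real.pi * |τ|)))).mul
    hsol.norm).sub (lim0.mul hsol'.norm))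
  have hfin := le_of_tendsto hlim key
  rw [zero_mul, sub_zero, norm_one, mul_one, norm_mul] at hfin
  -- The current identity with `‖δ‖²` discarded.
  have hbn : Real.sqrt (2 * κ / (ω * d)) ≤ ‖b‖ := by
    refine Real.sqrt_le_iff.2 ⟨norm_nonneg _, ?_⟩
    rw [hb]
    have : κ / (ω * d / 2) = 2 * κ / (ω * d) := by field_simp
    rw [this]
    have := sq_nonneg ‖δ‖
    linarith
  have e3 : Real.exp (-(2 * Real.pi * (|τ| + |κ|))) =
      Real.exp (-(2 * Real.pi * |τ|)) * (Real.exp (2 * Real.pi * |κ|))⁻¹ := by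
    rw [← Real.exp_neg, ← Real.exp_add]; congr 1; ring
  have hE : 0 < Real.exp (2 * Real.pi * |κ|) := Real.exp_pos _
  rw [e3, ← mul_assoc, ← div_eq_mul_inv, div_le_iff₀ hE]
  calc _ ≤ ‖b‖ * d * ‖Gamma p‖ * |ω| * Real.exp (-(2 * Real.pi * |τ|)) := by gcongr
    _ = (d * (Real.exp (-(2 * Real.pi * |τ|)) * (‖b‖ * ‖Gamma p‖))) * |ω| := by ring
    _ ≤ (‖c‖ * ‖W‖) * |ω| := by gcongr
    _ = ‖W‖ * (‖c‖ * |ω|) := by ring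
    _ ≤ ‖W‖ * Real.exp (2 * Real.pi * |κ|) := by gcongr

end Connection

/-! ### Explicit bounds for the Gamma function on the line `re z = 1`. -/

section GammaBounds

/-- `Γ z` is the transform of `t ^ (z - 1)` at `1`; that power has modulus one, so the bound is `Γ 1
= 1`. -/
theorem norm_Gamma_le_one {z : ℂ} (hz : z.re = 1) : ‖Complex.Gamma z‖ ≤ 1 := by
  have h1 := laplace_cpow (a := z) (z := 1) hz.ge (by simp)
  rw [Complex.one_cpow, one_mul] at h1
  have h2 := norm_laplace_le (φ := fun t : ℝ => (t : ℂ) ^ (z - 1)) (C := 1) (c := 0) one_pos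
    (fun t ht => by
      rw [Complex.norm_cpow_eq_rpow_re_of_pos ht]
      simp [hz]) (z := 1) (by simp)
  rw [h1] at h2
  simpa [Real.Gamma_one] using h2

/-- By reflection `Γ(1 + iy) Γ(1 - iy) = πy / sinh (πy)`. The first factor has modulus at most one,
and `sinh x ≤ x * exp x` for `x ≥ 0`. -/
theorem exp_neg_le_norm_Gamma (y : ℝ) :
    Real.exp (-(Real.pi * |y|)) ≤ ‖Complex.Gamma (1 - Complex.I * y)‖ := by
  rcases eq_or_ne y 0 with rfl | hy
  · simp
  have hyc : (y : ℂ) * Complex.I ≠ 0 := mul_ne_zero (by exact_mod_cast hy) Complex.I_ne_zero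
  have h1 := Complex.Gamma_mul_Gamma_one_sub ((y : ℂ) * Complex.I)
  have h2 := Complex.Gamma_add_one _ hyc
  rw [← mul_assoc, Complex.sin_mul_I, mul_comm (y : ℂ) Complex.I] at h1
  rw [mul_comm (y : ℂ) Complex.I] at h2
  set x := Real.pi * |y| with hx
  have hx0 : 0 < x := mul_pos Real.pi_pos (abs_pos.2 hy)
  have hsinh : |Real.sinh (Real.pi * y)| ≤ x * Real.exp x := by
    have e1 : |Real.sinh (Real.pi * y)| = Real.sinh x := by
      rw [Real.abs_sinh, abs_mul, abs_of_pos Real.pi_pos]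
    rw [e1, Real.sinh_eq]
    have h3 := Real.add_one_le_exp (-(2 * x))
    have h4 : Real.exp (-x) = Real.exp (-(2 * x)) * Real.exp x := by
      rw [← Real.exp_add]; congr 1; ring
    rw [h4]
    nlinarith [Real.exp_pos x]
  have hs0 : 0 < |Real.sinh (Real.pi * y)| :=
    abs_pos.2 (Real.sinh_ne_zero.2 (mul_ne_zero Real.pi_ne_zero hy))
  have h3 : ‖Complex.Gamma (Complex.I * y + 1)‖ * ‖Complex.Gamma (1 - Complex.I * y)‖ =
      x / |Real.sinh (Real.pi * y)| := by
    rw [h2, ← norm_mul, mul_assoc, h1, norm_mul, norm_div, norm_mul, norm_mul, Complex.norm_I,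
      ← Complex.ofReal_mul, ← Complex.ofReal_sinh]
    simp only [Complex.norm_real, Real.norm_eq_abs, abs_of_pos Real.pi_pos]
    rw [hx]; ring
  have h4 := norm_Gamma_le_one (z := Complex.I * y + 1) (by simp)
  have h5 : Real.exp (-x) ≤ x / |Real.sinh (Real.pi * y)| := by
    rw [le_div_iff₀ hs0, Real.exp_neg]
    calc (Real.exp x)⁻¹ * |Real.sinh (Real.pi * y)| ≤ (Real.exp x)⁻¹ * (x * Real.exp x) := by
          gcongr
      _ = x := by field_simp
  calc Real.exp (-x) ≤ _ := h5
    _ = _ := h3.symm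
    _ ≤ 1 * ‖Complex.Gamma (1 - Complex.I * y)‖ := by gcongr
    _ = _ := one_mul _

end GammaBounds

/-! ### Wronskians and linear dependence for `u'' = b u`. -/

section SecondOrder
variable {b : ℝ → ℂ} {y y' w w' : ℝ → ℂ}

theorem SolvesOn.wronskian_eq (hy : SolvesOn 0 b univ y y') (hw : SolvesOn 0 b univ w w')
    (s t : ℝ) : y' s * w s - y s * w' s = y' t * w t - y t * w' t := by
  have hd : ∀ x, HasDerivAt (fun x => y' x * w x - y x * w' x) 0 x := by
    intro x
    obtain ⟨a1, a2⟩ := hy x (mem_univ x)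
    obtain ⟨b1, b2⟩ := hw x (mem_univ x)
    refine ((a2.mul b1).sub (a1.mul b2)).congr_deriv ?_
    simp only [Pi.zero_apply]
    ring
  exact is_const_of_deriv_eq_zero (fun x => (hd x).differentiableAt) (fun x => (hd x).deriv) s t

theorem SolvesOn.lincomb (hy : SolvesOn 0 b univ y y') (hw : SolvesOn 0 b univ w w') (α β : ℂ) :
    SolvesOn 0 b univ (fun t => α * y t + β * w t) (fun t => α * y' t + β * w' t) := by
  intro t ht
  obtain ⟨a1, a2⟩ := hy t ht
  obtain ⟨b1, b2⟩ := hw t ht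
  refine ⟨(a1.const_mul α).add (b1.const_mul β),
    ((a2.const_mul α).add (b2.const_mul β)).congr_deriv ?_⟩
  simp only [Pi.zero_apply]
  ring

theorem SolvesOn.eq_const_mul (hb : Continuous b) (hy : SolvesOn 0 b univ y y')
    (hw : SolvesOn 0 b univ w w') {t₀ : ℝ} (h : y' t₀ * w t₀ - y t₀ * w' t₀ = 0) (hw₀ : w t₀ ≠ 0) :
    ∃ c : ℂ, ∀ t, y t = c * w t ∧ y' t = c * w' t := by
  refine ⟨y t₀ / w t₀, fun t => ?_⟩
  have h1 := hw.lincomb hw (y t₀ / w t₀) 0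
  simp only [zero_mul, add_zero] at h1
  refine hy.eqOn ordConnected_univ continuousOn_const hb.continuousOn h1 (mem_univ t₀) ?_ ?_ t
    (mem_univ t)
  · field_simp
  · field_simp
    linear_combination h

theorem SolvesOn.exists_lincomb (hb : Continuous b) {v v' : ℝ → ℂ} (hy : SolvesOn 0 b univ y y')
    (hw : SolvesOn 0 b univ w w') (hv : SolvesOn 0 b univ v v') {t₀ : ℝ}
    (h : y' t₀ * w t₀ - y t₀ * w' t₀ ≠ 0) : ∃ α β : ℂ, ∀ t, v t = α * y t + β * w t := by
  set W := y' t₀ * w t₀ - y t₀ * w' t₀ with hW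
  refine ⟨(v' t₀ * w t₀ - v t₀ * w' t₀) / W, (y' t₀ * v t₀ - y t₀ * v' t₀) / W, fun t => ?_⟩
  refine (hv.eqOn ordConnected_univ continuousOn_const hb.continuousOn (hy.lincomb hw _ _)
    (mem_univ t₀) ?_ ?_ t (mem_univ t)).1
  · field_simp
    rw [hW]; ring
  · field_simp
    rw [hW]; ring

theorem SolvesOn.conj (hb : ∀ t, starRingEnd ℂ (b t) = b t) (hy : SolvesOn 0 b univ y y') :
    SolvesOn 0 b univ (fun t => starRingEnd ℂ (y t)) (fun t => starRingEnd ℂ (y' t)) := by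
  intro t ht
  obtain ⟨a1, a2⟩ := hy t ht
  refine ⟨a1.star, (a2.star).congr_deriv ?_⟩
  simp only [Pi.zero_apply, zero_mul, zero_add, star_mul']
  change starRingEnd ℂ (b t) * starRingEnd ℂ (y t) = _
  rw [hb]

/-- An oscillating exponential with nonzero frequency has no limit. -/
theorem eq_zero_of_tendsto_mul_exp {ω : ℝ} (hω : ω ≠ 0) {β L : ℂ}
    (h : Tendsto (fun x : ℝ => β * Complex.exp (Complex.I * (ω * x))) atTop (𝓝 L)) : β = 0 := by
  -- A shift by half a period reverses the sign, so the limit is its own negative, hence zero,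
  -- whereas the modulus is constantly `‖β‖`.
  have h1 : Tendsto (fun x : ℝ => x + Real.pi / ω) atTop atTop := tendsto_atTop_add_const_right _ _
    tendsto_id
  have h2 := h.comp h1
  have h3 : (fun x : ℝ => β * Complex.exp (Complex.I * (ω * x))) ∘ (fun x : ℝ => x + Real.pi / ω) =
      fun x : ℝ => -(β * Complex.exp (Complex.I * (ω * x))) := by
    ext x
    have hωc : (ω : ℂ) ≠ 0 := by exact_mod_cast hω
    have : Complex.I * (ω * ((x + Real.pi / ω : ℝ) : ℂ)) =
        Complex.I * (ω * x) + Real.pi * Complex.I := by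
      push_cast; field_simp
    simp only [Function.comp]
    rw [this, Complex.exp_add, Complex.exp_pi_mul_I]
    ring
  rw [h3] at h2
  have h5 : L = 0 := by
    have := tendsto_nhds_unique h2 h.neg
    have h6 : L + L = 0 := by nth_rewrite 1 [this]; ring
    have h7 : 2 * L = 0 := by rw [two_mul]; exact h6
    exact (mul_eq_zero.1 h7).resolve_left two_ne_zero
  rw [h5] at h
  have h6 := h.norm
  have h7 : (fun x : ℝ => ‖β * Complex.exp (Complex.I * (ω * x))‖) = fun _ => ‖β‖ := by
    ext x
    have := Complex.norm_exp_ofReal_mul_I (ω * x)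
    rw [norm_mul]
    have e : Complex.I * (ω * (x : ℂ)) = ((ω * x : ℝ) : ℂ) * Complex.I := by push_cast; ring
    rw [e, this, mul_one]
  rw [h7, norm_zero] at h6
  exact norm_eq_zero.1 (tendsto_nhds_unique tendsto_const_nhds h6)

end SecondOrder

/-! ### The horizons and the tortoise coordinate. -/

section Radius
variable {a M : ℝ} (ha : |a| < M)
include ha

theorem sqrt_sq_sub_sq_pos : 0 < Real.sqrt (M ^ 2 - a ^ 2) := by
  have h1 : 0 ≤ |a| := abs_nonneg a
  have h2 := sq_abs a
  exact Real.sqrt_pos.2 (by nlinarith)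

theorem sq_sqrt_sq_sub_sq : Real.sqrt (M ^ 2 - a ^ 2) ^ 2 = M ^ 2 - a ^ 2 :=
  Real.sq_sqrt (by nlinarith [abs_nonneg a, sq_abs a])

theorem rMinus_lt_rPlus : rMinus a M < rPlus a M := by
  have := sqrt_sq_sub_sq_pos ha
  unfold rMinus rPlus; linarith

theorem rPlus_mul_rMinus : rPlus a M * rMinus a M = a ^ 2 := by
  have := sq_sqrt_sq_sub_sq ha
  unfold rMinus rPlus; linarith

theorem mass_pos : 0 < M := (abs_nonneg a).trans_lt ha

theorem rPlus_pos : 0 < rPlus a M := by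
  have := sqrt_sq_sub_sq_pos ha
  have := mass_pos ha
  unfold rPlus; linarith

omit ha in
theorem rPlus_add_rMinus : rPlus a M + rMinus a M = 2 * M := by unfold rMinus rPlus; ring

theorem rPlus_le : rPlus a M ≤ 2 * M := by
  have h1 := rPlus_mul_rMinus ha
  have h2 := rPlus_pos ha
  have h3 := rPlus_add_rMinus (a := a) (M := M)
  by_contra! h
  nlinarith [sq_nonneg a]

theorem Delta_eq (r : ℝ) : Delta a M r = (r - rPlus a M) * (r - rMinus a M) := by
  have h1 := rPlus_mul_rMinus ha
  have h3 := rPlus_add_rMinus (a := a) (M := M)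
  unfold Delta
  linear_combination r * h3 - h1

theorem Delta_pos {r : ℝ} (hr : rPlus a M < r) : 0 < Delta a M r := by
  rw [Delta_eq ha]
  have := rMinus_lt_rPlus ha
  exact mul_pos (by linarith) (by linarith)

/-- The tortoise coordinate as a function of the radius. -/
noncomputable def tortoise (a M r : ℝ) : ℝ :=
  r + 2 * M * rPlus a M / (rPlus a M - rMinus a M) * Real.log (r - rPlus a M)
    - 2 * M * rMinus a M / (rPlus a M - rMinus a M) * Real.log (r - rMinus a M)

/-- Partial fractions, with residues determined by `r± ^ 2 + a ^ 2 = 2 M r±`. -/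
theorem hasDerivAt_tortoise {r : ℝ} (hr : rPlus a M < r) :
    HasDerivAt (tortoise a M) ((r ^ 2 + a ^ 2) / Delta a M r) r := by
  have h0 := rMinus_lt_rPlus ha
  have e1 : r - rPlus a M ≠ 0 := by linarith
  have e2 : r - rMinus a M ≠ 0 := by linarith
  have e3 : rPlus a M - rMinus a M ≠ 0 := by linarith
  have d1 := ((hasDerivAt_id r).sub_const (rPlus a M)).log e1
  have d2 := ((hasDerivAt_id r).sub_const (rMinus a M)).log e2
  refine (((hasDerivAt_id r).add (d1.const_mul _)).sub (d2.const_mul _)).congr_deriv ?_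
  have h1 := rPlus_mul_rMinus ha
  have h3 := rPlus_add_rMinus (a := a) (M := M)
  rw [Delta_eq ha]
  simp only [id]
  field_simp
  rw [← h1]
  linear_combination -((rPlus a M - rMinus a M) * r) * h3

theorem strictMonoOn_tortoise : StrictMonoOn (tortoise a M) (Ioi (rPlus a M)) := by
  refine strictMonoOn_of_deriv_pos (convex_Ioi _)
    (fun r hr => (hasDerivAt_tortoise ha hr).continuousAt.continuousWithinAt) fun r hr => ?_
  rw [interior_Ioi] at hr
  rw [(hasDerivAt_tortoise ha hr).deriv]
  have h1 := Delta_pos ha hr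
  have h2 := (rPlus_pos ha).trans hr
  positivity

variable {rad : ℝ → ℝ} (hrad : IsRadius a M rad)
include hrad

/-- The explicit coordinate inverts every admissible `rad` up to translation. The limits of `rad` at
both ends follow from this and monotonicity. -/
theorem IsRadius.exists_tortoise_eq : ∃ c : ℝ, ∀ x, tortoise a M (rad x) = x + c := by
  refine ⟨tortoise a M (rad 0), fun x => ?_⟩
  have hd : ∀ x, HasDerivAt (fun x => tortoise a M (rad x) - x) 0 x := by
    intro x
    obtain ⟨h1, h2⟩ := hrad x
    refine (((hasDerivAt_tortoise ha h1).comp x h2).sub (hasDerivAt_id x)).congr_deriv ?_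
    have h3 := (Delta_pos ha h1).ne'
    have h4 := (rPlus_pos ha).trans h1
    have h5 : rad x ^ 2 + a ^ 2 ≠ 0 := by positivity
    field_simp
    ring
  have := is_const_of_deriv_eq_zero (fun x => (hd x).differentiableAt) (fun x => (hd x).deriv) x 0
  linarith

theorem IsRadius.tendsto_atTop : Tendsto rad atTop atTop := by
  obtain ⟨c, hc⟩ := hrad.exists_tortoise_eq ha
  refine Filter.tendsto_atTop.2 fun b => ?_
  set r := max b (rPlus a M + 1) with hr
  have hr1 : rPlus a M < r := lt_of_lt_of_le (by linarith) (le_max_right _ _)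
  filter_upwards [eventually_ge_atTop (tortoise a M r - c)] with x hx
  refine (le_max_left _ _).trans (b := r) ?_
  exact ((strictMonoOn_tortoise ha).le_iff_le hr1 (hrad x).1).1 (by rw [hc]; linarith)

theorem IsRadius.tendsto_atBot : Tendsto rad atBot (𝓝[>] (rPlus a M)) := by
  obtain ⟨c, hc⟩ := hrad.exists_tortoise_eq ha
  refine tendsto_nhdsWithin_iff.2 ⟨?_, Eventually.of_forall fun x => (hrad x).1⟩
  refine tendsto_order.2 ⟨fun b hb => Eventually.of_forall fun x => hb.trans (hrad x).1,
    fun b hb => ?_⟩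
  filter_upwards [eventually_lt_atBot (tortoise a M b - c)] with x hx
  exact ((strictMonoOn_tortoise ha).lt_iff_lt (hrad x).1 hb).1 (by rw [hc]; linarith)

end Radius

/-! ### From the radial equation to the confluent Heun equation. -/

section Radial

/-- The exponent of the outgoing solution at the inner horizon. -/
noncomputable def innerExponent (a M ω : ℝ) (m : ℤ) : ℂ :=
  -(2 * Complex.I * M * ω) - horExponent a M ω m

/-- The factor relating the radial function to the solution of the confluent Heun equation. -/
noncomputable def radialFactor (a M ω : ℝ) (m : ℤ) (r : ℝ) : ℂ :=
  ((Real.sqrt (r ^ 2 + a ^ 2) : ℝ) : ℂ) * ((r - rPlus a M : ℝ) : ℂ) ^ horExponent a M ω m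
    * ((r - rMinus a M : ℝ) : ℂ) ^ innerExponent a M ω m * Complex.exp (Complex.I * ω * r)

/-- The logarithmic derivative of `radialFactor`. -/
noncomputable def radialLogDeriv (a M ω : ℝ) (m : ℤ) (r : ℝ) : ℂ :=
  r / (r ^ 2 + a ^ 2) + (horExponent a M ω m / (r - rPlus a M)
    + innerExponent a M ω m / (r - rMinus a M) + Complex.I * ω)

/-- The radial function of the tortoise coordinate which belongs to a solution of the confluent Heun
equation. -/
noncomputable def radialLift (a M : ℝ) (rad : ℝ → ℝ) (ω : ℝ) (m : ℤ) (h : ℂ → ℂ) (x : ℝ) : ℂ :=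
  radialFactor a M ω m (rad x) * h (rad x - rPlus a M)

/-- The derivative of `radialLift`. -/
noncomputable def radialLift' (a M : ℝ) (rad : ℝ → ℝ) (ω : ℝ) (m : ℤ) (h h' : ℂ → ℂ) (x : ℝ) : ℂ :=
  radialFactor a M ω m (rad x) * (radialLogDeriv a M ω m (rad x) * h (rad x - rPlus a M)
    + h' (rad x - rPlus a M)) * ((Delta a M (rad x) / (rad x ^ 2 + a ^ 2) : ℝ) : ℂ)

/-- The coefficient of the radial equation `u'' = b u`. -/
noncomputable def radialCoeff (a M : ℝ) (rad : ℝ → ℝ) (ω : ℝ) (m : ℤ) (lam : ℝ) (x : ℝ) : ℂ :=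
  -((ω ^ 2 - potential a M ω m lam (rad x) : ℝ) : ℂ)

/-- The radial equation in the form of a confluent Heun equation in `s = r - r₊`. -/
def SolvesRadialHeun (a M ω : ℝ) (m : ℤ) (lam : ℝ) : Set ℂ → (ℂ → ℂ) → (ℂ → ℂ) → Prop :=
  SolvesHeun ((rPlus a M - rMinus a M : ℝ) : ℂ) (1 + 2 * horExponent a M ω m)
    (1 + 2 * innerExponent a M ω m) (2 * Complex.I * ω)
    (2 * Complex.I * ω * (1 - 4 * Complex.I * M * ω))
    (8 * M * ω ^ 2 * rPlus a M - 2 * a * m * ω - lam - a ^ 2 * ω ^ 2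
      + Complex.I * ω * (2 * rPlus a M - 4 * M))

variable {a M : ℝ}

theorem horExponent_mul (ha : |a| < M) (ω : ℝ) (m : ℤ) :
    horExponent a M ω m * (rPlus a M - rMinus a M) =
      Complex.I * (a * m - 2 * M * rPlus a M * ω) := by
  have h0 : (rPlus a M : ℂ) - rMinus a M ≠ 0 := by
    have := rMinus_lt_rPlus ha
    rw [← Complex.ofReal_sub]
    exact_mod_cast (sub_pos.2 this).ne'
  unfold horExponent
  push_cast
  field_simp

theorem horExponent_re (a M ω : ℝ) (m : ℤ) : (horExponent a M ω m).re = 0 := by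
  unfold horExponent
  rw [mul_div_assoc, ← Complex.ofReal_div, Complex.re_mul_ofReal]
  simp

theorem innerExponent_re (a M ω : ℝ) (m : ℤ) : (innerExponent a M ω m).re = 0 := by
  unfold innerExponent
  simp [horExponent_re]

variable {rad : ℝ → ℝ} {ω lam : ℝ} {m : ℤ}

theorem hasDerivAt_radialFactor (ha : |a| < M) {r : ℝ} (hr : rPlus a M < r) :
    HasDerivAt (radialFactor a M ω m) (radialFactor a M ω m r * radialLogDeriv a M ω m r) r := by
  have h0 := rMinus_lt_rPlus ha
  have hp := rPlus_pos ha
  have hf : 0 < r ^ 2 + a ^ 2 := by have := hp.trans hr; positivity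
  have cpowd : ∀ (r₀ : ℝ) (ξ : ℂ), r₀ < r → HasDerivAt (fun t : ℝ => ((t - r₀ : ℝ) : ℂ) ^ ξ)
      (((r - r₀ : ℝ) : ℂ) ^ ξ * (ξ / (r - r₀))) r := by
    intro r₀ ξ hr₀
    have hs : 0 < r - r₀ := by linarith
    have hs0 : ((r - r₀ : ℝ) : ℂ) ≠ 0 := by exact_mod_cast hs.ne'
    have h1 := ((hasDerivAt_id ((r - r₀ : ℝ) : ℂ)).cpow_const (c := ξ)
      (Or.inl (by simpa using hs))).comp_ofReal
    have h2 := HasDerivAt.scomp r h1 ((hasDerivAt_id r).sub_const r₀)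
    refine h2.congr_deriv ?_
    simp only [id, one_smul]
    rw [Complex.cpow_sub _ _ hs0, Complex.cpow_one]
    push_cast at hs0 ⊢
    field_simp
  have ds : HasDerivAt (fun t : ℝ => ((Real.sqrt (t ^ 2 + a ^ 2) : ℝ) : ℂ))
      (((Real.sqrt (r ^ 2 + a ^ 2) : ℝ) : ℂ) * (r / (r ^ 2 + a ^ 2))) r := by
    have h1 := (((hasDerivAt_pow 2 r).add_const (a ^ 2)).sqrt hf.ne').ofReal_comp
    refine h1.congr_deriv ?_
    have hs0 : ((Real.sqrt (r ^ 2 + a ^ 2) : ℝ) : ℂ) ≠ 0 := by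
      exact_mod_cast (Real.sqrt_pos.2 hf).ne'
    have hs2 : ((Real.sqrt (r ^ 2 + a ^ 2) : ℝ) : ℂ) ^ 2 = r ^ 2 + a ^ 2 := by
      have := Real.sq_sqrt hf.le
      exact_mod_cast congrArg (fun x : ℝ => (x : ℂ)) this
    have hfc : (r : ℂ) ^ 2 + a ^ 2 ≠ 0 := by exact_mod_cast hf.ne'
    push_cast
    field_simp
    rw [hs2]
  have d0 : HasDerivAt (fun t : ℝ => (t : ℂ)) 1 r := Complex.ofRealCLM.hasDerivAt
  have de := (d0.const_mul (Complex.I * ω)).cexp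
  refine (((ds.mul (cpowd _ (horExponent a M ω m) hr)).mul
    (cpowd _ (innerExponent a M ω m) (h0.trans hr))).mul de).congr_deriv ?_
  simp only [radialFactor, radialLogDeriv, Pi.mul_apply]
  ring

/-- The algebraic identity behind the passage to the confluent Heun equation. -/
theorem radial_identity {Δ f r M ω A a₂ lam e h h' h'' : ℂ} (hΔ : Δ ≠ 0) (hf0 : f ≠ 0)
    (hf : f = Δ + 2 * M * r) (ha₂ : a₂ = Δ - r ^ 2 + 2 * M * r)
    (he : e = Complex.I * (ω * Δ - (2 * M * ω * r - A)) / Δ)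
    (heun : Δ * h'' + (2 * (Complex.I * (ω * Δ - (2 * M * ω * r - A))) + (2 * r - 2 * M)) * h'
      + (8 * M * ω ^ 2 * r - 2 * A * ω - lam - a₂ * ω ^ 2 + Complex.I * ω * (2 * r - 4 * M)) * h
        = 0) :
    (Δ / f) * (((r / f + e) * (Δ / f) + ((2 * r - 2 * M) / f - 2 * r * Δ / f ^ 2))
      * ((r / f + e) * h + h') + (Δ / f) * (((1 / f - 2 * r ^ 2 / f ^ 2)
        + (Complex.I * ω * (2 * r - 4 * M) / Δ
          - Complex.I * (ω * Δ - (2 * M * ω * r - A)) * (2 * r - 2 * M) / Δ ^ 2)) * h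
        + (r / f + e) * h' + h'')) =
    -(ω ^ 2 - ((4 * M * r * A * ω - A ^ 2 + Δ * (lam + a₂ * ω ^ 2)) / f ^ 2
      + Δ / f ^ 4 * (a₂ * Δ + 2 * M * r * (r ^ 2 - a₂)))) * h := by
  subst he ha₂
  have hh : h'' = -((2 * (Complex.I * (ω * Δ - (2 * M * ω * r - A))) + (2 * r - 2 * M)) * h'
      + (8 * M * ω ^ 2 * r - 2 * A * ω - lam - (Δ - r ^ 2 + 2 * M * r) * ω ^ 2
        + Complex.I * ω * (2 * r - 4 * M)) * h) / Δ := by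
    rw [eq_div_iff hΔ]; linear_combination heun
  rw [hh]
  have hM : 2 * M * r = f - Δ := by rw [hf]; ring
  field_simp
  ring_nf
  simp only [Complex.I_sq]
  subst hf
  ring

/-- The chain rule with `dr/dr* = Δ / (r² + a²)`, where every derivative of the prefactor is
expressed through its logarithmic derivative. What remains is `radial_identity`. -/
theorem SolvesRadialHeun.hasDerivAt (ha : |a| < M) (hrad : IsRadius a M rad) {U : Set ℂ}
    {h h' : ℂ → ℂ} (hh : SolvesRadialHeun a M ω m lam U h h') {x : ℝ}
    (hx : (rad x : ℂ) - rPlus a M ∈ U) :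
    HasDerivAt (radialLift a M rad ω m h) (radialLift' a M rad ω m h h' x) x ∧
    HasDerivAt (radialLift' a M rad ω m h h')
      (radialCoeff a M rad ω m lam x * radialLift a M rad ω m h x) x := by
  obtain ⟨hr, dr⟩ := hrad x
  obtain ⟨h'', a1, a2, a3⟩ := hh _ hx
  set r := rad x with hrdef
  have h0 := rMinus_lt_rPlus ha
  have hp := rPlus_pos ha
  have hf : 0 < r ^ 2 + a ^ 2 := by have := hp.trans hr; positivity
  have hfc : (r : ℂ) ^ 2 + a ^ 2 ≠ 0 := by exact_mod_cast hf.ne'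
  have hΔ := Delta_pos ha hr
  have hΔc : (Delta a M r : ℂ) ≠ 0 := by exact_mod_cast hΔ.ne'
  have s0 : (r : ℂ) - rPlus a M ≠ 0 := by
    rw [← Complex.ofReal_sub]; exact_mod_cast (sub_pos.2 hr).ne'
  have s1 : (r : ℂ) - rMinus a M ≠ 0 := by
    rw [← Complex.ofReal_sub]; exact_mod_cast (sub_pos.2 (h0.trans hr)).ne'
  have d0 : HasDerivAt (fun t : ℝ => (t : ℂ)) 1 r := Complex.ofRealCLM.hasDerivAt
  have dh : HasDerivAt (fun t : ℝ => h (t - rPlus a M)) (h' (r - rPlus a M)) r := by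
    have := HasDerivAt.comp r a1 (d0.sub_const (rPlus a M : ℂ))
    simpa [Function.comp_def] using this
  have dh' : HasDerivAt (fun t : ℝ => h' (t - rPlus a M)) h'' r := by
    have := HasDerivAt.comp r a2 (d0.sub_const (rPlus a M : ℂ))
    simpa [Function.comp_def] using this
  have dF := hasDerivAt_radialFactor (ω := ω) (m := m) ha hr
  -- The two exponents are the residues that combine with `iω` to a single fraction over `Δ`, with
  -- the horizons eliminated in favour of `M`, `a` and `r`.
  have hN : horExponent a M ω m / (r - rPlus a M) + innerExponent a M ω m / (r - rMinus a M)
      + Complex.I * ω = Complex.I * (ω * Delta a M r - (2 * M * ω * r - a * m)) / Delta a M r := by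
    have e1 := horExponent_mul ha ω m
    have e2 : (rPlus a M : ℂ) + rMinus a M = 2 * M := by
      exact_mod_cast congrArg (fun x : ℝ => (x : ℂ)) (rPlus_add_rMinus (a := a) (M := M))
    rw [Delta_eq ha, innerExponent]
    push_cast
    field_simp
    linear_combination e1
  have hN' : -(horExponent a M ω m / (r - rPlus a M) ^ 2)
      - innerExponent a M ω m / (r - rMinus a M) ^ 2 =
      Complex.I * ω * (2 * r - 4 * M) / Delta a M r
      - Complex.I * (ω * Delta a M r - (2 * M * ω * r - a * m)) * (2 * r - 2 * M)
        / (Delta a M r) ^ 2 := by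
    have e1 := horExponent_mul ha ω m
    have e2 : (rPlus a M : ℂ) + rMinus a M = 2 * M := by
      exact_mod_cast congrArg (fun x : ℝ => (x : ℂ)) (rPlus_add_rMinus (a := a) (M := M))
    have e3 : (rMinus a M : ℂ) = 2 * M - rPlus a M := by rw [← e2]; ring
    rw [Delta_eq ha, innerExponent]
    push_cast
    field_simp
    rw [e3] at e1 ⊢
    linear_combination -(2 * (r : ℂ) - 2 * M) * e1
  have dL : HasDerivAt (radialLogDeriv a M ω m) ((1 / ((r : ℂ) ^ 2 + a ^ 2)
      - 2 * r ^ 2 / ((r : ℂ) ^ 2 + a ^ 2) ^ 2) + (-(horExponent a M ω m / (r - rPlus a M) ^ 2)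
      - innerExponent a M ω m / (r - rMinus a M) ^ 2)) r := by
    refine ((d0.div ((d0.pow 2).add_const ((a : ℂ) ^ 2)) hfc).add ((((hasDerivAt_const r
      (horExponent a M ω m)).div (d0.sub_const _) s0).add ((hasDerivAt_const r
      (innerExponent a M ω m)).div (d0.sub_const _) s1)).add_const _)).congr_deriv ?_
    simp only [Pi.pow_apply]
    field_simp
    ring
  have dj : HasDerivAt (fun t : ℝ => ((Delta a M t / (t ^ 2 + a ^ 2) : ℝ) : ℂ))
      ((2 * r - 2 * M) / ((r : ℂ) ^ 2 + a ^ 2)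
        - 2 * r * Delta a M r / ((r : ℂ) ^ 2 + a ^ 2) ^ 2) r := by
    have h1 : HasDerivAt (fun t : ℝ => Delta a M t) (2 * r - 2 * M) r := by
      refine ((((hasDerivAt_id r).pow 2).sub ((hasDerivAt_id r).const_mul (2 * M))).add_const
        (a ^ 2)).congr_deriv ?_
      simp
    have h2 := (h1.div (((hasDerivAt_id r).pow 2).add_const (a ^ 2)) hf.ne').ofReal_comp
    refine h2.congr_deriv ?_
    simp only [id, Pi.pow_apply]
    push_cast
    field_simp
  have dv := dF.mul dh
  have dw := (dF.mul ((dL.mul dh).add dh')).mul dj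
  refine ⟨((dv.scomp x dr).congr_deriv ?_ :), (dw.scomp x dr).congr_deriv ?_⟩
  · simp only [radialLift', Complex.real_smul, ← hrdef]
    ring
  · have heun := a3
    have e2 : (rPlus a M : ℂ) + rMinus a M = 2 * M := by
      exact_mod_cast congrArg (fun x : ℝ => (x : ℂ)) (rPlus_add_rMinus (a := a) (M := M))
    have e4 : (rPlus a M : ℂ) * rMinus a M = a ^ 2 := by
      exact_mod_cast congrArg (fun x : ℝ => (x : ℂ)) (rPlus_mul_rMinus ha)
    have e1 := horExponent_mul ha ω m
    have hDelta : (Delta a M r : ℂ) = (r - rPlus a M) * (r - rMinus a M) := by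
      rw [Delta_eq ha]; push_cast; ring
    have hDelta' : (Delta a M r : ℂ) = r ^ 2 - 2 * M * r + a ^ 2 := by
      unfold Delta; push_cast; ring
    have key := radial_identity (Δ := Delta a M r) (f := (r : ℂ) ^ 2 + a ^ 2) (r := r) (M := M)
      (ω := ω) (A := a * m) (a₂ := (a : ℂ) ^ 2) (lam := lam) (e := _) (h := h (r - rPlus a M))
      (h' := h' (r - rPlus a M)) (h'' := h'') hΔc hfc (by rw [hDelta']; ring)
      (by rw [hDelta']; ring) hN (by
        rw [hDelta]
        rw [innerExponent] at heun
        push_cast at heun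
        linear_combination heun - 2 * h' (r - rPlus a M) * e1
          + h' (r - rPlus a M) * e2
          + 8 * M * ω ^ 2 * (r - rPlus a M) * h (r - rPlus a M) * Complex.I_sq)
    rw [← hN'] at key
    simp only [radialLift, radialCoeff, potential, Complex.real_smul, ← hrdef, Pi.mul_apply,
      Pi.add_apply]
    simp only [radialLogDeriv] at key ⊢
    push_cast
    linear_combination (radialFactor a M ω m r) * key

theorem SolvesRadialHeun.solvesOn (ha : |a| < M) (hrad : IsRadius a M rad) {U : Set ℂ} {S : Set ℝ}
    {h h' : ℂ → ℂ} (hh : SolvesRadialHeun a M ω m lam U h h')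
    (hS : ∀ x ∈ S, (rad x : ℂ) - rPlus a M ∈ U) :
    SolvesOn 0 (radialCoeff a M rad ω m lam) S (radialLift a M rad ω m h)
      (radialLift' a M rad ω m h h') := by
  intro x hx
  obtain ⟨h1, h2⟩ := hh.hasDerivAt ha hrad (hS x hx)
  exact ⟨h1, by simpa using h2⟩

theorem continuous_radialCoeff (ha : |a| < M) (hrad : IsRadius a M rad) :
    Continuous (radialCoeff a M rad ω m lam) := by
  have hc : Continuous rad := continuous_iff_continuousAt.2 fun x => (hrad x).2.continuousAt
  have hf : ∀ x, rad x ^ 2 + a ^ 2 ≠ 0 := fun x => by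
    have := (rPlus_pos ha).trans (hrad x).1
    positivity
  have hf2 : ∀ x, (rad x ^ 2 + a ^ 2) ^ 2 ≠ 0 := fun x => pow_ne_zero _ (hf x)
  have hf4 : ∀ x, (rad x ^ 2 + a ^ 2) ^ 4 ≠ 0 := fun x => pow_ne_zero _ (hf x)
  unfold radialCoeff potential Delta
  fun_prop (disch := assumption)

theorem SolvesRadial.solvesOn {u : ℝ → ℂ} (hu : SolvesRadial a M rad ω m lam u) :
    SolvesOn 0 (radialCoeff a M rad ω m lam) univ u (deriv u) := by
  intro x _
  obtain ⟨h1, h2, h3⟩ := hu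
  refine ⟨(h1 x).hasDerivAt, (h2 x).hasDerivAt.congr_deriv ?_⟩
  simp only [Pi.zero_apply, radialCoeff]
  linear_combination h3 x

theorem SolvesOn.solvesRadial {u u' : ℝ → ℂ}
    (hu : SolvesOn 0 (radialCoeff a M rad ω m lam) univ u u') :
    SolvesRadial a M rad ω m lam u ∧ deriv u = u' := by
  have h1 : deriv u = u' := funext fun x => (hu x (mem_univ x)).1.deriv
  refine ⟨⟨fun x => (hu x (mem_univ x)).1.differentiableAt, ?_, fun x => ?_⟩, h1⟩
  · rw [h1]; exact fun x => (hu x (mem_univ x)).2.differentiableAt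
  · rw [h1, (hu x (mem_univ x)).2.deriv]
    simp only [Pi.zero_apply, radialCoeff]
    ring

/-- The Wronskian of two radial functions in terms of the solutions of the Heun equation. -/
theorem radialLift_wronskian (ha : |a| < M) (hrad : IsRadius a M rad) (h h' k k' : ℂ → ℂ) (x : ℝ) :
    radialLift' a M rad ω m h h' x * radialLift a M rad ω m k x
      - radialLift' a M rad ω m k k' x * radialLift a M rad ω m h x =
    Complex.exp (2 * Complex.I * ω * rPlus a M) *
      abelWronskian ((rPlus a M - rMinus a M : ℝ) : ℂ) (1 + 2 * horExponent a M ω m)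
        (1 + 2 * innerExponent a M ω m) (2 * Complex.I * ω) h h' k k' (rad x - rPlus a M) := by
  have hr := (hrad x).1
  set r := rad x with hrdef
  have h0 := rMinus_lt_rPlus ha
  have hp := rPlus_pos ha
  have hf : 0 < r ^ 2 + a ^ 2 := by have := hp.trans hr; positivity
  have hfc : (r : ℂ) ^ 2 + a ^ 2 ≠ 0 := by exact_mod_cast hf.ne'
  have hs2 : ((Real.sqrt (r ^ 2 + a ^ 2) : ℝ) : ℂ) ^ 2 = r ^ 2 + a ^ 2 := by
    have := Real.sq_sqrt hf.le
    exact_mod_cast congrArg (fun x : ℝ => (x : ℂ)) this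
  have s0 : (r : ℂ) - rPlus a M ≠ 0 := by
    rw [← Complex.ofReal_sub]; exact_mod_cast (sub_pos.2 hr).ne'
  have s1 : (r : ℂ) - rMinus a M ≠ 0 := by
    rw [← Complex.ofReal_sub]; exact_mod_cast (sub_pos.2 (h0.trans hr)).ne'
  -- The square of the prefactor times `dr/dr*` is the factor in Abel's identity, up to a phase from
  -- the shift `s = r - r₊` in the exponential.
  have hpre : radialFactor a M ω m r ^ 2 * ((Delta a M r / (r ^ 2 + a ^ 2) : ℝ) : ℂ) =
      Complex.exp (2 * Complex.I * ω * rPlus a M) *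
      (((r : ℂ) - rPlus a M) ^ (1 + 2 * horExponent a M ω m) *
      ((r : ℂ) - rPlus a M + ((rPlus a M - rMinus a M : ℝ) : ℂ)) ^ (1 + 2 * innerExponent a M ω m) *
      Complex.exp (2 * Complex.I * ω * ((r : ℂ) - rPlus a M))) := by
    have e1 : (r : ℂ) - rPlus a M + ((rPlus a M - rMinus a M : ℝ) : ℂ) = r - rMinus a M := by
      push_cast; ring
    have e2 : Complex.exp (2 * Complex.I * ω * rPlus a M) *
        Complex.exp (2 * Complex.I * ω * ((r : ℂ) - rPlus a M)) =
        Complex.exp (Complex.I * ω * r) ^ 2 := by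
      rw [← Complex.exp_add, ← Complex.exp_nat_mul]
      congr 1; push_cast; ring
    have e3 : ∀ ξ : ℂ, ∀ z : ℂ, z ≠ 0 → z ^ (1 + 2 * ξ) = z * (z ^ ξ) ^ 2 := by
      intro ξ z hz
      rw [Complex.cpow_add _ _ hz, Complex.cpow_one, two_mul, Complex.cpow_add _ _ hz]; ring
    rw [e1, e3 _ _ s0, e3 _ _ s1, radialFactor, Delta_eq ha]
    push_cast
    generalize Complex.exp (2 * Complex.I * ω * rPlus a M) = X at e2 ⊢
    generalize Complex.exp (2 * Complex.I * ω * ((r : ℂ) - rPlus a M)) = Y at e2 ⊢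
    generalize Complex.exp (Complex.I * ω * r) = Z at e2 ⊢
    field_simp
    rw [hs2]
    linear_combination -(((r : ℂ) - rPlus a M) ^ horExponent a M ω m) ^ 2 *
      (((r : ℂ) - rMinus a M) ^ innerExponent a M ω m) ^ 2 * ((r : ℂ) ^ 2 + a ^ 2) * e2
  rw [abelWronskian, ← mul_assoc, ← hpre]
  simp only [radialLift, radialLift', ← hrdef]
  ring

end Radial

/-! ### The horizon solution: existence and uniqueness up to a phase. -/

section Horizon
variable {a M : ℝ} {rad : ℝ → ℝ} {ω lam : ℝ} {m : ℤ}

/-- The Frobenius solution of the radial equation at the horizon. -/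
noncomputable def radialHeun (a M ω : ℝ) (m : ℤ) (lam : ℝ) : HeunCoeffs :=
  horizonHeun ((rPlus a M - rMinus a M : ℝ) : ℂ) (1 + 2 * horExponent a M ω m)
    (1 + 2 * innerExponent a M ω m) (2 * Complex.I * ω)
    (2 * Complex.I * ω * (1 - 4 * Complex.I * M * ω))
    (8 * M * ω ^ 2 * rPlus a M - 2 * a * m * ω - lam - a ^ 2 * ω ^ 2
      + Complex.I * ω * (2 * rPlus a M - 4 * M))

theorem solvesRadialHeun_radialHeun (ha : |a| < M) :
    SolvesRadialHeun a M ω m lam (Metric.ball 0 (rPlus a M - rMinus a M))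
      (radialHeun a M ω m lam).sol (radialHeun a M ω m lam).sol' := by
  have h0 := sub_pos.2 (rMinus_lt_rPlus ha)
  have := solvesHeun_horizonHeun (d := ((rPlus a M - rMinus a M : ℝ) : ℂ))
    (p := 1 + 2 * horExponent a M ω m) (p' := 1 + 2 * innerExponent a M ω m)
    (σ := 2 * Complex.I * ω) (α := 2 * Complex.I * ω * (1 - 4 * Complex.I * M * ω))
    (β := 8 * M * ω ^ 2 * rPlus a M - 2 * a * m * ω - lam - a ^ 2 * ω ^ 2
      + Complex.I * ω * (2 * rPlus a M - 4 * M)) (by exact_mod_cast h0.ne')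
    (by simp [horExponent_re])
  rwa [Complex.norm_real, Real.norm_of_nonneg h0.le] at this

/-- The lift of the Frobenius series, continued to the whole line. At the horizon the only factor of
`radialFactor` without modulus one is `√(r₊² + a²) = √(2 M r₊)`, whence the normalising constant. -/
theorem exists_isHor (ha : |a| < M) (hrad : IsRadius a M rad) :
    ∃ u : ℝ → ℂ, IsHor a M rad ω m lam u ∧ ∀ᶠ x in atBot,
      u x = (1 / Real.sqrt (2 * M * rPlus a M) : ℝ) *
        radialLift a M rad ω m (radialHeun a M ω m lam).sol x ∧
      deriv u x = (1 / Real.sqrt (2 * M * rPlus a M) : ℝ) *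
        radialLift' a M rad ω m (radialHeun a M ω m lam).sol (radialHeun a M ω m lam).sol' x := by
  set H := radialHeun a M ω m lam with hH
  set d := rPlus a M - rMinus a M with hd
  have hd0 : 0 < d := sub_pos.2 (rMinus_lt_rPlus ha)
  have hp := rPlus_pos ha
  have hM := mass_pos ha
  set κ : ℝ := 1 / Real.sqrt (2 * M * rPlus a M) with hκ
  have hκ0 : 0 < κ := by positivity
  have hnear : ∀ᶠ x in atBot, rad x < rPlus a M + d :=
    ((hrad.tendsto_atBot ha).mono_right nhdsWithin_le_nhds).eventually
      (gt_mem_nhds (by linarith))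
  obtain ⟨X, hX⟩ := eventually_atBot.1 hnear
  have hmem : ∀ x ∈ Iic X, (rad x : ℂ) - rPlus a M ∈ Metric.ball (0 : ℂ) d := by
    intro x hx
    rw [mem_ball_zero_iff, ← Complex.ofReal_sub, Complex.norm_real,
      Real.norm_of_nonneg (sub_nonneg.2 (hrad x).1.le)]
    linarith [hX x hx]
  have hloc := (solvesRadialHeun_radialHeun (ω := ω) (m := m) (lam := lam) ha).solvesOn ha hrad hmem
  have hb := continuous_radialCoeff (ω := ω) (m := m) (lam := lam) ha hrad
  -- The series converges only for `r - r₊ < d`; its Cauchy data at `X` determine the global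
  -- solution.
  obtain ⟨y, y', hy, hy0, hy0'⟩ := exists_solvesOn_univ (a := 0) continuous_const hb X
    (radialLift a M rad ω m H.sol X) (radialLift' a M rad ω m H.sol H.sol' X)
  have hEq := SolvesOn.eqOn (S := Iic X) ordConnected_Iic continuousOn_const hb.continuousOn
    (fun t _ => hy t (mem_univ t)) hloc (mem_Iic.2 le_rfl) hy0 hy0'
  have hκy : SolvesOn 0 (radialCoeff a M rad ω m lam) univ (fun t => (κ : ℂ) * y t)
      (fun t => (κ : ℂ) * y' t) := by
    simpa using hy.lincomb hy κ 0
  obtain ⟨hrade, hderiv⟩ := hκy.solvesRadial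
  set f : ℂ → ℂ := fun z => κ * ((z ^ 2 + a ^ 2) ^ (1 / 2 : ℂ)
    * (z - rMinus a M) ^ innerExponent a M ω m * Complex.exp (Complex.I * ω * z)
    * H.sol (z - rPlus a M)) with hf
  have hsolA : AnalyticAt ℂ H.sol 0 := by
    refine DifferentiableOn.analyticAt (s := Metric.ball 0 d) (fun z hz => ?_)
      (Metric.ball_mem_nhds 0 hd0)
    obtain ⟨h'', h1, -⟩ := solvesRadialHeun_radialHeun (ω := ω) (m := m) (lam := lam) ha z hz
    exact h1.differentiableAt.differentiableWithinAt
  have hfA : AnalyticAt ℂ f (rPlus a M : ℂ) := by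
    have i1 : AnalyticAt ℂ (fun z : ℂ => (z ^ 2 + (a : ℂ) ^ 2) ^ (1 / 2 : ℂ)) (rPlus a M : ℂ) := by
      refine AnalyticAt.cpow (by fun_prop) analyticAt_const (Or.inl ?_)
      have : 0 < rPlus a M ^ 2 + a ^ 2 := by positivity
      have e : (rPlus a M : ℂ) ^ 2 + (a : ℂ) ^ 2 = ((rPlus a M ^ 2 + a ^ 2 : ℝ) : ℂ) := by
        push_cast; ring
      rw [e, Complex.ofReal_re]; exact this
    have i2 : AnalyticAt ℂ (fun z : ℂ => (z - rMinus a M) ^ innerExponent a M ω m)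
        (rPlus a M : ℂ) := by
      refine AnalyticAt.cpow (by fun_prop) analyticAt_const (Or.inl ?_)
      simpa using rMinus_lt_rPlus ha
    have i3 : AnalyticAt ℂ (fun z : ℂ => H.sol (z - rPlus a M)) (rPlus a M : ℂ) := by
      refine AnalyticAt.fun_comp (f := fun z : ℂ => z - rPlus a M) ?_ (by fun_prop)
      simpa using hsolA
    have i4 : AnalyticAt ℂ (fun z : ℂ => Complex.exp (Complex.I * ω * z)) (rPlus a M : ℂ) := by
      fun_prop
    exact analyticAt_const.mul (((i1.mul i2).mul i4).mul i3)
  have hform : ∀ x ∈ Iic X, ((rad x - rPlus a M : ℝ) : ℂ) ^ (-horExponent a M ω m)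
      * ((κ : ℂ) * y x) = f (rad x : ℂ) := by
    intro x hx
    have hs : 0 < rad x - rPlus a M := sub_pos.2 (hrad x).1
    have hs0 : ((rad x - rPlus a M : ℝ) : ℂ) ≠ 0 := by exact_mod_cast hs.ne'
    have hsq : ((Real.sqrt (rad x ^ 2 + a ^ 2) : ℝ) : ℂ) =
        ((rad x : ℂ) ^ 2 + (a : ℂ) ^ 2) ^ (1 / 2 : ℂ) := by
      rw [Real.sqrt_eq_rpow, Complex.ofReal_cpow (by positivity)]
      push_cast; rfl
    have hinv : ((rad x - rPlus a M : ℝ) : ℂ) ^ (-horExponent a M ω m) *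
        ((rad x - rPlus a M : ℝ) : ℂ) ^ horExponent a M ω m = 1 := by
      rw [← Complex.cpow_add _ _ hs0, neg_add_cancel, Complex.cpow_zero]
    simp only [hf]
    rw [(hEq x hx).1, radialLift, radialFactor, ← hsq]
    push_cast at hinv ⊢
    linear_combination ((κ : ℂ) * ((Real.sqrt (rad x ^ 2 + a ^ 2) : ℝ) : ℂ)
      * ((rad x : ℂ) - rMinus a M) ^ innerExponent a M ω m * Complex.exp (Complex.I * ω * rad x)
      * H.sol (rad x - rPlus a M)) * hinv
  have hev : ∀ᶠ x in atBot, x ∈ Iic X := eventually_le_atBot X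
  have hradc : Tendsto (fun x => (rad x : ℂ)) atBot (𝓝 (rPlus a M : ℂ)) :=
    (Complex.continuous_ofReal.tendsto _).comp
      ((hrad.tendsto_atBot ha).mono_right nhdsWithin_le_nhds)
  refine ⟨fun t => (κ : ℂ) * y t, ⟨hrade, ⟨f, hfA, ?_⟩, ?_⟩, ?_⟩
  · filter_upwards [hev] with x hx using hform x hx
  · have hlim := ((hfA.continuousAt.tendsto.comp hradc).norm).pow 2
    have hval : ‖f (rPlus a M : ℂ)‖ ^ 2 = 1 := by
      have e : (rPlus a M : ℂ) ^ 2 + (a : ℂ) ^ 2 = ((2 * M * rPlus a M : ℝ) : ℂ) := by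
        have h1 := rPlus_mul_rMinus ha
        have h3 := rPlus_add_rMinus (a := a) (M := M)
        have : rPlus a M ^ 2 + a ^ 2 = 2 * M * rPlus a M := by rw [← h1, ← h3]; ring
        exact_mod_cast congrArg (fun x : ℝ => (x : ℂ)) this
      have hpos : 0 < 2 * M * rPlus a M := by positivity
      have e3 : ‖Complex.exp (Complex.I * ω * rPlus a M)‖ = 1 := by
        have := Complex.norm_exp_ofReal_mul_I (ω * rPlus a M)
        rw [← this]; congr 2; push_cast; ring
      simp only [hf]
      rw [e, sub_self, HeunCoeffs.sol_zero, mul_one, norm_mul, norm_mul, norm_mul, e3,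
        ← Complex.ofReal_sub, Complex.norm_cpow_eq_rpow_re_of_pos hd0, innerExponent_re,
        Complex.norm_cpow_eq_rpow_re_of_pos hpos, Complex.norm_real, Real.norm_of_nonneg hκ0.le, hκ]
      have e4 : ((1 / 2 : ℂ)).re = 1 / 2 := by norm_num
      rw [e4, ← Real.sqrt_eq_rpow]
      have : Real.sqrt (2 * M * rPlus a M) ≠ 0 := (Real.sqrt_pos.2 hpos).ne'
      rw [Real.rpow_zero]
      field_simp
    rw [hval] at hlim
    refine hlim.congr' ?_
    filter_upwards [hev] with x hx
    simp only [Function.comp]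
    rw [← hform x hx]
  · filter_upwards [hev] with x hx
    rw [hderiv]
    simp only
    rw [(hEq x hx).1, (hEq x hx).2]
    exact ⟨rfl, rfl⟩

/-- The horizon solution near the horizon, together with its derivative. -/
theorem IsHor.exists_form (ha : |a| < M) (hrad : IsRadius a M rad) {u : ℝ → ℂ}
    (hu : IsHor a M rad ω m lam u) : ∃ f : ℂ → ℂ, AnalyticAt ℂ f (rPlus a M : ℂ) ∧
      ‖f (rPlus a M : ℂ)‖ = 1 ∧ ∀ᶠ x in atBot,
        u x = ((rad x - rPlus a M : ℝ) : ℂ) ^ horExponent a M ω m * f (rad x) ∧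
        deriv u x = ((rad x - rPlus a M : ℝ) : ℂ) ^ horExponent a M ω m *
          (horExponent a M ω m / (rad x - rPlus a M) * f (rad x) + deriv f (rad x)) *
          ((Delta a M (rad x) / (rad x ^ 2 + a ^ 2) : ℝ) : ℂ) := by
  obtain ⟨f, hfA, hf⟩ := hu.asymptotics
  have hradc : Tendsto (fun x => (rad x : ℂ)) atBot (𝓝 (rPlus a M : ℂ)) :=
    (Complex.continuous_ofReal.tendsto _).comp
      ((hrad.tendsto_atBot ha).mono_right nhdsWithin_le_nhds)
  refine ⟨f, hfA, ?_, ?_⟩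
  · have h1 := ((hfA.continuousAt.tendsto.comp hradc).norm).pow 2
    have h2 : ‖f (rPlus a M : ℂ)‖ ^ 2 = 1 := by
      refine tendsto_nhds_unique h1 (hu.normalised.congr' ?_)
      filter_upwards [hf] with x hx
      simp only [Function.comp]
      rw [hx]
    exact (pow_eq_one_iff_of_nonneg (norm_nonneg _) two_ne_zero).1 h2
  · have hdiff : ∀ᶠ x in atBot, DifferentiableAt ℂ f (rad x) :=
      hradc.eventually (hfA.eventually_analyticAt.mono fun z hz => hz.differentiableAt)
    obtain ⟨X, hX⟩ := eventually_atBot.1 (hf.and hdiff)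
    have hval : ∀ x ≤ X, u x = ((rad x - rPlus a M : ℝ) : ℂ) ^ horExponent a M ω m * f (rad x) := by
      intro x hx
      have hs : 0 < rad x - rPlus a M := sub_pos.2 (hrad x).1
      have hs0 : ((rad x - rPlus a M : ℝ) : ℂ) ≠ 0 := by exact_mod_cast hs.ne'
      rw [← (hX x hx).1, ← mul_assoc, ← Complex.cpow_add _ _ hs0, add_neg_cancel, Complex.cpow_zero,
        one_mul]
    filter_upwards [eventually_lt_atBot X] with x hx
    refine ⟨hval x hx.le, ?_⟩
    have hs : 0 < rad x - rPlus a M := sub_pos.2 (hrad x).1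
    have hs0 : ((rad x - rPlus a M : ℝ) : ℂ) ≠ 0 := by exact_mod_cast hs.ne'
    have dr := (hrad x).2
    have d1 : HasDerivAt (fun t : ℝ => f t) (deriv f (rad x)) (rad x) :=
      ((hX x hx.le).2.hasDerivAt).comp_ofReal
    have d2 := HasDerivAt.scomp (rad x) (((hasDerivAt_id ((rad x - rPlus a M : ℝ) : ℂ)).cpow_const
      (c := horExponent a M ω m) (Or.inl (by simpa using hs))).comp_ofReal)
      ((hasDerivAt_id (rad x)).sub_const (rPlus a M))
    have d3 := (d2.mul d1).scomp x dr
    have d4 : HasDerivAt u _ x := d3.congr_of_eventuallyEq (by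
      filter_upwards [Iio_mem_nhds hx] with t ht
      exact hval t (le_of_lt ht))
    rw [d4.deriv]
    simp only [id, Complex.real_smul, one_smul, Function.comp]
    rw [Complex.cpow_sub _ _ hs0, Complex.cpow_one]
    push_cast at hs0 ⊢
    field_simp

/-- With regular factors `f` and `g`, the terms containing `ξ` cancel in the Wronskian. There
remains `(f' g - f g') Δ / (r² + a²)` times a phase, which tends to zero at the horizon. No
distinction is needed for `ξ = 0`, where the two exponents coincide. The normalisation makes the
constant unimodular. -/
theorem IsHor.eq_const_mul (ha : |a| < M) (hrad : IsRadius a M rad) {u v : ℝ → ℂ}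
    (hu : IsHor a M rad ω m lam u) (hv : IsHor a M rad ω m lam v) :
    ∃ c : ℂ, ‖c‖ = 1 ∧ ∀ x, u x = c * v x ∧ deriv u x = c * deriv v x := by
  obtain ⟨f, hfA, hf1, hf⟩ := hu.exists_form ha hrad
  obtain ⟨g, hgA, hg1, hg⟩ := hv.exists_form ha hrad
  have hradr := (hrad.tendsto_atBot ha).mono_right nhdsWithin_le_nhds
  have hradc : Tendsto (fun x => (rad x : ℂ)) atBot (𝓝 (rPlus a M : ℂ)) :=
    (Complex.continuous_ofReal.tendsto _).comp hradr
  have hp := rPlus_pos ha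
  have hj : Tendsto (fun x => Delta a M (rad x) / (rad x ^ 2 + a ^ 2)) atBot (𝓝 0) := by
    have hc : ContinuousAt (fun r : ℝ => Delta a M r / (r ^ 2 + a ^ 2)) (rPlus a M) := by
      have : rPlus a M ^ 2 + a ^ 2 ≠ 0 := by positivity
      unfold Delta
      fun_prop (disch := assumption)
    have h1 := hc.tendsto.comp hradr
    have h2 : Delta a M (rPlus a M) = 0 := by rw [Delta_eq ha]; ring
    rw [h2, zero_div] at h1
    exact h1
  have hW : Tendsto (fun x => ‖deriv u x * v x - u x * deriv v x‖) atBot (𝓝 0) := by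
    have h1 := (((hfA.deriv.continuousAt.tendsto.comp hradc).mul
      (hgA.continuousAt.tendsto.comp hradc)).sub ((hfA.continuousAt.tendsto.comp hradc).mul
      (hgA.deriv.continuousAt.tendsto.comp hradc))).norm.mul hj.norm
    rw [norm_zero, mul_zero] at h1
    refine h1.congr' ?_
    filter_upwards [hf, hg] with x hfx hgx
    have hs : 0 < rad x - rPlus a M := sub_pos.2 (hrad x).1
    rw [hfx.1, hfx.2, hgx.1, hgx.2]
    have hn : ‖((rad x - rPlus a M : ℝ) : ℂ) ^ horExponent a M ω m‖ = 1 := by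
      rw [Complex.norm_cpow_eq_rpow_re_of_pos hs, horExponent_re, Real.rpow_zero]
    set q := ((rad x - rPlus a M : ℝ) : ℂ) ^ horExponent a M ω m
    set j : ℝ := Delta a M (rad x) / (rad x ^ 2 + a ^ 2)
    have e : q * (horExponent a M ω m / (rad x - rPlus a M) * f (rad x) + deriv f (rad x)) * (j : ℂ)
        * (q * g (rad x)) - q * f (rad x) * (q * (horExponent a M ω m / (rad x - rPlus a M)
          * g (rad x) + deriv g (rad x)) * (j : ℂ)) =
        q * q * ((deriv f (rad x) * g (rad x) - f (rad x) * deriv g (rad x)) * j) := by ring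
    rw [e, norm_mul, norm_mul, hn, one_mul, one_mul, norm_mul, Complex.norm_real]
    rfl
  have hs := hu.ode.solvesOn
  have hs' := hv.ode.solvesOn
  have hW0 : deriv u 0 * v 0 - u 0 * deriv v 0 = 0 := by
    refine norm_eq_zero.1 (tendsto_nhds_unique (tendsto_const_nhds.congr fun x => ?_) hW)
    rw [hs.wronskian_eq hs' x 0]
  have hne : ∀ᶠ x in atBot, v x ≠ 0 := by
    have h1 : ∀ᶠ x in atBot, g (rad x) ≠ 0 :=
      (hgA.continuousAt.tendsto.comp hradc).eventually_ne (norm_pos_iff.1 (by rw [hg1]; norm_num))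
    filter_upwards [hg, h1] with x hgx hx
    have hs : 0 < rad x - rPlus a M := sub_pos.2 (hrad x).1
    rw [hgx.1]
    refine mul_ne_zero (Complex.cpow_ne_zero_iff.2 (Or.inl ?_)) hx
    exact_mod_cast hs.ne'
  obtain ⟨t₀, ht₀⟩ := hne.exists
  obtain ⟨c, hc⟩ := hs.eq_const_mul (continuous_radialCoeff ha hrad) hs'
    ((hs.wronskian_eq hs' t₀ 0).trans hW0) ht₀
  refine ⟨c, ?_, hc⟩
  have h1 := hv.normalised.const_mul (‖c‖ ^ 2)
  have h2 : ‖c‖ ^ 2 * 1 = 1 := by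
    refine tendsto_nhds_unique h1 (hu.normalised.congr fun x => ?_)
    rw [(hc x).1, mul_left_comm, norm_mul, mul_pow]
  rw [mul_one] at h2
  exact (pow_eq_one_iff_of_nonneg (norm_nonneg _) two_ne_zero).1 h2

end Horizon

/-! ### Asymptotic expansions and their calculus. -/

section Expansion

/-- `f` has an asymptotic expansion in powers of `w`. -/
def HasExpansion (w f : ℝ → ℂ) : Prop :=
  ∀ N : ℕ, ∃ P : Polynomial ℂ, (fun x => f x - P.eval (w x)) =O[atTop] fun x => w x ^ N

variable {w v f g : ℝ → ℂ}

theorem hasExpansion_eval (P : Polynomial ℂ) : HasExpansion w fun x => P.eval (w x) :=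
  fun _ => ⟨P, by simpa using Asymptotics.isBigO_zero _ _⟩

theorem isBigO_one_eval (hw : Tendsto w atTop (𝓝 0)) (P : Polynomial ℂ) :
    (fun x => P.eval (w x)) =O[atTop] fun _ => (1 : ℂ) :=
  ((P.continuous.tendsto 0).comp hw).isBigO_one ℂ

theorem HasExpansion.add (hf : HasExpansion w f) (hg : HasExpansion w g) :
    HasExpansion w fun x => f x + g x := by
  intro N
  obtain ⟨P, hP⟩ := hf N
  obtain ⟨Q, hQ⟩ := hg N
  refine ⟨P + Q, (hP.add hQ).congr_left fun x => ?_⟩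
  rw [Polynomial.eval_add]; ring

theorem HasExpansion.mul (hw : Tendsto w atTop (𝓝 0)) (hf : HasExpansion w f)
    (hg : HasExpansion w g) : HasExpansion w fun x => f x * g x := by
  intro N
  obtain ⟨P, hP⟩ := hf N
  obtain ⟨Q, hQ⟩ := hg N
  obtain ⟨Q₀, hQ₀⟩ := hg 0
  have hg1 : g =O[atTop] fun _ => (1 : ℂ) := by
    have := (hQ₀.congr_right (fun x => pow_zero (w x))).add (isBigO_one_eval hw Q₀)
    exact this.congr_left fun x => by ring
  refine ⟨P * Q, ?_⟩
  have h1 := (hP.mul hg1).congr_right fun x => mul_one _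
  have h2 := ((isBigO_one_eval hw P).mul hQ).congr_right fun x => one_mul _
  refine (h1.add h2).congr_left fun x => ?_
  rw [Polynomial.eval_mul]; ring

/-- Used to re-expand in powers of `1 / r` what is known in powers of `1 / (r - r₊)`. -/
theorem HasExpansion.comp (hw : Tendsto w atTop (𝓝 0)) (hv : HasExpansion w v) (hvw : v =O[atTop] w)
    (hf : HasExpansion v f) : HasExpansion w f := by
  have hpoly : ∀ P : Polynomial ℂ, HasExpansion w fun x => P.eval (v x) := by
    intro P
    induction P using Polynomial.induction_on' with
    | add p q hp hq => simpa using hp.add hq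
    | monomial n c =>
      have hpow : ∀ n : ℕ, HasExpansion w fun x => v x ^ n := by
        intro n
        induction n with
        | zero => simpa using hasExpansion_eval (w := w) 1
        | succ n ih => simpa [pow_succ] using ih.mul hw hv
      have hc := hasExpansion_eval (w := w) (Polynomial.C c)
      simpa using hc.mul hw (hpow n)
  intro N
  obtain ⟨P, hP⟩ := hf N
  obtain ⟨Q, hQ⟩ := hpoly P N
  exact ⟨Q, ((hP.trans (hvw.pow N)).add hQ).congr_left fun x => by ring⟩

theorem hasExpansion_of_analyticAt (hw : Tendsto w atTop (𝓝 0)) {F : ℂ → ℂ} (hF : AnalyticAt ℂ F 0) :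
    HasExpansion w fun x => F (w x) := by
  intro N
  obtain ⟨p, hp⟩ := hF
  refine ⟨∑ k ∈ Finset.range N, Polynomial.C (p.coeff k) * Polynomial.X ^ k, ?_⟩
  have h1 := (hp.isBigO_sub_partialSum_pow N).comp_tendsto hw
  have h2 : (fun x => F (w x) - (∑ k ∈ Finset.range N, Polynomial.C (p.coeff k)
      * Polynomial.X ^ k).eval (w x)) =O[atTop] fun x => ‖w x‖ ^ N := by
    refine h1.congr_left fun x => ?_
    simp only [Function.comp, FormalMultilinearSeries.partialSum, Polynomial.eval_finsetSum,
      zero_add, Polynomial.eval_mul, Polynomial.eval_C, Polynomial.eval_pow, Polynomial.eval_X]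
    refine congrArg _ (Finset.sum_congr rfl fun k _ => ?_)
    rw [p.apply_eq_pow_smul_coeff, smul_eq_mul, mul_comm]
  exact h2.trans (Asymptotics.IsBigO.of_bound 1 (by simp))

/-- If the order of vanishing `k` at zero were less than `n`, dividing by `w ^ k` would leave a
cofactor that tends to zero although its value at `0` is nonzero. This is the uniqueness of
expansion coefficients. -/
theorem X_pow_dvd_of_isBigO (hw : Tendsto w atTop (𝓝 0)) (hw0 : ∀ᶠ x in atTop, w x ≠ 0)
    {Q : Polynomial ℂ} {n : ℕ} (h : (fun x => Q.eval (w x)) =O[atTop] fun x => w x ^ n) :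
    Polynomial.X ^ n ∣ Q := by
  rcases eq_or_ne Q 0 with rfl | hQ
  · exact dvd_zero _
  obtain ⟨R, hR, hnd⟩ := Polynomial.exists_eq_pow_rootMultiplicity_mul_and_not_dvd Q hQ 0
  set k := Q.rootMultiplicity 0
  rw [Polynomial.C_0, sub_zero] at hR hnd
  by_cases hk : n ≤ k
  · rw [hR]; exact (pow_dvd_pow _ hk).mul_right _
  exfalso
  have hk' : k + (n - k) = n := by omega
  have h1 : (fun x => R.eval (w x)) =O[atTop] fun x => w x ^ (n - k) := by
    obtain ⟨C, hC⟩ := h.bound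
    refine Asymptotics.IsBigO.of_bound C ?_
    filter_upwards [hC, hw0] with x hx hx0
    rw [hR, Polynomial.eval_mul, Polynomial.eval_pow, Polynomial.eval_X, ← hk', pow_add, norm_mul,
      norm_mul, mul_left_comm] at hx
    exact le_of_mul_le_mul_left hx (norm_pos_iff.2 (pow_ne_zero _ hx0))
  have h2 : Tendsto (fun x => R.eval (w x)) atTop (𝓝 0) := by
    refine h1.trans_tendsto ?_
    have := hw.pow (n - k)
    rwa [zero_pow (by omega)] at this
  have h3 : R.eval 0 = 0 := tendsto_nhds_unique ((R.continuous.tendsto 0).comp hw) h2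
  exact hnd (Polynomial.X_dvd_iff.2 (by rw [Polynomial.coeff_zero_eq_eval_zero, h3]))

/-- `HasExpansion` allows unrelated polynomials for different orders; uniqueness forces their low
coefficients to agree, so one sequence serves all orders. -/
theorem HasExpansion.exists_coeff (hw : Tendsto w atTop (𝓝 0)) (hw0 : ∀ᶠ x in atTop, w x ≠ 0)
    (hf : HasExpansion w f) : ∃ c : ℕ → ℂ, ∀ N : ℕ,
      (fun x => f x - ∑ i ∈ Finset.range (N + 1), c i * w x ^ i) =O[atTop]
        fun x => w x ^ (N + 1) := by
  choose P hP using fun N => hf (N + 1)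
  -- `P i` is exact up to `O(w ^ (i + 1))`, so it is the first polynomial that determines the
  -- coefficient of index `i`.
  refine ⟨fun i => (P i).coeff i, fun N => ?_⟩
  set S : Polynomial ℂ := ∑ i ∈ Finset.range (N + 1), Polynomial.C ((P i).coeff i)
    * Polynomial.X ^ i with hS
  have hwb : w =O[atTop] fun _ => (1 : ℂ) := hw.isBigO_one ℂ
  have hmono : ∀ m n : ℕ, m ≤ n → (fun x => w x ^ n) =O[atTop] fun x => w x ^ m := by
    intro m n hmn
    obtain ⟨k, rfl⟩ := Nat.exists_eq_add_of_le hmn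
    have := (Asymptotics.isBigO_refl (fun x => w x ^ m) atTop).mul (hwb.pow k)
    simpa [pow_add] using this
  have hcoef : ∀ i ≤ N, (P N).coeff i = (P i).coeff i := by
    intro i hi
    have h1 := ((hP i).sub ((hP N).trans (hmono (i + 1) (N + 1) (by omega))))
    have h2 : (fun x => (P N - P i).eval (w x)) =O[atTop] fun x => w x ^ (i + 1) :=
      h1.congr_left fun x => by rw [Polynomial.eval_sub]; ring
    have h3 := Polynomial.X_pow_dvd_iff.1 (X_pow_dvd_of_isBigO hw hw0 h2) i (by omega)
    rw [Polynomial.coeff_sub] at h3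
    exact sub_eq_zero.1 h3
  have hdvd : Polynomial.X ^ (N + 1) ∣ P N - S := by
    refine Polynomial.X_pow_dvd_iff.2 fun i hi => ?_
    rw [Polynomial.coeff_sub, hS, Polynomial.finsetSum_coeff, hcoef i (by omega)]
    simp only [Polynomial.coeff_C_mul_X_pow]
    rw [Finset.sum_ite_eq, if_pos (Finset.mem_range.2 hi), sub_self]
  obtain ⟨R, hR⟩ := hdvd
  have h2 : (fun x => (P N - S).eval (w x)) =O[atTop] fun x => w x ^ (N + 1) := by
    have := (Asymptotics.isBigO_refl (fun x => w x ^ (N + 1)) atTop).mul (isBigO_one_eval hw R)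
    rw [hR]
    simpa using this
  refine ((hP N).add h2).congr_left fun x => ?_
  rw [Polynomial.eval_sub, hS, Polynomial.eval_finsetSum]
  simp

end Expansion

/-! ### The phase of a radial function at infinity. -/

section Outgoing
variable {a M : ℝ} {rad : ℝ → ℝ} {ω lam : ℝ} {m : ℤ}

/-- The regular factor at infinity in the outgoing solution, as a function of `1 / r`. -/
noncomputable def outFactor (a M : ℝ) (E z : ℂ) : ℂ :=
  (1 + a ^ 2 * z ^ 2) ^ (1 / 2 : ℂ) / (1 - rPlus a M * z)
    * ((1 - rMinus a M * z) / (1 - rPlus a M * z)) ^ E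

theorem analyticAt_outFactor (a M : ℝ) (E : ℂ) : AnalyticAt ℂ (outFactor a M E) 0 := by
  have h1 : AnalyticAt ℂ (fun z : ℂ => 1 - (rPlus a M : ℂ) * z) 0 := by fun_prop
  have h2 : AnalyticAt ℂ (fun z : ℂ => 1 - (rMinus a M : ℂ) * z) 0 := by fun_prop
  have h3 : AnalyticAt ℂ (fun z : ℂ => 1 + (a : ℂ) ^ 2 * z ^ 2) 0 := by fun_prop
  unfold outFactor
  refine ((h3.cpow analyticAt_const ?_).div h1 ?_).mul ((h2.div h1 ?_).cpow analyticAt_const ?_)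
  all_goals simp

theorem tendsto_inv_rad (ha : |a| < M) (hrad : IsRadius a M rad) :
    Tendsto (fun x => 1 / (rad x : ℂ)) atTop (𝓝 0) := by
  have h1 := tendsto_inv_atTop_zero.comp (hrad.tendsto_atTop ha)
  have h2 := (Complex.continuous_ofReal.tendsto 0).comp h1
  simpa [Function.comp_def] using h2

/-- The phase of a radial function at infinity, in terms of the tortoise coordinate. -/
theorem exists_radialLift_eq (ha : |a| < M) (hrad : IsRadius a M rad) (ω : ℝ) (m : ℤ) :
    ∃ E γ : ℂ, ‖γ‖ = 1 ∧ ∀ (h : ℂ → ℂ) (x : ℝ),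
      Complex.exp (-(Complex.I * ω * x)) * radialLift a M rad ω m h x =
        γ * outFactor a M E (1 / (rad x : ℂ)) *
          (((rad x - rPlus a M : ℝ) : ℂ) ^ (1 - Complex.I * (4 * M * ω : ℝ))
            * h ((rad x - rPlus a M : ℝ) : ℂ)) := by
  obtain ⟨c, hc⟩ := hrad.exists_tortoise_eq ha
  set d := rPlus a M - rMinus a M with hd
  have hd0 : 0 < d := sub_pos.2 (rMinus_lt_rPlus ha)
  -- `E` is the total exponent of `r - r₋` after the logarithms of `r*` are included. Written with
  -- the quotient `(r - r₋) / (r - r₊)`, it leaves the power `-4iMω` of `r - r₊`, which is `ρ`.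
  set E : ℂ := innerExponent a M ω m + Complex.I * ω * (2 * M * rMinus a M / d : ℝ) with hE
  refine ⟨E, Complex.exp (Complex.I * (ω * c : ℝ)), ?_, fun h x => ?_⟩
  · rw [mul_comm, Complex.norm_exp_ofReal_mul_I]
  have hr := (hrad x).1
  have hr0 := (rPlus_pos ha).trans hr
  have h0 := rMinus_lt_rPlus ha
  set r := rad x with hrdef
  have hs : 0 < r - rPlus a M := by linarith
  have hs' : 0 < r - rMinus a M := by linarith
  have hsc : ((r - rPlus a M : ℝ) : ℂ) ≠ 0 := by exact_mod_cast hs.ne'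
  have hsc' : ((r - rMinus a M : ℝ) : ℂ) ≠ 0 := by exact_mod_cast hs'.ne'
  have hrc : (r : ℂ) ≠ 0 := by exact_mod_cast hr0.ne'
  set ls : ℝ := Real.log (r - rPlus a M) with hls
  set ld : ℝ := Real.log (r - rMinus a M) with hld
  have els : Complex.log ((r - rPlus a M : ℝ) : ℂ) = ls := (Complex.ofReal_log hs.le).symm
  have eld : Complex.log ((r - rMinus a M : ℝ) : ℂ) = ld := (Complex.ofReal_log hs'.le).symm
  have hx : x = r + 2 * M * rPlus a M / d * ls - 2 * M * rMinus a M / d * ld - c := by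
    have := hc x
    rw [tortoise] at this
    linarith
  have hout : outFactor a M E (1 / (r : ℂ)) = ((Real.sqrt (r ^ 2 + a ^ 2) : ℝ) : ℂ)
      / ((r - rPlus a M : ℝ) : ℂ) * Complex.exp ((ld - ls) * E) := by
    have e1 : (1 + (a : ℂ) ^ 2 * (1 / (r : ℂ)) ^ 2) ^ (1 / 2 : ℂ) =
        ((Real.sqrt (r ^ 2 + a ^ 2) / r : ℝ) : ℂ) := by
      have h1 : Real.sqrt (r ^ 2 + a ^ 2) / r = Real.sqrt (1 + a ^ 2 * (1 / r) ^ 2) := by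
        have h2 : 1 + a ^ 2 * (1 / r) ^ 2 = (r ^ 2 + a ^ 2) / r ^ 2 := by field_simp
        rw [h2, Real.sqrt_div (by positivity), Real.sqrt_sq hr0.le]
      rw [h1, Real.sqrt_eq_rpow, Complex.ofReal_cpow (by positivity)]
      push_cast; rfl
    have e2 : (1 - (rMinus a M : ℂ) * (1 / (r : ℂ))) / (1 - (rPlus a M : ℂ) * (1 / (r : ℂ))) =
        (((r - rMinus a M) / (r - rPlus a M) : ℝ) : ℂ) := by
      push_cast at hsc ⊢
      have : 1 - (rPlus a M : ℂ) * (1 / (r : ℂ)) ≠ 0 := by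
        intro h
        apply hsc
        field_simp at h
        simpa using h
      field_simp
    have e3 : (((r - rMinus a M) / (r - rPlus a M) : ℝ) : ℂ) ^ E = Complex.exp ((ld - ls) * E) := by
      have hq : 0 < (r - rMinus a M) / (r - rPlus a M) := by positivity
      rw [Complex.cpow_def_of_ne_zero (by exact_mod_cast hq.ne'), ← Complex.ofReal_log hq.le,
        Real.log_div hs'.ne' hs.ne']
      push_cast; rfl
    rw [outFactor, e1, e2, e3]
    have : 1 - (rPlus a M : ℂ) * (1 / (r : ℂ)) = ((r - rPlus a M : ℝ) : ℂ) / r := by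
      push_cast; field_simp
    rw [this]
    push_cast
    field_simp
  rw [hout]
  have hq : ((r - rPlus a M : ℝ) : ℂ) = (r : ℂ) - rPlus a M := by push_cast; ring
  simp only [radialLift, radialFactor, ← hrdef, ← hq]
  generalize h ((r - rPlus a M : ℝ) : ℂ) = k
  have e4 : ((r - rPlus a M : ℝ) : ℂ) ^ (1 - Complex.I * (4 * M * ω : ℝ)) =
      ((r - rPlus a M : ℝ) : ℂ) * Complex.exp (ls * (-(Complex.I * (4 * M * ω : ℝ)))) := by
    rw [Complex.cpow_sub _ _ hsc, Complex.cpow_one, div_eq_mul_inv, ← Complex.cpow_neg,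
      Complex.cpow_def_of_ne_zero hsc, els]
  rw [e4, Complex.cpow_def_of_ne_zero hsc, Complex.cpow_def_of_ne_zero hsc', els, eld]
  have e5 : Complex.exp (-(Complex.I * ω * x)) * (Complex.exp (ls * horExponent a M ω m) *
      Complex.exp (ld * innerExponent a M ω m) * Complex.exp (Complex.I * ω * r)) =
      Complex.exp (Complex.I * (ω * c : ℝ)) * Complex.exp ((ld - ls) * E) *
        Complex.exp (ls * (-(Complex.I * (4 * M * ω : ℝ)))) := by
    simp only [← Complex.exp_add]
    congr 1
    rw [hx, hE, innerExponent]
    have hdc : (d : ℂ) ≠ 0 := by exact_mod_cast hd0.ne'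
    have hpm : (rPlus a M : ℂ) = rMinus a M + d := by rw [hd]; push_cast; ring
    push_cast
    rw [hpm]
    field_simp
    ring
  have hss : ((Real.sqrt (r ^ 2 + a ^ 2) : ℝ) : ℂ) / ((r - rPlus a M : ℝ) : ℂ)
      * ((r - rPlus a M : ℝ) : ℂ) = ((Real.sqrt (r ^ 2 + a ^ 2) : ℝ) : ℂ) :=
    div_mul_cancel₀ _ hsc
  linear_combination (((Real.sqrt (r ^ 2 + a ^ 2) : ℝ) : ℂ) * k) * e5
    - (Complex.exp (Complex.I * (ω * c : ℝ)) * Complex.exp ((ld - ls) * E) *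
        Complex.exp (ls * (-(Complex.I * (4 * M * ω : ℝ)))) * k) * hss

end Outgoing

/-! ### The outgoing solution: existence and uniqueness up to a phase. -/

section Outgoing
variable {a M : ℝ} {rad : ℝ → ℝ} {ω lam : ℝ} {m : ℤ}

theorem HasExpansion.comp_tendsto {w f : ℝ → ℂ} (hf : HasExpansion w f) {k : ℝ → ℝ}
    (hk : Tendsto k atTop atTop) : HasExpansion (fun x => w (k x)) fun x => f (k x) := by
  intro N
  obtain ⟨P, hP⟩ := hf N
  exact ⟨P, hP.comp_tendsto hk⟩

/-- Watson's expansion on the positive reals; for `s ≥ 2` the error in `s - 1` is one in `s` at the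
cost of a power of two. -/
theorem IsRaySolution.hasExpansion {D σ ρ p β : ℂ} {φ φ' : ℝ → ℂ}
    (h : IsRaySolution D σ ρ p β φ φ') (hD : 0 ≤ D.re) (hσ0 : σ ≠ 0) (hρ : ρ.re = 0) :
    HasExpansion (fun s : ℝ => 1 / (s : ℂ)) fun s => (s : ℂ) ^ (1 + ρ) * laplace φ s := by
  intro N
  obtain ⟨C, hC⟩ := h.exists_norm_laplace_sub_le hD hσ0 hρ N
  set H := rayHeun D σ ρ p β
  refine ⟨∑ k ∈ Finset.range N, Polynomial.C (H.coeff k * Complex.Gamma (k + 1 + ρ))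
    * Polynomial.X ^ k, Asymptotics.IsBigO.of_bound (|C| * 2 ^ (N + 1)) ?_⟩
  filter_upwards [eventually_ge_atTop 2] with s hs
  have hs0 : 0 < s := by linarith
  have hsc : (s : ℂ) ≠ 0 := by exact_mod_cast hs0.ne'
  have e : (s : ℂ) ^ (1 + ρ) * laplace φ s - (∑ k ∈ Finset.range N,
      Polynomial.C (H.coeff k * Complex.Gamma (k + 1 + ρ)) * Polynomial.X ^ k).eval (1 / (s : ℂ)) =
      (s : ℂ) ^ (1 + ρ) * (laplace φ s - ∑ k ∈ Finset.range N,
        H.coeff k * ((s : ℂ) ^ (-(k + 1 + ρ : ℂ)) * Complex.Gamma (k + 1 + ρ))) := by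
    rw [mul_sub, Finset.mul_sum, Polynomial.eval_finsetSum]
    congr 1
    refine Finset.sum_congr rfl fun k _ => ?_
    have h1 : (s : ℂ) ^ (1 + ρ) * (s : ℂ) ^ (-(k + 1 + ρ : ℂ)) = (1 / (s : ℂ)) ^ k := by
      rw [← Complex.cpow_add _ _ hsc, show 1 + ρ + -(k + 1 + ρ : ℂ) = -(k : ℂ) by ring,
        Complex.cpow_neg, Complex.cpow_natCast]
      simp
    simp only [Polynomial.eval_mul, Polynomial.eval_C, Polynomial.eval_pow, Polynomial.eval_X]
    rw [← h1]; ring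
  have h1 := hC s (by rw [Complex.ofReal_re]; linarith)
  rw [Complex.ofReal_re] at h1
  have h2 : (s - 1) ^ (-(N + 1 : ℝ)) ≤ 2 ^ (N + 1) * s⁻¹ ^ (N + 1) := by
    have : (-(N + 1 : ℝ)) = -((N + 1 : ℕ) : ℝ) := by push_cast; ring
    rw [this, Real.rpow_neg (by linarith), Real.rpow_natCast, ← mul_pow, ← inv_pow]
    have h0 : 0 < s - 1 := by linarith
    gcongr
    rw [← div_eq_mul_inv, inv_eq_one_div, div_le_div_iff₀ h0 hs0]
    linarith
  have hr1 : (1 + ρ).re = 1 := by simp [hρ]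
  rw [e, norm_mul, Complex.norm_cpow_eq_rpow_re_of_pos hs0, hr1, Real.rpow_one, norm_pow, norm_div,
    norm_one, Complex.norm_real, Real.norm_of_nonneg hs0.le]
  calc _ ≤ s * (|C| * (2 ^ (N + 1) * s⁻¹ ^ (N + 1))) := by
        gcongr
        refine h1.trans ?_
        have : 0 ≤ (s - 1) ^ (-(N + 1 : ℝ)) := Real.rpow_nonneg (by linarith) _
        calc _ ≤ |C| * (s - 1) ^ (-(N + 1 : ℝ)) := by gcongr; exact le_abs_self C
          _ ≤ _ := by gcongr
    _ = _ := by rw [pow_succ s⁻¹]; field_simp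

/-- The parameter `2 (2 M r₊ ω - a m) / (r₊ - r₋)`. -/
noncomputable def horFreq (a M ω : ℝ) (m : ℤ) : ℝ :=
  2 * (2 * M * rPlus a M * ω - a * m) / (rPlus a M - rMinus a M)

theorem one_add_two_mul_horExponent (a M ω : ℝ) (m : ℤ) :
    1 + 2 * horExponent a M ω m = 1 - Complex.I * horFreq a M ω m := by
  unfold horExponent horFreq
  push_cast
  ring

theorem one_add_two_mul_innerExponent (a M ω : ℝ) (m : ℤ) :
    1 + 2 * innerExponent a M ω m =
      2 + -(Complex.I * (4 * M * ω : ℝ)) - (1 - Complex.I * horFreq a M ω m) := by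
  rw [← one_add_two_mul_horExponent, innerExponent]
  push_cast
  ring

/-- Brings the constant to the form required by `exists_horizon_wronskian`, with the real number `μ
= λ + a²ω² - 2amω`. The eigenvalue enters only through `μ`, of which the lower bound there is
independent. -/
theorem heun_constant_eq (ha : |a| < M) (ω lam : ℝ) (m : ℤ) :
    (8 * M * ω ^ 2 * rPlus a M - 2 * a * m * ω - lam - a ^ 2 * ω ^ 2
      + Complex.I * ω * (2 * rPlus a M - 4 * M) : ℂ) =
    2 * ω * (rPlus a M - rMinus a M : ℝ) * horFreq a M ω m
      - (lam + a ^ 2 * ω ^ 2 - 2 * a * m * ω : ℝ)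
      + Complex.I * (ω * (rPlus a M - rMinus a M : ℝ) - (4 * M * ω : ℝ) / 2) := by
  have h0 : (rPlus a M : ℂ) - rMinus a M ≠ 0 := by
    have := rMinus_lt_rPlus ha
    rw [← Complex.ofReal_sub]
    exact_mod_cast (sub_pos.2 this).ne'
  have e2 : (rPlus a M : ℂ) + rMinus a M = 2 * M := by
    exact_mod_cast congrArg (fun x : ℝ => (x : ℂ)) (rPlus_add_rMinus (a := a) (M := M))
  have h1 : ((rPlus a M - rMinus a M : ℝ) : ℂ) * horFreq a M ω m =
      2 * (2 * M * rPlus a M * ω - a * m) := by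
    unfold horFreq
    push_cast
    field_simp
  rw [mul_assoc (2 * (ω : ℂ)), h1]
  push_cast
  linear_combination (Complex.I * ω) * e2

/-- The ray solution from which the outgoing solution is built. -/
def IsOutgoingRay (a M ω : ℝ) (m : ℤ) (lam : ℝ) : (ℝ → ℂ) → (ℝ → ℂ) → Prop :=
  IsRaySolution ((rPlus a M - rMinus a M : ℝ) : ℂ) (2 * Complex.I * ω)
    (-(Complex.I * (4 * M * ω : ℝ))) (1 - Complex.I * horFreq a M ω m)
    (2 * ω * (rPlus a M - rMinus a M : ℝ) * horFreq a M ω m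
      - (lam + a ^ 2 * ω ^ 2 - 2 * a * m * ω : ℝ)
      + Complex.I * (ω * (rPlus a M - rMinus a M : ℝ) - (4 * M * ω : ℝ) / 2))

theorem ofReal_ne_two_mul_I (hω : ω ≠ 0) (t : ℝ) : (t : ℂ) ≠ 2 * Complex.I * ω := by
  intro h
  have := congrArg Complex.im h
  simp at this
  exact hω this

theorem exists_isOutgoingRay (a M : ℝ) (hω : ω ≠ 0) (m : ℤ) (lam : ℝ) :
    ∃ φ φ' : ℝ → ℂ, IsOutgoingRay a M ω m lam φ φ' :=
  exists_isRaySolution (by exact_mod_cast (ofReal_ne_two_mul_I hω 0).symm)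
    (fun t _ => ofReal_ne_two_mul_I hω t) (by simp)

theorem IsOutgoingRay.solvesRadialHeun (ha : |a| < M) (hω : ω ≠ 0) {φ φ' : ℝ → ℂ}
    (h : IsOutgoingRay a M ω m lam φ φ') :
    SolvesRadialHeun a M ω m lam {s | 0 < s.re} (laplace φ)
      (fun s => -laplace (fun t => t * φ t) s) := by
  have h0 := rMinus_lt_rPlus ha
  have := IsRaySolution.solvesHeun_laplace h (by simpa using h0.le)
    (by exact_mod_cast (ofReal_ne_two_mul_I hω 0).symm) (fun t _ => ofReal_ne_two_mul_I hω t)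
    (by simp)
  rw [SolvesRadialHeun, one_add_two_mul_horExponent, one_add_two_mul_innerExponent,
    heun_constant_eq ha]
  convert this using 2
  push_cast; ring

/-- The expansion of the transform in `1 / (r - r₊)` is re-expanded in `1 / r` and multiplied by the
analytic `outFactor`. The leading coefficient has modulus `‖Γ(1 - 4iMω)‖`, which the constant in
front cancels. -/
theorem isOut_radialLift (ha : |a| < M) (hrad : IsRadius a M rad) (hω : ω ≠ 0) {φ φ' : ℝ → ℂ}
    (h : IsOutgoingRay a M ω m lam φ φ') :
    IsOut a M rad ω m lam (fun x => ((1 / ‖Complex.Gamma (1 - Complex.I * (4 * M * ω : ℝ))‖ : ℝ) : ℂ)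
      * radialLift a M rad ω m (laplace φ) x) := by
  have h0 := rMinus_lt_rPlus ha
  have hd0 : 0 ≤ ((rPlus a M - rMinus a M : ℝ) : ℂ).re := by simpa using h0.le
  have hσ0 : 2 * Complex.I * (ω : ℂ) ≠ 0 := by exact_mod_cast (ofReal_ne_two_mul_I hω 0).symm
  set ρ : ℂ := -(Complex.I * (4 * M * ω : ℝ)) with hρdef
  have hρ : ρ.re = 0 := by simp [hρdef]
  set κ : ℂ := ((1 / ‖Complex.Gamma (1 - Complex.I * (4 * M * ω : ℝ))‖ : ℝ) : ℂ) with hκ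
  have h1ρ : 1 - Complex.I * (4 * M * ω : ℝ) = 1 + ρ := by rw [hρdef]; ring
  have hΓ : Complex.Gamma (1 + ρ) ≠ 0 := Complex.Gamma_ne_zero_of_re_pos (by simp [hρ])
  have hsolves := (h.solvesRadialHeun ha hω).solvesOn ha hrad (S := univ) (fun x _ => by
    simpa using (hrad x).1)
  have hode : SolvesRadial a M rad ω m lam (fun x => κ * radialLift a M rad ω m (laplace φ) x) := by
    have := hsolves.lincomb hsolves κ 0
    simp only [zero_mul, add_zero] at this
    exact this.solvesRadial.1
  obtain ⟨E, γ, hγ, hform⟩ := exists_radialLift_eq ha hrad ω m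
  have hw := tendsto_inv_rad ha hrad
  have hw0 : ∀ᶠ x in atTop, 1 / (rad x : ℂ) ≠ 0 := Eventually.of_forall fun x => by
    have := (rPlus_pos ha).trans (hrad x).1
    exact one_div_ne_zero (by exact_mod_cast this.ne')
  have hs : Tendsto (fun x => rad x - rPlus a M) atTop atTop :=
    tendsto_atTop_add_const_right _ _ (hrad.tendsto_atTop ha)
  have hv : (fun x => 1 / ((rad x - rPlus a M : ℝ) : ℂ)) = fun x =>
      (fun z : ℂ => z / (1 - rPlus a M * z)) (1 / (rad x : ℂ)) := by
    ext x
    have h1 := (rPlus_pos ha).trans (hrad x).1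
    have h2 : (rad x : ℂ) ≠ 0 := by exact_mod_cast h1.ne'
    have h3 : (rad x : ℂ) - rPlus a M ≠ 0 := by
      rw [← Complex.ofReal_sub]; exact_mod_cast (sub_pos.2 (hrad x).1).ne'
    have h4 : 1 - (rPlus a M : ℂ) * (1 / (rad x : ℂ)) = (rad x - rPlus a M) / rad x := by field_simp
    simp only
    rw [h4]
    push_cast
    field_simp
  have hden : AnalyticAt ℂ (fun z : ℂ => 1 - (rPlus a M : ℂ) * z) 0 := by fun_prop
  have hvE : HasExpansion (fun x => 1 / (rad x : ℂ)) fun x => 1 / ((rad x - rPlus a M : ℝ) : ℂ) := by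
    rw [hv]
    exact hasExpansion_of_analyticAt hw (analyticAt_id.div hden (by simp))
  have hvO : (fun x => 1 / ((rad x - rPlus a M : ℝ) : ℂ)) =O[atTop] fun x => 1 / (rad x : ℂ) := by
    have h1 : (fun x => 1 / (1 - (rPlus a M : ℂ) * (1 / (rad x : ℂ)))) =O[atTop]
        fun _ => (1 : ℂ) := by
      have h2 : ContinuousAt (fun z : ℂ => 1 / (1 - (rPlus a M : ℂ) * z)) 0 :=
        (analyticAt_const.div hden (by simp)).continuousAt
      exact (h2.tendsto.comp hw).isBigO_one ℂ
    have h2 := (Asymptotics.isBigO_refl (fun x => 1 / (rad x : ℂ)) atTop).mul h1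
    rw [hv]
    refine (h2.congr_left fun x => ?_).congr_right fun x => mul_one _
    simp only
    rw [mul_one_div]
  have hφE := HasExpansion.comp hw hvE hvO ((IsRaySolution.hasExpansion h hd0 hσ0 hρ).comp_tendsto hs)
  have hF : HasExpansion (fun x => 1 / (rad x : ℂ)) fun x => κ * γ * outFactor a M E (1 / rad x) *
      (((rad x - rPlus a M : ℝ) : ℂ) ^ (1 + ρ) * laplace φ ((rad x - rPlus a M : ℝ) : ℂ)) := by
    have h1 := hasExpansion_eval (w := fun x => 1 / (rad x : ℂ)) (Polynomial.C (κ * γ))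
    simp only [Polynomial.eval_C] at h1
    exact (h1.mul hw (hasExpansion_of_analyticAt hw (analyticAt_outFactor a M E))).mul hw hφE
  have hval : ∀ x : ℝ, κ * γ * outFactor a M E (1 / rad x) *
      (((rad x - rPlus a M : ℝ) : ℂ) ^ (1 + ρ) * laplace φ ((rad x - rPlus a M : ℝ) : ℂ)) =
      Complex.exp (-(Complex.I * ω * x)) * (κ * radialLift a M rad ω m (laplace φ) x) := by
    intro x
    rw [mul_left_comm (Complex.exp _) κ, hform, h1ρ]
    ring
  obtain ⟨c, hc⟩ := hF.exists_coeff hw hw0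
  refine ⟨hode, ⟨c, fun N => ?_⟩, ?_⟩
  · have hexp : ∀ x : ℝ, ‖Complex.exp (Complex.I * ω * x)‖ = 1 := by
      intro x
      have := Complex.norm_exp_ofReal_mul_I (ω * x)
      rw [← this]; congr 2; push_cast; ring
    have h1 := hc N
    obtain ⟨C, hC⟩ := h1.bound
    refine Asymptotics.IsBigO.of_bound C ?_
    filter_upwards [hC] with x hx
    have hr : 0 < rad x := (rPlus_pos ha).trans (hrad x).1
    have e : κ * radialLift a M rad ω m (laplace φ) x - Complex.exp (Complex.I * ω * x)
        * ∑ i ∈ Finset.range (N + 1), c i / (rad x : ℂ) ^ i =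
        Complex.exp (Complex.I * ω * x) * (κ * γ * outFactor a M E (1 / rad x) *
      (((rad x - rPlus a M : ℝ) : ℂ) ^ (1 + ρ) * laplace φ ((rad x - rPlus a M : ℝ) : ℂ))
        - ∑ i ∈ Finset.range (N + 1), c i * (1 / (rad x : ℂ)) ^ i) := by
      rw [hval, mul_sub, ← mul_assoc (Complex.exp _), ← Complex.exp_add, add_neg_cancel,
        Complex.exp_zero, one_mul]
      congr 2
      refine Finset.sum_congr rfl fun i _ => ?_
      rw [one_div, inv_pow, div_eq_mul_inv]
    rw [e, norm_mul, hexp, one_mul]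
    refine hx.trans (le_of_eq ?_)
    congr 1
    rw [norm_pow, norm_div, norm_one, Complex.norm_real, Real.norm_of_nonneg hr.le,
      Real.norm_of_nonneg (by positivity), one_div, one_div, inv_pow]
  · have t1 : Tendsto (fun x => outFactor a M E (1 / rad x)) atTop (𝓝 1) := by
      have h1 := (analyticAt_outFactor a M E).continuousAt.tendsto.comp hw
      have h2 : outFactor a M E 0 = 1 := by simp [outFactor]
      rwa [h2] at h1
    have t2 := (IsRaySolution.tendsto_cpow_mul_laplace h hd0 hσ0 hρ (w := 1) (by simp)).comp hs
    simp only [Function.comp_def, mul_one] at t2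
    have t3 := (((tendsto_const_nhds (x := κ * γ)).mul t1).mul t2).norm.pow 2
    have e1 : ‖κ * γ * 1 * Complex.Gamma (1 + ρ)‖ ^ 2 = 1 := by
      rw [mul_one, norm_mul, norm_mul, hγ, hκ, Complex.norm_real, h1ρ,
        Real.norm_of_nonneg (by positivity)]
      have := norm_ne_zero_iff.2 hΓ
      field_simp
    rw [e1] at t3
    refine t3.congr fun x => ?_
    rw [hval]

/-- The limit at infinity of an outgoing solution. -/
theorem IsOut.exists_limit (ha : |a| < M) (hrad : IsRadius a M rad) {u : ℝ → ℂ}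
    (hu : IsOut a M rad ω m lam u) : ∃ γ : ℂ, ‖γ‖ = 1 ∧
      Tendsto (fun x : ℝ => Complex.exp (-(Complex.I * ω * x)) * u x) atTop (𝓝 γ) := by
  obtain ⟨c, hc⟩ := hu.asymptotics
  have hexp : ∀ x : ℝ, ‖Complex.exp (-(Complex.I * ω * x))‖ = 1 := by
    intro x
    have := Complex.norm_exp_ofReal_mul_I (-(ω * x))
    rw [← this]; congr 2; push_cast; ring
  have hlim : Tendsto (fun x : ℝ => Complex.exp (-(Complex.I * ω * x)) * u x) atTop (𝓝 (c 0)) := by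
    have h0 := hc 0
    have hz : Tendsto (fun x : ℝ => (1 / rad x ^ (0 + 1) : ℝ)) atTop (𝓝 0) := by
      have := tendsto_inv_atTop_zero.comp (hrad.tendsto_atTop ha)
      simpa [Function.comp_def] using this
    have h1 := (h0.trans_tendsto hz).norm
    rw [norm_zero] at h1
    rw [tendsto_iff_norm_sub_tendsto_zero]
    refine h1.congr fun x => ?_
    have e : u x - Complex.exp (Complex.I * ω * x)
        * ∑ i ∈ Finset.range (0 + 1), c i / (rad x : ℂ) ^ i =
        Complex.exp (Complex.I * ω * x) * (Complex.exp (-(Complex.I * ω * x)) * u x - c 0) := by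
      rw [mul_sub, ← mul_assoc, ← Complex.exp_add, add_neg_cancel, Complex.exp_zero]
      simp
    have h2 : ‖Complex.exp (Complex.I * ω * x)‖ = 1 := by
      have := hexp (-x)
      rw [← this]; congr 2; push_cast; ring
    rw [e, norm_mul, h2, one_mul]
  refine ⟨c 0, ?_, hlim⟩
  have := tendsto_nhds_unique (hlim.norm.pow 2) hu.normalised
  exact (pow_eq_one_iff_of_nonneg (norm_nonneg _) two_ne_zero).1 this

/-- The equation is real, so `conj v` is a solution too, and it is independent of `v` because `exp
(2iωx)` has no limit. In `u = α v + β conj v` the same fact forces `β = 0`, and comparing limits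
gives `‖α‖ = 1`. -/
theorem IsOut.eq_const_mul (ha : |a| < M) (hrad : IsRadius a M rad) (hω : ω ≠ 0) {u v : ℝ → ℂ}
    (hu : IsOut a M rad ω m lam u) (hv : IsOut a M rad ω m lam v) :
    ∃ c : ℂ, ‖c‖ = 1 ∧ ∀ x, u x = c * v x ∧ deriv u x = c * deriv v x := by
  obtain ⟨γ, hγ, hlu⟩ := hu.exists_limit ha hrad
  obtain ⟨δ, hδ, hlv⟩ := hv.exists_limit ha hrad
  have hδ0 : δ ≠ 0 := norm_pos_iff.1 (by rw [hδ]; norm_num)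
  have hb := continuous_radialCoeff (ω := ω) (m := m) (lam := lam) ha hrad
  have su := hu.ode.solvesOn
  have sv := hv.ode.solvesOn
  have sv' := sv.conj (fun t => by simp [radialCoeff])
  have hlv' : Tendsto (fun x : ℝ => Complex.exp (Complex.I * ω * x) * starRingEnd ℂ (v x)) atTop
      (𝓝 (starRingEnd ℂ δ)) := by
    refine ((Complex.continuous_conj.tendsto δ).comp hlv).congr fun x => ?_
    simp only [Function.comp, map_mul, ← Complex.exp_conj]
    congr 2
    simp
  have hδ' : starRingEnd ℂ δ ≠ 0 := by simpa using hδ0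
  obtain ⟨t₀, ht₀⟩ : ∃ t, v t ≠ 0 := by
    obtain ⟨t, ht⟩ := (hlv.eventually_ne hδ0).exists
    exact ⟨t, right_ne_zero_of_mul ht⟩
  have hW : deriv v t₀ * starRingEnd ℂ (v t₀) - v t₀ * starRingEnd ℂ (deriv v t₀) ≠ 0 := by
    intro h0
    obtain ⟨k, hk⟩ := sv'.eq_const_mul hb sv (t₀ := t₀) (by linear_combination -h0) ht₀
    have h1 : Tendsto (fun x : ℝ => k * Complex.exp (Complex.I * ((2 * ω : ℝ) * x))) atTop
        (𝓝 (starRingEnd ℂ δ / δ)) := by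
      refine (hlv'.div hlv hδ0).congr' ?_
      filter_upwards [hlv.eventually_ne hδ0] with x hx
      rw [Pi.div_apply, (hk x).1, div_eq_iff hx]
      have : Complex.exp (Complex.I * ω * x) = Complex.exp (Complex.I * ((2 * ω : ℝ) * x)) *
          Complex.exp (-(Complex.I * ω * x)) := by
        rw [← Complex.exp_add]; congr 1; push_cast; ring
      rw [this]; ring
    have h2 := eq_zero_of_tendsto_mul_exp (mul_ne_zero two_ne_zero hω) h1
    have h3 := (hk t₀).1
    rw [h2, zero_mul] at h3
    exact ht₀ (by simpa using h3)
  obtain ⟨α, β, hαβ⟩ := sv.exists_lincomb hb sv' su hW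
  have hβ : β = 0 := by
    have h1 : Tendsto (fun x : ℝ => β * Complex.exp (Complex.I * ((-(2 * ω) : ℝ) * x))) atTop
        (𝓝 ((γ - α * δ) / starRingEnd ℂ δ)) := by
      refine ((hlu.sub (hlv.const_mul α)).div hlv' hδ').congr' ?_
      filter_upwards [hlv'.eventually_ne hδ'] with x hx
      simp only [Pi.div_apply]
      rw [hαβ x, div_eq_iff hx]
      have : Complex.exp (-(Complex.I * ω * x)) = Complex.exp (Complex.I * ((-(2 * ω) : ℝ) * x)) *
          Complex.exp (Complex.I * ω * x) := by
        rw [← Complex.exp_add]; congr 1; push_cast; ring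
      rw [this]; ring
    exact eq_zero_of_tendsto_mul_exp (neg_ne_zero.2 (mul_ne_zero two_ne_zero hω)) h1
  have huv : u = fun x => α * v x := by
    ext x; rw [hαβ x, hβ]; ring
  refine ⟨α, ?_, fun x => ⟨congrFun huv x, ?_⟩⟩
  · have h1 : γ = α * δ := by
      refine tendsto_nhds_unique hlu ((hlv.const_mul α).congr fun x => ?_)
      rw [huv]; ring
    have h2 := congrArg norm h1
    rw [norm_mul, hγ, hδ, mul_one] at h2
    exact h2.symm
  · rw [huv, deriv_const_mul _ (hv.ode.1 x)]

end Outgoing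

/-! ### The explicit lower bound for the Wronskian. -/

section Wronskian
variable {a M : ℝ} {rad : ℝ → ℝ} {ω lam : ℝ} {m : ℤ}

/-- The lower bound for the Wronskian. -/
noncomputable def wronskianBound (a M ω : ℝ) (m : ℤ) : ℝ :=
  2 * Real.sqrt ((rPlus a M - rMinus a M) / rPlus a M) * |ω| *
    Real.exp (-(3 * Real.pi * |horFreq a M ω m| + 2 * Real.pi * |4 * M * ω|))

/-- The connection coefficient with `κ = 4Mω` and `τ = horFreq`, transported through the lift and
the two normalising constants. The constant of the outgoing solution is at least one and may be
dropped. -/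
theorem exists_isHor_isOut (ha : |a| < M) (hrad : IsRadius a M rad) (hω : ω ≠ 0) (m : ℤ) (lam : ℝ) :
    ∃ (uHor uOut : ℝ → ℂ) (W : ℂ), IsHor a M rad ω m lam uHor ∧ IsOut a M rad ω m lam uOut ∧
      (∀ x, deriv uOut x * uHor x - deriv uHor x * uOut x = W) ∧
      wronskianBound a M ω m ≤ ‖W‖ := by
  have h0 := rMinus_lt_rPlus ha
  set d := rPlus a M - rMinus a M with hd
  have hd0 : 0 < d := sub_pos.2 h0
  have hp := rPlus_pos ha
  have hM := mass_pos ha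
  obtain ⟨φ, φ', hφ⟩ := exists_isOutgoingRay a M hω m lam
  obtain ⟨u, hu, hueq⟩ := exists_isHor (ω := ω) (m := m) (lam := lam) ha hrad
  have hout := isOut_radialLift ha hrad hω hφ
  obtain ⟨W₀, hW₀, hW⟩ := exists_horizon_wronskian hω hd0 hφ
  set h' : ℂ → ℂ := fun s => -laplace (fun t => t * φ t) s with hh'
  set κ₁ : ℝ := 1 / Real.sqrt (2 * M * rPlus a M) with hκ₁
  set κ₂ : ℝ := 1 / ‖Complex.Gamma (1 - Complex.I * (4 * M * ω : ℝ))‖ with hκ₂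
  set v : ℝ → ℂ := fun x => (κ₂ : ℂ) * radialLift a M rad ω m (laplace φ) x with hv
  have hsol := hφ.solvesRadialHeun ha hω
  have hv' : ∀ x, deriv v x = κ₂ * radialLift' a M rad ω m (laplace φ) h' x := fun x =>
    ((hsol.hasDerivAt ha hrad (x := x) (by simpa using (hrad x).1)).1.const_mul _).deriv
  have hconst := fun x y => (hout.ode.solvesOn).wronskian_eq hu.ode.solvesOn x y
  set W := deriv v 0 * u 0 - v 0 * deriv u 0 with hWdef
  refine ⟨u, v, W, hu, hout, fun x => ?_, ?_⟩
  · rw [hWdef, ← hconst x 0]; ring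
  have hnear : ∀ᶠ x in atBot, rad x < rPlus a M + d :=
    ((hrad.tendsto_atBot ha).mono_right nhdsWithin_le_nhds).eventually
      (gt_mem_nhds (by linarith))
  -- The Wronskian is constant, so it can be evaluated at one point inside the disc of the Frobenius
  -- series.
  obtain ⟨x, hx1, hx2, hx3⟩ := (hnear.and hueq).exists
  have hs : 0 < rad x - rPlus a M := sub_pos.2 (hrad x).1
  have hWx : W = (κ₁ * κ₂ : ℝ) * (Complex.exp (2 * Complex.I * ω * rPlus a M) * W₀) := by
    have h1 := hW ((rad x : ℂ) - rPlus a M) (by simpa using hs) (by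
      rw [← Complex.ofReal_sub, Complex.norm_real, Real.norm_of_nonneg hs.le]; linarith)
    have h2 := radialLift_wronskian (ω := ω) (m := m) ha hrad (laplace φ) h'
      (radialHeun a M ω m lam).sol (radialHeun a M ω m lam).sol' x
    have h3 : radialHeun a M ω m lam = horizonHeun d (1 - Complex.I * horFreq a M ω m)
        (2 + -(Complex.I * (4 * M * ω : ℝ)) - (1 - Complex.I * horFreq a M ω m))
        (2 * Complex.I * ω) (2 * Complex.I * ω * (1 + -(Complex.I * (4 * M * ω : ℝ))))
        (2 * ω * d * horFreq a M ω m - (lam + a ^ 2 * ω ^ 2 - 2 * a * m * ω : ℝ)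
          + Complex.I * (ω * d - (4 * M * ω : ℝ) / 2)) := by
      rw [radialHeun, one_add_two_mul_horExponent, one_add_two_mul_innerExponent,
        heun_constant_eq ha]
      congr 1
      push_cast; ring
    rw [← h3, ← one_add_two_mul_innerExponent, ← one_add_two_mul_horExponent] at h1
    rw [h1] at h2
    rw [hWdef, ← hconst x 0, hv', hx2, hx3, ← h2]
    simp only [hv]
    push_cast
    ring
  have hΓ1 : ‖Complex.Gamma (1 - Complex.I * (4 * M * ω : ℝ))‖ ≤ 1 := norm_Gamma_le_one (by simp)
  have hΓ0 : 0 < ‖Complex.Gamma (1 - Complex.I * (4 * M * ω : ℝ))‖ :=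
    norm_pos_iff.2 (Complex.Gamma_ne_zero_of_re_pos (by simp))
  have hκ2 : 1 ≤ κ₂ := by rw [hκ₂, one_le_div hΓ0]; exact hΓ1
  have hexp1 : ‖Complex.exp (2 * Complex.I * ω * rPlus a M)‖ = 1 := by
    have := Complex.norm_exp_ofReal_mul_I (2 * ω * rPlus a M)
    rw [← this]; congr 2; push_cast; ring
  have hκ10 : 0 < κ₁ := by positivity
  -- The lower bound for the amplitude is `√(8M / d)`, in which the frequency has cancelled.
  have hroot : 2 * Real.sqrt (d / rPlus a M) = κ₁ * (Real.sqrt (2 * (4 * M * ω) / (ω * d)) * d) := by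
    have e1 : 2 * (4 * M * ω) / (ω * d) = 8 * M / d := by field_simp; ring
    rw [e1, hκ₁]
    rw [← sq_eq_sq₀ (by positivity) (by positivity), mul_pow, mul_pow, div_pow, mul_pow,
      Real.sq_sqrt (by positivity), Real.sq_sqrt (by positivity), Real.sq_sqrt (by positivity)]
    field_simp
    ring
  have hexp2 : Real.exp (-(3 * Real.pi * |horFreq a M ω m| + 2 * Real.pi * |4 * M * ω|)) =
      Real.exp (-(Real.pi * |horFreq a M ω m|)) *
        Real.exp (-(2 * Real.pi * (|horFreq a M ω m| + |4 * M * ω|))) := by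
    rw [← Real.exp_add]; congr 1; ring
  rw [hWx, norm_mul, norm_mul, hexp1, one_mul, Complex.norm_real, Real.norm_of_nonneg (by positivity),
    wronskianBound, hroot, hexp2]
  calc _ = κ₁ * (Real.sqrt (2 * (4 * M * ω) / (ω * d)) * d *
        Real.exp (-(Real.pi * |horFreq a M ω m|)) * |ω| *
        Real.exp (-(2 * Real.pi * (|horFreq a M ω m| + |4 * M * ω|)))) := by ring
    _ ≤ κ₁ * (Real.sqrt (2 * (4 * M * ω) / (ω * d)) * d *
        ‖Complex.Gamma (1 - Complex.I * horFreq a M ω m)‖ * |ω| *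
        Real.exp (-(2 * Real.pi * (|horFreq a M ω m| + |4 * M * ω|)))) := by
      gcongr
      exact exp_neg_le_norm_Gamma _
    _ ≤ κ₁ * ‖W₀‖ := by gcongr
    _ ≤ κ₁ * κ₂ * ‖W₀‖ := by
      have : κ₁ * 1 * ‖W₀‖ ≤ κ₁ * κ₂ * ‖W₀‖ := by gcongr
      linarith

theorem wronskianBound_le_norm (ha : |a| < M) (hrad : IsRadius a M rad) (hω : ω ≠ 0)
    {uHor uOut : ℝ → ℂ} (hHor : IsHor a M rad ω m lam uHor) (hOut : IsOut a M rad ω m lam uOut)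
    {W : ℂ} (hW : ∀ x, deriv uOut x * uHor x - deriv uHor x * uOut x = W) :
    wronskianBound a M ω m ≤ ‖W‖ := by
  obtain ⟨u, v, W', hu, hv, hW', hle⟩ := exists_isHor_isOut ha hrad hω m lam
  obtain ⟨c, hc1, hc⟩ := hHor.eq_const_mul ha hrad hu
  obtain ⟨e, he1, he⟩ := hOut.eq_const_mul ha hrad hω hv
  have : W = e * c * W' := by
    rw [← hW 0, ← hW' 0, (hc 0).1, (hc 0).2, (he 0).1, (he 0).2]; ring
  rw [this, norm_mul, norm_mul, hc1, he1]
  simpa using hle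

end Wronskian

/-! ### Spheroidal functions, regular at one pole. -/

/-- The equation `x (2 - x) f'' + 2 (k + 1) (1 - x) f' + (Λ + q (1 - x)²) f = 0`, which the angular
equation becomes for `S = sin^k θ f (1 - cos θ)`. -/
def spheroidalHeun (k : ℕ) (p : ℝ × ℝ) : HeunCoeffs where
  z₀ := 2
  q₀ := -(2 * (k + 1))
  q₁ := 2 * (k + 1)
  q₂ := 0
  k₀ := -(p.1 + p.2)
  k₁ := 2 * p.2
  k₂ := -p.2

/-- The spheroidal function that is regular and equal to one at `x = 0`. -/
noncomputable def spheroidal (k : ℕ) (p : ℝ × ℝ) (x : ℝ) : ℝ := ((spheroidalHeun k p).sol x).re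

/-- The derivative of the spheroidal function. -/
noncomputable def spheroidal' (k : ℕ) (p : ℝ × ℝ) (x : ℝ) : ℝ := ((spheroidalHeun k p).sol' x).re

variable {k : ℕ} {p : ℝ × ℝ} {x : ℝ}

theorem spheroidalHeun_norm_lt (hx : |x| < 2) : ‖(x : ℂ)‖ < ‖(spheroidalHeun k p).z₀‖ := by
  simpa [spheroidalHeun] using hx

theorem hasDerivAt_spheroidal (hx : |x| < 2) :
    HasDerivAt (spheroidal k p) (spheroidal' k p x) x :=
  (HeunCoeffs.hasDerivAt_sol (spheroidalHeun_norm_lt hx)).real_of_complex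

/-- The second derivative of the spheroidal function, from the differential equation. -/
noncomputable def spheroidal'' (k : ℕ) (p : ℝ × ℝ) (x : ℝ) : ℝ :=
  -(2 * (k + 1) * (1 - x) * spheroidal' k p x + (p.1 + p.2 * (1 - x) ^ 2) * spheroidal k p x) /
    (x * (2 - x))

theorem hasDerivAt_spheroidal' (hx : x ∈ Ioo (0 : ℝ) 2) :
    HasDerivAt (spheroidal' k p) (spheroidal'' k p x) x := by
  have hx' : |x| < 2 := abs_lt.2 ⟨by linarith [hx.1], hx.2⟩
  have h1 := (HeunCoeffs.hasDerivAt_sol' (spheroidalHeun_norm_lt (k := k) (p := p)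
    hx')).real_of_complex
  have hne : ∀ n : ℕ, (spheroidalHeun k p).q₀ - (spheroidalHeun k p).z₀ * n ≠ 0 := by
    intro n h
    have h2 : ((2 * (k + 1) + 2 * n : ℕ) : ℂ) = 0 := by
      simp only [spheroidalHeun] at h
      push_cast
      linear_combination -h
    have := Nat.cast_eq_zero.1 h2
    omega
  have h2 := HeunCoeffs.sol_eq hne (spheroidalHeun_norm_lt (k := k) (p := p) hx')
  have h3 := congrArg Complex.re h2
  have e : ((spheroidalHeun k p).sol'' x).re = spheroidal'' k p x := by
    have hx0 : x * (2 - x) ≠ 0 := (mul_pos hx.1 (by linarith [hx.2])).ne'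
    rw [spheroidal'', eq_div_iff hx0, spheroidal', spheroidal]
    have c1 : (x : ℂ) * (x - (spheroidalHeun k p).z₀) = ((x * (x - 2) : ℝ) : ℂ) := by
      simp [spheroidalHeun]
    have c2 : (spheroidalHeun k p).q₀ + (spheroidalHeun k p).q₁ * x
        + (spheroidalHeun k p).q₂ * (x : ℂ) ^ 2 = ((-(2 * (k + 1) * (1 - x)) : ℝ) : ℂ) := by
      simp only [spheroidalHeun]; push_cast; ring
    have c3 : (spheroidalHeun k p).k₀ + (spheroidalHeun k p).k₁ * x
        + (spheroidalHeun k p).k₂ * (x : ℂ) ^ 2 = ((-(p.1 + p.2 * (1 - x) ^ 2) : ℝ) : ℂ) := by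
      simp only [spheroidalHeun]; push_cast; ring
    rw [c1, c2, c3, Complex.add_re, Complex.add_re, Complex.re_ofReal_mul, Complex.re_ofReal_mul,
      Complex.re_ofReal_mul, Complex.zero_re] at h3
    linarith
  rw [← e]
  exact h1

theorem spheroidal_zero : spheroidal k p 0 = 1 := by
  simp [spheroidal, HeunCoeffs.sol_zero]

theorem analyticAt_spheroidal (hx : |x| < 2) : AnalyticAt ℝ (spheroidal k p) x := by
  have h1 : AnalyticAt ℂ (spheroidalHeun k p).sol x := by
    have hd : DifferentiableOn ℂ (spheroidalHeun k p).sol (Metric.ball 0 ‖(spheroidalHeun k p).z₀‖) :=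
      fun z hz => (HeunCoeffs.hasDerivAt_sol (by simpa using hz)).differentiableAt.differentiableWithinAt
    exact hd.analyticAt (Metric.isOpen_ball.mem_nhds (by simpa using spheroidalHeun_norm_lt hx))
  exact h1.re_ofReal

/-! ### Continuity in the parameters -/

theorem continuous_spheroidalHeun_state (k n : ℕ) :
    Continuous fun p : ℝ × ℝ => (spheroidalHeun k p).state n := by
  induction n with
  | zero => exact continuous_const
  | succ n ih =>
    simp only [HeunCoeffs.state]
    simp only [spheroidalHeun] at ih ⊢
    fun_prop

theorem continuous_spheroidalHeun_coeff (k n : ℕ) :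
    Continuous fun p : ℝ × ℝ => (spheroidalHeun k p).coeff n :=
  (continuous_spheroidalHeun_state k n).fst

/-- The ratio `3 / 4` lies between `1 / 2`, the inverse radius of convergence, and `1`. Thus the
series converges up to the equator `x = 1`, uniformly for bounded parameters. -/
theorem exists_spheroidalHeun_coeff_le (k : ℕ) (B : ℝ) :
    ∃ C : ℝ, ∀ p ∈ Metric.closedBall (0 : ℝ × ℝ) B, ∀ n,
      ‖(spheroidalHeun k p).coeff n‖ ≤ C * (3 / 4) ^ n := by
  obtain ⟨n₀, h⟩ := HeunCoeffs.exists_norm_coeff_le 2 (-(2 * (k + 1))) (R := 2 * |B| + 2 * (k + 1))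
    (θ := 3 / 4) (by positivity) (by norm_num) (by norm_num)
  have hK : IsCompact (Metric.closedBall (0 : ℝ × ℝ) B) := isCompact_closedBall _ _
  choose c hc using fun n => hK.exists_bound_of_continuousOn
    (continuous_spheroidalHeun_coeff k n).continuousOn
  refine ⟨∑ n ∈ Finset.range (n₀ + 1), |c n| / (3 / 4) ^ n, fun p hp n => ?_⟩
  have hp' : ‖p‖ ≤ |B| := (by simpa using hp : ‖p‖ ≤ B).trans (le_abs_self B)
  have h1 : ‖(p.1 : ℂ)‖ ≤ |B| := by
    rw [Complex.norm_real]; exact (norm_fst_le p).trans hp'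
  have h2 : ‖(p.2 : ℂ)‖ ≤ |B| := by
    rw [Complex.norm_real]; exact (norm_snd_le p).trans hp'
  have hk : ‖(2 : ℂ) * (k + 1)‖ = 2 * (k + 1) := by
    exact_mod_cast Complex.norm_natCast (2 * (k + 1))
  have hB := abs_nonneg B
  have hk0 : (0 : ℝ) ≤ k := Nat.cast_nonneg k
  refine h _ rfl rfl ?_ ?_ ?_ ?_ ?_ _ (fun j hj => ?_) n
  · simp only [spheroidalHeun]; linarith
  · simp only [spheroidalHeun, norm_zero]; positivity
  · simp only [spheroidalHeun, norm_neg]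
    linarith [norm_add_le (p.1 : ℂ) p.2]
  · simp only [spheroidalHeun, norm_mul, Complex.norm_ofNat]; linarith
  · simp only [spheroidalHeun, norm_neg]; linarith
  · rw [← div_le_iff₀ (by positivity)]
    refine le_trans ?_ (Finset.single_le_sum (f := fun n => |c n| / (3 / 4) ^ n)
      (fun n _ => by positivity) (Finset.mem_range.2 (by omega : j < n₀ + 1)))
    have : ‖(spheroidalHeun k p).coeff j‖ ≤ |c j| := (hc j p hp).trans (le_abs_self _)
    gcongr

theorem continuousOn_pseries_of_bound {c : ℝ × ℝ → ℕ → ℂ} (hc : ∀ n, Continuous fun p => c p n)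
    (hb : ∀ B : ℝ, ∃ u : ℕ → ℝ, Summable u ∧ ∀ p ∈ Metric.closedBall (0 : ℝ × ℝ) B, ∀ n,
      ‖c p n‖ ≤ u n) :
    ContinuousOn (fun v : (ℝ × ℝ) × ℝ => pseries (c v.1) v.2) (univ ×ˢ Icc 0 1) := by
  intro v hv
  obtain ⟨u, hu, hcu⟩ := hb (‖v.1‖ + 1)
  have h : ContinuousOn (fun v : (ℝ × ℝ) × ℝ => pseries (c v.1) v.2)
      (Metric.closedBall 0 (‖v.1‖ + 1) ×ˢ Icc 0 1) := by
    refine continuousOn_tsum (fun n => ?_) hu fun n w hw => ?_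
    · exact (((hc n).comp continuous_fst).mul
        ((Complex.continuous_ofReal.comp continuous_snd).pow n)).continuousOn
    · have hw2 : ‖(w.2 : ℂ) ^ n‖ ≤ 1 := by
        rw [norm_pow, Complex.norm_real, Real.norm_of_nonneg hw.2.1]
        exact pow_le_one₀ hw.2.1 hw.2.2
      calc _ = ‖c w.1 n‖ * ‖(w.2 : ℂ) ^ n‖ := norm_mul _ _
        _ ≤ u n * 1 := by
          have := hcu w.1 hw.1 n
          gcongr
          exact (norm_nonneg _).trans this
        _ = u n := mul_one _
  refine (h v ⟨by simp, hv.2⟩).mono_of_mem_nhdsWithin ?_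
  rw [mem_nhdsWithin]
  refine ⟨Metric.ball 0 (‖v.1‖ + 1) ×ˢ univ, Metric.isOpen_ball.prod isOpen_univ, by simp, ?_⟩
  rintro w ⟨hw1, hw2⟩
  exact ⟨Metric.ball_subset_closedBall hw1.1, hw2.2⟩

theorem continuousOn_spheroidal (k : ℕ) :
    ContinuousOn (fun v : (ℝ × ℝ) × ℝ => spheroidal k v.1 v.2) (univ ×ˢ Icc 0 1) := by
  refine Complex.continuous_re.comp_continuousOn (continuousOn_pseries_of_bound
    (c := fun p => (spheroidalHeun k p).coeff) (continuous_spheroidalHeun_coeff k) fun B => ?_)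
  obtain ⟨C, hC⟩ := exists_spheroidalHeun_coeff_le k B
  exact ⟨_, (summable_geometric_of_lt_one (by norm_num) (by norm_num)).mul_left C, hC⟩

theorem continuousOn_spheroidal' (k : ℕ) :
    ContinuousOn (fun v : (ℝ × ℝ) × ℝ => spheroidal' k v.1 v.2) (univ ×ˢ Icc 0 1) := by
  refine Complex.continuous_re.comp_continuousOn (continuousOn_pseries_of_bound
    (c := fun p => dcoeff (spheroidalHeun k p).coeff)
    (fun n => continuous_const.mul (continuous_spheroidalHeun_coeff k (n + 1))) fun B => ?_)
  obtain ⟨C, hC⟩ := exists_spheroidalHeun_coeff_le k B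
  have h1 : Summable fun n : ℕ => ((n + 1 : ℕ) : ℝ) ^ 1 * (3 / 4 : ℝ) ^ (n + 1) :=
    (summable_nat_add_iff (f := fun n : ℕ => (n : ℝ) ^ 1 * (3 / 4 : ℝ) ^ n) 1).2
      (summable_pow_mul_geometric_of_norm_lt_one 1 (by norm_num))
  refine ⟨_, h1.mul_left C, fun p hp n => ?_⟩
  have h2 := hC p hp (n + 1)
  have h3 : ‖(n : ℂ) + 1‖ = n + 1 := by exact_mod_cast Complex.norm_natCast (n + 1)
  rw [dcoeff, norm_mul, h3]
  calc _ ≤ ((n : ℝ) + 1) * (C * (3 / 4) ^ (n + 1)) := by gcongr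
    _ = _ := by push_cast; ring

/-! ### The Lagrange identity and the phase -/

/-- The power `(x (2 - x)) ^ (k + 1)` puts the equation in self-adjoint form, so only the difference
of the potentials survives. -/
theorem hasDerivAt_spheroidal_wronskian {p₁ p₂ : ℝ × ℝ} (hx : x ∈ Ioo (0 : ℝ) 2) :
    HasDerivAt (fun x => (x * (2 - x)) ^ (k + 1) *
      (spheroidal' k p₁ x * spheroidal k p₂ x - spheroidal k p₁ x * spheroidal' k p₂ x))
      ((x * (2 - x)) ^ k * ((p₂.1 - p₁.1) + (p₂.2 - p₁.2) * (1 - x) ^ 2) *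
        (spheroidal k p₁ x * spheroidal k p₂ x)) x := by
  have hx' : |x| < 2 := abs_lt.2 ⟨by linarith [hx.1], hx.2⟩
  have a1 := hasDerivAt_spheroidal (k := k) (p := p₁) hx'
  have a2 := hasDerivAt_spheroidal' (k := k) (p := p₁) hx
  have b1 := hasDerivAt_spheroidal (k := k) (p := p₂) hx'
  have b2 := hasDerivAt_spheroidal' (k := k) (p := p₂) hx
  have c : HasDerivAt (fun x : ℝ => (x * (2 - x)) ^ (k + 1))
      ((k + 1) * (x * (2 - x)) ^ k * (2 * (1 - x))) x := by
    have h : HasDerivAt (fun x : ℝ => x * (2 - x)) (2 * (1 - x)) x := by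
      refine ((hasDerivAt_id x).mul ((hasDerivAt_id x).const_sub 2)).congr_deriv ?_
      simp only [id]; ring
    exact (h.pow (k + 1)).congr_deriv (by simp)
  refine (c.mul ((a2.mul b1).sub (a1.mul b2))).congr_deriv ?_
  have hx0 : x * (2 - x) ≠ 0 := (mul_pos hx.1 (by linarith [hx.2])).ne'
  have d1 : (x * (2 - x)) * spheroidal'' k p₁ x = -(2 * (k + 1) * (1 - x) * spheroidal' k p₁ x
      + (p₁.1 + p₁.2 * (1 - x) ^ 2) * spheroidal k p₁ x) := by
    rw [spheroidal'', mul_div_cancel₀ _ hx0]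
  have d2 : (x * (2 - x)) * spheroidal'' k p₂ x = -(2 * (k + 1) * (1 - x) * spheroidal' k p₂ x
      + (p₂.1 + p₂.2 * (1 - x) ^ 2) * spheroidal k p₂ x) := by
    rw [spheroidal'', mul_div_cancel₀ _ hx0]
  simp only [Pi.sub_apply, Pi.mul_apply]
  rw [pow_succ]
  generalize (x * (2 - x)) ^ k = w
  linear_combination w * (spheroidal k p₂ x * d1 - spheroidal k p₁ x * d2)

/-- Integration from the pole to the equator; the weight vanishes at the pole and equals one at `x =
1`. -/
theorem spheroidal_wronskian_eq (p₁ p₂ : ℝ × ℝ) :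
    spheroidal' k p₁ 1 * spheroidal k p₂ 1 - spheroidal k p₁ 1 * spheroidal' k p₂ 1 =
      ∫ x in (0 : ℝ)..1, (x * (2 - x)) ^ k * ((p₂.1 - p₁.1) + (p₂.2 - p₁.2) * (1 - x) ^ 2) *
        (spheroidal k p₁ x * spheroidal k p₂ x) := by
  have hc : ∀ p : ℝ × ℝ, ContinuousOn (spheroidal k p) (Icc 0 1) := fun p =>
    (continuousOn_spheroidal k).comp (f := fun x : ℝ => (p, x)) (by fun_prop)
      fun x hx => ⟨mem_univ _, hx⟩
  have hc' : ∀ p : ℝ × ℝ, ContinuousOn (spheroidal' k p) (Icc 0 1) := fun p =>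
    (continuousOn_spheroidal' k).comp (f := fun x : ℝ => (p, x)) (by fun_prop)
      fun x hx => ⟨mem_univ _, hx⟩
  have h1 := hc p₁
  have h2 := hc p₂
  have h1' := hc' p₁
  have h2' := hc' p₂
  rw [intervalIntegral.integral_eq_sub_of_hasDerivAt_of_le zero_le_one ?_
    (fun x hx => hasDerivAt_spheroidal_wronskian ⟨hx.1, by linarith [hx.2]⟩) ?_]
  · norm_num
  · fun_prop
  · refine ContinuousOn.intervalIntegrable ?_
    rw [uIcc_of_le zero_le_one]
    fun_prop

theorem spheroidal_solvesOn (k : ℕ) (p : ℝ × ℝ) :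
    SolvesOn (fun x => ((-(2 * (k + 1) * (1 - x)) / (x * (2 - x)) : ℝ) : ℂ))
      (fun x => ((-(p.1 + p.2 * (1 - x) ^ 2) / (x * (2 - x)) : ℝ) : ℂ)) (Ioo 0 2)
      (fun x => (spheroidal k p x : ℂ)) (fun x => (spheroidal' k p x : ℂ)) := by
  intro x hx
  refine ⟨(hasDerivAt_spheroidal (abs_lt.2 ⟨by linarith [hx.1], hx.2⟩)).ofReal_comp,
    (hasDerivAt_spheroidal' hx).ofReal_comp.congr_deriv ?_⟩
  rw [spheroidal'']
  push_cast
  ring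

theorem continuousOn_spheroidal_coeff {g : ℝ → ℝ} (hg : Continuous g) :
    ContinuousOn (fun x : ℝ => ((g x / (x * (2 - x)) : ℝ) : ℂ)) (Ioo 0 2) := by
  refine Complex.continuous_ofReal.comp_continuousOn (ContinuousOn.div (by fun_prop) (by fun_prop) ?_)
  intro x hx
  exact (mul_pos hx.1 (by linarith [hx.2])).ne'

/-- Zero Cauchy data at the regular point `x = 1` would force `f = 0` on `(0, 2)`, against `f 0 =
1`. -/
theorem spheroidal_ne_zero_or (k : ℕ) (p : ℝ × ℝ) : spheroidal k p 1 ≠ 0 ∨ spheroidal' k p 1 ≠ 0 := by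
  by_contra! h
  have h1 : ∀ x ∈ Ioo (0 : ℝ) 2, spheroidal k p x = 0 := by
    intro x hx
    have hz : SolvesOn (fun x => ((-(2 * (k + 1) * (1 - x)) / (x * (2 - x)) : ℝ) : ℂ))
      (fun x => ((-(p.1 + p.2 * (1 - x) ^ 2) / (x * (2 - x)) : ℝ) : ℂ)) (Ioo 0 2)
      (fun _ => 0) (fun _ => 0) := fun t _ =>
        ⟨hasDerivAt_const _ _, by simpa using hasDerivAt_const t (0 : ℂ)⟩
    have := ((spheroidal_solvesOn k p).eqOn ordConnected_Ioo
      (continuousOn_spheroidal_coeff (by fun_prop))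
      (continuousOn_spheroidal_coeff (by fun_prop)) hz (t₀ := 1) (by norm_num) (by simp [h.1])
      (by simp [h.2]) x hx).1
    exact_mod_cast this
  have h2 : Tendsto (spheroidal k p) (𝓝[>] 0) (𝓝 1) := by
    have := (hasDerivAt_spheroidal (k := k) (p := p) (x := 0) (by norm_num)).continuousAt.tendsto
    rw [spheroidal_zero] at this
    exact this.mono_left nhdsWithin_le_nhds
  have h3 : Tendsto (spheroidal k p) (𝓝[>] 0) (𝓝 0) := by
    refine tendsto_const_nhds.congr' ?_
    filter_upwards [Ioo_mem_nhdsGT (zero_lt_two' ℝ)] with x hx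
    exact (h1 x hx).symm
  exact one_ne_zero (tendsto_nhds_unique h2 h3)

/-- The Prüfer point `f (1) + i f'(1)` of the spheroidal function at the equator. -/
noncomputable def pruefer (k : ℕ) (p : ℝ × ℝ) : ℂ :=
  ⟨spheroidal k p 1, spheroidal' k p 1⟩

theorem pruefer_ne_zero (k : ℕ) (p : ℝ × ℝ) : pruefer k p ≠ 0 := by
  intro h
  have h1 := congrArg Complex.re h
  have h2 := congrArg Complex.im h
  rcases spheroidal_ne_zero_or k p with h3 | h3
  · exact h3 h1
  · exact h3 h2

theorem continuous_pruefer (k : ℕ) : Continuous (pruefer k) := by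
  have h1 : Continuous fun p : ℝ × ℝ => spheroidal k p 1 :=
    (continuousOn_spheroidal k).comp_continuous (f := fun p => (p, (1 : ℝ))) (by fun_prop)
      fun p => ⟨mem_univ _, by norm_num⟩
  have h2 : Continuous fun p : ℝ × ℝ => spheroidal' k p 1 :=
    (continuousOn_spheroidal' k).comp_continuous (f := fun p => (p, (1 : ℝ))) (by fun_prop)
      fun p => ⟨mem_univ _, by norm_num⟩
  have : pruefer k = fun p => (spheroidal k p 1 : ℂ) + spheroidal' k p 1 * Complex.I := by
    funext p
    exact Complex.mk_eq_add_mul_I _ _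
  rw [this]
  fun_prop

/-- The parameter plane is simply connected and the Prüfer point never vanishes, so a continuous
logarithm exists; its imaginary part is the phase. -/
theorem exists_log_pruefer (k : ℕ) :
    ∃ ℓ : ℝ × ℝ → ℂ, Continuous ℓ ∧ ∀ p, Complex.exp (ℓ p) = pruefer k p := by
  have hsc : IsSimplyConnected (univ : Set (ℝ × ℝ)) := by
    have : ContractibleSpace (univ : Set (ℝ × ℝ)) :=
      (Homeomorph.Set.univ (ℝ × ℝ)).contractibleSpace
    exact SimplyConnectedSpace.ofContractible _
  obtain ⟨ℓ, h1, h2⟩ := Complex.exists_continuousOn_eqOn_exp_comp hsc isOpen_univ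
    (continuous_pruefer k).continuousOn (by rintro ⟨p, -, h⟩; exact pruefer_ne_zero k p h)
  exact ⟨ℓ, continuousOn_univ.1 h1, fun p => h2 (mem_univ p)⟩

theorem strictMono_of_eventually_lt {f : ℝ → ℝ} (hf : Continuous f)
    (h : ∀ x, ∀ᶠ y in 𝓝[>] x, f x < f y) : StrictMono f := by
  have hmono : Monotone f := by
    intro a b hab
    have hs : IsClosed ({x | f a ≤ f x} ∩ Icc a b) :=
      (isClosed_le continuous_const hf).inter isClosed_Icc
    refine hs.Icc_subset_of_forall_exists_gt (le_refl (f a)) (fun x hx y hy => ?_) (right_mem_Icc.2 hab)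
    obtain ⟨z, hz1, hz2⟩ := ((h x).and (Ioc_mem_nhdsGT hy)).exists
    exact ⟨z, (hx.1.trans hz1.le : f a ≤ f z), hz2⟩
  intro a b hab
  obtain ⟨z, hz1, hz2⟩ := ((h a).and (Ioc_mem_nhdsGT hab)).exists
  exact hz1.trans_le (hmono hz2.2)

/-! ### Monotonicity of the phase and the eigenvalue branches. -/

section Phase

variable {k : ℕ} {ℓ : ℝ × ℝ → ℂ}

theorem spheroidal_wronskian_eq_sin (hℓ : ∀ p, Complex.exp (ℓ p) = pruefer k p) (p₁ p₂ : ℝ × ℝ) :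
    spheroidal' k p₁ 1 * spheroidal k p₂ 1 - spheroidal k p₁ 1 * spheroidal' k p₂ 1 =
      Real.exp (ℓ p₁).re * Real.exp (ℓ p₂).re * Real.sin ((ℓ p₁).im - (ℓ p₂).im) := by
  have h1 : ∀ p, spheroidal k p 1 = Real.exp (ℓ p).re * Real.cos (ℓ p).im := fun p => by
    rw [← Complex.exp_re, hℓ]; rfl
  have h2 : ∀ p, spheroidal' k p 1 = Real.exp (ℓ p).re * Real.sin (ℓ p).im := fun p => by
    rw [← Complex.exp_im, hℓ]; rfl
  rw [h1, h1, h2, h2, Real.sin_sub]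
  ring

/-- The Wronskian at `p` and `p + h • d` is `h * J h`, where `J 0` is the integral of `f²` against a
positive weight. So the sine of the phase difference is positive for small `h > 0`, and the
difference itself is less than `π`. -/
theorem phase_eventually_lt (hc : Continuous ℓ) (hℓ : ∀ p, Complex.exp (ℓ p) = pruefer k p)
    (p d : ℝ × ℝ) (hd : ∀ x ∈ Ioo (0 : ℝ) 1, 0 < d.1 + d.2 * (1 - x) ^ 2) :
    ∀ᶠ h in 𝓝[>] (0 : ℝ), (ℓ (p + h • d)).im < (ℓ p).im := by
  set J : ℝ → ℝ := fun h => ∫ x in (0 : ℝ)..1, (x * (2 - x)) ^ k * (d.1 + d.2 * (1 - x) ^ 2) *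
    (spheroidal k p x * spheroidal k (p + h • d) x) with hJ
  have hW : ∀ h : ℝ, Real.exp (ℓ p).re * Real.exp (ℓ (p + h • d)).re *
      Real.sin ((ℓ p).im - (ℓ (p + h • d)).im) = h * J h := by
    intro h
    rw [← spheroidal_wronskian_eq_sin hℓ, spheroidal_wronskian_eq, hJ,
      ← intervalIntegral.integral_const_mul]
    refine intervalIntegral.integral_congr fun x _ => ?_
    simp only [Prod.fst_add, Prod.snd_add, Prod.smul_fst, Prod.smul_snd, smul_eq_mul]
    ring
  -- Clamping `x` to `[0, 1]` does not change the integral and makes the integrand continuous on the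
  -- whole plane.
  have hcl : ∀ x : ℝ, max 0 (min x 1) ∈ Icc (0 : ℝ) 1 := fun x =>
    ⟨le_max_left _ _, max_le zero_le_one (min_le_right _ _)⟩
  have hJc : Continuous J := by
    have e : J = fun h => ∫ x in (0 : ℝ)..1, (x * (2 - x)) ^ k * (d.1 + d.2 * (1 - x) ^ 2) *
        (spheroidal k p (max 0 (min x 1)) * spheroidal k (p + h • d) (max 0 (min x 1))) := by
      funext h
      refine intervalIntegral.integral_congr fun x hx => ?_
      rw [uIcc_of_le zero_le_one] at hx
      simp only [min_eq_left hx.2, max_eq_right hx.1]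
    rw [e]
    have c1 : Continuous fun v : ℝ × ℝ => spheroidal k p (max 0 (min v.2 1)) :=
      (continuousOn_spheroidal k).comp_continuous
        (f := fun v : ℝ × ℝ => (p, max 0 (min v.2 1))) (by fun_prop) fun v => ⟨mem_univ _, hcl _⟩
    have c2 : Continuous fun v : ℝ × ℝ => spheroidal k (p + v.1 • d) (max 0 (min v.2 1)) :=
      (continuousOn_spheroidal k).comp_continuous
        (f := fun v : ℝ × ℝ => (p + v.1 • d, max 0 (min v.2 1))) (by fun_prop)
        fun v => ⟨mem_univ _, hcl _⟩
    refine intervalIntegral.continuous_parametric_intervalIntegral_of_continuous' (μ := volume)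
      ?_ 0 1
    simp only [Function.uncurry_def]
    fun_prop
  have hp : ContinuousOn (spheroidal k p) (Icc 0 1) :=
    (continuousOn_spheroidal k).comp (f := fun x : ℝ => (p, x)) (by fun_prop)
      fun x hx => ⟨mem_univ _, hx⟩
  have hJ0 : 0 < J 0 := by
    have hcI : ContinuousOn (fun x => (x * (2 - x)) ^ k * (d.1 + d.2 * (1 - x) ^ 2) *
        (spheroidal k p x * spheroidal k p x)) (Icc 0 1) := by fun_prop
    rw [hJ]
    simp only [zero_smul, add_zero]
    have hd' : ∀ x ∈ Ioc (0 : ℝ) 1, 0 ≤ d.1 + d.2 * (1 - x) ^ 2 := by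
      have hcd : ContinuousOn (fun x : ℝ => d.1 + d.2 * (1 - x) ^ 2) (Icc 0 1) := by fun_prop
      intro x hx
      have hm : x ∈ closure (Ioo (0 : ℝ) 1) := by
        rw [closure_Ioo zero_ne_one]; exact ⟨hx.1.le, hx.2⟩
      have := mem_closure_iff_nhdsWithin_neBot.1 hm
      exact ge_of_tendsto (f := fun x : ℝ => d.1 + d.2 * (1 - x) ^ 2) (x := 𝓝[Ioo 0 1] x)
        (Continuous.continuousWithinAt (by fun_prop))
        (by filter_upwards [self_mem_nhdsWithin] with y hy using (hd y hy).le)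
    obtain ⟨c, hc0, hc1⟩ : ∃ c ∈ Ioo (0 : ℝ) 1, spheroidal k p c ≠ 0 := by
      have hz : ContinuousAt (spheroidal k p) 0 :=
        (hasDerivAt_spheroidal (by norm_num)).continuousAt
      have := hz.eventually_ne (by rw [spheroidal_zero]; exact one_ne_zero)
      obtain ⟨c, h1, h2⟩ := ((this.filter_mono nhdsWithin_le_nhds).and
        (Ioo_mem_nhdsGT (zero_lt_one' ℝ))).exists
      exact ⟨c, h2, h1⟩
    refine intervalIntegral.integral_pos zero_lt_one hcI (fun x hx => ?_)
      ⟨c, ⟨hc0.1.le, hc0.2.le⟩, ?_⟩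
    · have h1 : 0 ≤ x * (2 - x) := mul_nonneg hx.1.le (by linarith [hx.2])
      exact mul_nonneg (mul_nonneg (pow_nonneg h1 k) (hd' x hx)) (mul_self_nonneg _)
    · have h1 : 0 < c * (2 - c) := mul_pos hc0.1 (by linarith [hc0.2])
      exact mul_pos (mul_pos (pow_pos h1 k) (hd c hc0)) (mul_self_pos.2 hc1)
  have e1 : ∀ᶠ h in 𝓝[>] (0 : ℝ), 0 < J h :=
    (hJc.continuousAt.eventually (lt_mem_nhds hJ0)).filter_mono nhdsWithin_le_nhds
  have e2 : ∀ᶠ h in 𝓝[>] (0 : ℝ), |(ℓ p).im - (ℓ (p + h • d)).im| < Real.pi := by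
    have hcont : Continuous fun h : ℝ => |(ℓ p).im - (ℓ (p + h • d)).im| := by fun_prop
    have h0 : |(ℓ p).im - (ℓ (p + (0 : ℝ) • d)).im| < Real.pi := by simpa using Real.pi_pos
    have := hcont.continuousAt.eventually (Iio_mem_nhds h0)
    exact this.filter_mono nhdsWithin_le_nhds
  filter_upwards [e1, e2, self_mem_nhdsWithin] with h h1 h2 h3
  have h4 : 0 < Real.sin ((ℓ p).im - (ℓ (p + h • d)).im) := by
    have h5 := mul_pos (show (0 : ℝ) < h from h3) h1
    rw [← hW h] at h5
    exact pos_of_mul_pos_right h5 (by positivity)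
  by_contra! h5
  have h6 := Real.sin_nonneg_of_nonneg_of_le_pi
    (x := (ℓ (p + h • d)).im - (ℓ p).im) (by linarith)
    (by rw [← neg_sub]; exact (neg_le_abs _).trans h2.le)
  rw [← neg_sub, Real.sin_neg] at h6
  linarith

theorem strictAnti_phase (hc : Continuous ℓ) (hℓ : ∀ p, Complex.exp (ℓ p) = pruefer k p)
    (p d : ℝ × ℝ) (hd : ∀ x ∈ Ioo (0 : ℝ) 1, 0 < d.1 + d.2 * (1 - x) ^ 2) :
    StrictAnti fun h : ℝ => (ℓ (p + h • d)).im := by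
  have h : StrictMono fun h : ℝ => -(ℓ (p + h • d)).im := by
    refine strictMono_of_eventually_lt (by fun_prop) fun x => ?_
    have h1 := phase_eventually_lt hc hℓ (p + x • d) d hd
    have h2 : Tendsto (fun y => y - x) (𝓝[>] x) (𝓝[>] 0) := by
      refine tendsto_nhdsWithin_iff.2 ⟨?_, ?_⟩
      · have : Continuous fun y : ℝ => y - x := by fun_prop
        simpa using (this.tendsto x).mono_left nhdsWithin_le_nhds
      · filter_upwards [self_mem_nhdsWithin] with y hy
        exact sub_pos.2 (mem_Ioi.1 hy)
    filter_upwards [h2.eventually h1] with y hy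
    rw [add_assoc, ← add_smul, add_sub_cancel] at hy
    exact neg_lt_neg hy
  intro a b hab
  exact neg_lt_neg_iff.1 (h hab)

/-- The phase decreases in the directions `(0, 1)` and `(1, -1)`, because `(1 - x)²` and `1 - (1 -
x)²` are positive on `(0, 1)`. Hence on the line of second coordinate `q` the points with first
coordinates `p.1` and `p.1 - (q - p.2)` bracket the phase at `p`. The level set is thus a graph of
Lipschitz constant one, without any differentiability of the phase. -/
theorem exists_phase_eq (hc : Continuous ℓ) (hℓ : ∀ p, Complex.exp (ℓ p) = pruefer k p)
    (p : ℝ × ℝ) (q : ℝ) : ∃ Λ : ℝ, |Λ - p.1| ≤ |q - p.2| ∧ (ℓ (Λ, q)).im = (ℓ p).im := by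
  have m2 := (strictAnti_phase hc hℓ p (0, 1) fun x hx => by
    have : 0 < 1 - x := by linarith [hx.2]
    simp only [one_mul, zero_add]; positivity).antitone
  have m3 := (strictAnti_phase hc hℓ p (1, -1) fun x hx => by
    nlinarith [hx.1, hx.2]).antitone
  have e2 : p + (q - p.2) • ((0, 1) : ℝ × ℝ) = (p.1, q) := by ext <;> simp
  have e3 : p + (-(q - p.2)) • ((1, -1) : ℝ × ℝ) = (p.1 - (q - p.2), q) := by
    ext <;> simp
    ring
  have e0 : ∀ d : ℝ × ℝ, p + (0 : ℝ) • d = p := fun d => by simp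
  have hcont : Continuous fun Λ : ℝ => (ℓ (Λ, q)).im := by fun_prop
  have key : (ℓ p).im ∈ uIcc (ℓ (p.1, q)).im (ℓ (p.1 - (q - p.2), q)).im := by
    rcases le_total p.2 q with h | h
    · have h1 := m2 (sub_nonneg.2 h)
      have h2 := m3 (neg_nonpos.2 (sub_nonneg.2 h))
      simp only [e0, e2, e3] at h1 h2
      exact mem_uIcc.2 (Or.inl ⟨h1, h2⟩)
    · have h1 := m2 (sub_nonpos.2 h)
      have h2 := m3 (neg_nonneg.2 (sub_nonpos.2 h))
      simp only [e0, e2, e3] at h1 h2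
      exact mem_uIcc.2 (Or.inr ⟨h2, h1⟩)
  obtain ⟨Λ, hΛ, hΛ'⟩ := intermediate_value_uIcc hcont.continuousOn key
  refine ⟨Λ, ?_, hΛ'⟩
  have := abs_sub_left_of_mem_uIcc hΛ
  rw [sub_sub_cancel_left, abs_neg] at this
  exact this

/-- The eigenvalue branch through a given point, as a function of the rotation parameter. -/
theorem exists_spheroidal_branch (k : ℕ) (Λ₀ : ℝ)
    (h₀ : spheroidal k (Λ₀, 0) 1 * spheroidal' k (Λ₀, 0) 1 = 0) :
    ∃ L : ℝ → ℝ, Continuous L ∧ L 0 = Λ₀ ∧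
      ∀ q, spheroidal k (L q, q) 1 * spheroidal' k (L q, q) 1 = 0 := by
  obtain ⟨ℓ, hc, hℓ⟩ := exists_log_pruefer k
  have hinj : ∀ q, Function.Injective fun Λ : ℝ => (ℓ (Λ, q)).im := fun q => by
    have h := strictAnti_phase hc hℓ (0, q) (1, 0) fun x hx => by norm_num
    simpa using h.injective
  choose L hL hL' using fun q => exists_phase_eq hc hℓ (Λ₀, 0) q
  refine ⟨L, ?_, ?_, fun q => ?_⟩
  -- The point of equal phase at `q` found from `q'` must be `L q`, since the phase is injective in
  -- `Λ`.
  · have : LipschitzWith 1 L := LipschitzWith.of_dist_le_mul fun q q' => by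
      obtain ⟨Λ, h1, h2⟩ := exists_phase_eq hc hℓ (L q', q') q
      have : Λ = L q := hinj q (h2.trans ((hL' q').trans (hL' q).symm))
      rw [this] at h1
      simpa [Real.dist_eq] using h1
    exact this.continuous
  · simpa [sub_eq_zero] using hL 0
  -- Vanishing of `f 1 * f' 1` depends only on the phase, which is constant along the branch.
  · have h1 : ∀ p, spheroidal k p 1 = Real.exp (ℓ p).re * Real.cos (ℓ p).im := fun p => by
      rw [← Complex.exp_re, hℓ]; rfl
    have h2 : ∀ p, spheroidal' k p 1 = Real.exp (ℓ p).re * Real.sin (ℓ p).im := fun p => by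
      rw [← Complex.exp_im, hℓ]; rfl
    rw [h1, h2] at h₀ ⊢
    rw [hL']
    rcases mul_eq_zero.1 h₀ with h | h <;> rcases mul_eq_zero.1 h with h | h
    · exact absurd h (Real.exp_pos _).ne'
    · rw [h]; ring
    · exact absurd h (Real.exp_pos _).ne'
    · rw [h]; ring

end Phase

/-! ### The spherical case -/

/-- For `q = 0` the recurrence has two terms, and its numerator at index `n` vanishes for `Λ = n (n
+ 2k + 1)`; the series is a polynomial. -/
theorem spheroidalHeun_coeff_eq_zero (k n : ℕ) {j : ℕ} (hj : n < j) :
    (spheroidalHeun k ((n : ℝ) * (n + 2 * k + 1), 0)).coeff j = 0 := by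
  set H := spheroidalHeun k ((n : ℝ) * (n + 2 * k + 1), 0) with hH
  have hs : ∀ i, H.coeff (i + 1) = -((i : ℂ) * (i - 1) + H.q₁ * i + H.k₀) * H.coeff i /
      ((i + 1) * (H.q₀ - H.z₀ * i)) := by
    intro i
    have h1 : H.q₂ = 0 := rfl
    have h2 : H.k₁ = 0 := by simp [hH, spheroidalHeun]
    have h3 : H.k₂ = 0 := by simp [hH, spheroidalHeun]
    rw [H.coeff_succ, h1, h2, h3]
    ring
  obtain ⟨i, rfl⟩ := Nat.exists_eq_add_of_lt hj
  induction i with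
  | zero =>
    rw [add_zero, hs]
    have : (n : ℂ) * (n - 1) + H.q₁ * n + H.k₀ = 0 := by
      simp only [hH, spheroidalHeun]; push_cast; ring
    rw [this]; simp
  | succ i ih =>
    rw [show n + (i + 1) + 1 = (n + i + 1) + 1 by ring, hs, ih (by omega)]
    simp

/-- The reflection `f (2 - x)` solves the same equation, so its weighted Wronskian with `f` is
constant. It vanishes at `x = 0`, where polynomiality keeps `f (2 - x)` and its derivative finite,
and at `x = 1` it equals `2 f(1) f'(1)`. -/
theorem spheroidal_mul_deriv_eq_zero (k n : ℕ) :
    spheroidal k ((n : ℝ) * (n + 2 * k + 1), 0) 1 * spheroidal' k ((n : ℝ) * (n + 2 * k + 1), 0) 1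
      = 0 := by
  set p : ℝ × ℝ := ((n : ℝ) * (n + 2 * k + 1), 0) with hp
  have hc : Continuous (spheroidal k p) := by
    have : (spheroidalHeun k p).sol = fun z : ℂ => ∑ j ∈ Finset.range (n + 1),
        (spheroidalHeun k p).coeff j * z ^ j := by
      funext z
      refine tsum_eq_sum fun j hj => ?_
      rw [spheroidalHeun_coeff_eq_zero k n (by simpa using hj), zero_mul]
    unfold spheroidal
    rw [this]
    fun_prop
  have hc' : Continuous (spheroidal' k p) := by
    have : (spheroidalHeun k p).sol' = fun z : ℂ => ∑ j ∈ Finset.range (n + 1),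
        dcoeff (spheroidalHeun k p).coeff j * z ^ j := by
      funext z
      refine tsum_eq_sum fun j hj => ?_
      have hj' : n < j + 1 := by simp at hj; omega
      rw [dcoeff, spheroidalHeun_coeff_eq_zero k n hj', mul_zero, zero_mul]
    unfold spheroidal'
    rw [this]
    fun_prop
  set w : ℝ → ℝ := fun x => (x * (2 - x)) ^ (k + 1) *
    (spheroidal' k p x * spheroidal k p (2 - x) + spheroidal k p x * spheroidal' k p (2 - x)) with hw
  have hwc : Continuous w := by rw [hw]; fun_prop
  have hwd : ∀ x ∈ Ioo (0 : ℝ) 2, HasDerivAt w 0 x := by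
    intro x hx
    have hy : 2 - x ∈ Ioo (0 : ℝ) 2 := ⟨by linarith [hx.2], by linarith [hx.1]⟩
    have hx' : |x| < 2 := abs_lt.2 ⟨by linarith [hx.1], hx.2⟩
    have hy' : |2 - x| < 2 := abs_lt.2 ⟨by linarith [hy.1], hy.2⟩
    have a1 := hasDerivAt_spheroidal (k := k) (p := p) hx'
    have a2 := hasDerivAt_spheroidal' (k := k) (p := p) hx
    have r : HasDerivAt (fun x : ℝ => 2 - x) (-1) x := by
      simpa using (hasDerivAt_id x).const_sub 2
    have b1 := (hasDerivAt_spheroidal (k := k) (p := p) hy').comp x r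
    have b2 := (hasDerivAt_spheroidal' (k := k) (p := p) hy).comp x r
    have c : HasDerivAt (fun x : ℝ => (x * (2 - x)) ^ (k + 1))
        ((k + 1) * (x * (2 - x)) ^ k * (2 * (1 - x))) x := by
      have h : HasDerivAt (fun x : ℝ => x * (2 - x)) (2 * (1 - x)) x := by
        refine ((hasDerivAt_id x).mul r).congr_deriv ?_
        simp only [id]; ring
      exact (h.pow (k + 1)).congr_deriv (by simp)
    refine (c.mul ((a2.mul b1).add (a1.mul b2))).congr_deriv ?_
    have hx0 : x * (2 - x) ≠ 0 := (mul_pos hx.1 hy.1).ne'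
    have hy0 : (2 - x) * (2 - (2 - x)) ≠ 0 := (mul_pos hy.1 (by linarith [hx.1])).ne'
    have d1 : (x * (2 - x)) * spheroidal'' k p x = -(2 * (k + 1) * (1 - x) * spheroidal' k p x
        + (p.1 + p.2 * (1 - x) ^ 2) * spheroidal k p x) := by
      rw [spheroidal'', mul_div_cancel₀ _ hx0]
    have d2 : ((2 - x) * (2 - (2 - x))) * spheroidal'' k p (2 - x) =
        -(2 * (k + 1) * (1 - (2 - x)) * spheroidal' k p (2 - x)
        + (p.1 + p.2 * (1 - (2 - x)) ^ 2) * spheroidal k p (2 - x)) := by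
      rw [spheroidal'', mul_div_cancel₀ _ hy0]
    simp only [Pi.add_apply, Pi.mul_apply, Function.comp_apply]
    rw [pow_succ]
    generalize (x * (2 - x)) ^ k = v
    linear_combination v * (spheroidal k p (2 - x) * d1 - spheroidal k p x * d2)
  have h1 : w 1 = w 0 := by
    by_contra hne
    obtain ⟨c, hc1, hc2⟩ := exists_hasDerivAt_eq_slope w 0 zero_lt_one hwc.continuousOn
      fun x hx => hwd x ⟨hx.1, by linarith [hx.2]⟩
    simp only [Pi.zero_apply, sub_zero, div_one] at hc2
    exact hne (by linarith)
  have h0 : w 0 = 0 := by simp [hw]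
  rw [h0] at h1
  simp only [hw] at h1
  norm_num at h1
  linarith

/-- Solutions which satisfy a boundary condition at the equator are even or odd. -/
theorem exists_spheroidal_parity {k : ℕ} {p : ℝ × ℝ}
    (h : spheroidal k p 1 * spheroidal' k p 1 = 0) :
    ∃ ε : ℝ, ∀ x ∈ Ioo (0 : ℝ) 2, spheroidal k p x = ε * spheroidal k p (2 - x) := by
  have hs := spheroidal_solvesOn k p
  have hr : ∀ ε : ℝ, SolvesOn (fun x => ((-(2 * (k + 1) * (1 - x)) / (x * (2 - x)) : ℝ) : ℂ))
      (fun x => ((-(p.1 + p.2 * (1 - x) ^ 2) / (x * (2 - x)) : ℝ) : ℂ)) (Ioo 0 2)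
      (fun x => ((ε * spheroidal k p (2 - x) : ℝ) : ℂ))
      (fun x => ((-(ε * spheroidal' k p (2 - x)) : ℝ) : ℂ)) := by
    intro ε x hx
    have hy : 2 - x ∈ Ioo (0 : ℝ) 2 := ⟨by linarith [hx.2], by linarith [hx.1]⟩
    have hy' : |2 - x| < 2 := abs_lt.2 ⟨by linarith [hy.1], hy.2⟩
    have r : HasDerivAt (fun x : ℝ => 2 - x) (-1) x := by
      simpa using (hasDerivAt_id x).const_sub 2
    have b1 := ((hasDerivAt_spheroidal (k := k) (p := p) hy').comp x r).const_mul ε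
    have b2 := (((hasDerivAt_spheroidal' (k := k) (p := p) hy).comp x r).const_mul ε).neg
    refine ⟨(b1.ofReal_comp).congr_deriv (by push_cast; ring), (b2.ofReal_comp).congr_deriv ?_⟩
    rw [spheroidal'', show (2 - x) * (2 - (2 - x)) = x * (2 - x) by ring]
    push_cast
    ring
  have key : ∀ ε : ℝ, spheroidal k p 1 = ε * spheroidal k p 1 →
      spheroidal' k p 1 = -(ε * spheroidal' k p 1) →
      ∀ x ∈ Ioo (0 : ℝ) 2, spheroidal k p x = ε * spheroidal k p (2 - x) := by
    intro ε h1 h2 x hx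
    have e : (2 : ℝ) - 1 = 1 := by norm_num
    have := (hs.eqOn ordConnected_Ioo (continuousOn_spheroidal_coeff (by fun_prop))
      (continuousOn_spheroidal_coeff (by fun_prop)) (hr ε) (t₀ := 1) (by norm_num)
      (by simp only [e]; exact_mod_cast h1) (by simp only [e]; exact_mod_cast h2) x hx).1
    exact_mod_cast this
  rcases mul_eq_zero.1 h with h | h
  · exact ⟨-1, key _ (by simp [h]) (by simp)⟩
  · exact ⟨1, key _ (by simp) (by simp [h])⟩

/-! ### Eigenfunctions on the sphere and labelled eigenvalues. -/

/-- In Cartesian coordinates `sin^|m| θ * exp (imφ)` is `(x ± iy) ^ |m|`, with the sign of `m`. The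
function is therefore the restriction of a polynomial times `F z`. -/
theorem extendsSmoothly_sin_pow_mul (m : ℤ) {F : ℝ → ℝ}
    (hF : ∀ z ∈ Icc (-1 : ℝ) 1, ContDiffAt ℝ ((⊤ : ℕ∞) : WithTop ℕ∞) F z) :
    ExtendsSmoothly m fun θ => ((Real.sin θ ^ m.natAbs * F (Real.cos θ) : ℝ) : ℂ) := by
  obtain ⟨ε, hε⟩ : ∃ ε : ℤ, (ε = 1 ∨ ε = -1) ∧ m = ε * m.natAbs := by
    rcases le_total 0 m with h | h
    · exact ⟨1, Or.inl rfl, by omega⟩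
    · exact ⟨-1, Or.inr rfl, by omega⟩
  set G : EuclideanSpace ℝ (Fin 3) → ℂ := fun v =>
    ((v 0 : ℂ) + (ε : ℂ) * Complex.I * (v 1 : ℂ)) ^ m.natAbs * (F (v 2) : ℂ) with hG
  refine ⟨fun p => G p, fun p => ?_, fun p θ _ φ hp => ?_⟩
  · have := Fact.mk (finrank_euclideanSpace_fin (𝕜 := ℝ) (n := 2 + 1))
    have hp : ‖(p : EuclideanSpace ℝ (Fin 3))‖ = 1 := by simp
    have h2 : (p : EuclideanSpace ℝ (Fin 3)) 2 ∈ Icc (-1 : ℝ) 1 := by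
      have := PiLp.norm_apply_le (p : EuclideanSpace ℝ (Fin 3)) 2
      rw [hp, Real.norm_eq_abs] at this
      exact abs_le.1 this
    have hcoord : ∀ i : Fin 3, ContDiff ℝ ((⊤ : ℕ∞) : WithTop ℕ∞)
        fun v : EuclideanSpace ℝ (Fin 3) => (v i : ℂ) := fun i =>
      Complex.ofRealCLM.contDiff.comp (contDiff_piLp_apply (p := 2))
    have hF2 : ContDiffAt ℝ ((⊤ : ℕ∞) : WithTop ℕ∞)
        (fun v : EuclideanSpace ℝ (Fin 3) => (F (v 2) : ℂ)) p :=
      Complex.ofRealCLM.contDiff.contDiffAt.comp _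
        ((hF _ h2).comp (p : EuclideanSpace ℝ (Fin 3)) (contDiff_piLp_apply (p := 2)).contDiffAt)
    have hGd : ContDiffAt ℝ ((⊤ : ℕ∞) : WithTop ℕ∞) G p :=
      ((((hcoord 0).add (contDiff_const.mul (hcoord 1))).pow _).contDiffAt).mul hF2
    exact hGd.comp_contMDiffAt (contMDiff_coe_sphere p)
  · simp only [hG, hp]
    have e1 : Complex.exp (Complex.I * m * φ) =
        ((Real.cos φ : ℂ) + ε * Complex.I * Real.sin φ) ^ m.natAbs := by
      have h1 : (Real.cos φ : ℂ) + ε * Complex.I * Real.sin φ = Complex.exp (ε * φ * Complex.I) := by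
        rw [Complex.exp_mul_I]
        rcases hε.1 with h | h <;> simp [h] <;> ring
      rw [h1, ← Complex.exp_nat_mul]
      congr 1
      have h2 : (m : ℂ) = ε * (m.natAbs : ℂ) := by
        rw [← Int.cast_natCast, ← Int.cast_mul, ← hε.2]
      rw [h2]; ring
    rw [e1]
    simp only [Matrix.cons_val_zero, Matrix.cons_val_one, Matrix.cons_val, Complex.ofReal_mul,
      Complex.ofReal_pow]
    rw [show (Real.sin θ : ℂ) * Real.cos φ + ε * Complex.I * (Real.sin θ * Real.sin φ) =
      (Real.cos φ + ε * Complex.I * Real.sin φ) * Real.sin θ by ring, mul_pow]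
    ring

/-- The equatorial condition makes `f` even or odd under reflection, so regularity at one pole
carries over to the other. Inserting `sin^k θ` shifts the eigenvalue by `k (k + 1)`. -/
theorem isAngularEigenvalue_of_spheroidal (a ω : ℝ) (m : ℤ) (Λ : ℝ)
    (h : spheroidal m.natAbs (Λ, a ^ 2 * ω ^ 2) 1 * spheroidal' m.natAbs (Λ, a ^ 2 * ω ^ 2) 1 = 0) :
    IsAngularEigenvalue a ω m (m.natAbs * (m.natAbs + 1) + Λ) := by
  obtain ⟨ε, hε⟩ := exists_spheroidal_parity h
  set k := m.natAbs with hk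
  set p : ℝ × ℝ := (Λ, a ^ 2 * ω ^ 2) with hp
  set f := spheroidal k p with hf
  -- Each branch evaluates `f` only where its series converges; the branches agree on `(-1, 1)` by
  -- parity, so `F` is smooth up to both poles.
  set F : ℝ → ℝ := fun z => if 0 < z then f (1 - z) else ε * f (1 + z) with hFdef
  have hFeq : ∀ z ∈ Ioo (-1 : ℝ) 1, F z = f (1 - z) := by
    intro z hz
    simp only [hFdef]
    split_ifs with h0
    · rfl
    · rw [hε (1 - z) ⟨by linarith [hz.2], by linarith [hz.1]⟩]
      congr 2; ring
  have hFs : ∀ z ∈ Icc (-1 : ℝ) 1, ContDiffAt ℝ ((⊤ : ℕ∞) : WithTop ℕ∞) F z := by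
    intro z hz
    have hfs : ∀ x : ℝ, |x| < 2 → ContDiffAt ℝ ((⊤ : ℕ∞) : WithTop ℕ∞) f x := fun x hx =>
      (analyticAt_spheroidal hx).contDiffAt
    rcases lt_or_ge 0 z with h0 | h0
    · have e : F =ᶠ[𝓝 z] fun z => f (1 - z) := by
        filter_upwards [Ioi_mem_nhds h0] with y hy
        simp only [hFdef]; rw [if_pos (mem_Ioi.1 hy)]
      refine ContDiffAt.congr_of_eventuallyEq ?_ e
      exact (hfs (1 - z) (abs_lt.2 ⟨by linarith [hz.2], by linarith⟩)).comp z
        (contDiffAt_const.sub contDiffAt_id)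
    · have e : F =ᶠ[𝓝 z] fun z => ε * f (1 + z) := by
        filter_upwards [Iio_mem_nhds (show z < 1 by linarith)] with y hy
        rcases lt_or_ge 0 y with hy0 | hy0
        · rw [hFeq y ⟨by linarith, hy⟩, hε (1 - y) ⟨by linarith [mem_Iio.1 hy], by linarith⟩]
          congr 2; ring
        · simp only [hFdef]; rw [if_neg (not_lt.2 hy0)]
      refine ContDiffAt.congr_of_eventuallyEq ?_ e
      exact contDiffAt_const.mul ((hfs (1 + z) (abs_lt.2 ⟨by linarith [hz.1], by linarith⟩)).comp z
        (contDiffAt_const.add contDiffAt_id))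
  have hcos : ∀ θ ∈ Ioo 0 Real.pi, Real.cos θ ∈ Ioo (-1 : ℝ) 1 ∧ 0 < Real.sin θ := by
    intro θ hθ
    have hs := Real.sin_pos_of_pos_of_lt_pi hθ.1 hθ.2
    have h1 := Real.sin_sq_add_cos_sq θ
    exact ⟨abs_lt.1 ((sq_lt_one_iff_abs_lt_one _).1 (by nlinarith)), hs⟩
  refine ⟨_, extendsSmoothly_sin_pow_mul m hFs, ?_, ?_⟩
  · have hz : ContinuousAt f 0 := (hasDerivAt_spheroidal (by norm_num)).continuousAt
    have := hz.eventually_ne (by rw [hf, spheroidal_zero]; exact one_ne_zero)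
    obtain ⟨x, h1, h2⟩ := ((this.filter_mono nhdsWithin_le_nhds).and
      (Ioo_mem_nhdsGT (zero_lt_one' ℝ))).exists
    have hc : Real.cos (Real.arccos (1 - x)) = 1 - x :=
      Real.cos_arccos (by linarith [h2.2]) (by linarith [h2.1])
    have hθ : Real.arccos (1 - x) ∈ Ioo 0 Real.pi := by
      refine ⟨Real.arccos_pos.2 (by linarith [h2.1]), ?_⟩
      refine lt_of_le_of_ne (Real.arccos_le_pi _) fun h3 => ?_
      rw [h3, Real.cos_pi] at hc
      linarith [h2.2]
    refine ⟨_, hθ, ?_⟩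
    rw [hc, hFeq _ ⟨by linarith [h2.2], by linarith [h2.1]⟩, sub_sub_cancel]
    exact Complex.ofReal_ne_zero.2 (mul_ne_zero (pow_ne_zero _ (hcos _ hθ).2.ne') h1)
  intro θ hθ
  set f' := spheroidal' k p with hf'
  have hsin : ∀ t ∈ Ioo 0 Real.pi, HasDerivAt (fun t => Real.sin t ^ k)
      (k * Real.sin t ^ k / Real.sin t * Real.cos t) t := by
    intro t ht
    refine ((Real.hasDerivAt_sin t).fun_pow k).congr_deriv ?_
    have hs := (hcos t ht).2.ne'
    rcases Nat.eq_zero_or_pos k with h0 | h0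
    · simp [h0]
    · obtain ⟨j, hj⟩ := Nat.exists_eq_add_of_lt h0
      rw [zero_add] at hj
      rw [hj, Nat.add_sub_cancel, pow_succ]
      field_simp
  have hx : ∀ t ∈ Ioo 0 Real.pi, 1 - Real.cos t ∈ Ioo (0 : ℝ) 2 := fun t ht =>
    ⟨by linarith [(hcos t ht).1.2], by linarith [(hcos t ht).1.1]⟩
  have harg : ∀ t : ℝ, HasDerivAt (fun t => 1 - Real.cos t) (Real.sin t) t := fun t => by
    simpa using (Real.hasDerivAt_cos t).const_sub 1
  have hd : ∀ t ∈ Ioo 0 Real.pi, HasDerivAt (fun t => f (1 - Real.cos t))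
      (f' (1 - Real.cos t) * Real.sin t) t := fun t ht =>
    HasDerivAt.comp t (h₂ := f)
      (hasDerivAt_spheroidal (abs_lt.2 ⟨by linarith [(hx t ht).1], (hx t ht).2⟩)) (harg t)
  have hd' : ∀ t ∈ Ioo 0 Real.pi, HasDerivAt (fun t => f' (1 - Real.cos t))
      (spheroidal'' k p (1 - Real.cos t) * Real.sin t) t := fun t ht =>
    HasDerivAt.comp t (h₂ := f') (hasDerivAt_spheroidal' (hx t ht)) (harg t)
  have hS : ∀ t ∈ Ioo 0 Real.pi,
      deriv (fun θ => ((Real.sin θ ^ k * F (Real.cos θ) : ℝ) : ℂ)) t =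
        ((k * Real.sin t ^ k / Real.sin t * Real.cos t * f (1 - Real.cos t) +
          Real.sin t ^ k * (f' (1 - Real.cos t) * Real.sin t) : ℝ) : ℂ) := by
    intro t ht
    have e : (fun θ => ((Real.sin θ ^ k * F (Real.cos θ) : ℝ) : ℂ)) =ᶠ[𝓝 t]
        fun θ => ((Real.sin θ ^ k * f (1 - Real.cos θ) : ℝ) : ℂ) := by
      filter_upwards [isOpen_Ioo.mem_nhds ht] with s hs
      rw [hFeq _ (hcos s hs).1]
    rw [e.deriv_eq]
    exact (((hsin t ht).fun_mul (hd t ht)).ofReal_comp).deriv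
  have hT : deriv (fun t : ℝ => (Real.sin t : ℂ) *
      deriv (fun θ => ((Real.sin θ ^ k * F (Real.cos θ) : ℝ) : ℂ)) t) θ =
      (((k * (k * Real.sin θ ^ k / Real.sin θ * Real.cos θ) * Real.cos θ
        + k * Real.sin θ ^ k * (-Real.sin θ)) * f (1 - Real.cos θ)
        + k * Real.sin θ ^ k * Real.cos θ * (f' (1 - Real.cos θ) * Real.sin θ)
        + ((k * Real.sin θ ^ k / Real.sin θ * Real.cos θ * Real.sin θ ^ 2
          + Real.sin θ ^ k * (2 * Real.sin θ * Real.cos θ)) * f' (1 - Real.cos θ)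
          + Real.sin θ ^ k * Real.sin θ ^ 2 *
            (spheroidal'' k p (1 - Real.cos θ) * Real.sin θ)) : ℝ) : ℂ) := by
    have e : (fun t : ℝ => (Real.sin t : ℂ) *
        deriv (fun θ => ((Real.sin θ ^ k * F (Real.cos θ) : ℝ) : ℂ)) t) =ᶠ[𝓝 θ]
        fun t => ((k * Real.sin t ^ k * Real.cos t * f (1 - Real.cos t)
          + Real.sin t ^ k * Real.sin t ^ 2 * f' (1 - Real.cos t) : ℝ) : ℂ) := by
      filter_upwards [isOpen_Ioo.mem_nhds hθ] with t ht
      rw [hS t ht, ← Complex.ofReal_mul]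
      congr 1
      have hs := (hcos t ht).2.ne'
      field_simp
    rw [e.deriv_eq]
    refine HasDerivAt.deriv (HasDerivAt.ofReal_comp ?_)
    have s2 : HasDerivAt (fun t => Real.sin t ^ 2) (2 * Real.sin θ * Real.cos θ) θ := by
      simpa using (Real.hasDerivAt_sin θ).fun_pow 2
    exact ((((hsin θ hθ).const_mul (k : ℝ)).fun_mul (Real.hasDerivAt_cos θ)).fun_mul
      (hd θ hθ)).fun_add (((hsin θ hθ).fun_mul s2).fun_mul (hd' θ hθ))
  rw [hT, hFeq _ (hcos θ hθ).1]
  have hs := (hcos θ hθ).2.ne'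
  have hm : ((m : ℝ)) ^ 2 = (k : ℝ) ^ 2 := by
    rw [hk]
    rw [Nat.cast_natAbs, Int.cast_abs, sq_abs]
  have hode : Real.sin θ ^ 2 * spheroidal'' k p (1 - Real.cos θ) =
      -(2 * (k + 1) * Real.cos θ * f' (1 - Real.cos θ)
        + (Λ + a ^ 2 * ω ^ 2 * Real.cos θ ^ 2) * f (1 - Real.cos θ)) := by
    have h1 : (1 - Real.cos θ) * (2 - (1 - Real.cos θ)) = Real.sin θ ^ 2 := by
      linear_combination -Real.sin_sq_add_cos_sq θ
    rw [spheroidal'', h1, mul_div_cancel₀ _ (pow_ne_zero 2 hs), sub_sub_cancel]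
  rw [hm, ← hk]
  norm_cast
  generalize spheroidal'' k p (1 - Real.cos θ) = f'' at hode ⊢
  generalize f' (1 - Real.cos θ) = y' at hode ⊢
  generalize f (1 - Real.cos θ) = y at hode ⊢
  have hsc := Real.sin_sq_add_cos_sq θ
  generalize Real.sin θ ^ k = w at hode ⊢
  generalize Real.cos θ = c at hode hsc ⊢
  generalize Real.sin θ = s at hs hode hsc ⊢
  field_simp
  push_cast
  linear_combination s ^ 2 * w * hode + k ^ 2 * w * y * hsc

/-- The branch starts at the polynomial solution of degree parameter `n = l - |m|`, where `k (k + 1)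
+ n (n + 2k + 1) = l (l + 1)` with `k = |m|`, and is followed along `q = s²ω²`. -/
theorem exists_isAngularEigenvalueLabelled (a ω : ℝ) {m l : ℤ} (hml : |m| ≤ l) :
    ∃ lam : ℝ, IsAngularEigenvalueLabelled a ω m l lam := by
  obtain ⟨n, hn⟩ : ∃ n : ℕ, l = m.natAbs + n := ⟨(l - |m|).toNat, by
    rw [Int.abs_eq_natAbs] at hml ⊢; omega⟩
  obtain ⟨L, hL, hL0, hL1⟩ := exists_spheroidal_branch m.natAbs _
    (spheroidal_mul_deriv_eq_zero m.natAbs n)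
  refine ⟨_, fun s => m.natAbs * (m.natAbs + 1) + L (s ^ 2 * ω ^ 2), ?_, fun s _ =>
    isAngularEigenvalue_of_spheroidal s ω m _ (hL1 _), ?_, rfl⟩
  · exact Continuous.continuousOn (by fun_prop)
  · have : (l : ℝ) = m.natAbs + n := by
      rw [hn, Int.cast_add, Int.cast_natCast, Int.cast_natCast]
    rw [this]
    simp only [ne_eq, OfNat.ofNat_ne_zero, not_false_eq_true, zero_pow, zero_mul, hL0]
    ring

/-! ### The effective bound. -/

/-- A computable function which bounds the inverse of the Wronskian. -/
def wronskianInvBound (N : ℕ) : ℕ := N ^ 2 * 3 ^ (73 * N ^ 4)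

theorem computable_wronskianInvBound : Computable wronskianInvBound := by
  have hpow : Primrec₂ (fun a b : ℕ => a ^ b) := Primrec₂.unpaired'.1 Nat.Primrec.pow
  have h : Primrec wronskianInvBound :=
    Primrec.nat_mul.comp (hpow.comp Primrec.id (Primrec.const 2))
      (hpow.comp (Primrec.const 3)
        (Primrec.nat_mul.comp (Primrec.const 73) (hpow.comp Primrec.id (Primrec.const 4))))
  exact h.to_comp

theorem monotone_wronskianInvBound : Monotone wronskianInvBound := by
  intro a b hab
  unfold wronskianInvBound
  gcongr
  norm_num

theorem one_le_of_bounds {a M : ℝ} {N : ℕ} (ha : |a| < M) (hM : M ≤ N) : (1 : ℝ) ≤ N := by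
  have h : (0 : ℝ) < N := (mass_pos ha).trans_le hM
  exact_mod_cast Nat.one_le_cast.2 (Nat.cast_pos.1 h)

/-- The gap `r₊ - r₋` is at least `2 / N` and `r₊ ≤ 2N`, so the square root is at least `1 / N`;
together with `|ω| ≥ 1 / N` this gives the factor `N ^ 2`. -/
theorem inv_wronskianInvBound_le {a M ω : ℝ} {m : ℤ} {N : ℕ} (ha : |a| < M) (hω : ω ≠ 0)
    (hM : M ≤ N) (hMa : 1 / (M - |a|) ≤ N) (hωN : |ω| ≤ N) (hωN' : |ω|⁻¹ ≤ N) (hmN : |(m : ℝ)| ≤ N) :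
    ((wronskianInvBound N : ℕ) : ℝ)⁻¹ ≤ wronskianBound a M ω m := by
  have hN := one_le_of_bounds ha hM
  set n : ℝ := (N : ℝ) with hn
  have hn0 : 0 < n := by linarith
  have hM0 := mass_pos ha
  have hr0 := rPlus_pos ha
  have hr : rPlus a M ≤ 2 * n := (rPlus_le ha).trans (by linarith)
  have hd : 2 / n ≤ rPlus a M - rMinus a M := by
    have h1 : 1 / n ≤ M - |a| := by
      rw [one_div_le hn0 (by linarith)]; exact hMa
    have h2 : M - |a| ≤ Real.sqrt (M ^ 2 - a ^ 2) := by
      refine Real.le_sqrt_of_sq_le ?_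
      rw [← sq_abs a]
      nlinarith [abs_nonneg a]
    have h3 : 2 / n = 2 * (1 / n) := by ring
    rw [rPlus, rMinus, h3]
    linarith
  have hd0 : 0 < rPlus a M - rMinus a M := lt_of_lt_of_le (by positivity) hd
  have hω1 : 1 / n ≤ |ω| := by
    rw [one_div_le hn0 (abs_pos.2 hω), one_div]; exact hωN'
  have hsqrt : 1 / n ≤ Real.sqrt ((rPlus a M - rMinus a M) / rPlus a M) := by
    refine Real.le_sqrt_of_sq_le ?_
    calc (1 / n) ^ 2 = (2 / n) / (2 * n) := by field_simp
      _ ≤ (rPlus a M - rMinus a M) / rPlus a M := by gcongr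
  have hfreq : |horFreq a M ω m| ≤ 5 * n ^ 4 := by
    have h1 : |2 * (2 * M * rPlus a M * ω - a * m)| ≤ 10 * n ^ 3 := by
      have h2 : |2 * M * rPlus a M * ω| ≤ 2 * n * (2 * n) * n := by
        rw [abs_mul, abs_of_nonneg (by positivity : 0 ≤ 2 * M * rPlus a M)]
        gcongr
      have h3 : |a * m| ≤ n * n := by
        rw [abs_mul]
        have := ha.le.trans hM
        gcongr
      have h4 : n * n ≤ n ^ 3 := by nlinarith [mul_pos hn0 hn0]
      rw [abs_mul, abs_two]
      have := abs_sub (2 * M * rPlus a M * ω) (a * m)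
      nlinarith
    rw [horFreq, abs_div, abs_of_pos hd0]
    calc _ ≤ (10 * n ^ 3) / (2 / n) := by gcongr
      _ = 5 * n ^ 4 := by field_simp; norm_num
  have h4M : |4 * M * ω| ≤ 4 * n ^ 4 := by
    rw [abs_mul, abs_of_nonneg (by positivity : 0 ≤ 4 * M)]
    calc 4 * M * |ω| ≤ 4 * n * n := by gcongr
      _ = 4 * n ^ 2 := by ring
      _ ≤ 4 * n ^ 4 := by gcongr; norm_num
  have hexp : ((3 : ℝ) ^ (73 * N ^ 4))⁻¹ ≤
      Real.exp (-(3 * Real.pi * |horFreq a M ω m| + 2 * Real.pi * |4 * M * ω|)) := by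
    rw [Real.exp_neg]
    refine inv_anti₀ (Real.exp_pos _) ?_
    -- The exponent is at most `(15 + 8) π N ^ 4`, and `23 π < 73`; the base `3` bounds `e`.
    have h1 : 3 * Real.pi * |horFreq a M ω m| + 2 * Real.pi * |4 * M * ω| ≤
        ((73 * N ^ 4 : ℕ) : ℝ) := by
      have hpi := Real.pi_lt_d2
      have hpi0 := Real.pi_pos
      calc _ ≤ 3 * Real.pi * (5 * n ^ 4) + 2 * Real.pi * (4 * n ^ 4) := by gcongr
        _ = 23 * Real.pi * n ^ 4 := by ring
        _ ≤ 73 * n ^ 4 := by gcongr; linarith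
        _ = _ := by push_cast; rfl
    calc _ ≤ Real.exp ((73 * N ^ 4 : ℕ) : ℝ) := Real.exp_le_exp.2 h1
      _ = Real.exp 1 ^ (73 * N ^ 4) := by rw [← Real.exp_nat_mul, mul_one]
      _ ≤ 3 ^ (73 * N ^ 4) := by
        gcongr
        exact Real.exp_one_lt_d9.le.trans (by norm_num)
  have e : ((wronskianInvBound N : ℕ) : ℝ)⁻¹ = 1 * (1 / n) * (1 / n) * ((3 : ℝ) ^ (73 * N ^ 4))⁻¹ := by
    rw [wronskianInvBound]
    push_cast
    rw [mul_inv, ← hn]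
    ring
  rw [e, wronskianBound]
  gcongr
  norm_num

/-- The bounding function `G (C, a, M)`. -/
noncomputable def effectiveBound (C a M : ℝ) : ℝ :=
  wronskianInvBound ⌈max C (max M (1 / (M - |a|)))⌉₊

theorem isEffective_effectiveBound : IsEffective effectiveBound := by
  refine ⟨wronskianInvBound, computable_wronskianInvBound, fun N C a M _ h1 h2 h3 => ?_⟩
  exact Nat.cast_le.2 (monotone_wronskianInvBound (Nat.ceil_le.2 (max_le h1 (max_le h2 h3))))

/-- Each summand is bounded by the supremum; `ω ≠ 0` because the inverse of zero is infinite there.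
-/
theorem le_freqBound_toReal {A : Set (ℝ × ℤ × ℤ)} (hA : freqBound A < ⊤) {ω : ℝ} {m l : ℤ}
    (h : (ω, m, l) ∈ A) : ω ≠ 0 ∧ |ω| ≤ (freqBound A).toReal ∧ |ω|⁻¹ ≤ (freqBound A).toReal ∧
      |(m : ℝ)| ≤ (freqBound A).toReal := by
  have h1 : ‖ω‖ₑ + ‖ω‖ₑ⁻¹ + (m.natAbs : ℝ≥0∞) + (l.natAbs : ℝ≥0∞) ≤ freqBound A :=
    le_iSup₂ (f := fun (p : ℝ × ℤ × ℤ) (_ : p ∈ A) =>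
      ‖p.1‖ₑ + ‖p.1‖ₑ⁻¹ + (p.2.1.natAbs : ℝ≥0∞) + (p.2.2.natAbs : ℝ≥0∞)) (ω, m, l) h
  have h2 : ‖ω‖ₑ ≤ freqBound A := le_trans (by rw [add_assoc, add_assoc]; exact le_self_add) h1
  have h3 : ‖ω‖ₑ⁻¹ ≤ freqBound A :=
    le_trans (le_add_self.trans (le_self_add.trans le_self_add)) h1
  have h4 : (m.natAbs : ℝ≥0∞) ≤ freqBound A := le_trans (le_add_self.trans le_self_add) h1
  have hω : ω ≠ 0 := by
    rintro rfl
    rw [enorm_zero, ENNReal.inv_zero] at h3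
    exact absurd hA (not_lt.2 h3)
  refine ⟨hω, ?_, ?_, ?_⟩
  · have := ENNReal.toReal_mono hA.ne h2
    rwa [toReal_enorm, Real.norm_eq_abs] at this
  · have := ENNReal.toReal_mono hA.ne h3
    rwa [ENNReal.toReal_inv, toReal_enorm, Real.norm_eq_abs] at this
  · have := ENNReal.toReal_mono hA.ne h4
    rwa [ENNReal.toReal_natCast, Nat.cast_natAbs, Int.cast_abs] at this

end Kerr

theorem theorem1p1 :
    ∃ G : ℝ → ℝ → ℝ → ℝ, Kerr.IsEffective G ∧
      ∀ (a M : ℝ), |a| < M →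
      ∀ rad : ℝ → ℝ, Kerr.IsRadius a M rad →
      ∀ A : Set (ℝ × ℤ × ℤ), (∀ ω m l, (ω, m, l) ∈ A → |m| ≤ l) →
      Kerr.freqBound A < ⊤ →
        (∀ ω m l, (ω, m, l) ∈ A → (Kerr.wronskianValues a M rad ω m l).Nonempty) ∧
        (⨆ p ∈ A, ⨆ W ∈ Kerr.wronskianValues a M rad p.1 p.2.1 p.2.2, ‖W‖ₑ⁻¹)
          ≤ ENNReal.ofReal (G (Kerr.freqBound A).toReal a M) := by
  refine ⟨Kerr.effectiveBound, Kerr.isEffective_effectiveBound, fun a M ha rad hrad A hA hfin =>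
    ⟨fun ω m l h => ?_, ?_⟩⟩
  · obtain ⟨lam, hlam⟩ := Kerr.exists_isAngularEigenvalueLabelled a ω (hA ω m l h)
    obtain ⟨uHor, uOut, W, h1, h2, h3, -⟩ :=
      Kerr.exists_isHor_isOut ha hrad (Kerr.le_freqBound_toReal hfin h).1 m lam
    exact ⟨W, lam, uHor, uOut, hlam, h1, h2, h3⟩
  · refine iSup₂_le fun p hp => iSup₂_le fun W hW => ?_
    obtain ⟨ω, m, l⟩ := p
    obtain ⟨lam, uHor, uOut, -, h1, h2, h3⟩ := hW
    obtain ⟨hω, b1, b2, b3⟩ := Kerr.le_freqBound_toReal hfin hp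
    -- The bound holds for whichever `lam` accompanies `W`, so the supremum over all admissible
    -- values is covered.
    have hW := Kerr.wronskianBound_le_norm ha hrad hω h1 h2 h3
    -- Rounding up the largest of the three controls gives the integer at which the computable bound
    -- is evaluated.
    set x := max (Kerr.freqBound A).toReal (max M (1 / (M - |a|))) with hx
    have hc : x ≤ (⌈x⌉₊ : ℝ) := Nat.le_ceil x
    have c1 : (Kerr.freqBound A).toReal ≤ (⌈x⌉₊ : ℝ) := (le_max_left _ _).trans hc
    have c2 : M ≤ (⌈x⌉₊ : ℝ) := ((le_max_left _ _).trans (le_max_right _ _)).trans hc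
    have c3 : 1 / (M - |a|) ≤ (⌈x⌉₊ : ℝ) := ((le_max_right _ _).trans (le_max_right _ _)).trans hc
    have hb := (Kerr.inv_wronskianInvBound_le ha hω c2 c3 (b1.trans c1) (b2.trans c1)
      (b3.trans c1)).trans hW
    have hG : 0 < ((Kerr.wronskianInvBound ⌈x⌉₊ : ℕ) : ℝ) := by
      have := Kerr.one_le_of_bounds ha c2
      rw [Kerr.wronskianInvBound]
      push_cast
      positivity
    have hW0 : 0 < ‖W‖ := lt_of_lt_of_le (inv_pos.2 hG) hb
    rw [← ofReal_norm, ← ENNReal.ofReal_inv_of_pos hW0, Kerr.effectiveBound, ← hx]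
    exact ENNReal.ofReal_le_ofReal (inv_le_of_inv_le₀ hG hb)
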